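/- **Proposition (removability of point singularities).** Let $D\subset\mathbb{C}=\mathbb{R}^2$ be the open unit disk and fix $n$ and $R>0$. For an open set $\Omega\subset\mathbb{R}^2$ and $p>1$, let $\mathcal{F}^p(\Omega,R)$ be the set of maps $f:\Omega\to\mathbb{R}^n$ such that 1. $f\in W^{2,p}_{loc}(\Omega,\mathbb{R}^n)$; 2. $|f(z)|\le R$ for all $z\in\Omega$; 3. there is a nonnegative measurable function $\beta$ on $\Omega$ with $|\Delta f|\le\beta\,|\nabla f|^2$ a.e. on $\Omega$ and $\int_\Omega\beta^2|\nabla f|^2<+\infty$. Here $\nabla f$ and $\Delta f$ are taken in the weak sense. Let $\mathcal{F}^p_{conf}(\Omega,R)$ be the set of those $f\in\mathcal{F}^p(\Omega,R)$ which are weakly conformal a.e., i.e. $\sum_{k=1}^n\left(\frac{\partial f_k}{\partial z}\right)^2=0$ a.e. on $\Omega$, where $\frac{\partial}{\partial z}=\frac12\left(\frac{\partial}{\partial x}-i\frac{\partial}{\partial y}\right)$ (equivalently $|f_x|=|f_y|$ and $f_x\cdot f_y=0$ a.e.). Let $1<p<2$ and $f\in\mathcal{F}^p_{conf}(D\setminus\{0\},R)$.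 If $\int_{D\setminus\{0\}}|\nabla f|^2<+\infty$, then $f$ extends to a map $g:D\to\mathbb{R}^n$ (that is, $g=f$ on $D\setminus\{0\}$) such that $g\in\mathcal{F}^{p'}_{conf}(D,R)$ for every $p'\in(1,\tfrac43)\cap(1,p]$. -/

import Mathlib

open MeasureTheory Set
open scoped ContDiff ENNReal NNReal

noncomputable section

/-- `g` is a weak derivative of `f` in the direction `v` on the open set `Ω ⊆ ℂ = ℝ²`. -/
structure IsWeakDerivOn {n : ℕ} (Ω : Set ℂ) (v : ℂ) (f g : ℂ → EuclideanSpace ℝ (Fin n)) :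
    Prop where
  locallyIntegrableOn : LocallyIntegrableOn f Ω volume
  locallyIntegrableOn_deriv : LocallyIntegrableOn g Ω volume
  integral_eq : ∀ φ : ℂ → ℝ, ContDiff ℝ ∞ φ → HasCompactSupport φ → tsupport φ ⊆ Ω →
    ∫ z, (fderiv ℝ φ z v) • f z = - ∫ z, φ z • g z

/-- Weak derivatives on an open set are unique up to a null set. -/
theorem IsWeakDerivOn.ae_eq {n : ℕ} {Ω : Set ℂ} (hΩ : IsOpen Ω) {v : ℂ}
    {f g₁ g₂ : ℂ → EuclideanSpace ℝ (Fin n)} (h₁ : IsWeakDerivOn Ω v f g₁)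
    (h₂ : IsWeakDerivOn Ω v f g₂) : g₁ =ᵐ[volume.restrict Ω] g₂ := by
  have key : ∀ g : ℂ → EuclideanSpace ℝ (Fin n), LocallyIntegrableOn g Ω volume →
      ∀ φ : ℂ → ℝ, ContDiff ℝ ∞ φ → HasCompactSupport φ → tsupport φ ⊆ Ω →
      Integrable (fun z => φ z • g z) volume := by
    intro g hg φ hφ hc hs
    have hK : IntegrableOn (fun z => φ z • g z) (tsupport φ) volume :=
      (hg.integrableOn_compact_subset hs hc).continuousOn_smul hφ.continuous.continuousOn hc
    refine (integrableOn_iff_integrable_of_support_subset ?_).1 hK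
    intro z hz
    by_contra h
    exact hz (by simp [image_eq_zero_of_notMem_tsupport h])
  have h := hΩ.ae_eq_zero_of_integral_contDiff_smul_eq_zero (μ := volume)
    (f := fun z => g₁ z - g₂ z)
    (h₁.locallyIntegrableOn_deriv.sub h₂.locallyIntegrableOn_deriv) (by
      intro φ hφ hc hs
      simp only [smul_sub]
      rw [integral_sub (key _ h₁.locallyIntegrableOn_deriv φ hφ hc hs)
        (key _ h₂.locallyIntegrableOn_deriv φ hφ hc hs), sub_eq_zero]
      exact neg_injective
        ((h₁.integral_eq φ hφ hc hs).symm.trans (h₂.integral_eq φ hφ hc hs)))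
  rw [Filter.EventuallyEq, ae_restrict_iff' hΩ.measurableSet]
  filter_upwards [h] with z hz hzΩ
  exact sub_eq_zero.1 (hz hzΩ)

open Classical in
/-- A representative of the weak derivative of `f` on `Ω` in the direction `v`
(equal to `0` if `f` has no weak derivative there). -/
def weakDeriv {n : ℕ} (Ω : Set ℂ) (v : ℂ) (f : ℂ → EuclideanSpace ℝ (Fin n)) :
    ℂ → EuclideanSpace ℝ (Fin n) :=
  if h : ∃ g, IsWeakDerivOn Ω v f g then h.choose else 0

/-- The coordinate directions `∂/∂x` and `∂/∂y` of `ℂ = ℝ²`. -/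
def coordDir : Fin 2 → ℂ := ![1, Complex.I]

/-- The weak partial derivative `∂ᵢ f` on `Ω`. -/
def weakPartial {n : ℕ} (Ω : Set ℂ) (i : Fin 2) (f : ℂ → EuclideanSpace ℝ (Fin n)) :
    ℂ → EuclideanSpace ℝ (Fin n) :=
  weakDeriv Ω (coordDir i) f

/-- `f ∈ L^p_loc(Ω)`. -/
def MemLpLocOn {n : ℕ} (p : ℝ) (Ω : Set ℂ) (f : ℂ → EuclideanSpace ℝ (Fin n)) : Prop :=
  ∀ K : Set ℂ, IsCompact K → K ⊆ Ω → MemLp f (ENNReal.ofReal p) (volume.restrict K)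

/-- `f ∈ W^{2,p}_loc(Ω)`: the weak partial derivatives of `f` up to order two exist on `Ω`
and, together with `f`, lie in `L^p_loc(Ω)`. -/
structure MemW2Loc {n : ℕ} (p : ℝ) (Ω : Set ℂ) (f : ℂ → EuclideanSpace ℝ (Fin n)) : Prop where
  memLp : MemLpLocOn p Ω f
  isWeakDeriv : ∀ i, IsWeakDerivOn Ω (coordDir i) f (weakPartial Ω i f)
  memLp_partial : ∀ i, MemLpLocOn p Ω (weakPartial Ω i f)
  isWeakDeriv_partial : ∀ i j,
    IsWeakDerivOn Ω (coordDir j) (weakPartial Ω i f) (weakPartial Ω j (weakPartial Ω i f))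
  memLp_partial_partial : ∀ i j, MemLpLocOn p Ω (weakPartial Ω j (weakPartial Ω i f))

/-- `|∇f|² = |∂ₓf|² + |∂ᵧf|²`. -/
def gradSq {n : ℕ} (Ω : Set ℂ) (f : ℂ → EuclideanSpace ℝ (Fin n)) (z : ℂ) : ℝ :=
  ∑ i, ‖weakPartial Ω i f z‖ ^ 2

/-- `Δf = ∂ₓ∂ₓf + ∂ᵧ∂ᵧf`. -/
def weakLaplacian {n : ℕ} (Ω : Set ℂ) (f : ℂ → EuclideanSpace ℝ (Fin n)) (z : ℂ) :
    EuclideanSpace ℝ (Fin n) :=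
  ∑ i, weakPartial Ω i (weakPartial Ω i f) z

/-- The Dirichlet energy `∫_Ω |∇f|²`, with values in `[0, ∞]`. -/
def dirichletEnergy {n : ℕ} (Ω : Set ℂ) (f : ℂ → EuclideanSpace ℝ (Fin n)) : ℝ≥0∞ :=
  ∫⁻ z in Ω, ENNReal.ofReal (gradSq Ω f z)

/-- The `k`-th component of `∂f/∂z = (∂ₓf - i ∂ᵧf) / 2`. -/
def weakDz {n : ℕ} (Ω : Set ℂ) (f : ℂ → EuclideanSpace ℝ (Fin n)) (z : ℂ) (k : Fin n) : ℂ :=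
  ((weakPartial Ω 0 f z k : ℂ) - Complex.I * (weakPartial Ω 1 f z k : ℂ)) / 2

/-- The class `𝓕^p(Ω, R)` of maps `Ω → ℝⁿ`, for `Ω ⊆ ℂ` open with the Euclidean metric.
Only the values of the maps on `Ω` matter. -/
structure MemF {n : ℕ} (p R : ℝ) (Ω : Set ℂ) (f : ℂ → EuclideanSpace ℝ (Fin n)) : Prop where
  memW2Loc : MemW2Loc p Ω f
  mapsTo : MapsTo f Ω (Metric.closedBall 0 R)
  laplacian_le : ∃ β : ℂ → ℝ≥0, Measurable β ∧
    (∀ᵐ z ∂(volume.restrict Ω), ‖weakLaplacian Ω f z‖ ≤ β z * gradSq Ω f z) ∧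
    ∫⁻ z in Ω, ENNReal.ofReal ((β z : ℝ) ^ 2 * gradSq Ω f z) < ⊤

/-- The class `𝓕^p_conf(Ω, R)`: the elements of `𝓕^p(Ω, R)` that are weakly conformal a.e.,
i.e. `∂f/∂z · ∂f/∂z = 0` a.e. for the complex bilinear extension of the inner product of `ℝⁿ`. -/
structure MemFConf {n : ℕ} (p R : ℝ) (Ω : Set ℂ) (f : ℂ → EuclideanSpace ℝ (Fin n)) : Prop
    extends MemF p R Ω f where
  conformal : ∀ᵐ z ∂(volume.restrict Ω), ∑ k, weakDz Ω f z k ^ 2 = 0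

end

/-! Put b = β|∇f|. The hypotheses then say that b is square-integrable on the punctured disk and
|Δf| ≤ b|∇f|. Away from the origin there is nothing to prove, so two facts suffice. First, the
second derivatives of f lie in L^q near 0 for 1 < q < 4/3, q ≤ p (`ConfData.exists_memLp_hessian`).
Second, a point is no obstacle to the weak differentiation of square-integrable functions
(`IsWeakDerivOn.of_pDisk`); this is applied to f, which is bounded, and then to ∇f, which has finite
energy.

Local regularity. The complex gradient f_x - i f_y satisfies (∂_x + i∂_y)(f_x - i f_y) = Δf, so
second derivatives are governed by an L^q bound for the Cauchy–Riemann operator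
(`exists_eLpNorm_fderiv_le_dzBarOp`). That bound is obtained from the Beurling transform with
kernels regularised at scale ε: an L² identity by integration by parts, a Calderón–Zygmund
decomposition over Vitali balls, and integration of the resulting distribution estimate, all uniform
in ε. Combined with Sobolev's inequality it lets the critical term b|∇f| be absorbed wherever the L²
norm of b is small (`exists_eLpNorm_hessian_le`).

Energy decay. Test Δf against a radial weight times f minus its mean over circles. After Wirtinger's
inequality with its sharp constant, the weight |z|^(-s) bounds the weighted angular energy by s/2
times the weighted full energy, plus an error (`integral_angD_sq_le`). For a conformal map the
angular energy is exactly half of the full energy, so for every s < 1 a positive multiple (1 - s)/2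
of the weighted energy is left on the good side. The error pairs Δf with differences of f and its
rotations. On dyadic annuli it is at most the L² norm of b times the local energy, with all powers
of the radius cancelling, and it is absorbed close to the origin (`exists_weighted_energy_le`).
Hence the energy of the disk of radius ε is O(ε^s) (`ConfData.exists_energy_decay`).

The exponent 4/3. Apply the Hessian estimate with a cutoff vanishing near the origin at scale ε. By
Hölder its gradient contributes ε^(-1) ε^(2/q - 1) ε^(s/2), which is bounded for s = 4 - 4/q, and
this s is below 1 exactly when q < 4/3. Letting ε tend to 0, Fatou's lemma gives the L^q bound on
the Hessian. -/

noncomputable section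

open Filter ContinuousLinearMap Metric
open scoped Topology Convolution ComplexConjugate

/-! ### Young's inequality and mollification -/

/-- **Young's inequality** for the convolution of an `L¹` kernel with an `Lᵖ` function. -/
theorem lintegral_rpow_lintegral_sub_mul_le {k G : ℂ → ℝ≥0∞} (hk : Measurable k)
    (hG : AEMeasurable G) {p : ℝ} (hp : 1 ≤ p) :
    ∫⁻ x, (∫⁻ y, k (x - y) * G y) ^ p ≤ (∫⁻ z, k z) ^ p * ∫⁻ y, G y ^ p := by
  have hkx : ∀ x, Measurable fun y => k (x - y) := fun x => hk.comp (measurable_const.sub measurable_id)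
  have hmass : ∀ x, ∫⁻ y, k (x - y) = ∫⁻ z, k z := fun x => by
    rw [lintegral_sub_left_eq_self (fun z => k z) x]
  have hmass' : ∀ y, ∫⁻ x, k (x - y) = ∫⁻ z, k z := fun y => by
    rw [lintegral_sub_right_eq_self (fun z => k z) y]
  have hpt : ∀ x, (∫⁻ y, k (x - y) * G y) ^ p
      ≤ (∫⁻ z, k z) ^ (p - 1) * ∫⁻ y, k (x - y) * G y ^ p := by
    intro x
    rcases hp.eq_or_lt with rfl | hp1
    · simp
    have hpq := Real.HolderConjugate.conjExponent hp1
    set q := p.conjExponent with hq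
    have hp0 : 0 < p := by linarith
    -- Hölder for the splitting k G = (k^(1/p) G) · k^(1/q). The second factor integrates to the
    -- total mass of k whatever x is, and Tonelli handles the first.
    have h := ENNReal.lintegral_mul_le_Lp_mul_Lq volume hpq
      (f := fun y => k (x - y) ^ (1 / p) * G y) (g := fun y => k (x - y) ^ (1 / q))
      (((hkx x).pow_const _).aemeasurable.mul hG) ((hkx x).pow_const _).aemeasurable
    have e1 : ∀ y, ((fun y => k (x - y) ^ (1 / p) * G y) * fun y => k (x - y) ^ (1 / q)) y
        = k (x - y) * G y := by
      intro y
      simp only [Pi.mul_apply]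
      rw [mul_right_comm, ← ENNReal.rpow_add_of_nonneg _ _ (by positivity)
        (one_div_nonneg.2 hpq.symm.nonneg)]
      rw [hpq.one_div_add_one_div, div_one, ENNReal.rpow_one]
    have e2 : ∀ y, (k (x - y) ^ (1 / p) * G y) ^ p = k (x - y) * G y ^ p := by
      intro y
      rw [ENNReal.mul_rpow_of_nonneg _ _ hp0.le, ← ENNReal.rpow_mul, one_div_mul_cancel hp0.ne',
        ENNReal.rpow_one]
    have e3 : ∀ y, (k (x - y) ^ (1 / q)) ^ q = k (x - y) := by
      intro y
      rw [← ENNReal.rpow_mul, one_div_mul_cancel hpq.symm.pos.ne', ENNReal.rpow_one]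
    simp only [e1, e2, e3, hmass] at h
    calc (∫⁻ y, k (x - y) * G y) ^ p
        ≤ ((∫⁻ y, k (x - y) * G y ^ p) ^ (1 / p) * (∫⁻ z, k z) ^ (1 / q)) ^ p := by gcongr
      _ = (∫⁻ z, k z) ^ (p - 1) * ∫⁻ y, k (x - y) * G y ^ p := by
          rw [ENNReal.mul_rpow_of_nonneg _ _ hp0.le, ← ENNReal.rpow_mul, ← ENNReal.rpow_mul,
            one_div_mul_cancel hp0.ne', ENNReal.rpow_one, mul_comm]
          congr 2
          rw [hq, Real.conjExponent]
          field_simp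
  have hkm : Measurable fun z : ℂ × ℂ => k (z.1 - z.2) :=
    hk.comp (measurable_fst.sub measurable_snd)
  calc ∫⁻ x, (∫⁻ y, k (x - y) * G y) ^ p
      ≤ ∫⁻ x, (∫⁻ z, k z) ^ (p - 1) * ∫⁻ y, k (x - y) * G y ^ p := lintegral_mono hpt
    _ = (∫⁻ z, k z) ^ (p - 1) * ∫⁻ x, ∫⁻ y, k (x - y) * G y ^ p := by
        apply lintegral_const_mul''
        exact AEMeasurable.lintegral_prod_right'
          (f := fun z : ℂ × ℂ => k (z.1 - z.2) * G z.2 ^ p)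
          (hkm.aemeasurable.mul ((hG.pow_const p).comp_quasiMeasurePreserving
            Measure.quasiMeasurePreserving_snd))
    _ = (∫⁻ z, k z) ^ (p - 1) * ∫⁻ y, (∫⁻ z, k z) * G y ^ p := by
        rw [lintegral_lintegral_swap (hkm.aemeasurable.mul
          ((hG.pow_const p).comp_quasiMeasurePreserving Measure.quasiMeasurePreserving_snd))]
        congr 2 with y
        have hky : Measurable fun x => k (x - y) := hk.comp (measurable_id.sub measurable_const)
        rw [lintegral_mul_const'' _ hky.aemeasurable, hmass']
    _ = (∫⁻ z, k z) ^ p * ∫⁻ y, G y ^ p := by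
        rw [lintegral_const_mul'' _ (hG.pow_const p), ← mul_assoc]
        congr 1
        nth_rewrite 2 [← ENNReal.rpow_one (∫⁻ z, k z)]
        rw [← ENNReal.rpow_add_of_nonneg _ _ (by linarith) zero_le_one]
        simp

variable {F : Type*} [NormedAddCommGroup F] [NormedSpace ℝ F]

/-- A sequence of smooth bumps shrinking to the origin. -/
def mollBump (n : ℕ) : ContDiffBump (0 : ℂ) where
  rIn := 1 / (n + 1)
  -- The ratio of the two radii stays equal to 2; a bounded ratio is what the almost everywhere
  -- convergence of mollifications requires.
  rOut := 2 / (n + 1)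
  rIn_pos := by positivity
  rIn_lt_rOut := by gcongr; norm_num

/-- The `n`-th mollification of a function on the plane. -/
def mollify (n : ℕ) (g : ℂ → F) : ℂ → F :=
  (mollBump n).normed volume ⋆[lsmul ℝ ℝ, volume] g

theorem tendsto_mollBump_rOut : Tendsto (fun n => (mollBump n).rOut) atTop (𝓝 0) := by
  have := (tendsto_one_div_add_atTop_nhds_zero_nat (𝕜 := ℝ)).const_mul 2
  simp only [mul_one_div, mul_zero] at this
  exact this

theorem mollBump_rOut_le (n : ℕ) : (mollBump n).rOut ≤ 2 := by
  simp only [mollBump]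
  rw [div_le_iff₀ (by positivity)]
  nlinarith [(Nat.cast_nonneg n : (0:ℝ) ≤ n)]

theorem mollify_apply (n : ℕ) (g : ℂ → F) (x : ℂ) :
    mollify n g x = ∫ t, (mollBump n).normed volume (x - t) • g t := by
  rw [mollify, convolution_eq_swap]; rfl

theorem contDiff_mollify (n : ℕ) {g : ℂ → F} (hg : LocallyIntegrable g) :
    ContDiff ℝ ∞ (mollify n g) :=
  (mollBump n).hasCompactSupport_normed.contDiff_convolution_left (n := ⊤) _
    (mollBump n).contDiff_normed hg

theorem hasCompactSupport_mollify (n : ℕ) {g : ℂ → F} (hg : HasCompactSupport g) :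
    HasCompactSupport (mollify n g) :=
  (mollBump n).hasCompactSupport_normed.convolution _ hg

theorem ae_tendsto_mollify [CompleteSpace F] {g : ℂ → F} (hg : LocallyIntegrable g) :
    ∀ᵐ x, Tendsto (fun n => mollify n g x) atTop (𝓝 (g x)) := by
  refine ContDiffBump.ae_convolution_tendsto_right_of_locallyIntegrable (K := 2)
    tendsto_mollBump_rOut (Eventually.of_forall fun n => ?_) hg
  simp only [mollBump]
  exact le_of_eq (by ring)

theorem lintegral_enorm_mollBump (n : ℕ) :
    ∫⁻ z, ‖(mollBump n).normed volume z‖ₑ = 1 := by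
  have h := ofReal_integral_norm_eq_lintegral_enorm
    (f := (mollBump n).normed volume) (μ := volume) (mollBump n).integrable_normed
  rw [← h]
  simp only [Real.norm_of_nonneg ((mollBump n).nonneg_normed _)]
  rw [(mollBump n).integral_normed, ENNReal.ofReal_one]

/-- Young's inequality with a kernel of mass one. -/
theorem eLpNorm_mollify_le (n : ℕ) {g : ℂ → F} (hg : AEStronglyMeasurable g) {p : ℝ}
    (hp : 1 ≤ p) :
    eLpNorm (mollify n g) (ENNReal.ofReal p) volume ≤ eLpNorm g (ENNReal.ofReal p) volume := by
  have hp0 : 0 < p := by linarith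
  have hp1 : ENNReal.ofReal p ≠ 0 := by simpa using hp0
  rw [eLpNorm_eq_lintegral_rpow_enorm_toReal hp1 ENNReal.ofReal_ne_top,
    eLpNorm_eq_lintegral_rpow_enorm_toReal hp1 ENNReal.ofReal_ne_top, ENNReal.toReal_ofReal hp0.le]
  gcongr ?_ ^ (1 / p)
  have h := lintegral_rpow_lintegral_sub_mul_le
    (k := fun z => ‖(mollBump n).normed volume z‖ₑ)
    ((mollBump n).continuous_normed.enorm.measurable) hg.enorm hp
  rw [lintegral_enorm_mollBump, ENNReal.one_rpow, one_mul] at h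
  refine le_trans (lintegral_mono fun x => ?_) h
  gcongr
  rw [mollify_apply]
  refine (enorm_integral_le_lintegral_enorm _).trans (lintegral_mono fun t => ?_)
  rw [enorm_smul]

theorem mollify_sub (n : ℕ) {g h : ℂ → F} (hg : LocallyIntegrable g) (hh : LocallyIntegrable h) :
    mollify n (g - h) = mollify n g - mollify n h := by
  ext x
  have key : ∀ {u : ℂ → F}, LocallyIntegrable u →
      Integrable fun t => (mollBump n).normed volume (x - t) • u t := by
    intro u hu
    have hc : HasCompactSupport fun t => (mollBump n).normed volume (x - t) :=
      (mollBump n).hasCompactSupport_normed.comp_homeomorph (Homeomorph.subLeft x)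
    exact hu.integrable_smul_left_of_hasCompactSupport
      ((mollBump n).continuous_normed.comp (continuous_const.sub continuous_id)) hc
  simp only [Pi.sub_apply, mollify_apply, smul_sub]
  exact integral_sub (key hg) (key hh)

/-- Uniform continuity makes the error at most δ everywhere, and the error lives in one fixed ball,
so its norm is at most δ times a fixed power of the area. -/
theorem tendsto_eLpNorm_mollify_sub_of_continuous [CompleteSpace F] {g : ℂ → F}
    (hg : Continuous g)
    (hc : HasCompactSupport g) {p : ℝ} (hp : 1 ≤ p) :
    Tendsto (fun n => eLpNorm (mollify n g - g) (ENNReal.ofReal p) volume) atTop (𝓝 0) := by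
  have hp0 : 0 < p := by linarith
  obtain ⟨M, hM⟩ := hc.isCompact.isBounded.subset_closedBall 0
  have hM0 : ∀ x, g x ≠ 0 → ‖x‖ ≤ M := fun x hx => by
    simpa using hM (subset_tsupport g hx)
  have huc := hc.uniformContinuous_of_continuous hg
  -- The margin 2 holds the supports of all mollifications, whose outer radii are at most 2.
  set V := volume (Metric.closedBall (0 : ℂ) (M + 2)) ^ (1 / p) with hV
  have hVtop : V ≠ ⊤ := ENNReal.rpow_ne_top_of_nonneg (by positivity) measure_closedBall_lt_top.ne
  rw [ENNReal.tendsto_atTop_zero]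
  intro ε hε
  obtain ⟨δ, hδ0, hδ⟩ : ∃ δ : ℝ, 0 < δ ∧ V * ENNReal.ofReal δ ≤ ε := by
    by_cases hεt : ε = ⊤
    · exact ⟨1, one_pos, by simp [hεt]⟩
    · refine ⟨ε.toReal / (V.toReal + 1), by
        have := ENNReal.toReal_pos hε.ne' hεt
        positivity, ?_⟩
      rw [← ENNReal.ofReal_toReal hVtop, ← ENNReal.ofReal_mul ENNReal.toReal_nonneg]
      rw [ENNReal.ofReal_le_iff_le_toReal hεt, ENNReal.toReal_ofReal ENNReal.toReal_nonneg]
      have h1 := ENNReal.toReal_nonneg (a := V)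
      have h2 := ENNReal.toReal_nonneg (a := ε)
      rw [mul_div_assoc', div_le_iff₀ (by positivity)]
      nlinarith
  obtain ⟨η, hη0, hη⟩ := Metric.uniformContinuous_iff.1 huc δ hδ0
  obtain ⟨N, hN⟩ := ((tendsto_mollBump_rOut).eventually (gt_mem_nhds hη0)).exists_forall_of_atTop
  refine ⟨N, fun n hn => ?_⟩
  refine le_trans ?_ hδ
  have hsupp : ∀ x, x ∉ Metric.closedBall (0 : ℂ) (M + 2) → (mollify n g - g) x = 0 := by
    intro x hx
    have hx' : M + 2 < ‖x‖ := by simpa using hx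
    have hgx : g x = 0 := by
      by_contra h
      linarith [hM0 x h]
    rw [Pi.sub_apply, hgx, sub_zero, mollify,
      ContDiffBump.normed_convolution_eq_right (fun y hy => ?_), hgx]
    rw [hgx]
    by_contra h
    have h1 := hM0 y h
    have h2 : ‖x‖ ≤ ‖y‖ + ‖x - y‖ := by
      simpa using norm_add_le y (x - y)
    have h3 : ‖x - y‖ < 2 := by
      rw [Metric.mem_ball, dist_comm, dist_eq_norm] at hy
      exact hy.trans_le (mollBump_rOut_le n)
    linarith
  have hb : ∀ᵐ x ∂(volume.restrict (Metric.closedBall (0 : ℂ) (M + 2))),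
      ‖(mollify n g - g) x‖ ≤ δ := by
    refine Eventually.of_forall fun x => ?_
    rw [Pi.sub_apply, ← dist_eq_norm]
    refine ContDiffBump.dist_normed_convolution_le hg.aestronglyMeasurable fun y hy => ?_
    refine (hη (a := y) (b := x) ?_).le
    exact (Metric.mem_ball.1 hy).trans (hN n hn)
  have := eLpNorm_le_of_ae_bound (p := ENNReal.ofReal p) hb
  rw [ENNReal.toReal_ofReal hp0.le, Measure.restrict_apply_univ, inv_eq_one_div] at this
  refine le_trans (le_of_eq ?_) this
  rw [eLpNorm_restrict_eq_of_support_subset]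
  intro x hx
  by_contra h
  exact hx (hsupp x h)

/-- Density of continuous compactly supported functions, together with the fact that mollification
is a contraction: three errors of ε/3. -/
theorem tendsto_eLpNorm_mollify_sub [CompleteSpace F] {g : ℂ → F} {p : ℝ} (hp : 1 ≤ p)
    (hg : MemLp g (ENNReal.ofReal p) volume) :
    Tendsto (fun n => eLpNorm (mollify n g - g) (ENNReal.ofReal p) volume) atTop (𝓝 0) := by
  have hp1 : 1 ≤ ENNReal.ofReal p := by simpa using hp
  rw [ENNReal.tendsto_atTop_zero]
  intro ε hε
  have hε3 : ε / 3 ≠ 0 := (ENNReal.div_pos hε.ne' (by norm_num)).ne'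
  obtain ⟨c, hcs, hce, hcc, hcm⟩ :=
    hg.exists_hasCompactSupport_eLpNorm_sub_le ENNReal.ofReal_ne_top hε3
  obtain ⟨N, hN⟩ := ENNReal.tendsto_atTop_zero.1
    (tendsto_eLpNorm_mollify_sub_of_continuous hcc hcs hp) (ε / 3) (pos_iff_ne_zero.2 hε3)
  refine ⟨N, fun n hn => ?_⟩
  have hgl : LocallyIntegrable g := hg.locallyIntegrable hp1
  have hcl : LocallyIntegrable c := hcm.locallyIntegrable hp1
  have hd : mollify n g - g = mollify n (g - c) + ((mollify n c - c) + (c - g)) := by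
    rw [mollify_sub n hgl hcl]; abel
  have hm1 : AEStronglyMeasurable (mollify n (g - c)) :=
    (contDiff_mollify n (hgl.sub hcl)).continuous.aestronglyMeasurable
  have hm2 : AEStronglyMeasurable (mollify n c - c) :=
    ((contDiff_mollify n hcl).continuous.sub hcc).aestronglyMeasurable
  have hm3 : AEStronglyMeasurable (c - g) := hcm.1.sub hg.1
  rw [hd]
  calc eLpNorm (mollify n (g - c) + ((mollify n c - c) + (c - g))) (ENNReal.ofReal p) volume
      ≤ ε / 3 + (ε / 3 + ε / 3) := by
        refine (eLpNorm_add_le hm1 (hm2.add hm3) hp1).trans (add_le_add ?_ ?_)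
        · exact (eLpNorm_mollify_le n (hg.1.sub hcm.1) hp).trans hce
        · refine (eLpNorm_add_le hm2 hm3 hp1).trans (add_le_add (hN n hn) ?_)
          rwa [eLpNorm_sub_comm]
    _ = ε := by rw [← add_assoc]; exact ENNReal.add_thirds ε

/-! ### Weak derivatives on the whole plane. -/

/-- `G` is the weak derivative of `f` on the whole plane in the direction `v`. -/
structure HasWeakDeriv (v : ℂ) (f G : ℂ → F) : Prop where
  locallyIntegrable : LocallyIntegrable f
  locallyIntegrable_deriv : LocallyIntegrable G
  integral_eq : ∀ φ : ℂ → ℝ, ContDiff ℝ ∞ φ → HasCompactSupport φ →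
    ∫ z, (fderiv ℝ φ z v) • f z = - ∫ z, φ z • G z

/-- The derivative of the convolution falls on the bump ρ, and t ↦ ρ(x - t) is itself a test
function, whose derivative has the opposite sign. -/
theorem HasWeakDeriv.fderiv_mollify {v : ℂ} {f G : ℂ → F} (h : HasWeakDeriv v f G)
    (n : ℕ) (x : ℂ) : fderiv ℝ (mollify n f) x v = mollify n G x := by
  set ρ := (mollBump n).normed volume with hρ
  have hρs : ContDiff ℝ ∞ ρ := (mollBump n).contDiff_normed (n := ⊤)
  have hρc : HasCompactSupport ρ := (mollBump n).hasCompactSupport_normed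
  have hd := hρc.hasFDerivAt_convolution_left (lsmul ℝ ℝ)
    (hρs.of_le (by norm_cast)) h.locallyIntegrable x
  have hd' : fderiv ℝ (mollify n f) x v
      = ∫ t, (fderiv ℝ ρ (x - t) v) • f t := by
    rw [mollify, hd.fderiv, convolution_eq_swap]
    rw [ContinuousLinearMap.integral_apply]
    · rfl
    have := (hρc.fderiv ℝ).convolutionExists_left ((lsmul ℝ ℝ : ℝ →L[ℝ] F →L[ℝ] F).precompL ℂ)
      (hρs.continuous_fderiv (by simp)) h.locallyIntegrable x
    exact this.integrable_swap
  have hφ : ContDiff ℝ ∞ fun t => ρ (x - t) := hρs.comp (contDiff_const.sub contDiff_id)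
  have hφc : HasCompactSupport fun t => ρ (x - t) :=
    hρc.comp_homeomorph (Homeomorph.subLeft x)
  have hφd : ∀ t, fderiv ℝ (fun t => ρ (x - t)) t v = - fderiv ℝ ρ (x - t) v := by
    intro t
    have h1 : HasFDerivAt (fun t => ρ (x - t)) _ t :=
      ((hρs.differentiable (by simp)) (x - t)).hasFDerivAt.comp t ((hasFDerivAt_id t).const_sub x)
    rw [h1.fderiv]
    simp
  have := h.integral_eq _ hφ hφc
  simp only [hφd, neg_smul, integral_neg, neg_inj] at this
  rw [hd', this, mollify_apply]

/-! ### A regularised Beurling transform and its `L²` bound -/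

/-- The regularised Cauchy kernel `z̄ / (|z|² + ε²)`. -/
def cauchyKer (ε : ℝ) (z : ℂ) : ℂ := conj z / ((‖z‖ ^ 2 + ε ^ 2 : ℝ) : ℂ)

/-- The regularised Beurling kernel, the square of the regularised Cauchy kernel. -/
def beurlingKer (ε : ℝ) (z : ℂ) : ℂ := cauchyKer ε z ^ 2

/-- The approximate identity `ε² / (|z|² + ε²)²`. -/
def approxIdKer (ε : ℝ) (z : ℂ) : ℂ := ((ε ^ 2 / (‖z‖ ^ 2 + ε ^ 2) ^ 2 : ℝ) : ℂ)

/-- Convolution of a kernel with a function. -/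
def kerConv (k g : ℂ → ℂ) (x : ℂ) : ℂ := ∫ y, k (x - y) * g y

section Kernels

variable {ε : ℝ}

theorem normSq_add_sq_pos (hε : 0 < ε) (z : ℂ) : 0 < ‖z‖ ^ 2 + ε ^ 2 := by positivity

theorem continuous_cauchyKer (hε : 0 < ε) : Continuous (cauchyKer ε) := by
  unfold cauchyKer
  refine Complex.continuous_conj.div (by fun_prop) fun z => ?_
  exact_mod_cast (normSq_add_sq_pos hε z).ne'

theorem continuous_beurlingKer (hε : 0 < ε) : Continuous (beurlingKer ε) :=
  (continuous_cauchyKer hε).pow 2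

theorem continuous_approxIdKer (hε : 0 < ε) : Continuous (approxIdKer ε) := by
  unfold approxIdKer
  refine Complex.continuous_ofReal.comp (continuous_const.div (by fun_prop) fun z => ?_)
  exact (pow_pos (normSq_add_sq_pos hε z) 2).ne'

theorem norm_cauchyKer (hε : 0 < ε) (z : ℂ) : ‖cauchyKer ε z‖ = ‖z‖ / (‖z‖ ^ 2 + ε ^ 2) := by
  rw [cauchyKer, norm_div, RCLike.norm_conj, Complex.norm_real,
    Real.norm_of_nonneg (normSq_add_sq_pos hε z).le]

theorem norm_approxIdKer (hε : 0 < ε) (z : ℂ) :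
    ‖approxIdKer ε z‖ = ε ^ 2 / (‖z‖ ^ 2 + ε ^ 2) ^ 2 := by
  rw [approxIdKer, Complex.norm_real, Real.norm_of_nonneg (by positivity)]

theorem norm_cauchyKer_le (hε : 0 < ε) (z : ℂ) :
    ‖cauchyKer ε z‖ ≤ (2 + 2 / ε ^ 2) / (1 + ‖z‖) := by
  rw [norm_cauchyKer hε, div_le_div_iff₀ (normSq_add_sq_pos hε z) (by positivity)]
  have h : (2 + 2 / ε ^ 2) * (‖z‖ ^ 2 + ε ^ 2)
      = 2 * ‖z‖ ^ 2 + 2 + 2 * ε ^ 2 + 2 / ε ^ 2 * ‖z‖ ^ 2 := by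
    field_simp
    ring
  rw [h]
  have : 0 ≤ 2 / ε ^ 2 * ‖z‖ ^ 2 := by positivity
  nlinarith [sq_nonneg (‖z‖ - 1), sq_nonneg ε]

theorem norm_beurlingKer_le (hε : 0 < ε) (z : ℂ) :
    ‖beurlingKer ε z‖ ≤ (2 + 2 / ε ^ 2) ^ 2 / (1 + ‖z‖) ^ 2 := by
  rw [beurlingKer, norm_pow, ← div_pow]
  exact pow_le_pow_left₀ (norm_nonneg _) (norm_cauchyKer_le hε z) 2

theorem norm_approxIdKer_le (hε : 0 < ε) (z : ℂ) :
    ‖approxIdKer ε z‖ ≤ (2 + 2 / ε ^ 2) / (1 + ‖z‖) ^ 2 := by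
  have hN := normSq_add_sq_pos hε z
  rw [norm_approxIdKer hε, div_le_div_iff₀ (by positivity) (by positivity)]
  have h : (2 + 2 / ε ^ 2) * (‖z‖ ^ 2 + ε ^ 2)
      = 2 * ‖z‖ ^ 2 + 2 + 2 * ε ^ 2 + 2 / ε ^ 2 * ‖z‖ ^ 2 := by
    field_simp
    ring
  have h1 : (1 + ‖z‖) ^ 2 ≤ (2 + 2 / ε ^ 2) * (‖z‖ ^ 2 + ε ^ 2) := by
    rw [h]
    have : 0 ≤ 2 / ε ^ 2 * ‖z‖ ^ 2 := by positivity
    nlinarith [sq_nonneg (‖z‖ - 1), sq_nonneg ε]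
  calc ε ^ 2 * (1 + ‖z‖) ^ 2
      ≤ (‖z‖ ^ 2 + ε ^ 2) * ((2 + 2 / ε ^ 2) * (‖z‖ ^ 2 + ε ^ 2)) := by
        gcongr
        nlinarith [sq_nonneg ‖z‖]
    _ = _ := by ring

/-- In Wirtinger notation, ∂ of the Cauchy kernel is minus the Beurling kernel and ∂̄ of it is the
approximate identity. That the singular kernel and the approximate identity are derivatives of one
function is the source of the L² theory. -/
theorem hasFDerivAt_cauchyKer (hε : 0 < ε) (z : ℂ) :
    HasFDerivAt (cauchyKer ε)
      ((-beurlingKer ε z) • ContinuousLinearMap.id ℝ ℂ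
        + approxIdKer ε z • (Complex.conjCLE : ℂ →L[ℝ] ℂ)) z := by
  have hN : (z * conj z + (ε : ℂ) ^ 2) ≠ 0 := by
    rw [Complex.mul_conj, Complex.normSq_eq_norm_sq]
    exact_mod_cast (normSq_add_sq_pos hε z).ne'
  have hc : HasFDerivAt (fun z : ℂ => conj z) (Complex.conjCLE : ℂ →L[ℝ] ℂ) z :=
    (Complex.conjCLE : ℂ →L[ℝ] ℂ).hasFDerivAt
  have hd := (((hasFDerivAt_id z).mul hc).add_const ((ε : ℂ) ^ 2))
  have hinv := (hasDerivAt_inv hN).comp_hasFDerivAt_of_eq z (hd : HasFDerivAt (𝕜 := ℝ) _ _ z) rfl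
  have h := hc.mul hinv
  -- Writing |z|² as z z̄ opens the kernel to the product and inverse rules.
  have heq : cauchyKer ε = fun z : ℂ => conj z * (z * conj z + (ε : ℂ) ^ 2)⁻¹ := by
    ext w
    rw [cauchyKer, Complex.mul_conj, Complex.normSq_eq_norm_sq]
    push_cast
    rw [div_eq_mul_inv]
  have e1 : beurlingKer ε z = (conj z * (z * conj z + (ε : ℂ) ^ 2)⁻¹) ^ 2 := by
    rw [beurlingKer, heq]
  have e2 : approxIdKer ε z = (ε : ℂ) ^ 2 / (z * conj z + (ε : ℂ) ^ 2) ^ 2 := by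
    rw [approxIdKer, Complex.mul_conj, Complex.normSq_eq_norm_sq]
    push_cast
    ring
  rw [e1, e2, heq]
  refine h.congr_fderiv ?_
  ext v
  simp
  field_simp
  ring

end Kernels

/-! ### Convolutions with the regularised kernels and the L² identity. -/

section KerConv

/-- A bounded continuous kernel. -/
theorem integrable_kerConv {k g : ℂ → ℂ} (hk : Continuous k) {M : ℝ} (hM : ∀ z, ‖k z‖ ≤ M)
    (hg : Integrable g) (x : ℂ) : Integrable fun y => k (x - y) * g y :=
  hg.bdd_mul (hk.comp (continuous_const.sub continuous_id)).aestronglyMeasurable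
    (Eventually.of_forall fun y => hM (x - y))

theorem norm_le_of_norm_le_div {k : ℂ → ℂ} {C : ℝ} {m : ℕ} (hC : 0 ≤ C)
    (h : ∀ z, ‖k z‖ ≤ C / (1 + ‖z‖) ^ m) (z : ℂ) : ‖k z‖ ≤ C :=
  (h z).trans (div_le_self hC (one_le_pow₀ (by linarith [norm_nonneg z])))

/-- Polynomial decay survives convolution with a compactly supported function, because 1 + ‖x‖ ≤ (1
+ |M|)(1 + ‖x - y‖) when ‖y‖ ≤ M. -/
theorem norm_kerConv_le {k g : ℂ → ℂ} {C M : ℝ} {m : ℕ} (hC : 0 ≤ C)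
    (h : ∀ z, ‖k z‖ ≤ C / (1 + ‖z‖) ^ m) (hg : Integrable g) (hM : ∀ y, g y ≠ 0 → ‖y‖ ≤ M)
    (x : ℂ) :
    ‖kerConv k g x‖ ≤ (C * (1 + |M|) ^ m * ∫ y, ‖g y‖) / (1 + ‖x‖) ^ m := by
  have h1 : ∀ y, ‖k (x - y) * g y‖ ≤ C * (1 + |M|) ^ m / (1 + ‖x‖) ^ m * ‖g y‖ := by
    intro y
    rw [norm_mul]
    by_cases hy : g y = 0
    · simp [hy]
    gcongr
    refine (h _).trans ?_
    rw [div_le_div_iff₀ (by positivity) (by positivity), mul_assoc, ← mul_pow]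
    gcongr
    have h2 : ‖x‖ ≤ ‖x - y‖ + ‖y‖ := by simpa using norm_add_le (x - y) y
    have h3 := (hM y hy).trans (le_abs_self M)
    nlinarith [norm_nonneg (x - y), abs_nonneg M, mul_nonneg (abs_nonneg M) (norm_nonneg (x - y))]
  refine (norm_integral_le_integral_norm _).trans ?_
  refine (integral_mono_of_nonneg (Eventually.of_forall fun y => norm_nonneg _)
    (hg.norm.const_mul _) (Eventually.of_forall h1)).trans (le_of_eq ?_)
  rw [integral_const_mul]
  ring

/-- Here the derivative falls on g, while in `hasFDerivAt_kerConv_cauchyKer` it falls on the kernel.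
Equating the two expressions yields the relations between the three convolutions. -/
theorem hasFDerivAt_kerConv_of_contDiff {k g : ℂ → ℂ} (hk : Continuous k)
    (hg : ContDiff ℝ 1 g) (hc : HasCompactSupport g) (x : ℂ) :
    ∃ D : ℂ →L[ℝ] ℂ, HasFDerivAt (kerConv k g) D x ∧ ∀ v, D v = kerConv k (fun y => fderiv ℝ g y v) x := by
  have heq : kerConv k g = k ⋆[mul ℝ ℂ, volume] g := by
    ext x
    rw [kerConv, ← integral_sub_left_eq_self _ volume x]
    simp [convolution]
  have h := hc.hasFDerivAt_convolution_right (mul ℝ ℂ) hk.locallyIntegrable hg x (μ := volume)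
  refine ⟨_, heq ▸ h, fun v => ?_⟩
  rw [convolution, ContinuousLinearMap.integral_apply]
  · rw [kerConv, ← integral_sub_left_eq_self _ volume x]
    simp
  · exact (hc.fderiv ℝ).convolutionExists_right ((mul ℝ ℂ).precompR ℂ) hk.locallyIntegrable
      (hg.continuous_fderiv one_ne_zero) x

theorem hasFDerivAt_kerConv_cauchyKer {ε : ℝ} (hε : 0 < ε) {g : ℂ → ℂ} (hg : Integrable g)
    (x : ℂ) :
    ∃ D : ℂ →L[ℝ] ℂ, HasFDerivAt (kerConv (cauchyKer ε) g) D x ∧ ∀ v, D v =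
      -kerConv (beurlingKer ε) g x * v + kerConv (approxIdKer ε) g x * conj v := by
  have hC : 0 ≤ 2 + 2 / ε ^ 2 := by positivity
  have b1 := norm_le_of_norm_le_div (m := 1) hC (by simpa using norm_cauchyKer_le hε)
  have b2 := norm_le_of_norm_le_div (sq_nonneg _) (norm_beurlingKer_le hε)
  have b3 := norm_le_of_norm_le_div hC (norm_approxIdKer_le hε)
  set D : ℂ → ℂ →L[ℝ] ℂ := fun z => (-beurlingKer ε z) • ContinuousLinearMap.id ℝ ℂ
        + approxIdKer ε z • (Complex.conjCLE : ℂ →L[ℝ] ℂ) with hD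
  have hDc : Continuous D := by
    have h1 := continuous_beurlingKer hε
    have h2 := continuous_approxIdKer hε
    fun_prop
  have hDb : ∀ z, ‖D z‖ ≤ (2 + 2 / ε ^ 2) ^ 2 + (2 + 2 / ε ^ 2) := by
    intro z
    refine ContinuousLinearMap.opNorm_le_bound _ (by positivity) fun v => ?_
    simp only [hD, add_apply, smul_apply, smul_eq_mul, coe_id', id_eq]
    refine (norm_add_le _ _).trans ?_
    simp only [norm_mul, norm_neg]
    have hv : ‖(Complex.conjCLE : ℂ →L[ℝ] ℂ) v‖ = ‖v‖ := by simp
    rw [hv, ← add_mul]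
    exact mul_le_mul_of_nonneg_right (add_le_add (b2 z) (b3 z)) (norm_nonneg v)
  have hint : ∀ x, Integrable fun y => g y • D (x - y) := by
    intro x
    refine hg.smul_bdd _ (hDc.comp (continuous_const.sub continuous_id)).aestronglyMeasurable
      (Eventually.of_forall fun y => hDb (x - y))
  have key := hasFDerivAt_integral_of_dominated_of_fderiv_le (𝕜 := ℝ) (μ := volume)
    (F := fun x y => cauchyKer ε (x - y) * g y) (F' := fun x y => g y • D (x - y)) (x₀ := x)
    (bound := fun y => ‖g y‖ * ((2 + 2 / ε ^ 2) ^ 2 + (2 + 2 / ε ^ 2))) univ_mem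
    (Eventually.of_forall fun x =>
      (integrable_kerConv (continuous_cauchyKer hε) b1 hg x).aestronglyMeasurable)
    (integrable_kerConv (continuous_cauchyKer hε) b1 hg x) (hint x).aestronglyMeasurable
    (Eventually.of_forall fun y x _ => by
      rw [norm_smul]; gcongr; exact hDb _)
    (hg.norm.mul_const _)
    (Eventually.of_forall fun y x _ => by
      have h1 : HasFDerivAt (fun x => cauchyKer ε (x - y)) (D (x - y)) x :=
        (hasFDerivAt_comp_sub y).2 (hasFDerivAt_cauchyKer hε (x - y))
      exact h1.mul_const' (g y) |>.congr_fderiv (by ext; simp))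
  refine ⟨_, key, fun v => ?_⟩
  rw [ContinuousLinearMap.integral_apply (hint x)]
  simp only [hD, smul_apply, add_apply, coe_id', id_eq, smul_eq_mul]
  have i2 := integrable_kerConv (continuous_beurlingKer hε) b2 hg x
  have i3 := integrable_kerConv (continuous_approxIdKer hε) b3 hg x
  rw [kerConv, kerConv, ← integral_neg, ← integral_mul_const, ← integral_mul_const,
    ← integral_add (f := fun a => -(beurlingKer ε (x - a) * g a) * v) (i2.neg.mul_const v)
      (i3.mul_const _)]
  congr 1 with y
  have hv : (Complex.conjCLE : ℂ →L[ℝ] ℂ) v = conj v := rfl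
  rw [hv]
  ring

theorem continuous_kerConv {k g : ℂ → ℂ} (hk : Continuous k) {M : ℝ} (hM : ∀ z, ‖k z‖ ≤ M)
    (hg : Integrable g) : Continuous (kerConv k g) := by
  refine continuous_of_dominated (bound := fun y => M * ‖g y‖)
    (fun x => (integrable_kerConv hk hM hg x).aestronglyMeasurable)
    (fun x => Eventually.of_forall fun y => ?_) (hg.norm.const_mul M)
    (Eventually.of_forall fun y => ?_)
  · rw [norm_mul]; gcongr; exact hM _
  · exact (hk.comp (continuous_id.sub continuous_const)).mul continuous_const

/-- Three is the first integer exceeding the real dimension of the plane. -/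
theorem integrable_of_norm_le_div {X : ℂ → ℂ} (hX : Continuous X) {C : ℝ} {m : ℕ} (hm : 3 ≤ m)
    (h : ∀ x, ‖X x‖ ≤ C / (1 + ‖x‖) ^ m) : Integrable X := by
  have hi : Integrable (fun x : ℂ => C * (1 + ‖x‖) ^ (-(m : ℝ))) := by
    refine (integrable_one_add_norm ?_).const_mul C
    rw [Complex.finrank_real_complex]
    exact_mod_cast hm
  refine hi.mono' hX.aestronglyMeasurable (Eventually.of_forall fun x => ?_)
  rw [Real.rpow_neg (by positivity), Real.rpow_natCast, ← div_eq_mul_inv]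
  exact h x

theorem integral_fderiv_mul_conj_eq {X Y : ℂ → ℂ} {v : ℂ} (hX : Differentiable ℝ X)
    (hY : Differentiable ℝ Y) (h1 : Integrable fun x => fderiv ℝ X x v * conj (Y x))
    (h2 : Integrable fun x => X x * conj (fderiv ℝ Y x v))
    (h3 : Integrable fun x => X x * conj (Y x)) :
    ∫ x, fderiv ℝ X x v * conj (Y x) = -∫ x, X x * conj (fderiv ℝ Y x v) := by
  set B : ℂ →L[ℝ] ℂ →L[ℝ] ℂ :=
    ((mul ℝ ℂ).flip.comp (Complex.conjCLE : ℂ →L[ℝ] ℂ)).flip with hB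
  have hBa : ∀ x y, B x y = x * conj y := fun x y => by simp [hB, mul_comm]
  have := integral_bilinear_fderiv_right_eq_neg_left_of_integrable (μ := volume)
    (f := X) (g := Y) (v := v) (B := B) (by simpa only [hBa] using h1)
    (by simpa only [hBa] using h2) (by simpa only [hBa] using h3)
    (fun x _ => hX x) (fun x _ => hY x)
  simp only [hBa] at this
  rw [this, neg_neg]

/-- With w the Cauchy convolution of g, the two convolutions are -∂w and ∂̄w, so the equality reads
∫|∂w|² = ∫|∂̄w|². It follows by integrating by parts on each side, since ∂ and ∂̄ commute; decay at
infinity removes the boundary terms. -/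
theorem integral_norm_sq_kerConv_beurlingKer {ε : ℝ} (hε : 0 < ε) {g : ℂ → ℂ}
    (hg : ContDiff ℝ 1 g) (hc : HasCompactSupport g) :
    (Integrable fun x => kerConv (beurlingKer ε) g x * conj (kerConv (beurlingKer ε) g x)) ∧
    (Integrable fun x => kerConv (approxIdKer ε) g x * conj (kerConv (approxIdKer ε) g x)) ∧
    ∫ x, kerConv (beurlingKer ε) g x * conj (kerConv (beurlingKer ε) g x) =
      ∫ x, kerConv (approxIdKer ε) g x * conj (kerConv (approxIdKer ε) g x) := by
  have hC : 0 ≤ 2 + 2 / ε ^ 2 := by positivity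
  have d1 : ∀ z, ‖cauchyKer ε z‖ ≤ (2 + 2 / ε ^ 2) / (1 + ‖z‖) ^ 1 := by
    simpa using norm_cauchyKer_le hε
  have d2 := norm_beurlingKer_le hε
  have d3 := norm_approxIdKer_le hε
  have c1 := continuous_cauchyKer hε
  have c2 := continuous_beurlingKer hε
  have c3 := continuous_approxIdKer hε
  obtain ⟨M, hM⟩ := hc.isCompact.isBounded.subset_closedBall 0
  set gv : ℂ → ℂ → ℂ := fun v y => fderiv ℝ g y v with hgv
  have gi : Integrable g := hg.continuous.integrable_of_hasCompactSupport hc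
  have gM : ∀ y, g y ≠ 0 → ‖y‖ ≤ M := fun y hy => by simpa using hM (subset_tsupport g hy)
  have gvc : ∀ v, HasCompactSupport (gv v) := fun v => hc.fderiv_apply ℝ v
  have gvcont : ∀ v, Continuous (gv v) := fun v =>
    (hg.continuous_fderiv one_ne_zero).clm_apply continuous_const
  have gvi : ∀ v, Integrable (gv v) := fun v => (gvcont v).integrable_of_hasCompactSupport (gvc v)
  have gvM : ∀ v y, gv v y ≠ 0 → ‖y‖ ≤ M := fun v y hy => by
    have : y ∈ tsupport (fderiv ℝ g) := subset_tsupport _ (fun h => hy (by simp [hgv, h]))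
    simpa using hM (tsupport_fderiv_subset ℝ this)
  set w := kerConv (cauchyKer ε) g with hw
  set A := kerConv (beurlingKer ε) g with hA
  set B := kerConv (approxIdKer ε) g with hB
  choose Dw hDw hDw' using fun x => hasFDerivAt_kerConv_of_contDiff c1 hg hc x
  choose DA hDA hDA' using fun x => hasFDerivAt_kerConv_of_contDiff c2 hg hc x
  choose DB hDB hDB' using fun x => hasFDerivAt_kerConv_of_contDiff c3 hg hc x
  have fw : ∀ x v, fderiv ℝ w x v = -A x * v + B x * conj v := by
    intro x v
    obtain ⟨D, hD, hD'⟩ := hasFDerivAt_kerConv_cauchyKer hε gi x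
    rw [hw, hD.fderiv, hD']
  have fw' : ∀ x v, kerConv (cauchyKer ε) (gv v) x = -A x * v + B x * conj v := by
    intro x v
    rw [← fw, hw, (hDw x).fderiv, hDw']
  have fA : ∀ x v, fderiv ℝ A x v = kerConv (beurlingKer ε) (gv v) x := fun x v => by
    rw [hA, (hDA x).fderiv, hDA']
  have fB : ∀ x v, fderiv ℝ B x v = kerConv (approxIdKer ε) (gv v) x := fun x v => by
    rw [hB, (hDB x).fderiv, hDB']
  have lin : ∀ (k : ℂ → ℂ), Continuous k → ∀ M', (∀ z, ‖k z‖ ≤ M') → ∀ x,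
      kerConv k (fun y => (gv 1 y + Complex.I * gv Complex.I y) / 2) x
        = (kerConv k (gv 1) x + Complex.I * kerConv k (gv Complex.I) x) / 2 := by
    intro k hk M' hM' x
    have i1 := integrable_kerConv hk hM' (gvi 1) x
    have i2 := integrable_kerConv hk hM' (gvi Complex.I) x
    simp only [kerConv]
    rw [← integral_const_mul, ← integral_add i1 (i2.const_mul _), ← integral_div]
    congr 1 with y
    ring
  -- B = ∂̄w is also the Cauchy convolution of ∂̄g, and in that form it can be differentiated
  -- through the kernel once more.
  have hBeq : B = kerConv (cauchyKer ε)
      (fun y => (gv 1 y + Complex.I * gv Complex.I y) / 2) := by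
    ext x
    rw [lin _ c1 _ (norm_le_of_norm_le_div hC d1), fw', fw']
    simp only [map_one, Complex.conj_I]
    linear_combination (B x / 2 + A x / 2) * Complex.I_mul_I
  have fB2 : ∀ x v, fderiv ℝ B x v =
      -((fderiv ℝ A x 1 + Complex.I * fderiv ℝ A x Complex.I) / 2) * v
        + kerConv (approxIdKer ε) (fun y => (gv 1 y + Complex.I * gv Complex.I y) / 2) x
          * conj v := by
    intro x v
    have g2i : Integrable (fun y => (gv 1 y + Complex.I * gv Complex.I y) / 2) :=
      ((gvi 1).add ((gvi Complex.I).const_mul _)).div_const 2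
    obtain ⟨D, hD, hD'⟩ := hasFDerivAt_kerConv_cauchyKer hε g2i x
    rw [hBeq, hD.fderiv, hD', lin _ c2 _ (norm_le_of_norm_le_div (sq_nonneg _) d2), ← fA, ← fA]
  -- This is ∂B = -∂̄A, that is, ∂∂̄w = ∂̄∂w.
  have hAB : ∀ x, (fderiv ℝ B x 1 - Complex.I * fderiv ℝ B x Complex.I) / 2
      = -((fderiv ℝ A x 1 + Complex.I * fderiv ℝ A x Complex.I) / 2) := by
    intro x
    rw [fB2 x 1, fB2 x Complex.I]
    simp only [map_one, Complex.conj_I]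
    linear_combination (((fderiv ℝ A x 1 + Complex.I * fderiv ℝ A x Complex.I) / 4)
      + kerConv (approxIdKer ε) (fun y => (gv 1 y + Complex.I * gv Complex.I y) / 2) x / 2)
      * Complex.I_mul_I
  have bw := norm_kerConv_le hC d1 gi gM
  have bA := norm_kerConv_le (sq_nonneg _) d2 gi gM
  have bB := norm_kerConv_le hC d3 gi gM
  have bfA : ∀ v, _ := fun v => norm_kerConv_le (sq_nonneg _) d2 (gvi v) (gvM v)
  have bfB : ∀ v, _ := fun v => norm_kerConv_le hC d3 (gvi v) (gvM v)
  have cw : Continuous w := continuous_kerConv c1 (norm_le_of_norm_le_div hC d1) gi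
  have cA : Continuous A := continuous_kerConv c2 (norm_le_of_norm_le_div (sq_nonneg _) d2) gi
  have cB : Continuous B := continuous_kerConv c3 (norm_le_of_norm_le_div hC d3) gi
  have cfA : ∀ v, Continuous (kerConv (beurlingKer ε) (gv v)) := fun v =>
    continuous_kerConv c2 (norm_le_of_norm_le_div (sq_nonneg _) d2) (gvi v)
  have cfB : ∀ v, Continuous (kerConv (approxIdKer ε) (gv v)) := fun v =>
    continuous_kerConv c3 (norm_le_of_norm_le_div hC d3) (gvi v)
  -- Decay orders add: w has order 1, while A, B and their derivatives have order 2, so every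
  -- product that occurs has order at least 3.
  have prod : ∀ {X Y : ℂ → ℂ} {C₁ C₂ : ℝ} {m₁ m₂ : ℕ}, Continuous X → Continuous Y →
      (∀ x, ‖X x‖ ≤ C₁ / (1 + ‖x‖) ^ m₁) → (∀ x, ‖Y x‖ ≤ C₂ / (1 + ‖x‖) ^ m₂) → 3 ≤ m₁ + m₂ →
      Integrable fun x => X x * conj (Y x) := by
    intro X Y C₁ C₂ m₁ m₂ hX hY h1 h2 hm
    refine integrable_of_norm_le_div (C := C₁ * C₂) (hX.mul (Complex.continuous_conj.comp hY)) hm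
      fun x => ?_
    rw [norm_mul, RCLike.norm_conj, pow_add, ← div_mul_div_comm]
    exact mul_le_mul (h1 x) (h2 x) (norm_nonneg _) ((norm_nonneg _).trans (h1 x))
  have iAA := prod cA cA bA bA (by norm_num)
  have iBB := prod cB cB bB bB (by norm_num)
  have iAB := prod cA cB bA bB (by norm_num)
  have iBA := prod cB cA bB bA (by norm_num)
  have iwA := prod cw cA bw bA (by norm_num)
  have iwB := prod cw cB bw bB (by norm_num)
  have iwfA : ∀ v, Integrable fun x => w x * conj (fderiv ℝ A x v) := fun v => by
    simp only [fA]
    exact prod cw (cfA v) bw (bfA v) (by norm_num)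
  have iwfB : ∀ v, Integrable fun x => w x * conj (fderiv ℝ B x v) := fun v => by
    simp only [fB]
    exact prod cw (cfB v) bw (bfB v) (by norm_num)
  have ifwA : ∀ v, Integrable fun x => fderiv ℝ w x v * conj (A x) := fun v => by
    simp only [fw]
    refine ((iAA.neg.mul_const v).add (iBA.mul_const (conj v))).congr
      (Eventually.of_forall fun x => ?_)
    simp only [Pi.add_apply, Pi.neg_apply]
    ring
  have ifwB : ∀ v, Integrable fun x => fderiv ℝ w x v * conj (B x) := fun v => by
    simp only [fw]
    refine ((iAB.neg.mul_const v).add (iBB.mul_const (conj v))).congr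
      (Eventually.of_forall fun x => ?_)
    simp only [Pi.add_apply, Pi.neg_apply]
    ring
  have dw : Differentiable ℝ w := fun x => (hDw x).differentiableAt
  have dA : Differentiable ℝ A := fun x => (hDA x).differentiableAt
  have dB : Differentiable ℝ B := fun x => (hDB x).differentiableAt
  refine ⟨iAA, iBB, ?_⟩
  have pA : ∀ v, _ := fun v => integral_fderiv_mul_conj_eq dw dA (ifwA v) (iwfA v) iwA
  have pB : ∀ v, _ := fun v => integral_fderiv_mul_conj_eq dw dB (ifwB v) (iwfB v) iwB
  have eA : ∀ x, A x * conj (A x) = -((fderiv ℝ w x 1 * conj (A x)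
      - Complex.I * (fderiv ℝ w x Complex.I * conj (A x))) / 2) := by
    intro x
    rw [fw, fw]
    simp only [map_one, Complex.conj_I]
    linear_combination (A x * conj (A x) / 2 + B x * conj (A x) / 2) * Complex.I_mul_I
  have eB : ∀ x, B x * conj (B x) = (fderiv ℝ w x 1 * conj (B x)
      + Complex.I * (fderiv ℝ w x Complex.I * conj (B x))) / 2 := by
    intro x
    rw [fw, fw]
    simp only [map_one, Complex.conj_I]
    linear_combination (A x * conj (B x) / 2 + B x * conj (B x) / 2) * Complex.I_mul_I
  simp only [eA, eB]
  rw [integral_neg, integral_div, integral_div, integral_sub (ifwA 1) ((ifwA _).const_mul _),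
    integral_add (ifwB 1) ((ifwB _).const_mul _), integral_const_mul, integral_const_mul,
    pA, pA, pB, pB]
  have e3 : ∫ x, (w x * conj (fderiv ℝ A x 1) - Complex.I * (w x * conj (fderiv ℝ A x Complex.I)))
      = - ∫ x, (w x * conj (fderiv ℝ B x 1)
        + Complex.I * (w x * conj (fderiv ℝ B x Complex.I))) := by
    rw [← integral_neg]
    congr 1 with x
    have := congrArg conj (hAB x)
    simp only [map_div₀, map_sub, map_add, map_mul, map_neg, Complex.conj_I, map_ofNat] at this
    linear_combination (2 * w x) * this
  rw [integral_sub (iwfA 1) ((iwfA _).const_mul _),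
    integral_add (iwfB 1) ((iwfB _).const_mul _), integral_const_mul, integral_const_mul] at e3
  linear_combination e3 / 2

end KerConv

/-! ### Scaling, the uniform L² bound, and smoothness of the Beurling kernel. -/

theorem lintegral_comp_inv_smul_complex {G : ℂ → ℝ≥0∞} (hG : Measurable G) {r : ℝ} (hr : 0 < r) :
    ∫⁻ x, G (r⁻¹ • x) = ENNReal.ofReal (r ^ 2) * ∫⁻ x, G x := by
  rw [← lintegral_map hG (measurable_const_smul r⁻¹),
    Measure.map_addHaar_smul volume (inv_ne_zero hr.ne'), lintegral_smul_measure,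
    Complex.finrank_real_complex, smul_eq_mul]
  congr 2
  rw [abs_of_pos (by positivity)]
  field_simp

theorem norm_approxIdKer_eq_smul {ε : ℝ} (hε : 0 < ε) (z : ℂ) :
    ‖approxIdKer ε z‖ = (ε ^ 2)⁻¹ * ‖approxIdKer 1 (ε⁻¹ • z)‖ := by
  rw [norm_approxIdKer hε, norm_approxIdKer one_pos, norm_smul, Real.norm_of_nonneg (by positivity)]
  have := normSq_add_sq_pos hε z
  have h2 : (ε⁻¹ * ‖z‖) ^ 2 + 1 ^ 2 = (‖z‖ ^ 2 + ε ^ 2) / ε ^ 2 := by field_simp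
  rw [h2]
  field_simp

theorem integrable_approxIdKer {ε : ℝ} (hε : 0 < ε) : Integrable (approxIdKer ε) := by
  refine integrable_of_norm_le_div (C := ε ^ 2 * (2 + 2 / ε ^ 2) ^ 2)
    (m := 4) (continuous_approxIdKer hε) (by norm_num) fun x => ?_
  have hN := normSq_add_sq_pos hε x
  rw [norm_approxIdKer hε, div_le_div_iff₀ (by positivity) (by positivity)]
  have h : (2 + 2 / ε ^ 2) * (‖x‖ ^ 2 + ε ^ 2)
      = 2 * ‖x‖ ^ 2 + 2 + 2 * ε ^ 2 + 2 / ε ^ 2 * ‖x‖ ^ 2 := by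
    field_simp
    ring
  have h1 : (1 + ‖x‖) ^ 2 ≤ (2 + 2 / ε ^ 2) * (‖x‖ ^ 2 + ε ^ 2) := by
    rw [h]
    have : 0 ≤ 2 / ε ^ 2 * ‖x‖ ^ 2 := by positivity
    nlinarith [sq_nonneg (‖x‖ - 1), sq_nonneg ε]
  calc ε ^ 2 * (1 + ‖x‖) ^ 4 = ε ^ 2 * ((1 + ‖x‖) ^ 2) ^ 2 := by ring
    _ ≤ ε ^ 2 * ((2 + 2 / ε ^ 2) * (‖x‖ ^ 2 + ε ^ 2)) ^ 2 := by gcongr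
    _ = _ := by ring

/-- The common mass of the approximate identities. -/
def approxIdMass : ℝ≥0∞ := ∫⁻ z, ‖approxIdKer 1 z‖ₑ

theorem approxIdMass_ne_top : approxIdMass ≠ ⊤ :=
  (integrable_approxIdKer one_pos).2.ne

/-- The kernels are dilates of one another with the normalisation that preserves mass. This is where
uniformity in ε enters. -/
theorem lintegral_enorm_approxIdKer {ε : ℝ} (hε : 0 < ε) :
    ∫⁻ z, ‖approxIdKer ε z‖ₑ = approxIdMass := by
  have h : ∀ z, ‖approxIdKer ε z‖ₑ = ENNReal.ofReal (ε ^ 2)⁻¹ * ‖approxIdKer 1 (ε⁻¹ • z)‖ₑ := by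
    intro z
    rw [← ofReal_norm, ← ofReal_norm, norm_approxIdKer_eq_smul hε,
      ENNReal.ofReal_mul (by positivity)]
  have hm : Measurable fun z => ‖approxIdKer 1 z‖ₑ :=
    (continuous_approxIdKer one_pos).enorm.measurable
  simp only [h]
  have hm' : Measurable fun z : ℂ => ‖approxIdKer 1 (ε⁻¹ • z)‖ₑ :=
    hm.comp (measurable_const_smul ε⁻¹)
  rw [lintegral_const_mul _ hm',
    lintegral_comp_inv_smul_complex (G := fun z => ‖approxIdKer 1 z‖ₑ) hm hε, ← mul_assoc, ← ENNReal.ofReal_mul (by positivity),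
    inv_mul_cancel₀ (by positivity), ENNReal.ofReal_one, one_mul, approxIdMass]

/-- The L² identity trades the singular kernel for the approximate identity, to which Young's
inequality applies. -/
theorem lintegral_sq_kerConv_beurlingKer_le_of_contDiff {ε : ℝ} (hε : 0 < ε) {g : ℂ → ℂ}
    (hg : ContDiff ℝ 1 g) (hc : HasCompactSupport g) :
    ∫⁻ x, ‖kerConv (beurlingKer ε) g x‖ₑ ^ (2 : ℝ)
      ≤ approxIdMass ^ (2 : ℝ) * ∫⁻ x, ‖g x‖ₑ ^ (2 : ℝ) := by
  obtain ⟨iA, iB, hAB⟩ := integral_norm_sq_kerConv_beurlingKer hε hg hc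
  have conv : ∀ X : ℂ → ℂ, (Integrable fun x => X x * conj (X x)) →
      ∫⁻ x, ‖X x‖ₑ ^ (2 : ℝ) = ENNReal.ofReal ‖∫ x, X x * conj (X x)‖ := by
    intro X hX
    have h1 : ∀ x, X x * conj (X x) = ((‖X x‖ ^ 2 : ℝ) : ℂ) := fun x => by
      rw [Complex.mul_conj, Complex.normSq_eq_norm_sq]
    simp only [h1] at hX ⊢
    have h2 : Integrable fun x => ‖X x‖ ^ 2 := by
      refine hX.norm.congr (Eventually.of_forall fun x => ?_)
      simp
    rw [integral_complex_ofReal, Complex.norm_real, Real.norm_eq_abs, abs_of_nonneg (integral_nonneg fun x => sq_nonneg _),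
      ofReal_integral_eq_lintegral_ofReal h2 (Eventually.of_forall fun x => sq_nonneg _)]
    congr 1 with x
    rw [← ofReal_norm, ENNReal.ofReal_rpow_of_nonneg (norm_nonneg _) (by norm_num)]
    norm_num
  rw [conv _ iA, hAB, ← conv _ iB, ← lintegral_enorm_approxIdKer hε]
  refine le_trans (lintegral_mono fun x => ?_) (lintegral_rpow_lintegral_sub_mul_le
    (continuous_approxIdKer hε).enorm.measurable hg.continuous.enorm.measurable.aemeasurable
    (by norm_num))
  gcongr
  refine (enorm_integral_le_lintegral_enorm _).trans (lintegral_mono fun t => ?_)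
  rw [enorm_mul]

/-- Smoothness of g has to go, because the good part of a Calderón–Zygmund decomposition jumps
across the selected balls. For fixed ε the kernel is bounded, so L¹ convergence of the
mollifications gives pointwise convergence of the convolutions, and Fatou concludes. -/
theorem lintegral_sq_kerConv_beurlingKer_le {ε : ℝ} (hε : 0 < ε) {g : ℂ → ℂ}
    (hg : Integrable g) (hc : HasCompactSupport g) :
    ∫⁻ x, ‖kerConv (beurlingKer ε) g x‖ₑ ^ (2 : ℝ)
      ≤ approxIdMass ^ (2 : ℝ) * ∫⁻ x, ‖g x‖ₑ ^ (2 : ℝ) := by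
  have c2 := continuous_beurlingKer hε
  have b2 := norm_le_of_norm_le_div (sq_nonneg _) (norm_beurlingKer_le hε)
  set M := (2 + 2 / ε ^ 2) ^ 2
  have hgl : LocallyIntegrable g := hg.locallyIntegrable
  have hgn : ∀ n, Integrable (mollify n g) := fun n =>
    (contDiff_mollify n hgl).continuous.integrable_of_hasCompactSupport
      (hasCompactSupport_mollify n hc)
  have hlim : ∀ x, Tendsto (fun n => kerConv (beurlingKer ε) (mollify n g) x) atTop
      (𝓝 (kerConv (beurlingKer ε) g x)) := by
    intro x
    have h0 := tendsto_eLpNorm_mollify_sub (p := 1) le_rfl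
      (by simpa using memLp_one_iff_integrable.2 hg)
    simp only [ENNReal.ofReal_one, eLpNorm_one_eq_lintegral_enorm] at h0
    rw [tendsto_iff_edist_tendsto_0]
    have hle : ∀ n, edist (kerConv (beurlingKer ε) (mollify n g) x) (kerConv (beurlingKer ε) g x)
        ≤ ENNReal.ofReal M * ∫⁻ y, ‖(mollify n g - g) y‖ₑ := by
      intro n
      rw [edist_eq_enorm_sub, kerConv, kerConv, ← integral_sub
        (integrable_kerConv c2 b2 (hgn n) x) (integrable_kerConv c2 b2 hg x)]
      refine (enorm_integral_le_lintegral_enorm _).trans ?_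
      rw [← lintegral_const_mul' _ _ ENNReal.ofReal_ne_top]
      refine lintegral_mono fun y => ?_
      rw [← mul_sub, enorm_mul]
      gcongr
      · rw [← ofReal_norm]
        exact ENNReal.ofReal_le_ofReal (b2 _)
      · rfl
    have := ENNReal.Tendsto.const_mul (a := ENNReal.ofReal M) h0 (Or.inr ENNReal.ofReal_ne_top)
    rw [mul_zero] at this
    exact tendsto_of_tendsto_of_tendsto_of_le_of_le tendsto_const_nhds this
      (fun _ => zero_le) hle
  have hn : ∀ n, ∫⁻ x, ‖kerConv (beurlingKer ε) (mollify n g) x‖ₑ ^ (2 : ℝ)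
      ≤ approxIdMass ^ (2 : ℝ) * ∫⁻ x, ‖g x‖ₑ ^ (2 : ℝ) := by
    intro n
    refine (lintegral_sq_kerConv_beurlingKer_le_of_contDiff hε
      ((contDiff_mollify n hgl).of_le (by norm_cast))
      (hasCompactSupport_mollify n hc)).trans ?_
    gcongr _ * ?_
    have := eLpNorm_mollify_le n hg.1 (p := 2) (by norm_num)
    rw [eLpNorm_eq_lintegral_rpow_enorm_toReal (by norm_num) ENNReal.ofReal_ne_top,
      eLpNorm_eq_lintegral_rpow_enorm_toReal (by norm_num) ENNReal.ofReal_ne_top,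
      ENNReal.toReal_ofReal (by norm_num)] at this
    exact (ENNReal.rpow_le_rpow_iff (by norm_num)).1 this
  calc ∫⁻ x, ‖kerConv (beurlingKer ε) g x‖ₑ ^ (2 : ℝ)
      = ∫⁻ x, liminf (fun n => ‖kerConv (beurlingKer ε) (mollify n g) x‖ₑ ^ (2 : ℝ)) atTop := by
        congr 1 with x
        have := ((ENNReal.continuous_rpow_const (y := (2 : ℝ))).tendsto _).comp
          ((continuous_enorm.tendsto _).comp (hlim x))
        exact this.liminf_eq.symm
    _ ≤ liminf (fun n => ∫⁻ x, ‖kerConv (beurlingKer ε) (mollify n g) x‖ₑ ^ (2 : ℝ)) atTop :=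
        lintegral_liminf_le fun n =>
          ((continuous_kerConv c2 b2 (hgn n)).enorm.measurable.pow_const _)
    _ ≤ _ := liminf_le_of_le (by isBoundedDefault) fun b hb => by
        obtain ⟨n, hn'⟩ := hb.exists
        exact hn'.trans (hn n)

/-- A Hörmander-type condition with a constant free of ε. The Cauchy kernels differ by a fraction
with numerator at most (|z||w| + ε²)|w - z|, and the term ε² is dominated by the regularised
denominators. The Beurling difference is this difference times a sum of Cauchy kernels, which is at
most 3/|z|. -/
theorem norm_beurlingKer_sub_le {ε : ℝ} (hε : 0 < ε) {z w : ℂ} (hz : z ≠ 0)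
    (hw : ‖z‖ ≤ 2 * ‖w‖) :
    ‖beurlingKer ε w - beurlingKer ε z‖ ≤ 6 * ‖w - z‖ / ‖z‖ ^ 3 := by
  have hz0 : 0 < ‖z‖ := norm_pos_iff.2 hz
  have hw0 : 0 < ‖w‖ := by linarith
  have hNz := normSq_add_sq_pos hε z
  have hNw := normSq_add_sq_pos hε w
  have b : ∀ {x : ℂ}, 0 < ‖x‖ → ‖cauchyKer ε x‖ ≤ 1 / ‖x‖ := by
    intro x hx
    rw [norm_cauchyKer hε, div_le_div_iff₀ (normSq_add_sq_pos hε x) hx]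
    nlinarith [sq_nonneg ε]
  have hdiff : cauchyKer ε w - cauchyKer ε z
      = (conj z * conj w * (z - w) + (ε : ℂ) ^ 2 * (conj w - conj z))
        / (((‖w‖ ^ 2 + ε ^ 2) * (‖z‖ ^ 2 + ε ^ 2) : ℝ) : ℂ) := by
    have h1 : ((‖w‖ ^ 2 + ε ^ 2 : ℝ) : ℂ) ≠ 0 := by exact_mod_cast hNw.ne'
    have h2 : ((‖z‖ ^ 2 + ε ^ 2 : ℝ) : ℂ) ≠ 0 := by exact_mod_cast hNz.ne'
    rw [cauchyKer, cauchyKer, Complex.ofReal_mul, div_sub_div _ _ h1 h2]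
    congr 1
    rw [← Complex.normSq_eq_norm_sq, ← Complex.normSq_eq_norm_sq]
    push_cast
    rw [← Complex.mul_conj, ← Complex.mul_conj]
    ring
  have hd : ‖cauchyKer ε w - cauchyKer ε z‖ ≤ ‖w - z‖ / (‖w‖ * ‖z‖) := by
    rw [hdiff, norm_div, Complex.norm_real, Real.norm_of_nonneg (by positivity),
      div_le_div_iff₀ (by positivity) (by positivity)]
    have hnum : ‖conj z * conj w * (z - w) + (ε : ℂ) ^ 2 * (conj w - conj z)‖
        ≤ (‖z‖ * ‖w‖ + ε ^ 2) * ‖w - z‖ := by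
      refine (norm_add_le _ _).trans ?_
      rw [← map_sub, norm_mul, norm_mul, norm_mul, RCLike.norm_conj, RCLike.norm_conj,
        RCLike.norm_conj, norm_sub_rev z w, norm_pow, Complex.norm_real,
        Real.norm_of_nonneg hε.le]
      exact le_of_eq (by ring)
    have hmul : (‖z‖ * ‖w‖ + ε ^ 2) * (‖w‖ * ‖z‖)
        ≤ (‖w‖ ^ 2 + ε ^ 2) * (‖z‖ ^ 2 + ε ^ 2) := by
      nlinarith [sq_nonneg (‖w‖ - ‖z‖), sq_nonneg ε, mul_nonneg (sq_nonneg ε)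
        (sq_nonneg (‖w‖ - ‖z‖)), mul_pos hw0 hz0, sq_nonneg (ε ^ 2),
        mul_nonneg (sq_nonneg ε) (mul_pos hw0 hz0).le]
    calc _ ≤ ((‖z‖ * ‖w‖ + ε ^ 2) * ‖w - z‖) * (‖w‖ * ‖z‖) := by gcongr
      _ = ‖w - z‖ * ((‖z‖ * ‖w‖ + ε ^ 2) * (‖w‖ * ‖z‖)) := by ring
      _ ≤ _ := by gcongr
  have hfac : beurlingKer ε w - beurlingKer ε z
      = (cauchyKer ε w - cauchyKer ε z) * (cauchyKer ε w + cauchyKer ε z) := by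
    simp only [beurlingKer]; ring
  have hwi : 1 / ‖w‖ ≤ 2 / ‖z‖ := by
    rw [div_le_div_iff₀ hw0 hz0]; linarith
  calc ‖beurlingKer ε w - beurlingKer ε z‖
      ≤ (‖w - z‖ * (1 / ‖w‖) * (1 / ‖z‖)) * (1 / ‖w‖ + 1 / ‖z‖) := by
        rw [hfac, norm_mul]
        refine mul_le_mul (hd.trans (le_of_eq ?_))
          ((norm_add_le _ _).trans (add_le_add (b hw0) (b hz0))) (norm_nonneg _) (by positivity)
        field_simp
    _ ≤ (‖w - z‖ * (2 / ‖z‖) * (1 / ‖z‖)) * (2 / ‖z‖ + 1 / ‖z‖) := by gcongr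
    _ = 6 * ‖w - z‖ / ‖z‖ ^ 3 := by
        field_simp
        ring

/-- The tail integral `∫_{|x| ≥ 1} |x|⁻³`. -/
def tailConst : ℝ≥0∞ := ∫⁻ x : ℂ, {x : ℂ | 1 ≤ ‖x‖}.indicator
  (fun x => ENNReal.ofReal (1 / ‖x‖ ^ 3)) x

theorem tailConst_ne_top : tailConst ≠ ⊤ := by
  have hi : Integrable (fun x : ℂ => 8 * (1 + ‖x‖) ^ (-(3 : ℝ))) := by
    refine (integrable_one_add_norm ?_).const_mul 8
    rw [Complex.finrank_real_complex]
    norm_num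
  refine ne_top_of_le_ne_top hi.2.ne (lintegral_mono fun x => ?_)
  by_cases hx : 1 ≤ ‖x‖
  swap
  · rw [indicator_of_notMem (by exact hx)]
    exact bot_le
  rw [indicator_of_mem (by exact hx), ← ofReal_norm]
  refine ENNReal.ofReal_le_ofReal ?_
  rw [Real.norm_of_nonneg (by positivity)]
  beta_reduce
  rw [Real.rpow_neg (by positivity), show (3 : ℝ) = ((3 : ℕ) : ℝ) by norm_num, Real.rpow_natCast, ← div_eq_mul_inv,
    div_le_div_iff₀ (by positivity) (by positivity)]
  have : (1 + ‖x‖) ^ 3 ≤ (2 * ‖x‖) ^ 3 := by gcongr; linarith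
  linarith [show (2 * ‖x‖) ^ 3 = 8 * ‖x‖ ^ 3 by ring]

/-- The factor r makes the tail dilation invariant, so balls of all sizes share one constant. -/
theorem lintegral_tail_le (c : ℂ) {r : ℝ} (hr : 0 < r) :
    ∫⁻ x, {x : ℂ | r ≤ ‖x - c‖}.indicator (fun x => ENNReal.ofReal (r / ‖x - c‖ ^ 3)) x
      = tailConst := by
  have hm : Measurable ({x : ℂ | 1 ≤ ‖x‖}.indicator
      (fun x : ℂ => ENNReal.ofReal (1 / ‖x‖ ^ 3))) := by
    refine Measurable.indicator (by fun_prop) ?_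
    exact measurableSet_le measurable_const measurable_norm
  have ht : ∀ x, {x : ℂ | r ≤ ‖x - c‖}.indicator (fun x => ENNReal.ofReal (r / ‖x - c‖ ^ 3)) x
      = {x : ℂ | r ≤ ‖x‖}.indicator (fun x => ENNReal.ofReal (r / ‖x‖ ^ 3)) (x - c) :=
    fun x => rfl
  simp only [ht]
  rw [lintegral_sub_right_eq_self
    (fun x => {x : ℂ | r ≤ ‖x‖}.indicator (fun x => ENNReal.ofReal (r / ‖x‖ ^ 3)) x) c]
  have h : ∀ x : ℂ, {x : ℂ | r ≤ ‖x‖}.indicator (fun x => ENNReal.ofReal (r / ‖x‖ ^ 3)) x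
      = ENNReal.ofReal (r ^ 2)⁻¹ * {x : ℂ | 1 ≤ ‖x‖}.indicator
        (fun x : ℂ => ENNReal.ofReal (1 / ‖x‖ ^ 3)) (r⁻¹ • x) := by
    intro x
    have hn : ‖r⁻¹ • x‖ = ‖x‖ / r := by
      rw [norm_smul, Real.norm_of_nonneg (by positivity), div_eq_inv_mul]
    by_cases hx : r ≤ ‖x‖
    · have hx' : 1 ≤ ‖r⁻¹ • x‖ := by rw [hn, le_div_iff₀ hr]; linarith
      rw [indicator_of_mem (by exact hx), indicator_of_mem (by exact hx'),
        ← ENNReal.ofReal_mul (by positivity), hn]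
      congr 1
      have : 0 < ‖x‖ := hr.trans_le hx
      field_simp
    · have hx' : ¬ 1 ≤ ‖r⁻¹ • x‖ := by rw [hn, le_div_iff₀ hr]; linarith
      rw [indicator_of_notMem (by exact hx), indicator_of_notMem (by exact hx'), mul_zero]
  simp only [h]
  have hm' : Measurable fun x : ℂ => {x : ℂ | 1 ≤ ‖x‖}.indicator
      (fun x : ℂ => ENNReal.ofReal (1 / ‖x‖ ^ 3)) (r⁻¹ • x) :=
    hm.comp (measurable_const_smul r⁻¹)
  rw [lintegral_const_mul _ hm', lintegral_comp_inv_smul_complex hm hr, ← mul_assoc, ← ENNReal.ofReal_mul (by positivity),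
    inv_mul_cancel₀ (by positivity), ENNReal.ofReal_one, one_mul, tailConst]

/-! ### The Calderón–Zygmund decomposition -/

theorem volume_closedBall_mul (c : ℂ) {r k : ℝ} (hk : 0 ≤ k) :
    volume (closedBall c (k * r)) = ENNReal.ofReal (k ^ 2) * volume (closedBall c r) := by
  rw [Complex.volume_closedBall, Complex.volume_closedBall, ENNReal.ofReal_mul hk, mul_pow,
    ← ENNReal.ofReal_pow hk, mul_assoc]

/-- Selection of balls at height `t` for a continuous compactly supported function. -/
theorem exists_calderonZygmund_balls {g : ℂ → ℂ} (hg : Continuous g) (hc : HasCompactSupport g)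
    {t : ℝ} (ht : 0 < t) :
    ∃ (u : Set ℂ) (r : ℂ → ℝ), u.Countable ∧ (∀ c ∈ u, 0 < r c) ∧
      (u.PairwiseDisjoint fun c => closedBall c (r c)) ∧
      (∀ c ∈ u, ENNReal.ofReal t * volume (closedBall c (r c))
        ≤ ∫⁻ y in closedBall c (r c), ‖g y‖ₑ) ∧
      (∀ c ∈ u, ∫⁻ y in closedBall c (5 * r c), ‖g y‖ₑ
        ≤ ENNReal.ofReal t * volume (closedBall c (5 * r c))) ∧
      {x | t < ‖g x‖} ⊆ ⋃ c ∈ u, closedBall c (5 * r c) ∧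
      ∃ M, ∀ c ∈ u, ‖c‖ + 5 * r c ≤ M := by
  have gi : Integrable g := hg.integrable_of_hasCompactSupport hc
  obtain ⟨M₀, hM₀⟩ := hc.isCompact.isBounded.subset_closedBall 0
  set S : ℂ → Set ℝ := fun x => {r | 0 < r ∧ ENNReal.ofReal t * volume (closedBall x r)
        ≤ ∫⁻ y in closedBall x r, ‖g y‖ₑ} with hS
  set I := ∫⁻ y, ‖g y‖ₑ with hI
  have hItop : I ≠ ⊤ := gi.2.ne
  -- Membership of r in S x forces t r² ≤ I, hence r ≤ 1 + r² ≤ Rm.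
  set Rm : ℝ := 1 + I.toReal / t with hRm
  have hRm1 : 1 ≤ Rm := by
    have : 0 ≤ I.toReal / t := by positivity
    linarith
  have hbd : ∀ x, ∀ r ∈ S x, r ≤ Rm := by
    rintro x r ⟨hr0, hr⟩
    have h1 : ENNReal.ofReal t * volume (closedBall x r) ≤ I :=
      hr.trans (setLIntegral_le_lintegral _ _)
    rw [Complex.volume_closedBall] at h1
    have h2 : ENNReal.ofReal (t * r ^ 2) ≤ I := by
      refine le_trans ?_ h1
      rw [ENNReal.ofReal_mul ht.le, ENNReal.ofReal_pow hr0.le]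
      gcongr
      refine le_mul_of_one_le_right' ?_
      have : (1 : ℝ≥0) ≤ NNReal.pi := by
        rw [← NNReal.coe_le_coe]
        simpa using (by linarith [Real.pi_gt_three] : (1 : ℝ) ≤ Real.pi)
      exact_mod_cast this
    have h3 : t * r ^ 2 ≤ I.toReal := (ENNReal.ofReal_le_iff_le_toReal hItop).1 h2
    have h4 : r ^ 2 ≤ I.toReal / t := by rw [le_div_iff₀ ht]; linarith
    nlinarith [sq_nonneg (r - 1)]
  have hne : ∀ x, t < ‖g x‖ → (S x).Nonempty := by
    intro x hx
    obtain ⟨δ, hδ, hball⟩ := Metric.nhds_basis_closedBall.mem_iff.1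
      ((isOpen_lt continuous_const hg.norm).mem_nhds hx)
    refine ⟨δ, hδ, ?_⟩
    rw [← setLIntegral_const]
    refine setLIntegral_mono' measurableSet_closedBall fun y hy => ?_
    rw [← ofReal_norm]
    exact ENNReal.ofReal_le_ofReal (le_of_lt (hball hy))
  -- Stopping radius: r lies in S x and exceeds a fifth of its supremum, so 5 r is no longer in S x.
  -- The mean of |g| is thus at least t on the ball and below t on the fivefold ball, the
  -- enlargement used in Vitali's lemma.
  have hex : ∀ x, ∃ r, t < ‖g x‖ → r ∈ S x ∧ 5 * r ∉ S x := by
    intro x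
    by_cases hx : t < ‖g x‖
    · have hb : BddAbove (S x) := ⟨Rm, hbd x⟩
      have hs0 : 0 < sSup (S x) := by
        obtain ⟨r, hr⟩ := hne x hx
        exact hr.1.trans_le (le_csSup hb hr)
      obtain ⟨r, hr, hrs⟩ := exists_lt_of_lt_csSup (hne x hx)
        (by linarith : sSup (S x) / 5 < sSup (S x))
      refine ⟨r, fun _ => ⟨hr, fun h5 => ?_⟩⟩
      have := le_csSup hb h5
      linarith
    · exact ⟨0, fun h => absurd h hx⟩
  choose r hr using hex
  obtain ⟨u, hut, hud, huc⟩ := Vitali.exists_disjoint_subfamily_covering_enlargement_closedBall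
    {x | t < ‖g x‖} id r Rm (fun a ha => hbd a _ (hr a ha).1) 5 (by norm_num)
  have hpos : ∀ c ∈ u, 0 < r c := fun c hc' => (hr c (hut hc')).1.1
  refine ⟨u, r, ?_, hpos, hud, fun c hc' => (hr c (hut hc')).1.2, ?_, ?_, M₀ + 5 * Rm, ?_⟩
  · refine hud.countable_of_nonempty_interior fun c hc' => ?_
    exact ⟨c, ball_subset_interior_closedBall (mem_ball_self (hpos c hc'))⟩
  · intro c hc'
    have h := (hr c (hut hc')).2
    simp only [hS, mem_ofPred_eq, not_and, not_le] at h
    exact (h (by linarith [hpos c hc'])).le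
  · intro x hx
    obtain ⟨b, hb, hsub⟩ := huc x hx
    exact mem_biUnion hb (hsub (mem_closedBall_self (hr x hx).1.1.le))
  · intro c hc'
    have h1 : ‖c‖ ≤ M₀ := by
      have : c ∈ tsupport g := subset_tsupport g (fun h0 => by
        have := hut hc'
        simp only [mem_ofPred_eq, h0, norm_zero] at this
        linarith)
      simpa using hM₀ this
    linarith [hbd c _ (hr c (hut hc')).1]

/-- The part of g on Q and its mass spread evenly over the small ball have equal integrals, so the
kernel may be replaced by its increment from the centre. For y in the fivefold ball and ‖x - c‖ ≥ 10
r one has ‖x - c‖ ≤ 2‖x - y‖, and the increment is at most 6 · 5r/‖x - c‖³. Each of the two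
integrals contributes once, which produces 60 r. -/
theorem enorm_bad_term_le {ε : ℝ} (hε : 0 < ε) {g : ℂ → ℂ} (hg : Integrable g) {c x : ℂ} {r : ℝ}
    (hr : 0 < r) {Q : Set ℂ} (hQm : MeasurableSet Q) (hQ : Q ⊆ closedBall c (5 * r))
    (hx : 10 * r ≤ ‖x - c‖) :
    ‖(∫ y in Q, beurlingKer ε (x - y) * g y) - ∫ y in closedBall c r, beurlingKer ε (x - y) *
        ((∫ y in Q, g y) / (volume.real (closedBall c r) : ℂ))‖ₑ
      ≤ 6 * ENNReal.ofReal (10 * r / ‖x - c‖ ^ 3) * ∫⁻ y in Q, ‖g y‖ₑ := by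
  have c2 := continuous_beurlingKer hε
  have b2 := norm_le_of_norm_le_div (sq_nonneg _) (norm_beurlingKer_le hε)
  have hxc : 0 < ‖x - c‖ := by linarith
  set κ : ℝ := 30 * r / ‖x - c‖ ^ 3 with hκ
  have hκ0 : 0 ≤ κ := by positivity
  have hk : ∀ y ∈ closedBall c (5 * r), ‖beurlingKer ε (x - y) - beurlingKer ε (x - c)‖ ≤ κ := by
    intro y hy
    have hy' : ‖y - c‖ ≤ 5 * r := by simpa [dist_eq_norm] using hy
    have h1 : ‖x - c‖ ≤ ‖x - y‖ + ‖y - c‖ := by simpa using norm_add_le (x - y) (y - c)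
    have h := norm_beurlingKer_sub_le hε (z := x - c) (w := x - y) (norm_pos_iff.1 hxc)
      (by linarith)
    refine h.trans ?_
    rw [sub_sub_sub_cancel_left, norm_sub_rev c y, hκ]
    exact div_le_div_of_nonneg_right (by linarith) (by positivity)
  set V : ℝ := volume.real (closedBall c r) with hV
  have hVpos : 0 < V := by
    rw [hV, measureReal_def]
    exact ENNReal.toReal_pos (measure_closedBall_pos _ _ hr).ne' measure_closedBall_lt_top.ne
  have hVc : (V : ℂ) ≠ 0 := by exact_mod_cast hVpos.ne'
  set a := ∫ y in Q, g y with ha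
  have ikg : IntegrableOn (fun y => beurlingKer ε (x - y) * g y) Q :=
    (integrable_kerConv c2 b2 hg x).integrableOn
  have icg : IntegrableOn (fun y => beurlingKer ε (x - c) * g y) Q :=
    (hg.const_mul _).integrableOn
  have ikb : IntegrableOn (fun y => beurlingKer ε (x - y) * (a / V)) (closedBall c r) :=
    ContinuousOn.integrableOn_compact (isCompact_closedBall _ _)
      (((c2.comp (continuous_const.sub continuous_id)).mul continuous_const).continuousOn)
  have icb : IntegrableOn (fun _ : ℂ => beurlingKer ε (x - c) * (a / V)) (closedBall c r) :=
    integrableOn_const measure_closedBall_lt_top.ne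
  have hsplit : (∫ y in Q, beurlingKer ε (x - y) * g y)
        - ∫ y in closedBall c r, beurlingKer ε (x - y) * (a / V)
      = (∫ y in Q, (beurlingKer ε (x - y) - beurlingKer ε (x - c)) * g y)
        - ∫ y in closedBall c r, (beurlingKer ε (x - y) - beurlingKer ε (x - c)) * (a / V) := by
    simp only [sub_mul]
    rw [integral_sub ikg icg, integral_sub ikb icb, integral_const_mul, setIntegral_const, ← ha,
      ← hV, Complex.real_smul]
    have : (V : ℂ) * (beurlingKer ε (x - c) * (a / V)) = beurlingKer ε (x - c) * a := by
      field_simp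
    rw [this]
    ring
  have e1 : ‖∫ y in Q, (beurlingKer ε (x - y) - beurlingKer ε (x - c)) * g y‖ₑ
      ≤ ENNReal.ofReal κ * ∫⁻ y in Q, ‖g y‖ₑ := by
    refine (enorm_integral_le_lintegral_enorm _).trans ?_
    rw [← lintegral_const_mul' _ _ ENNReal.ofReal_ne_top]
    refine setLIntegral_mono' hQm fun y hy => ?_
    rw [enorm_mul, ← ofReal_norm (_ - _)]
    gcongr
    exact hk y (hQ hy)
  have e2 : ‖∫ y in closedBall c r, (beurlingKer ε (x - y) - beurlingKer ε (x - c)) * (a / V)‖ₑ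
      ≤ ENNReal.ofReal κ * ∫⁻ y in Q, ‖g y‖ₑ := by
    have h1 : ‖∫ y in closedBall c r, (beurlingKer ε (x - y) - beurlingKer ε (x - c)) * (a / V)‖
        ≤ κ * ‖a / V‖ * V := by
      rw [hV]
      refine norm_setIntegral_le_of_norm_le_const measure_closedBall_lt_top fun y hy => ?_
      rw [norm_mul]
      gcongr
      exact hk y (closedBall_subset_closedBall (by linarith) hy)
    have h2 : κ * ‖a / V‖ * V = κ * ‖a‖ := by
      rw [norm_div, Complex.norm_real, Real.norm_of_nonneg hVpos.le]
      field_simp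
    rw [h2] at h1
    rw [← ofReal_norm]
    refine (ENNReal.ofReal_le_ofReal h1).trans ?_
    rw [ENNReal.ofReal_mul hκ0, ofReal_norm]
    gcongr
    exact enorm_integral_le_lintegral_enorm _
  rw [hsplit]
  refine (enorm_sub_le).trans ((add_le_add e1 e2).trans (le_of_eq ?_))
  have h3 : (6 : ℝ≥0∞) * ENNReal.ofReal (10 * r / ‖x - c‖ ^ 3) = 2 * ENNReal.ofReal κ := by
    rw [show (6 : ℝ≥0∞) = ENNReal.ofReal 6 by simp, show (2 : ℝ≥0∞) = ENNReal.ofReal 2 by simp,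
      ← ENNReal.ofReal_mul (by norm_num), ← ENNReal.ofReal_mul (by norm_num), hκ]
    congr 1
    ring
  rw [h3]
  ring

/-- The distribution function estimate behind the `Lᵖ` bound of the Beurling transform. -/
theorem volume_kerConv_beurlingKer_le {ε : ℝ} (hε : 0 < ε) {g : ℂ → ℂ} (hgc : Continuous g)
    (hc : HasCompactSupport g) {t : ℝ} (ht : 0 < t) :
      volume {x | 2 * t < ‖kerConv (beurlingKer ε) g x‖} ≤
        (200 + 300 * tailConst + 1251 * approxIdMass ^ (2 : ℝ))
          * (ENNReal.ofReal t⁻¹ * (∫⁻ y in {y | t / 2 < ‖g y‖}, ‖g y‖ₑ)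
          + ENNReal.ofReal (t ^ 2)⁻¹ * ∫⁻ y in {y | ‖g y‖ ≤ t}, ‖g y‖ₑ ^ (2 : ℝ)) := by
  classical
  have c2 := continuous_beurlingKer hε
  have b2 := norm_le_of_norm_le_div (sq_nonneg _) (norm_beurlingKer_le hε)
  have hg : Integrable g := hgc.integrable_of_hasCompactSupport hc
  obtain ⟨u, r, hu, hr, hdisj, hlow, hup, hcov, M, hM⟩ := exists_calderonZygmund_balls hgc hc ht
  have : Countable u := hu.to_subtype
  let _ : Encodable u := Encodable.ofCountable u
  set B : u → Set ℂ := fun i => closedBall i (r i) with hB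
  set B5 : u → Set ℂ := fun i => closedBall i (5 * r i) with hB5
  set B10 : u → Set ℂ := fun i => closedBall i (10 * r i) with hB10
  -- The fivefold balls cover the large values of g but may overlap; an enumeration of the centres
  -- cuts them into disjoint pieces with the same union.
  set Q : u → Set ℂ := fun i => B5 i \ ⋃ j : {j : u // Encodable.encode j < Encodable.encode i},
    B5 j with hQ
  have hr' : ∀ i : u, 0 < r i := fun i => hr i i.2
  have hBm : ∀ i, MeasurableSet (B i) := fun i => measurableSet_closedBall
  have hB5m : ∀ i, MeasurableSet (B5 i) := fun i => measurableSet_closedBall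
  have hQm : ∀ i, MeasurableSet (Q i) := fun i =>
    (hB5m i).diff (MeasurableSet.iUnion fun j => hB5m j)
  have hQ5 : ∀ i, Q i ⊆ B5 i := fun i => sdiff_subset
  have hBB5 : ∀ i, B i ⊆ B5 i := fun i => closedBall_subset_closedBall (by linarith [hr' i])
  have hBd : Pairwise (Function.onFun Disjoint B) := fun i j hij =>
    hdisj i.2 j.2 (fun h => hij (Subtype.ext h))
  have hQd : Pairwise (Function.onFun Disjoint Q) := by
    have aux : ∀ i j : u, Encodable.encode i < Encodable.encode j → Disjoint (Q i) (Q j) := by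
      intro i j hij
      refine Set.disjoint_left.2 fun x hx hx' => hx'.2 ?_
      exact mem_iUnion.2 ⟨⟨i, hij⟩, hQ5 i hx⟩
    intro i j hij
    rcases lt_trichotomy (Encodable.encode i) (Encodable.encode j) with h | h | h
    · exact aux i j h
    · exact absurd (Encodable.encode_injective h) hij
    · exact (aux j i h).symm
  have hQU : ⋃ i, Q i = ⋃ i, B5 i := by
    refine Subset.antisymm (iUnion_mono hQ5) fun x hx => ?_
    have hex : ∃ n, ∃ i : u, Encodable.encode i = n ∧ x ∈ B5 i := by
      obtain ⟨i, hi⟩ := mem_iUnion.1 hx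
      exact ⟨_, i, rfl, hi⟩
    obtain ⟨i, hi, hxi⟩ := Nat.find_spec hex
    refine mem_iUnion.2 ⟨i, hxi, fun hx' => ?_⟩
    obtain ⟨⟨j, hj⟩, hxj⟩ := mem_iUnion.1 hx'
    exact Nat.find_min hex (hi ▸ hj) ⟨j, rfl, hxj⟩
  set U := ⋃ i, Q i with hU
  have hUm : MeasurableSet U := MeasurableSet.iUnion hQm
  have hUcov : ∀ x, x ∉ U → ‖g x‖ ≤ t := by
    intro x hx
    by_contra h
    obtain ⟨c, hc', hx'⟩ := mem_iUnion₂.1 (hcov (not_le.1 h))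
    rw [hQU] at hx
    exact hx (mem_iUnion.2 ⟨⟨c, hc'⟩, hx'⟩)
  set P := {y | t / 2 < ‖g y‖} with hP
  have hPm : MeasurableSet P := measurableSet_lt measurable_const hgc.norm.measurable
  set S := ∑' i, volume (B i) with hS
  have hBfin : ∀ i, volume (B i) ≠ ⊤ := fun i => measure_closedBall_lt_top.ne
  have hvol : volume (⋃ i, B i) = S := measure_iUnion hBd hBm
  -- On a selected ball the values up to t/2 account for at most half of the required mass t |B|, so
  -- only the values above t/2 are charged. This restriction is what lets the estimate be integrated
  -- in t down to 0.
  have hSle : S ≤ 2 * (ENNReal.ofReal t⁻¹ * ∫⁻ y in P, ‖g y‖ₑ) := by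
    have h1 : ∀ i, ENNReal.ofReal (t / 2) * volume (B i) ≤ ∫⁻ y in B i ∩ P, ‖g y‖ₑ := by
      intro i
      have h2 : ∫⁻ y in B i, ‖g y‖ₑ ≤ (∫⁻ y in B i ∩ P, ‖g y‖ₑ)
          + ENNReal.ofReal (t / 2) * volume (B i) := by
        rw [← lintegral_inter_add_sdiff (fun y => ‖g y‖ₑ) (B i) hPm]
        gcongr
        calc ∫⁻ y in B i \ P, ‖g y‖ₑ ≤ ∫⁻ y in B i \ P, ENNReal.ofReal (t / 2) := by
              refine setLIntegral_mono' ((hBm i).diff hPm) fun y hy => ?_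
              rw [← ofReal_norm]
              exact ENNReal.ofReal_le_ofReal (not_lt.1 hy.2)
          _ ≤ _ := by
              rw [setLIntegral_const]
              gcongr
              exact sdiff_subset
      have h3 := (hlow i i.2).trans h2
      have h4 : ENNReal.ofReal t = ENNReal.ofReal (t / 2) + ENNReal.ofReal (t / 2) := by
        rw [← ENNReal.ofReal_add (by positivity) (by positivity)]
        congr 1
        ring
      rw [h4, add_mul] at h3
      exact (ENNReal.add_le_add_iff_right
        (ENNReal.mul_ne_top ENNReal.ofReal_ne_top (hBfin i))).1 h3
    have h5 : ENNReal.ofReal (t / 2) * S ≤ ∫⁻ y in P, ‖g y‖ₑ := by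
      rw [hS, ← ENNReal.tsum_mul_left]
      refine (ENNReal.tsum_le_tsum h1).trans ?_
      rw [← lintegral_iUnion (fun i => (hBm i).inter hPm)
        (fun i j hij => (hBd hij).mono inter_subset_left inter_subset_left)]
      exact lintegral_mono_set (iUnion_subset fun i => inter_subset_right)
    calc S = 2 * (ENNReal.ofReal t⁻¹ * (ENNReal.ofReal (t / 2) * S)) := by
          rw [← mul_assoc, ← mul_assoc, show (2 : ℝ≥0∞) = ENNReal.ofReal 2 by simp,
            ← ENNReal.ofReal_mul (by norm_num), ← ENNReal.ofReal_mul (by positivity)]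
          have : 2 * t⁻¹ * (t / 2) = 1 := by field_simp
          rw [this, ENNReal.ofReal_one, one_mul]
      _ ≤ _ := by gcongr
  have hStop : S ≠ ⊤ := by
    refine ne_top_of_le_ne_top ?_ hSle
    refine ENNReal.mul_ne_top (by norm_num) (ENNReal.mul_ne_top ENNReal.ofReal_ne_top ?_)
    exact ne_top_of_le_ne_top hg.2.ne (setLIntegral_le_lintegral _ _)
  -- 25 = 5² is the ratio of the areas of the fivefold ball and the ball.
  have hQint : ∀ i, ∫⁻ y in Q i, ‖g y‖ₑ ≤ ENNReal.ofReal (25 * t) * volume (B i) := by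
    intro i
    refine (lintegral_mono_set (hQ5 i)).trans ((hup i i.2).trans (le_of_eq ?_))
    rw [volume_closedBall_mul _ (by norm_num), ← mul_assoc, ← ENNReal.ofReal_mul ht.le]
    congr 2
    ring
  -- The mass of g on Q i is put on the ball B i, not on Q i: after the disjointification Q i may be
  -- tiny, and the mean over it would not be bounded by a multiple of t.
  set m : u → ℂ := fun i => (∫ y in Q i, g y) / (volume.real (B i) : ℂ) with hm
  have hVpos : ∀ i, 0 < volume.real (B i) := fun i => by
    rw [measureReal_def]
    exact ENNReal.toReal_pos (measure_closedBall_pos _ _ (hr' i)).ne' (hBfin i)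
  have hmle : ∀ i, ‖m i‖ ≤ 25 * t := by
    intro i
    have h1 : ‖∫ y in Q i, g y‖ₑ ≤ ENNReal.ofReal (25 * t) * volume (B i) :=
      (enorm_integral_le_lintegral_enorm _).trans (hQint i)
    rw [← ofReal_norm, ← ENNReal.ofReal_toReal (hBfin i), ← measureReal_def,
      ← ENNReal.ofReal_mul (by positivity), ENNReal.ofReal_le_ofReal_iff (by positivity)] at h1
    rw [hm]
    simp only [norm_div, Complex.norm_real, Real.norm_of_nonneg (hVpos i).le]
    rwa [div_le_iff₀ (hVpos i)]
  set H : ℂ → ℂ := fun x => ∑' i, (B i).indicator (fun _ => m i) x with hH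
  have hHB : ∀ i, ∀ x ∈ B i, H x = m i := by
    intro i x hx
    rw [hH]
    simp only
    rw [tsum_eq_single i, indicator_of_mem hx]
    intro j hj
    exact indicator_of_notMem (fun hx' => Set.disjoint_left.1 (hBd hj) hx' hx) _
  have hH0 : ∀ x, x ∉ ⋃ i, B i → H x = 0 := by
    intro x hx
    rw [hH]
    simp only
    refine (tsum_congr fun i => ?_).trans tsum_zero
    exact indicator_of_notMem (fun hx' => hx (mem_iUnion.2 ⟨i, hx'⟩)) _
  have hHint : Integrable H := by
    have h1 : IntegrableOn H (⋃ i, B i) := by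
      have hcongr : ∀ i, IntegrableOn H (B i) := fun i =>
        (integrableOn_congr_fun (hHB i) (hBm i)).2 (integrableOn_const (hBfin i))
      refine integrableOn_iUnion_of_summable_integral_norm hcongr ?_
      have hsum : Summable fun i => 25 * t * volume.real (B i) :=
        (ENNReal.summable_toReal hStop).mul_left _
      refine Summable.of_nonneg_of_le (fun i => integral_nonneg fun _ => norm_nonneg _)
        (fun i => ?_) hsum
      rw [setIntegral_congr_fun (g := fun _ => ‖m i‖) (hBm i) (fun x hx => by rw [hHB i x hx]),
        setIntegral_const, smul_eq_mul, mul_comm]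
      exact mul_le_mul_of_nonneg_right (hmle i) (hVpos i).le
    refine (integrableOn_iff_integrable_of_support_subset fun x hx => ?_).1 h1
    by_contra h
    exact hx (hH0 x h)
  have hBU : ⋃ i, B i ⊆ U := by
    rw [hQU]
    exact iUnion_mono hBB5
  -- The good part. It is bounded by a multiple of t, and its square is controlled by |g|² on {|g| ≤
  -- t} plus (25 t)² on the selected balls.
  set G : ℂ → ℂ := fun x => Uᶜ.indicator g x + H x with hG
  have hGint : Integrable G := (hg.indicator hUm.compl).add hHint
  have hGc : HasCompactSupport G := by
    obtain ⟨M₀, hM₀⟩ := hc.isCompact.isBounded.subset_closedBall 0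
    refine HasCompactSupport.intro (isCompact_closedBall (0 : ℂ) (max M M₀)) fun x hx => ?_
    have hx' : max M M₀ < ‖x‖ := by simpa using hx
    have h1 : g x = 0 := by
      by_contra h
      have : ‖x‖ ≤ M₀ := by simpa using hM₀ (subset_tsupport g h)
      linarith [le_max_right M M₀]
    have h2 : H x = 0 := by
      refine hH0 x fun h => ?_
      obtain ⟨i, hi⟩ := mem_iUnion.1 (iUnion_mono hBB5 h)
      have h3 : ‖x - i‖ ≤ 5 * r i := by simpa [hB5, dist_eq_norm] using hi
      have h4 : ‖x‖ ≤ ‖x - i‖ + ‖(i : ℂ)‖ := by simpa using norm_add_le (x - i) i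
      linarith [hM i i.2, le_max_left M M₀]
    simp [hG, indicator, h1, h2]
  have hG2 : ∫⁻ y, ‖G y‖ₑ ^ (2 : ℝ) ≤ (∫⁻ y in {y | ‖g y‖ ≤ t}, ‖g y‖ₑ ^ (2 : ℝ))
      + ENNReal.ofReal (625 * t ^ 2) * S := by
    have hpt : ∀ y, ‖G y‖ₑ ^ (2 : ℝ) ≤ {y | ‖g y‖ ≤ t}.indicator (fun y => ‖g y‖ₑ ^ (2 : ℝ)) y
        + (⋃ i, B i).indicator (fun _ => ENNReal.ofReal (625 * t ^ 2)) y := by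
      intro y
      by_cases hy : y ∈ U
      · have : G y = H y := by simp [hG, hy]
        rw [this]
        refine le_add_left ?_
        by_cases hyB : y ∈ ⋃ i, B i
        · rw [indicator_of_mem hyB]
          obtain ⟨i, hi⟩ := mem_iUnion.1 hyB
          rw [hHB i y hi, ← ofReal_norm, ENNReal.ofReal_rpow_of_nonneg (norm_nonneg _)
            (by norm_num)]
          refine ENNReal.ofReal_le_ofReal ?_
          have := pow_le_pow_left₀ (norm_nonneg _) (hmle i) 2
          norm_num
          nlinarith
        · rw [hH0 y hyB]
          simp
      · have h1 : G y = g y := by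
          simp [hG, hy, hH0 y (fun h => hy (hBU h))]
        rw [h1]
        refine le_add_right ?_
        rw [indicator_of_mem (show y ∈ {y | ‖g y‖ ≤ t} from hUcov y hy)]
    refine (lintegral_mono hpt).trans ?_
    rw [lintegral_add_right _ (measurable_const.indicator (MeasurableSet.iUnion hBm)),
      lintegral_indicator (measurableSet_le hgc.norm.measurable measurable_const),
      lintegral_indicator (MeasurableSet.iUnion hBm), setLIntegral_const, hvol]
  set T := kerConv (beurlingKer ε) with hT
  set bad : ℂ → ℂ := fun x => T g x - T G x with hbad
  set term : u → ℂ → ℂ := fun i x => (∫ y in Q i, beurlingKer ε (x - y) * g y)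
    - ∫ y in B i, beurlingKer ε (x - y) * m i with hterm
  -- The bad part is the transform of g - G, and each summand is the transform of a function of mean
  -- zero near one ball, as `enorm_bad_term_le` requires.
  have hsum : ∀ x, HasSum (fun i => term i x) (bad x) := by
    intro x
    have ig := integrable_kerConv c2 b2 hg x
    have iH := integrable_kerConv c2 b2 hHint x
    have iG := integrable_kerConv c2 b2 hGint x
    have s1 := hasSum_integral_iUnion (μ := volume) hQm hQd ig.integrableOn
    have s2 := hasSum_integral_iUnion (μ := volume) hBm hBd iH.integrableOn
    have e1 : ∀ i, ∫ y in B i, beurlingKer ε (x - y) * H y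
        = ∫ y in B i, beurlingKer ε (x - y) * m i := fun i =>
      setIntegral_congr_fun (hBm i) fun y hy => by simp only [hHB i y hy]
    simp only [e1] at s2
    have s3 := s1.sub s2
    suffices hbx : bad x = (∫ y in ⋃ i, Q i, beurlingKer ε (x - y) * g y)
        - ∫ y in ⋃ i, B i, beurlingKer ε (x - y) * H y by
      rw [hbx]
      exact s3
    rw [hbad]
    simp only [hT, kerConv]
    rw [← integral_sub ig iG, ← hU, ← integral_indicator hUm,
      ← integral_indicator (MeasurableSet.iUnion hBm),
      ← integral_sub (ig.indicator hUm) (iH.indicator (MeasurableSet.iUnion hBm))]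
    congr 1 with y
    by_cases hy : y ∈ U
    · by_cases hyB : y ∈ ⋃ i, B i
      · simp only [hG, indicator_of_mem hy, indicator_of_mem hyB, mem_compl_iff, hy,
          not_true_eq_false, not_false_eq_true, indicator_of_notMem]
        ring
      · simp only [hG, indicator_of_mem hy, indicator_of_notMem hyB, mem_compl_iff, hy,
          not_true_eq_false, not_false_eq_true, indicator_of_notMem, hH0 y hyB]
        ring
    · have hyB : y ∉ ⋃ i, B i := fun h => hy (hBU h)
      simp only [hG, indicator_of_notMem hy, indicator_of_notMem hyB, hH0 y hyB,
        indicator_of_mem (mem_compl hy)]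
      ring
  set W := ⋃ i, B10 i with hW
  have hWm : MeasurableSet W := MeasurableSet.iUnion fun i => measurableSet_closedBall
  have hWvol : volume W ≤ 100 * S := by
    refine (measure_iUnion_le _).trans (le_of_eq ?_)
    rw [hS, ← ENNReal.tsum_mul_left]
    congr 1 with i
    rw [hB10]
    simp only
    rw [volume_closedBall_mul _ (by norm_num)]
    congr 1
    norm_num
  -- 150 = 6 · 25, from the kernel increment and the area ratio.
  have hbadint : ∫⁻ x in Wᶜ, ‖bad x‖ₑ ≤ ENNReal.ofReal t * (150 * tailConst * S) := by
    set tail : u → ℂ → ℝ≥0∞ := fun i x => {x : ℂ | 10 * r i ≤ ‖x - i‖}.indicator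
      (fun x => ENNReal.ofReal (10 * r i / ‖x - i‖ ^ 3)) x with htail
    have htm : ∀ i, Measurable (tail i) := fun i => by
      refine Measurable.indicator (by fun_prop) ?_
      exact measurableSet_le measurable_const (by fun_prop)
    have hpt : ∀ x ∈ Wᶜ, ‖bad x‖ₑ ≤ ∑' i, 6 * (∫⁻ y in Q i, ‖g y‖ₑ) * tail i x := by
      intro x hx
      rw [← (hsum x).tsum_eq]
      refine enorm_tsum_le_tsum_enorm.trans (ENNReal.tsum_le_tsum fun i => ?_)
      have hxi : 10 * r i ≤ ‖x - i‖ := by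
        by_contra h
        exact hx (mem_iUnion.2 ⟨i, by simpa [hB10, dist_eq_norm] using (not_le.1 h).le⟩)
      rw [htail]
      simp only
      rw [indicator_of_mem (by exact hxi)]
      refine (enorm_bad_term_le hε hg (hr' i) (hQm i) (hQ5 i) hxi).trans (le_of_eq ?_)
      ring
    calc ∫⁻ x in Wᶜ, ‖bad x‖ₑ
        ≤ ∫⁻ x in Wᶜ, ∑' i, 6 * (∫⁻ y in Q i, ‖g y‖ₑ) * tail i x :=
          setLIntegral_mono' hWm.compl hpt
      _ ≤ ∫⁻ x, ∑' i, 6 * (∫⁻ y in Q i, ‖g y‖ₑ) * tail i x := setLIntegral_le_lintegral _ _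
      _ = ∑' i, 6 * (∫⁻ y in Q i, ‖g y‖ₑ) * tailConst := by
          rw [lintegral_tsum fun i => ((htm i).const_mul _).aemeasurable]
          congr 1 with i
          rw [lintegral_const_mul _ (htm i), htail]
          simp only
          rw [lintegral_tail_le (i : ℂ) (by linarith [hr' i] : 0 < 10 * r i)]
      _ ≤ ∑' i, 6 * (ENNReal.ofReal (25 * t) * volume (B i)) * tailConst := by
          gcongr with i
          exact hQint i
      _ = ENNReal.ofReal t * (150 * tailConst * S) := by
          rw [ENNReal.tsum_mul_right, ENNReal.tsum_mul_left, ENNReal.tsum_mul_left, ← hS,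
            ENNReal.ofReal_mul (by norm_num), show ENNReal.ofReal 25 = 25 by simp]
          ring
  have hbadc : Continuous bad :=
    (continuous_kerConv c2 b2 hg).sub (continuous_kerConv c2 b2 hGint)
  have htinv : ENNReal.ofReal t⁻¹ * ENNReal.ofReal t = 1 := by
    rw [← ENNReal.ofReal_mul (by positivity), inv_mul_cancel₀ ht.ne', ENNReal.ofReal_one]
  have m1 : volume (Wᶜ ∩ {x | t < ‖bad x‖}) ≤ 150 * tailConst * S := by
    have h1 := mul_meas_ge_le_lintegral (μ := volume.restrict Wᶜ) hbadc.enorm.measurable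
      (ENNReal.ofReal t)
    have h2 : volume (Wᶜ ∩ {x | t < ‖bad x‖})
        ≤ (volume.restrict Wᶜ) {x | ENNReal.ofReal t ≤ ‖bad x‖ₑ} := by
      rw [Measure.restrict_apply (measurableSet_le measurable_const hbadc.enorm.measurable),
        inter_comm]
      refine measure_mono (inter_subset_inter_left _ fun x hx => ?_)
      have hx : t < ‖bad x‖ := hx
      change ENNReal.ofReal t ≤ ‖bad x‖ₑ
      rw [← ofReal_norm]
      exact ENNReal.ofReal_le_ofReal hx.le
    calc volume (Wᶜ ∩ {x | t < ‖bad x‖})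
        ≤ ENNReal.ofReal t⁻¹ * (ENNReal.ofReal t
          * (volume.restrict Wᶜ) {x | ENNReal.ofReal t ≤ ‖bad x‖ₑ}) := by
          rw [← mul_assoc, htinv, one_mul]; exact h2
      _ ≤ ENNReal.ofReal t⁻¹ * (ENNReal.ofReal t * (150 * tailConst * S)) := by
          refine mul_le_mul' le_rfl ?_
          exact h1.trans hbadint
      _ = _ := by rw [← mul_assoc, htinv, one_mul]
  have hTGc : Continuous (T G) := continuous_kerConv c2 b2 hGint
  have m2 : volume {x | t < ‖T G x‖} ≤ ENNReal.ofReal (t ^ 2)⁻¹ *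
      (approxIdMass ^ (2 : ℝ) * ((∫⁻ y in {y | ‖g y‖ ≤ t}, ‖g y‖ₑ ^ (2 : ℝ))
      + ENNReal.ofReal (625 * t ^ 2) * S)) := by
    have h1 := mul_meas_ge_le_lintegral (μ := volume)
      (hTGc.enorm.measurable.pow_const (2 : ℝ)) (ENNReal.ofReal (t ^ 2))
    have h2 : volume {x | t < ‖T G x‖} ≤ volume {x | ENNReal.ofReal (t ^ 2) ≤ ‖T G x‖ₑ ^ (2:ℝ)} := by
      refine measure_mono fun x hx => ?_
      have hx : t < ‖T G x‖ := hx
      change ENNReal.ofReal (t ^ 2) ≤ ‖T G x‖ₑ ^ (2 : ℝ)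
      rw [← ofReal_norm, ENNReal.ofReal_rpow_of_nonneg (norm_nonneg _) (by norm_num)]
      refine ENNReal.ofReal_le_ofReal ?_
      rw [show (2 : ℝ) = ((2 : ℕ) : ℝ) by norm_num, Real.rpow_natCast]
      gcongr
    have h3 : ENNReal.ofReal (t ^ 2)⁻¹ * ENNReal.ofReal (t ^ 2) = 1 := by
      rw [← ENNReal.ofReal_mul (by positivity), inv_mul_cancel₀ (by positivity), ENNReal.ofReal_one]
    calc volume {x | t < ‖T G x‖}
        ≤ ENNReal.ofReal (t ^ 2)⁻¹ * (ENNReal.ofReal (t ^ 2)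
          * volume {x | ENNReal.ofReal (t ^ 2) ≤ ‖T G x‖ₑ ^ (2 : ℝ)}) := by
          rw [← mul_assoc, h3, one_mul]; exact h2
      _ ≤ _ := by
          refine mul_le_mul' le_rfl ?_
          refine h1.trans ((lintegral_sq_kerConv_beurlingKer_le hε hGint hGc).trans ?_)
          gcongr
  have hcover : {x | 2 * t < ‖T g x‖} ⊆ W ∪ (Wᶜ ∩ {x | t < ‖bad x‖}) ∪ {x | t < ‖T G x‖} := by
    intro x hx
    have hx : 2 * t < ‖T g x‖ := hx
    by_cases h1 : t < ‖T G x‖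
    · exact Or.inr h1
    · left
      by_cases h2 : x ∈ W
      · exact Or.inl h2
      · refine Or.inr ⟨h2, ?_⟩
        change t < ‖T g x - T G x‖
        have : ‖T g x‖ ≤ ‖T g x - T G x‖ + ‖T G x‖ := by
          simpa using norm_add_le (T g x - T G x) (T G x)
        linarith [not_lt.1 h1]
  set X := ENNReal.ofReal t⁻¹ * ∫⁻ y in P, ‖g y‖ₑ with hX
  set J := ∫⁻ y in {y | ‖g y‖ ≤ t}, ‖g y‖ₑ ^ (2 : ℝ) with hJ
  set A2 := approxIdMass ^ (2 : ℝ) with hA2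
  have h625 : ENNReal.ofReal (t ^ 2)⁻¹ * ENNReal.ofReal (625 * t ^ 2) = 625 := by
    rw [← ENNReal.ofReal_mul (by positivity)]
    have : (t ^ 2)⁻¹ * (625 * t ^ 2) = 625 := by field_simp
    rw [this]
    simp
  calc volume {x | 2 * t < ‖T g x‖}
      ≤ 100 * S + 150 * tailConst * S + ENNReal.ofReal (t ^ 2)⁻¹ * (A2 * (J
        + ENNReal.ofReal (625 * t ^ 2) * S)) := by
        refine (measure_mono hcover).trans ((measure_union_le _ _).trans (add_le_add ?_ m2))
        exact (measure_union_le _ _).trans (add_le_add hWvol m1)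
    _ = (100 + 150 * tailConst + 625 * A2) * S + A2 * (ENNReal.ofReal (t ^ 2)⁻¹ * J) := by
        have : ENNReal.ofReal (t ^ 2)⁻¹ * (A2 * (J + ENNReal.ofReal (625 * t ^ 2) * S))
          = A2 * (ENNReal.ofReal (t ^ 2)⁻¹ * J) + (ENNReal.ofReal (t ^ 2)⁻¹ *
            ENNReal.ofReal (625 * t ^ 2)) * A2 * S := by ring
        rw [this, h625]
        ring
    _ ≤ (100 + 150 * tailConst + 625 * A2) * (2 * X) + A2 * (ENNReal.ofReal (t ^ 2)⁻¹ * J) := by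
        gcongr
    -- Nonnegative terms are added so that both summands carry one common constant.
    _ ≤ (100 + 150 * tailConst + 625 * A2) * (2 * X) + A2 * (ENNReal.ofReal (t ^ 2)⁻¹ * J)
        + (A2 * X + (200 + 300 * tailConst + 1250 * A2) * (ENNReal.ofReal (t ^ 2)⁻¹ * J)) :=
        le_self_add
    _ = (200 + 300 * tailConst + 1251 * A2) * (X + ENNReal.ofReal (t ^ 2)⁻¹ * J) := by
        generalize ENNReal.ofReal (t ^ 2)⁻¹ * J = Y
        ring

/-! ### `Lᵖ` bounds for `1 < p < 2` -/

theorem lintegral_Ioo_rpow_le {p a : ℝ} (hp : 1 < p) (ha : 0 ≤ a) :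
    ∫⁻ t in Ioo 0 a, ENNReal.ofReal (t ^ (p - 2)) ≤ ENNReal.ofReal (a ^ (p - 1) / (p - 1)) := by
  have hi : IntervalIntegrable (fun t : ℝ => t ^ (p - 2)) volume 0 a :=
    intervalIntegral.intervalIntegrable_rpow' (by linarith)
  have h := ofReal_integral_eq_lintegral_ofReal ((intervalIntegrable_iff_integrableOn_Ioo_of_le
    ha).1 hi) (by
      refine (ae_restrict_iff' measurableSet_Ioo).2 (Eventually.of_forall fun t ht => ?_)
      exact Real.rpow_nonneg ht.1.le _)
  rw [← h, ← integral_Ioc_eq_integral_Ioo, ← intervalIntegral.integral_of_le ha,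
    integral_rpow (Or.inl (by linarith)), Real.zero_rpow (by linarith), sub_zero,
    show p - 2 + 1 = p - 1 by ring]

theorem lintegral_Ioi_rpow_le {p a : ℝ} (hp : p < 2) (ha : 0 < a) :
    ∫⁻ t in Ioi a, ENNReal.ofReal (t ^ (p - 3)) ≤ ENNReal.ofReal (a ^ (p - 2) / (2 - p)) := by
  have h := ofReal_integral_eq_lintegral_ofReal
    (integrableOn_Ioi_rpow_of_lt (by linarith : p - 3 < -1) ha) (by
      refine (ae_restrict_iff' measurableSet_Ioi).2 (Eventually.of_forall fun t ht => ?_)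
      exact Real.rpow_nonneg (ha.trans ht).le _)
  rw [← h, integral_Ioi_rpow_of_lt (by linarith) ha, show p - 3 + 1 = p - 2 by ring]
  refine ENNReal.ofReal_le_ofReal (le_of_eq ?_)
  rw [neg_div, ← div_neg, neg_sub]

/-- The distribution estimate is integrated against t^(p-1) dt and the order of integration
exchanged. At a point y the first term leaves ∫ t^(p-2) over (0, 2|g(y)|), finite because p > 1; the
second leaves ∫ t^(p-3) over (|g(y)|, ∞), finite because p < 2. Both are multiples of |g(y)|^p after
restoring the factors |g| and |g|². -/
theorem exists_lintegral_rpow_kerConv_beurlingKer_le {p : ℝ} (hp1 : 1 < p) (hp2 : p < 2) :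
    ∃ C : ℝ≥0∞, C ≠ ⊤ ∧ ∀ ε : ℝ, 0 < ε → ∀ g : ℂ → ℂ, Continuous g → HasCompactSupport g →
      ∫⁻ x, ‖kerConv (beurlingKer ε) g x‖ₑ ^ p ≤ C * ∫⁻ x, ‖g x‖ₑ ^ p := by
  set K : ℝ≥0∞ := 200 + 300 * tailConst + 1251 * approxIdMass ^ (2 : ℝ) with hK
  have hKtop : K ≠ ⊤ := by
    refine ENNReal.add_ne_top.2 ⟨ENNReal.add_ne_top.2 ⟨by norm_num, ?_⟩, ?_⟩
    · exact ENNReal.mul_ne_top (by norm_num) tailConst_ne_top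
    · exact ENNReal.mul_ne_top (by norm_num)
        (ENNReal.rpow_ne_top_of_nonneg (by norm_num) approxIdMass_ne_top)
  refine ⟨ENNReal.ofReal (2 ^ p) * (ENNReal.ofReal p * (K *
    (ENNReal.ofReal (2 ^ (p - 1) / (p - 1)) + ENNReal.ofReal (1 / (2 - p))))), ?_, ?_⟩
  · exact ENNReal.mul_ne_top ENNReal.ofReal_ne_top (ENNReal.mul_ne_top ENNReal.ofReal_ne_top
      (ENNReal.mul_ne_top hKtop (ENNReal.add_ne_top.2 ⟨ENNReal.ofReal_ne_top,
        ENNReal.ofReal_ne_top⟩)))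
  intro ε hε g hgc hc
  have hp0 : 0 < p := by linarith
  have c2 := continuous_beurlingKer hε
  have b2 := norm_le_of_norm_le_div (sq_nonneg _) (norm_beurlingKer_le hε)
  have hg : Integrable g := hgc.integrable_of_hasCompactSupport hc
  set T := kerConv (beurlingKer ε) g with hT
  have hTc : Continuous T := continuous_kerConv c2 b2 hg
  -- Halving the transform matches the level 2 t of the distribution estimate.
  have hlayer := lintegral_rpow_eq_lintegral_meas_lt_mul volume (f := fun x => ‖T x‖ / 2)
    (Eventually.of_forall fun x => by positivity)
    (hTc.norm.div_const 2).measurable.aemeasurable hp0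
  have e1 : ∫⁻ x, ‖T x‖ₑ ^ p
      = ENNReal.ofReal (2 ^ p) * ∫⁻ x, ENNReal.ofReal ((‖T x‖ / 2) ^ p) := by
    rw [← lintegral_const_mul' _ _ ENNReal.ofReal_ne_top]
    congr 1 with x
    rw [← ofReal_norm, ENNReal.ofReal_rpow_of_nonneg (norm_nonneg _) hp0.le,
      ← ENNReal.ofReal_mul (by positivity), ← Real.mul_rpow (by norm_num) (by positivity)]
    congr 2
    ring
  rw [e1, hlayer, mul_assoc, mul_assoc]
  gcongr ENNReal.ofReal (2 ^ p) * (ENNReal.ofReal p * ?_)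
  set F1 : ℝ → ℂ → ℝ≥0∞ := fun t y => ENNReal.ofReal (t ^ (p - 2)) *
    {z : ℝ × ℂ | z.1 / 2 < ‖g z.2‖}.indicator (fun z => ‖g z.2‖ₑ) (t, y) with hF1
  set F2 : ℝ → ℂ → ℝ≥0∞ := fun t y => ENNReal.ofReal (t ^ (p - 3)) *
    {z : ℝ × ℂ | ‖g z.2‖ ≤ z.1}.indicator (fun z => ‖g z.2‖ₑ ^ (2 : ℝ)) (t, y) with hF2
  have hgm : Measurable fun z : ℝ × ℂ => ‖g z.2‖ :=
    (hgc.norm.comp continuous_snd).measurable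
  have hgm' : Measurable fun z : ℝ × ℂ => ‖g z.2‖ₑ :=
    (hgc.enorm.comp continuous_snd).measurable
  have m1 : Measurable (Function.uncurry F1) := by
    refine Measurable.mul (by fun_prop) (Measurable.indicator hgm' ?_)
    exact measurableSet_lt (by fun_prop) hgm
  have m2 : Measurable (Function.uncurry F2) := by
    refine Measurable.mul (by fun_prop) (Measurable.indicator (hgm'.pow_const _) ?_)
    exact measurableSet_le hgm (by fun_prop)
  have hpt : ∀ t ∈ Ioi (0 : ℝ), volume {a | t < ‖T a‖ / 2} * ENNReal.ofReal (t ^ (p - 1))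
      ≤ K * ((∫⁻ y, F1 t y) + ∫⁻ y, F2 t y) := by
    intro t ht
    have ht : 0 < t := ht
    have hset : {a | t < ‖T a‖ / 2} = {a | 2 * t < ‖T a‖} := by
      ext a
      simp only [mem_ofPred_eq]
      constructor <;> intro h <;> linarith
    rw [hset]
    have h := volume_kerConv_beurlingKer_le hε hgc hc ht
    rw [← hK, ← hT] at h
    have i1 : ∫⁻ y, F1 t y = ENNReal.ofReal (t ^ (p - 2))
        * ∫⁻ y in {y | t / 2 < ‖g y‖}, ‖g y‖ₑ := by
      rw [hF1]
      simp only
      rw [lintegral_const_mul' _ _ ENNReal.ofReal_ne_top,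
        ← lintegral_indicator (measurableSet_lt measurable_const hgc.norm.measurable)]
      rfl
    have i2 : ∫⁻ y, F2 t y = ENNReal.ofReal (t ^ (p - 3))
        * ∫⁻ y in {y | ‖g y‖ ≤ t}, ‖g y‖ₑ ^ (2 : ℝ) := by
      rw [hF2]
      simp only
      rw [lintegral_const_mul' _ _ ENNReal.ofReal_ne_top,
        ← lintegral_indicator (measurableSet_le hgc.norm.measurable measurable_const)]
      rfl
    have r1 : ENNReal.ofReal t⁻¹ * ENNReal.ofReal (t ^ (p - 1)) = ENNReal.ofReal (t ^ (p - 2)) := by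
      rw [← ENNReal.ofReal_mul (by positivity), ← Real.rpow_neg_one, ← Real.rpow_add ht]
      congr 2
      ring
    have r2 : ENNReal.ofReal (t ^ 2)⁻¹ * ENNReal.ofReal (t ^ (p - 1))
        = ENNReal.ofReal (t ^ (p - 3)) := by
      rw [← ENNReal.ofReal_mul (by positivity), ← Real.rpow_natCast, ← Real.rpow_neg ht.le,
        ← Real.rpow_add ht]
      congr 2
      push_cast
      ring
    refine (mul_le_mul' h le_rfl).trans (le_of_eq ?_)
    rw [i1, i2, ← r1, ← r2]
    ring
  have b1' : ∀ y, ∫⁻ t in Ioi (0 : ℝ), F1 t y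
      ≤ ENNReal.ofReal (2 ^ (p - 1) / (p - 1)) * ‖g y‖ₑ ^ p := by
    intro y
    have h1 : ∫⁻ t in Ioi (0 : ℝ), F1 t y
        = ∫⁻ t in Ioo 0 (2 * ‖g y‖), ENNReal.ofReal (t ^ (p - 2)) * ‖g y‖ₑ := by
      rw [← lintegral_indicator measurableSet_Ioi, ← lintegral_indicator measurableSet_Ioo]
      congr 1 with t
      by_cases ht : 0 < t
      · rw [indicator_of_mem (by exact ht)]
        by_cases h2 : t / 2 < ‖g y‖
        · rw [indicator_of_mem (show t ∈ Ioo 0 (2 * ‖g y‖) from ⟨ht, by linarith⟩), hF1]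
          simp only
          rw [indicator_of_mem (by exact h2)]
        · rw [indicator_of_notMem (fun h => h2 (by linarith [h.2])), hF1]
          simp only
          rw [indicator_of_notMem (by exact h2), mul_zero]
      · rw [indicator_of_notMem (by exact ht), indicator_of_notMem (fun h => ht h.1)]
    rw [h1, lintegral_mul_const' _ _ enorm_ne_top]
    refine (mul_le_mul' (lintegral_Ioo_rpow_le hp1 (by positivity)) le_rfl).trans (le_of_eq ?_)
    rw [← ofReal_norm, ENNReal.ofReal_rpow_of_nonneg (norm_nonneg _) hp0.le,
      ← ENNReal.ofReal_mul (by
        have := Real.rpow_nonneg (by positivity : 0 ≤ 2 * ‖g y‖) (p - 1)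
        have : 0 < p - 1 := by linarith
        positivity), ← ENNReal.ofReal_mul (by
        have : 0 < p - 1 := by linarith
        positivity)]
    congr 1
    rw [Real.mul_rpow (by norm_num) (norm_nonneg _)]
    have : ‖g y‖ ^ p = ‖g y‖ ^ (p - 1) * ‖g y‖ := by
      rcases (norm_nonneg (g y)).eq_or_lt with h0 | h0
      · rw [← h0, Real.zero_rpow (by linarith), mul_zero]
      · nth_rewrite 3 [← Real.rpow_one ‖g y‖]
        rw [← Real.rpow_add h0]
        congr 1
        ring
    rw [this]
    ring
  have b2' : ∀ y, ∫⁻ t in Ioi (0 : ℝ), F2 t y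
      ≤ ENNReal.ofReal (1 / (2 - p)) * ‖g y‖ₑ ^ p := by
    intro y
    rcases (norm_nonneg (g y)).eq_or_lt with h0 | h0
    · have hg0 : g y = 0 := norm_eq_zero.1 h0.symm
      have : ∀ t, F2 t y = 0 := by
        intro t
        rw [hF2]
        simp [indicator, hg0]
      simp [this]
    have h1 : ∫⁻ t in Ioi (0 : ℝ), F2 t y
        = ∫⁻ t in Ioi ‖g y‖, ENNReal.ofReal (t ^ (p - 3)) * ‖g y‖ₑ ^ (2 : ℝ) := by
      rw [setLIntegral_congr (Ioi_ae_eq_Ici : Ioi ‖g y‖ =ᵐ[volume] Ici ‖g y‖),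
        ← lintegral_indicator measurableSet_Ioi, ← lintegral_indicator measurableSet_Ici]
      congr 1 with t
      by_cases h2 : ‖g y‖ ≤ t
      · rw [indicator_of_mem (show t ∈ Ioi (0 : ℝ) from h0.trans_le h2),
          indicator_of_mem (by exact h2), hF2]
        simp only
        rw [indicator_of_mem (by exact h2)]
      · rw [indicator_of_notMem (by exact h2 : t ∉ Ici ‖g y‖)]
        refine indicator_apply_eq_zero.2 fun _ => ?_
        rw [hF2]
        simp only
        rw [indicator_of_notMem (by exact h2), mul_zero]
    rw [h1, lintegral_mul_const' _ _ (ENNReal.rpow_ne_top_of_nonneg (by norm_num) enorm_ne_top)]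
    refine (mul_le_mul' (lintegral_Ioi_rpow_le hp2 h0) le_rfl).trans (le_of_eq ?_)
    have : 0 < 2 - p := by linarith
    rw [← ofReal_norm, ENNReal.ofReal_rpow_of_nonneg (norm_nonneg _) hp0.le,
      ENNReal.ofReal_rpow_of_nonneg (norm_nonneg _) (by norm_num),
      ← ENNReal.ofReal_mul (by positivity), ← ENNReal.ofReal_mul (by positivity)]
    congr 1
    have h3 : ‖g y‖ ^ p = ‖g y‖ ^ (p - 2) * ‖g y‖ ^ (2 : ℝ) := by
      rw [← Real.rpow_add h0]
      congr 1
      ring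
    rw [h3]
    ring
  calc ∫⁻ t in Ioi (0 : ℝ), volume {a | t < ‖T a‖ / 2} * ENNReal.ofReal (t ^ (p - 1))
      ≤ ∫⁻ t in Ioi (0 : ℝ), K * ((∫⁻ y, F1 t y) + ∫⁻ y, F2 t y) :=
        setLIntegral_mono' measurableSet_Ioi hpt
    _ = K * ((∫⁻ t in Ioi (0 : ℝ), ∫⁻ y, F1 t y) + ∫⁻ t in Ioi (0 : ℝ), ∫⁻ y, F2 t y) := by
        rw [lintegral_const_mul' _ _ hKtop, 
          lintegral_add_left (f := fun t => ∫⁻ y, F1 t y) m1.lintegral_prod_right']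
    _ = K * ((∫⁻ y, ∫⁻ t in Ioi (0 : ℝ), F1 t y) + ∫⁻ y, ∫⁻ t in Ioi (0 : ℝ), F2 t y) := by
        rw [lintegral_lintegral_swap m1.aemeasurable, lintegral_lintegral_swap m2.aemeasurable]
    _ ≤ K * ((∫⁻ y, ENNReal.ofReal (2 ^ (p - 1) / (p - 1)) * ‖g y‖ₑ ^ p)
        + ∫⁻ y, ENNReal.ofReal (1 / (2 - p)) * ‖g y‖ₑ ^ p) := by
        gcongr with y y
        · exact b1' y
        · exact b2' y
    _ = K * (ENNReal.ofReal (2 ^ (p - 1) / (p - 1)) + ENNReal.ofReal (1 / (2 - p)))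
        * ∫⁻ y, ‖g y‖ₑ ^ p := by
        rw [lintegral_const_mul' _ _ ENNReal.ofReal_ne_top,
          lintegral_const_mul' _ _ ENNReal.ofReal_ne_top]
        ring

/-! ### From ∂̄ to the full gradient. -/

/-- The Wirtinger derivative `∂v = (∂ₓv - i ∂ᵧv) / 2`. -/
def dzOp (v : ℂ → ℂ) (x : ℂ) : ℂ := (fderiv ℝ v x 1 - Complex.I * fderiv ℝ v x Complex.I) / 2

/-- The Wirtinger derivative `∂̄v = (∂ₓv + i ∂ᵧv) / 2`. -/
def dzBarOp (v : ℂ → ℂ) (x : ℂ) : ℂ := (fderiv ℝ v x 1 + Complex.I * fderiv ℝ v x Complex.I) / 2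

theorem fderiv_eq_dzOp_add (v : ℂ → ℂ) (x w : ℂ) :
    fderiv ℝ v x w = dzOp v x * w + dzBarOp v x * conj w := by
  have hw : w = w.re • (1 : ℂ) + w.im • Complex.I := by
    simp
  have h1 : fderiv ℝ v x w
      = (w.re : ℂ) * fderiv ℝ v x 1 + (w.im : ℂ) * fderiv ℝ v x Complex.I := by
    conv_lhs => rw [hw]
    rw [map_add, map_smul, map_smul, Complex.real_smul, Complex.real_smul]
  have h2 : w = (w.re : ℂ) + (w.im : ℂ) * Complex.I := (Complex.re_add_im w).symm
  have h3 : conj w = (w.re : ℂ) - (w.im : ℂ) * Complex.I := by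
    apply Complex.ext <;> simp
  rw [h1, h3]
  conv_rhs => rw [h2]
  simp only [Complex.add_re, Complex.ofReal_re, Complex.mul_re, Complex.I_re, Complex.ofReal_im,
    Complex.I_im, Complex.add_im, Complex.mul_im]
  rw [dzOp, dzBarOp]
  ring_nf
  rw [Complex.I_sq]
  ring

theorem continuous_dzOp {v : ℂ → ℂ} (hv : ContDiff ℝ 1 v) : Continuous (dzOp v) := by
  have h : ∀ w : ℂ, Continuous fun x => fderiv ℝ v x w := fun w =>
    (hv.continuous_fderiv one_ne_zero).clm_apply continuous_const
  exact ((h 1).sub (continuous_const.mul (h _))).div_const 2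

theorem continuous_dzBarOp {v : ℂ → ℂ} (hv : ContDiff ℝ 1 v) : Continuous (dzBarOp v) := by
  have h : ∀ w : ℂ, Continuous fun x => fderiv ℝ v x w := fun w =>
    (hv.continuous_fderiv one_ne_zero).clm_apply continuous_const
  exact ((h 1).add (continuous_const.mul (h _))).div_const 2

theorem hasCompactSupport_dzBarOp {v : ℂ → ℂ} (hc : HasCompactSupport v) :
    HasCompactSupport (dzBarOp v) := by
  refine (hc.fderiv ℝ).mono fun x hx h => hx ?_
  simp [dzBarOp, h]

theorem hasCompactSupport_dzOp {v : ℂ → ℂ} (hc : HasCompactSupport v) :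
    HasCompactSupport (dzOp v) := by
  refine (hc.fderiv ℝ).mono fun x hx h => hx ?_
  simp [dzOp, h]

/-- The regularised Beurling transform maps `∂̄v` to `∂v`, up to smoothing and a sign. -/
theorem kerConv_beurlingKer_dzBarOp {ε : ℝ} (hε : 0 < ε) {v : ℂ → ℂ} (hv : ContDiff ℝ 1 v)
    (hc : HasCompactSupport v) (x : ℂ) :
    kerConv (beurlingKer ε) (dzBarOp v) x = -kerConv (approxIdKer ε) (dzOp v) x := by
  have hC : 0 ≤ 2 + 2 / ε ^ 2 := by positivity
  have b1 := norm_le_of_norm_le_div (m := 1) hC (by simpa using norm_cauchyKer_le hε)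
  have b3 := norm_le_of_norm_le_div hC (norm_approxIdKer_le hε)
  have c1 := continuous_cauchyKer hε
  have c3 := continuous_approxIdKer hε
  have vi : Integrable v := hv.continuous.integrable_of_hasCompactSupport hc
  have vvi : ∀ w, Integrable fun y => fderiv ℝ v y w := fun w =>
    ((hv.continuous_fderiv one_ne_zero).clm_apply continuous_const).integrable_of_hasCompactSupport
      (hc.fderiv_apply ℝ w)
  have hdi : Integrable (dzBarOp v) :=
    (continuous_dzBarOp hv).integrable_of_hasCompactSupport (hasCompactSupport_dzBarOp hc)
  have lin : ∀ (k : ℂ → ℂ), Continuous k → ∀ M', (∀ z, ‖k z‖ ≤ M') → ∀ (s x : ℂ),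
      kerConv k (fun y => (fderiv ℝ v y 1 + s * fderiv ℝ v y Complex.I) / 2) x
        = (kerConv k (fun y => fderiv ℝ v y 1) x
          + s * kerConv k (fun y => fderiv ℝ v y Complex.I) x) / 2 := by
    intro k hk M' hM' s x
    have i1 := integrable_kerConv hk hM' (vvi 1) x
    have i2 := integrable_kerConv hk hM' (vvi Complex.I) x
    simp only [kerConv]
    rw [← integral_const_mul, ← integral_add i1 (i2.const_mul _), ← integral_div]
    congr 1 with y
    ring
  -- Two expressions for ∂̄ of the Cauchy convolution of v, with the derivative on the kernel or on
  -- v. The lemma is ∂ of this identity, computed on the left by differentiating v and on the right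
  -- by differentiating the kernel.
  have hBeq : kerConv (approxIdKer ε) v = kerConv (cauchyKer ε) (dzBarOp v) := by
    ext x
    obtain ⟨D, hD, hD'⟩ := hasFDerivAt_kerConv_cauchyKer hε vi x
    obtain ⟨D₂, hD₂, hD₂'⟩ := hasFDerivAt_kerConv_of_contDiff c1 hv hc x
    have hDD : D = D₂ := hD.unique hD₂
    have h : dzBarOp v
      = fun y => (fderiv ℝ v y 1 + Complex.I * fderiv ℝ v y Complex.I) / 2 := rfl
    rw [h, lin _ c1 _ b1, ← hD₂', ← hD₂', ← hDD, hD', hD']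
    simp only [map_one, Complex.conj_I]
    linear_combination (kerConv (approxIdKer ε) v x / 2 + kerConv (beurlingKer ε) v x / 2)
      * Complex.I_mul_I
  obtain ⟨D, hD, hD'⟩ := hasFDerivAt_kerConv_cauchyKer hε hdi x
  obtain ⟨D₂, hD₂, hD₂'⟩ := hasFDerivAt_kerConv_of_contDiff c3 hv hc x
  rw [hBeq] at hD₂
  have hDD : D₂ = D := hD₂.unique hD
  have h : dzOp v
      = fun y => (fderiv ℝ v y 1 + (-Complex.I) * fderiv ℝ v y Complex.I) / 2 := by
    ext y
    simp only [dzOp]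
    ring
  rw [h, lin _ c3 _ b3, ← hD₂', ← hD₂', hDD, hD', hD']
  simp only [map_one, Complex.conj_I]
  linear_combination (kerConv (beurlingKer ε) (dzBarOp v) x / 2
    + kerConv (approxIdKer ε) (dzBarOp v) x / 2) * Complex.I_mul_I

/-- After rescaling the integration variable the kernel no longer depends on ε, and dominated
convergence applies. The kernel is not normalised, so its mass appears in the limit. -/
theorem tendsto_kerConv_approxIdKer {h : ℂ → ℂ} (hh : Continuous h) (hc : HasCompactSupport h)
    (x : ℂ) :
    Tendsto (fun n : ℕ => kerConv (approxIdKer (1 / ((n : ℝ) + 1))) h x) atTop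
      (𝓝 ((∫ z, approxIdKer 1 z) * h x)) := by
  obtain ⟨M, hM⟩ := hc.exists_bound_of_continuous hh
  have hscale : ∀ ε : ℝ, 0 < ε → kerConv (approxIdKer ε) h x
      = ∫ y, approxIdKer 1 y * h (x - ε • y) := by
    intro ε hε
    rw [kerConv, ← integral_sub_left_eq_self _ volume x]
    have h1 : ∀ y, approxIdKer ε (x - (x - y)) * h (x - y)
        = ((ε ^ 2)⁻¹ : ℝ) • (approxIdKer 1 (ε⁻¹ • y) * h (x - ε • (ε⁻¹ • y))) := by
      intro y
      rw [smul_inv_smul₀ hε.ne', sub_sub_cancel, Complex.real_smul, ← mul_assoc]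
      congr 1
      rw [approxIdKer, approxIdKer, norm_smul, Real.norm_of_nonneg (by positivity),
        ← Complex.ofReal_mul]
      congr 1
      have := normSq_add_sq_pos hε y
      have h2 : (ε⁻¹ * ‖y‖) ^ 2 + 1 ^ 2 = (‖y‖ ^ 2 + ε ^ 2) / ε ^ 2 := by field_simp
      rw [h2]
      field_simp
    simp only [h1]
    rw [integral_smul, Measure.integral_comp_smul volume
      (fun y => approxIdKer 1 y * h (x - ε • y)) ε⁻¹, Complex.finrank_real_complex, smul_smul,
      abs_of_pos (by positivity)]
    have : (ε ^ 2)⁻¹ * (ε⁻¹ ^ 2)⁻¹ = 1 := by field_simp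
    rw [this, one_smul]
  have heq : (fun n : ℕ => kerConv (approxIdKer (1 / ((n : ℝ) + 1))) h x)
      = fun n : ℕ => ∫ y, approxIdKer 1 y * h (x - (1 / ((n : ℝ) + 1)) • y) := by
    ext n
    exact hscale _ (by positivity)
  rw [heq, ← integral_mul_const]
  refine tendsto_integral_of_dominated_convergence (fun y => ‖approxIdKer 1 y‖ * M)
    (fun n => ?_) ((integrable_approxIdKer one_pos).norm.mul_const M) (fun n => ?_) ?_
  · refine Continuous.aestronglyMeasurable ?_
    exact (continuous_approxIdKer one_pos).mul (hh.comp (by fun_prop))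
  · refine Eventually.of_forall fun y => ?_
    rw [norm_mul]
    gcongr
    exact hM _
  · refine Eventually.of_forall fun y => ?_
    refine Tendsto.const_mul _ ?_
    have h0 : Tendsto (fun n : ℕ => x - (1 / ((n : ℝ) + 1)) • y) atTop (𝓝 (x - (0 : ℝ) • y)) :=
      tendsto_const_nhds.sub (tendsto_one_div_add_atTop_nhds_zero_nat.smul_const y)
    rw [zero_smul, sub_zero] at h0
    exact (hh.tendsto x).comp h0

theorem integral_approxIdKer_ne_zero : ∫ z, approxIdKer 1 z ≠ 0 := by
  have h1 : ∀ z, approxIdKer 1 z = ((‖approxIdKer 1 z‖ : ℝ) : ℂ) := fun z => by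
    rw [norm_approxIdKer one_pos, approxIdKer]
  have h2 : 0 < ∫ z, ‖approxIdKer 1 z‖ := by
    refine (integral_pos_iff_support_of_nonneg (fun z => norm_nonneg _)
      (integrable_approxIdKer one_pos).norm).2 ?_
    have : Function.support (fun z => ‖approxIdKer 1 z‖) = univ := by
      refine eq_univ_of_forall fun z => ?_
      rw [Function.mem_support, norm_approxIdKer one_pos]
      have := normSq_add_sq_pos one_pos z
      positivity
    rw [this]
    simp
  rw [show (∫ z, approxIdKer 1 z) = ∫ z, ((‖approxIdKer 1 z‖ : ℝ) : ℂ) from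
    integral_congr_ae (Eventually.of_forall h1), integral_complex_ofReal]
  exact_mod_cast h2.ne'

/-- The `Lᵖ` bound `‖Dv‖_p ≤ C ‖∂̄v‖_p` for compactly supported functions, `1 < p < 2`. -/
theorem exists_eLpNorm_fderiv_le_dzBarOp {p : ℝ} (hp1 : 1 < p) (hp2 : p < 2) :
    ∃ C : ℝ≥0∞, C ≠ ⊤ ∧ ∀ v : ℂ → ℂ, ContDiff ℝ 1 v → HasCompactSupport v →
      eLpNorm (fderiv ℝ v) (ENNReal.ofReal p) volume
        ≤ C * eLpNorm (dzBarOp v) (ENNReal.ofReal p) volume := by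
  obtain ⟨C₀, hC₀, hC⟩ := exists_lintegral_rpow_kerConv_beurlingKer_le hp1 hp2
  set c := ∫ z, approxIdKer 1 z with hc0
  have hcne : ‖c‖ₑ ≠ 0 := by simpa using integral_approxIdKer_ne_zero
  have hp0 : 0 < p := by linarith
  have hq : ENNReal.ofReal p ≠ 0 := by simpa using hp0
  refine ⟨‖c‖ₑ⁻¹ * C₀ ^ (1 / p) + 1, ?_, fun v hv hc => ?_⟩
  · refine ENNReal.add_ne_top.2 ⟨ENNReal.mul_ne_top (ENNReal.inv_ne_top.2 hcne) ?_, by simp⟩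
    exact ENNReal.rpow_ne_top_of_nonneg (by positivity) hC₀
  have hdc := continuous_dzOp hv
  have hdbc := continuous_dzBarOp hv
  set εn : ℕ → ℝ := fun n => 1 / ((n : ℝ) + 1) with hεn
  have hεpos : ∀ n, 0 < εn n := fun n => by positivity
  have hdi : Integrable (dzOp v) :=
    hdc.integrable_of_hasCompactSupport (hasCompactSupport_dzOp hc)
  have hn : ∀ n, eLpNorm (kerConv (approxIdKer (εn n)) (dzOp v)) (ENNReal.ofReal p) volume
      ≤ C₀ ^ (1 / p) * eLpNorm (dzBarOp v) (ENNReal.ofReal p) volume := by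
    intro n
    have h1 : eLpNorm (kerConv (approxIdKer (εn n)) (dzOp v)) (ENNReal.ofReal p) volume
        = eLpNorm (kerConv (beurlingKer (εn n)) (dzBarOp v)) (ENNReal.ofReal p) volume := by
      refine eLpNorm_congr_norm_ae (Eventually.of_forall fun x => ?_)
      rw [kerConv_beurlingKer_dzBarOp (hεpos n) hv hc, norm_neg]
    rw [h1, eLpNorm_eq_lintegral_rpow_enorm_toReal hq ENNReal.ofReal_ne_top,
      eLpNorm_eq_lintegral_rpow_enorm_toReal hq ENNReal.ofReal_ne_top,
      ENNReal.toReal_ofReal hp0.le, ← ENNReal.mul_rpow_of_nonneg _ _ (by positivity)]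
    gcongr
    exact hC _ (hεpos n) _ hdbc (hasCompactSupport_dzBarOp hc)
  -- The bound is uniform along ε = 1/(n+1), and Fatou passes it to the pointwise limit c ∂v.
  have hlim : eLpNorm (fun x => c * dzOp v x) (ENNReal.ofReal p) volume
      ≤ C₀ ^ (1 / p) * eLpNorm (dzBarOp v) (ENNReal.ofReal p) volume := by
    refine (Lp.eLpNorm_lim_le_liminf_eLpNorm
      (f := fun n => kerConv (approxIdKer (εn n)) (dzOp v)) (fun n => ?_) _
      (Eventually.of_forall fun x =>
        tendsto_kerConv_approxIdKer hdc (hasCompactSupport_dzOp hc) x)).trans ?_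
    · exact (continuous_kerConv (continuous_approxIdKer (hεpos n)) (norm_le_of_norm_le_div
        (by positivity) (norm_approxIdKer_le (hεpos n))) hdi).aestronglyMeasurable
    · refine liminf_le_of_le (by isBoundedDefault) fun b hb => ?_
      obtain ⟨n, hn'⟩ := hb.exists
      exact hn'.trans (hn n)
  have hdz : eLpNorm (dzOp v) (ENNReal.ofReal p) volume
      ≤ ‖c‖ₑ⁻¹ * C₀ ^ (1 / p) * eLpNorm (dzBarOp v) (ENNReal.ofReal p) volume := by
    have h1 : eLpNorm (fun x => c * dzOp v x) (ENNReal.ofReal p) volume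
        = ‖c‖ₑ * eLpNorm (dzOp v) (ENNReal.ofReal p) volume :=
      eLpNorm_const_smul c (dzOp v) _ _
    rw [h1] at hlim
    calc eLpNorm (dzOp v) (ENNReal.ofReal p) volume
        = ‖c‖ₑ⁻¹ * (‖c‖ₑ * eLpNorm (dzOp v) (ENNReal.ofReal p) volume) := by
          rw [← mul_assoc, ENNReal.inv_mul_cancel hcne enorm_ne_top, one_mul]
      _ ≤ _ := by
          rw [mul_assoc]
          exact mul_le_mul' le_rfl hlim
  have hle : eLpNorm (fderiv ℝ v) (ENNReal.ofReal p) volume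
      ≤ eLpNorm (fun x => ‖dzOp v x‖ + ‖dzBarOp v x‖) (ENNReal.ofReal p) volume := by
    refine eLpNorm_mono_real fun x => ?_
    refine ContinuousLinearMap.opNorm_le_bound _ (by positivity) fun w => ?_
    rw [fderiv_eq_dzOp_add]
    refine (norm_add_le _ _).trans ?_
    rw [norm_mul, norm_mul, RCLike.norm_conj, add_mul]
  refine hle.trans ((eLpNorm_add_le hdc.norm.aestronglyMeasurable
    hdbc.norm.aestronglyMeasurable (by simpa using hp1.le)).trans ?_)
  rw [eLpNorm_norm, eLpNorm_norm, add_mul, one_mul]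
  exact add_le_add hdz le_rfl

/-! ### Linearity of mollification and of weak derivatives. -/

section
variable {F F' : Type*} [NormedAddCommGroup F] [NormedSpace ℝ F]
  [NormedAddCommGroup F'] [NormedSpace ℝ F']

theorem integrable_mollBump_smul (n : ℕ) {g : ℂ → F} (hg : LocallyIntegrable g) (x : ℂ) :
    Integrable fun t => (mollBump n).normed volume (x - t) • g t := by
  have hc : HasCompactSupport fun t => (mollBump n).normed volume (x - t) :=
    (mollBump n).hasCompactSupport_normed.comp_homeomorph (Homeomorph.subLeft x)
  exact hg.integrable_smul_left_of_hasCompactSupport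
    ((mollBump n).continuous_normed.comp (continuous_const.sub continuous_id)) hc

theorem mollify_add (n : ℕ) {g h : ℂ → F} (hg : LocallyIntegrable g) (hh : LocallyIntegrable h) :
    mollify n (g + h) = mollify n g + mollify n h := by
  ext x
  simp only [Pi.add_apply, mollify_apply, smul_add]
  exact integral_add (integrable_mollBump_smul n hg x) (integrable_mollBump_smul n hh x)

theorem LocallyIntegrable.clm_comp {g : ℂ → F} (hg : LocallyIntegrable g) (L : F →L[ℝ] F') :
    LocallyIntegrable fun z => L (g z) := by
  intro x
  obtain ⟨s, hs, h⟩ := hg x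
  exact ⟨s, hs, L.integrable_comp h⟩

theorem mollify_clm_comp [CompleteSpace F] [CompleteSpace F'] (n : ℕ) {g : ℂ → F}
    (hg : LocallyIntegrable g)
    (L : F →L[ℝ] F') (x : ℂ) : mollify n (fun z => L (g z)) x = L (mollify n g x) := by
  rw [mollify_apply, mollify_apply, ← L.integral_comp_comm (integrable_mollBump_smul n hg x)]
  simp only [map_smul]

theorem HasWeakDeriv.clm_comp [CompleteSpace F] [CompleteSpace F'] {v : ℂ} {f G : ℂ → F}
    (h : HasWeakDeriv v f G)
    (L : F →L[ℝ] F') : HasWeakDeriv v (fun z => L (f z)) (fun z => L (G z)) := by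
  refine ⟨LocallyIntegrable.clm_comp h.1 L, LocallyIntegrable.clm_comp h.2 L,
    fun φ hφ hc => ?_⟩
  have h1 := h.1.integrable_smul_left_of_hasCompactSupport (g := fun z => fderiv ℝ φ z v)
    ((hφ.continuous_fderiv (by simp)).clm_apply continuous_const) (hc.fderiv_apply ℝ v)
  have h2 := h.2.integrable_smul_left_of_hasCompactSupport hφ.continuous hc
  have := congrArg L (h.integral_eq φ hφ hc)
  rw [map_neg, ← L.integral_comp_comm h1, ← L.integral_comp_comm h2] at this
  simpa only [map_smul] using this

theorem HasWeakDeriv.add {v : ℂ} {f G f' G' : ℂ → F}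
    (h : HasWeakDeriv v f G) (h' : HasWeakDeriv v f' G') :
    HasWeakDeriv v (fun z => f z + f' z) (fun z => G z + G' z) := by
  refine ⟨h.1.add h'.1, h.2.add h'.2, fun φ hφ hc => ?_⟩
  have hd : Continuous fun z => fderiv ℝ φ z v :=
    (hφ.continuous_fderiv (by simp)).clm_apply continuous_const
  simp only [smul_add]
  rw [integral_add (h.1.integrable_smul_left_of_hasCompactSupport hd (hc.fderiv_apply ℝ v))
    (h'.1.integrable_smul_left_of_hasCompactSupport hd (hc.fderiv_apply ℝ v)),
    integral_add (h.2.integrable_smul_left_of_hasCompactSupport hφ.continuous hc)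
    (h'.2.integrable_smul_left_of_hasCompactSupport hφ.continuous hc),
    h.integral_eq φ hφ hc, h'.integral_eq φ hφ hc, neg_add]

end

/-- Mollification commutes with weak derivatives and does not increase norms, so the smooth estimate
holds for all mollifications with one right-hand side; Fatou returns to the limit. The third bound
is the Sobolev inequality in dimension two, whose conjugate exponent is 2p/(2 - p). -/
theorem exists_eLpNorm_le_dzBar {p : ℝ} (hp1 : 1 < p) (hp2 : p < 2) :
    ∃ C : ℝ≥0∞, C ≠ ⊤ ∧ ∀ V V₀ V₁ : ℂ → ℂ, HasCompactSupport V → HasWeakDeriv 1 V V₀ →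
      HasWeakDeriv Complex.I V V₁ →
      eLpNorm V₀ (ENNReal.ofReal p) volume
        ≤ C * eLpNorm (fun z => V₀ z + Complex.I * V₁ z) (ENNReal.ofReal p) volume ∧
      eLpNorm V₁ (ENNReal.ofReal p) volume
        ≤ C * eLpNorm (fun z => V₀ z + Complex.I * V₁ z) (ENNReal.ofReal p) volume ∧
      eLpNorm V (ENNReal.ofReal (2 * p / (2 - p))) volume
        ≤ C * eLpNorm (fun z => V₀ z + Complex.I * V₁ z) (ENNReal.ofReal p) volume := by
  obtain ⟨C₀, hC₀, hC⟩ := exists_eLpNorm_fderiv_le_dzBarOp hp1 hp2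
  have hp0 : 0 < p := by linarith
  set P : ℝ≥0 := Real.toNNReal p with hP
  set Q : ℝ≥0 := Real.toNNReal (2 * p / (2 - p)) with hQ
  set K : ℝ≥0 := SNormLESNormFDerivOfEqConst ℂ (volume : Measure ℂ) P with hK
  have hq0 : 0 < 2 * p / (2 - p) := by
    have : 0 < 2 - p := by linarith
    positivity
  refine ⟨C₀ + K * C₀, ENNReal.add_ne_top.2 ⟨hC₀, ENNReal.mul_ne_top (by simp) hC₀⟩,
    fun V V₀ V₁ hc h0 h1 => ?_⟩
  set g : ℂ → ℂ := fun z => V₀ z + Complex.I * V₁ z with hg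
  have hI : LocallyIntegrable fun z => Complex.I * V₁ z :=
    LocallyIntegrable.clm_comp h1.2 (ContinuousLinearMap.mul ℝ ℂ Complex.I)
  have hgl : LocallyIntegrable g := h0.2.add hI
  have hs : ∀ n, ContDiff ℝ 1 (mollify n V) := fun n =>
    (contDiff_mollify n h0.1).of_le (by norm_cast)
  have hbar : ∀ n x, dzBarOp (mollify n V) x = mollify n g x / 2 := fun n x => by
    have h2 := mollify_clm_comp n h1.2 (ContinuousLinearMap.mul ℝ ℂ Complex.I) x
    have h3 := congrFun (mollify_add n h0.2 hI) x
    simp only [ContinuousLinearMap.mul_apply'] at h2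
    rw [dzBarOp, h0.fderiv_mollify, h1.fderiv_mollify, ← h2]
    congr 1
    exact h3.symm
  have hbarle : ∀ n, eLpNorm (dzBarOp (mollify n V)) (ENNReal.ofReal p) volume
      ≤ eLpNorm g (ENNReal.ofReal p) volume := fun n => by
    refine (eLpNorm_mono fun x => ?_).trans
      (eLpNorm_mollify_le n hgl.aestronglyMeasurable hp1.le)
    rw [hbar, norm_div]
    have := norm_nonneg (mollify n g x)
    simp only [Complex.norm_ofNat]
    linarith
  have hD : ∀ n, eLpNorm (fderiv ℝ (mollify n V)) (ENNReal.ofReal p) volume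
      ≤ C₀ * eLpNorm g (ENNReal.ofReal p) volume := fun n =>
    (hC _ (hs n) (hasCompactSupport_mollify n hc)).trans (mul_le_mul' le_rfl (hbarle n))
  have key : ∀ (G : ℂ → ℂ) (q : ℝ≥0∞) (B : ℝ≥0∞), LocallyIntegrable G →
      (∀ n, eLpNorm (mollify n G) q volume ≤ B) → eLpNorm G q volume ≤ B := by
    intro G q B hG hB
    refine (Lp.eLpNorm_lim_le_liminf_eLpNorm
      (fun n => (contDiff_mollify n hG).continuous.aestronglyMeasurable) G
      (ae_tendsto_mollify hG)).trans ?_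
    refine liminf_le_of_le (by isBoundedDefault) fun b hb => ?_
    obtain ⟨n, hn⟩ := hb.exists
    exact hn.trans (hB n)
  have hdir : ∀ (v : ℂ) (G : ℂ → ℂ), ‖v‖ = 1 → HasWeakDeriv v V G →
      eLpNorm G (ENNReal.ofReal p) volume ≤ C₀ * eLpNorm g (ENNReal.ofReal p) volume := by
    intro v G hv hG
    refine key G _ _ hG.2 fun n => le_trans (eLpNorm_mono fun x => ?_) (hD n)
    rw [← hG.fderiv_mollify]
    simpa [hv] using (fderiv ℝ (mollify n V) x).le_opNorm v
  rw [add_mul]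
  refine ⟨(hdir 1 V₀ (by simp) h0).trans le_self_add,
    (hdir _ V₁ (by simp) h1).trans le_self_add, ?_⟩
  refine le_trans (key V _ (K * C₀ * eLpNorm g (ENNReal.ofReal p) volume) h0.1 fun n => ?_)
    le_add_self
  have hgns := eLpNorm_le_eLpNorm_fderiv_of_eq (volume : Measure ℂ) (hs n)
    (hasCompactSupport_mollify n hc) (p := P) (p' := Q)
    (by rw [hP]; simpa using hp1.le) (by simp) (by
      rw [hP, hQ, NNReal.coe_inv, Real.coe_toNNReal _ hp0.le, Real.coe_toNNReal _ hq0.le,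
        Complex.finrank_real_complex]
      have : 2 - p ≠ 0 := by linarith
      push_cast
      field_simp)
  rw [mul_assoc]
  exact hgns.trans (mul_le_mul' le_rfl (hD n))

/-! ### Wirtinger's inequality and rotations of the plane. -/

/-- Sharp Wirtinger inequality on the circle of length `2π`. -/
theorem integral_sq_le_integral_deriv_sq {g g' : ℝ → ℝ} (hg : ∀ x, HasDerivAt g (g' x) x)
    (hg' : Continuous g') (hper : g (2 * Real.pi) = g 0)
    (hmean : ∫ x in (0 : ℝ)..2 * Real.pi, g x = 0) :
    ∫ x in (0 : ℝ)..2 * Real.pi, g x ^ 2 ≤ ∫ x in (0 : ℝ)..2 * Real.pi, g' x ^ 2 := by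
  have hpi : (0 : ℝ) < 2 * Real.pi := by positivity
  have hgc : Continuous g := continuous_iff_continuousAt.2 fun x => (hg x).continuousAt
  have hL : ∀ h : ℝ → ℝ, Continuous h →
      MemLp (fun x => (h x : ℂ)) 2 (volume.restrict (Ioc 0 (2 * Real.pi))) := by
    intro h hh
    obtain ⟨B, hB⟩ := (isCompact_Icc (a := (0 : ℝ)) (b := 2 * Real.pi)).exists_bound_of_continuousOn
      hh.continuousOn
    refine MemLp.of_bound (Complex.continuous_ofReal.comp hh).aestronglyMeasurable B ?_
    filter_upwards [ae_restrict_mem measurableSet_Ioc] with x hx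
    rw [Complex.norm_real]
    exact hB x (Ioc_subset_Icc_self hx)
  have h1 := hasSum_sq_fourierCoeffOn hpi (hL g hgc)
  have h2 := hasSum_sq_fourierCoeffOn hpi (hL g' hg')
  -- Coefficient by coefficient: the zeroth one vanishes by the mean condition, and for i ≠ 0
  -- differentiation multiplies by a number of modulus |i| ≥ 1. Parseval adds these up.
  have hle : ∀ i : ℤ, ‖fourierCoeffOn hpi (fun x => (g x : ℂ)) i‖ ^ 2
      ≤ ‖fourierCoeffOn hpi (fun x => (g' x : ℂ)) i‖ ^ 2 := by
    intro i
    by_cases hi : i = 0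
    · subst hi
      have : fourierCoeffOn hpi (fun x => (g x : ℂ)) 0 = 0 := by
        rw [fourierCoeffOn_eq_integral]
        simp only [neg_zero, fourier_zero, one_smul]
        rw [intervalIntegral.integral_ofReal, hmean]
        simp
      rw [this]
      simp
    · have h3 := fourierCoeffOn_of_hasDerivAt hpi (f := fun x => (g x : ℂ))
        (f' := fun x => (g' x : ℂ)) hi (fun x _ => (hg x).ofReal_comp)
        ((Complex.continuous_ofReal.comp hg').intervalIntegrable _ _)
      rw [h3, hper]
      have hi1 : (1 : ℝ) ≤ |(i : ℝ)| := by
        exact_mod_cast Int.one_le_abs hi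
      have hnorm : ‖(1 : ℂ) / (-2 * Real.pi * Complex.I * i)‖ * ‖((2 * Real.pi : ℝ) : ℂ)‖ ≤ 1 := by
        have : (0:ℝ) < Real.pi := Real.pi_pos
        simp only [norm_div, norm_mul, norm_neg, Complex.norm_I, Complex.norm_real,
          Complex.norm_intCast, norm_one, Complex.norm_ofNat, Real.norm_eq_abs, abs_of_pos this,
          abs_two]
        rw [div_mul_eq_mul_div, div_le_one (by positivity)]
        nlinarith
      refine pow_le_pow_left₀ (norm_nonneg _) ?_ 2
      rw [sub_self, mul_zero, zero_sub, norm_mul, norm_neg, norm_mul, ← mul_assoc]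
      have h4 : ‖((2 * Real.pi : ℝ) : ℂ) - ((0 : ℝ) : ℂ)‖ = ‖((2 * Real.pi : ℝ) : ℂ)‖ := by simp
      rw [h4]
      exact mul_le_of_le_one_left (norm_nonneg _) hnorm
  have h5 := hasSum_le hle h1 h2
  simp only [sub_zero, smul_eq_mul, Complex.norm_real, Real.norm_eq_abs, sq_abs] at h5
  exact le_of_mul_le_mul_left h5 (by positivity)

/-- The point `e^{iτ}` of the unit circle. -/
def cis (τ : ℝ) : ℂ := Complex.exp (τ * Complex.I)

theorem norm_cis (τ : ℝ) : ‖cis τ‖ = 1 := Complex.norm_exp_ofReal_mul_I τ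

theorem continuous_cis : Continuous cis := by unfold cis; fun_prop

theorem norm_cis_mul (τ : ℝ) (z : ℂ) : ‖cis τ * z‖ = ‖z‖ := by rw [norm_mul, norm_cis, one_mul]

theorem normSq_cis_mul (τ : ℝ) (z : ℂ) : Complex.normSq (cis τ * z) = Complex.normSq z := by
  rw [Complex.normSq_eq_norm_sq, Complex.normSq_eq_norm_sq, norm_cis_mul]

theorem cis_add (σ τ : ℝ) : cis (σ + τ) = cis σ * cis τ := by
  rw [cis, cis, cis, ← Complex.exp_add]; push_cast; ring_nf

theorem cis_add_two_pi (τ : ℝ) : cis (τ + 2 * Real.pi) = cis τ := by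
  rw [cis_add, cis, cis]
  push_cast
  rw [Complex.exp_two_pi_mul_I, mul_one]

theorem cis_zero : cis 0 = 1 := by simp [cis]

theorem cis_mul_eq_rotation (τ : ℝ) :
    (fun z : ℂ => cis τ * z) = ⇑(_root_.rotation (Circle.exp τ)) := by
  ext z
  rw [rotation_apply, Circle.coe_exp, cis]

theorem measurePreserving_cis_mul (τ : ℝ) :
    MeasurePreserving (fun z : ℂ => cis τ * z) volume volume := by
  rw [cis_mul_eq_rotation]
  exact (_root_.rotation (Circle.exp τ)).measurePreserving

theorem measurableEmbedding_cis_mul (τ : ℝ) : MeasurableEmbedding (fun z : ℂ => cis τ * z) := by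
  rw [cis_mul_eq_rotation]
  exact (_root_.rotation (Circle.exp τ)).toHomeomorph.measurableEmbedding

theorem integral_cis_mul (τ : ℝ) (g : ℂ → ℝ) : ∫ z, g (cis τ * z) = ∫ z, g z :=
  (measurePreserving_cis_mul τ).integral_comp (measurableEmbedding_cis_mul τ) g

/-! ### Energy inequalities in polar form for smooth functions. -/

/-- Radial derivative `|z| ∂_r u`. -/
def radD (u : ℂ → ℝ) (z : ℂ) : ℝ := fderiv ℝ u z z

/-- Angular derivative `∂_θ u`. -/
def angD (u : ℂ → ℝ) (z : ℂ) : ℝ := fderiv ℝ u z (Complex.I * z)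

/-- The Laplacian of a smooth function. -/
def lap (u : ℂ → ℝ) (z : ℂ) : ℝ :=
  fderiv ℝ (fun w => fderiv ℝ u w 1) z 1
    + fderiv ℝ (fun w => fderiv ℝ u w Complex.I) z Complex.I

theorem hasDerivAt_comp_cis {u : ℂ → ℝ} (hu : Differentiable ℝ u) (z : ℂ) (τ : ℝ) :
    HasDerivAt (fun t => u (cis t * z)) (angD u (cis τ * z)) τ := by
  have h1 : HasDerivAt (fun t : ℝ => cis t * z) (Complex.I * (cis τ * z)) τ := by
    have h2 : HasDerivAt (fun t : ℝ => (t : ℂ) * Complex.I) (1 * Complex.I) τ :=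
      (Complex.ofRealCLM.hasDerivAt (x := τ)).mul_const Complex.I
    have := (h2.cexp).mul_const z
    refine HasDerivAt.congr_deriv (f := fun t : ℝ => cis t * z) this ?_
    change _ = Complex.I * (Complex.exp (τ * Complex.I) * z)
    ring
  exact (hu (cis τ * z)).hasFDerivAt.comp_hasDerivAt τ h1

theorem fderiv_comp_mul_left {u : ℂ → ℝ} (hu : Differentiable ℝ u) (c z v : ℂ) :
    fderiv ℝ (fun w => u (c * w)) z v = fderiv ℝ u (c * z) (c * v) := by
  have h1 : HasFDerivAt (fun w => u (c * w))
      ((fderiv ℝ u (c * z)).comp (ContinuousLinearMap.mul ℝ ℂ c)) z :=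
    (hu (c * z)).hasFDerivAt.comp z (ContinuousLinearMap.mul ℝ ℂ c).hasFDerivAt
  rw [h1.fderiv]
  rfl

theorem clm_apply_eq (A : ℂ →L[ℝ] ℝ) (z : ℂ) : A z = z.re * A 1 + z.im * A Complex.I := by
  have hz : z = z.re • (1 : ℂ) + z.im • Complex.I := by simp
  conv_lhs => rw [hz]
  rw [map_add, map_smul, map_smul, smul_eq_mul, smul_eq_mul]

/-- The vectors z and iz are orthogonal of length |z|, so both sides compute the inner product, on
the right in the polar frame. -/
theorem normSq_mul_inner_clm (A B : ℂ →L[ℝ] ℝ) (z : ℂ) :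
    Complex.normSq z * (A 1 * B 1 + A Complex.I * B Complex.I)
      = A z * B z + A (Complex.I * z) * B (Complex.I * z) := by
  rw [clm_apply_eq A z, clm_apply_eq B z, clm_apply_eq A (Complex.I * z),
    clm_apply_eq B (Complex.I * z), Complex.normSq_apply]
  simp
  ring

theorem setIntegral_closedBall_eq {F : ℝ → ℂ → ℝ} {M : ℝ}
    (h0 : ∀ τ z, M < ‖z‖ → F τ z = 0) (τ : ℝ) :
    ∫ z in closedBall (0 : ℂ) M, F τ z = ∫ z, F τ z := by
  refine setIntegral_eq_integral_of_forall_compl_eq_zero fun z hz => h0 τ z ?_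
  simpa using hz

theorem continuous_integral_slice {F : ℝ → ℂ → ℝ}
    (hF : Continuous (Function.uncurry F)) {M : ℝ} (h0 : ∀ τ z, M < ‖z‖ → F τ z = 0) :
    Continuous fun τ => ∫ z, F τ z := by
  have := continuous_parametric_integral_of_continuous (μ := (volume : Measure ℂ)) hF
    (isCompact_closedBall (0 : ℂ) M)
  simpa only [setIntegral_closedBall_eq h0] using this

theorem intervalIntegral_integral_swap_of_support {F : ℝ → ℂ → ℝ}
    (hF : Continuous (Function.uncurry F)) {M : ℝ} (h0 : ∀ τ z, M < ‖z‖ → F τ z = 0)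
    (a b : ℝ) :
    ∫ τ in a..b, ∫ z, F τ z = ∫ z, ∫ τ in a..b, F τ z := by
  refine intervalIntegral_integral_swap ?_
  have hc : IntegrableOn (Function.uncurry F) (uIcc a b ×ˢ closedBall (0 : ℂ) M)
      (volume.prod volume) :=
    hF.continuousOn.integrableOn_compact (isCompact_uIcc.prod (isCompact_closedBall _ _))
  have h1 : IntegrableOn (Function.uncurry F) (uIoc a b ×ˢ (univ : Set ℂ))
      (volume.prod volume) := by
    refine IntegrableOn.of_forall_sdiff_eq_zero
      (s := uIoc a b ×ˢ closedBall (0 : ℂ) M) ?_ ?_ ?_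
    · exact hc.mono_set (prod_mono uIoc_subset_uIcc le_rfl)
    · exact measurableSet_uIoc.prod MeasurableSet.univ
    · rintro ⟨τ, z⟩ ⟨⟨h1, -⟩, h2⟩
      refine h0 τ z ?_
      by_contra h
      exact h2 ⟨h1, by simpa using h⟩
  rw [IntegrableOn, ← Measure.prod_restrict, Measure.restrict_univ] at h1
  exact h1

theorem hasFDerivAt_normSq (z : ℂ) : HasFDerivAt (fun z : ℂ => Complex.normSq z)
    ((2 * z.re) • Complex.reCLM + (2 * z.im) • Complex.imCLM) z := by
  have h1 := (Complex.reCLM.hasFDerivAt (x := z)).mul (Complex.reCLM.hasFDerivAt (x := z))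
  have h2 := (Complex.imCLM.hasFDerivAt (x := z)).mul (Complex.imCLM.hasFDerivAt (x := z))
  refine ((h1.add h2).congr_fderiv ?_).congr_of_eventuallyEq
    (Eventually.of_forall fun w => ?_)
  · ext v
    all_goals (simp; ring)
  · simp [Complex.normSq_apply]

theorem contDiff_normSq : ContDiff ℝ ∞ (fun z : ℂ => Complex.normSq z) := by
  have h : (fun z : ℂ => Complex.normSq z) = fun z => Complex.reCLM z * Complex.reCLM z
      + Complex.imCLM z * Complex.imCLM z := by
    ext z; simp [Complex.normSq_apply]
  rw [h]
  exact (Complex.reCLM.contDiff.mul Complex.reCLM.contDiff).add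
    (Complex.imCLM.contDiff.mul Complex.imCLM.contDiff)

theorem contDiff_fderiv_apply {u : ℂ → ℝ} (hu : ContDiff ℝ ∞ u) (v : ℂ) :
    ContDiff ℝ ∞ fun z => fderiv ℝ u z v :=
  (hu.fderiv_right (m := ∞) (by norm_cast)).clm_apply contDiff_const

theorem continuous_radD {u : ℂ → ℝ} (hu : ContDiff ℝ ∞ u) : Continuous (radD u) :=
  (hu.continuous_fderiv (by simp)).clm_apply continuous_id

theorem continuous_angD {u : ℂ → ℝ} (hu : ContDiff ℝ ∞ u) : Continuous (angD u) :=
  (hu.continuous_fderiv (by simp)).clm_apply (continuous_const.mul continuous_id)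

theorem continuous_lap {u : ℂ → ℝ} (hu : ContDiff ℝ ∞ u) : Continuous (lap u) :=
  (((contDiff_fderiv_apply hu 1).continuous_fderiv (by simp)).clm_apply continuous_const).add
  (((contDiff_fderiv_apply hu Complex.I).continuous_fderiv (by simp)).clm_apply continuous_const)

theorem exists_forall_fderiv_eq_zero {u : ℂ → ℝ} (hc : HasCompactSupport u) :
    ∃ M : ℝ, ∀ z, M < ‖z‖ → u z = 0 ∧ fderiv ℝ u z = 0 := by
  obtain ⟨M, hM⟩ := hc.isCompact.isBounded.subset_closedBall 0
  refine ⟨M, fun z hz => ?_⟩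
  have hz' : z ∉ tsupport u := fun h => by
    have := hM h
    simp only [mem_closedBall, dist_zero_right] at this
    linarith
  exact ⟨image_eq_zero_of_notMem_tsupport hz', by
    by_contra h
    exact hz' (support_fderiv_subset ℝ h)⟩

theorem integrable_of_continuous_of_forall {h : ℂ → ℝ} (hh : Continuous h) {M : ℝ}
    (h0 : ∀ z, M < ‖z‖ → h z = 0) : Integrable h :=
  hh.integrable_of_hasCompactSupport
    (HasCompactSupport.intro (isCompact_closedBall (0 : ℂ) M) fun z hz => h0 z (by simpa using hz))

/-- Testing the Laplacian of `u` against a radial multiple of `u - u(e^{iτ} ·)`. -/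
theorem integral_energy_rotation_eq {u : ℂ → ℝ} (hu : ContDiff ℝ ∞ u) (hc : HasCompactSupport u)
    {Θ : ℝ → ℝ} (hΘ : ContDiff ℝ ∞ Θ) (τ : ℝ) :
    ∫ z, Θ (Complex.normSq z) * (radD u z ^ 2 + angD u z ^ 2
        - radD u z * radD u (cis τ * z) - angD u z * angD u (cis τ * z))
      = - (∫ z, Complex.normSq z * Θ (Complex.normSq z) * (u z - u (cis τ * z)) * lap u z)
        - 2 * ∫ z, (Θ (Complex.normSq z) + Complex.normSq z * deriv Θ (Complex.normSq z))
          * radD u z * (u z - u (cis τ * z)) := by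
  obtain ⟨M, hM⟩ := exists_forall_fderiv_eq_zero hc
  have hud : Differentiable ℝ u := hu.differentiable (by simp)
  set c := cis τ with hcis
  have hcn : ∀ z, ‖c * z‖ = ‖z‖ := norm_cis_mul τ
  set w : ℂ → ℝ := fun z => u z - u (c * z) with hw
  have hwd : ContDiff ℝ ∞ w := hu.sub (hu.comp (contDiff_const.mul contDiff_id))
  have hw0 : ∀ z, M < ‖z‖ → w z = 0 := fun z hz => by
    simp only [hw]
    rw [(hM z hz).1, (hM (c * z) (by rwa [hcn])).1, sub_zero]
  -- The test function is φ w. As φ is radial, its gradient at z is 2 Ψ(z) z, where Ψ is the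
  -- derivative of ρ ↦ ρ Θ(ρ) at ρ = |z|²; this brings in the radial derivative of u.
  set φ : ℂ → ℝ := fun z => Complex.normSq z * Θ (Complex.normSq z) with hφ
  have hφd : ContDiff ℝ ∞ φ := contDiff_normSq.mul (hΘ.comp contDiff_normSq)
  set Ψ : ℂ → ℝ := fun z => Θ (Complex.normSq z) + Complex.normSq z * deriv Θ (Complex.normSq z)
    with hΨ
  have hNc : Continuous fun z : ℂ => Complex.normSq z := contDiff_normSq.continuous
  have hΨc : Continuous Ψ := (hΘ.continuous.comp hNc).add
    (hNc.mul ((hΘ.continuous_deriv (by norm_cast)).comp hNc))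
  have hφf : ∀ z v, fderiv ℝ φ z v = Ψ z * (2 * z.re * v.re + 2 * z.im * v.im) := by
    intro z v
    have h1 := hasFDerivAt_normSq z
    have h2 : HasFDerivAt (fun z : ℂ => Θ (Complex.normSq z)) _ z :=
      (hΘ.differentiable (by simp) (Complex.normSq z)).hasDerivAt.comp_hasFDerivAt z h1
    have h3 : HasFDerivAt φ _ z := h1.mul h2
    rw [h3.fderiv]
    simp [hΨ]
    ring
  have hwf : ∀ z v, fderiv ℝ w z v = fderiv ℝ u z v - fderiv ℝ u (c * z) (c * v) := by
    intro z v
    have hcd : Differentiable ℝ fun z => u (c * z) :=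
      hud.comp (differentiable_const _ |>.mul differentiable_id)
    rw [hw, fderiv_fun_sub (hud z) (hcd z), sub_apply,
      fderiv_comp_mul_left hud]
  have hφw : ContDiff ℝ ∞ fun z => φ z * w z := hφd.mul hwd
  have hφwf : ∀ z v, fderiv ℝ (fun z => φ z * w z) z v
      = φ z * fderiv ℝ w z v + w z * fderiv ℝ φ z v := by
    intro z v
    rw [fderiv_fun_mul (hφd.differentiable (by simp) z) (hwd.differentiable (by simp) z)]
    simp
  have ibp : ∀ v, ∫ z, φ z * w z * fderiv ℝ (fun z => fderiv ℝ u z v) z v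
      = - ∫ z, (φ z * fderiv ℝ w z v + w z * fderiv ℝ φ z v) * fderiv ℝ u z v := by
    intro v
    have hg := contDiff_fderiv_apply hu v
    have hgc : Continuous fun z => fderiv ℝ (fun z => fderiv ℝ u z v) z v :=
      (hg.continuous_fderiv (by simp)).clm_apply continuous_const
    have := integral_mul_fderiv_eq_neg_fderiv_mul_of_integrable (μ := (volume : Measure ℂ))
      (f := fun z => φ z * w z) (g := fun z => fderiv ℝ u z v) (v := v)
      (integrable_of_continuous_of_forall (M := M)
        (((hφw.continuous_fderiv (by simp)).clm_apply continuous_const).mul hg.continuous)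
        fun z hz => by rw [(hM z hz).2]; simp)
      (integrable_of_continuous_of_forall (M := M) (hφw.continuous.mul hgc)
        fun z hz => by rw [hw0 z hz]; simp)
      (integrable_of_continuous_of_forall (M := M) (hφw.continuous.mul hg.continuous)
        fun z hz => by rw [hw0 z hz]; simp)
      (fun z _ => hφw.differentiable (by simp) z) (fun z _ => hg.differentiable (by simp) z)
    rw [this]
    simp only [hφwf]
  have hi : ∀ v, Integrable fun z =>
      (φ z * fderiv ℝ w z v + w z * fderiv ℝ φ z v) * fderiv ℝ u z v := by
    intro v
    refine integrable_of_continuous_of_forall (M := M) ?_ fun z hz => by rw [(hM z hz).2]; simp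
    exact ((hφd.continuous.mul ((hwd.continuous_fderiv (by simp)).clm_apply continuous_const)).add
      (hwd.continuous.mul ((hφd.continuous_fderiv (by simp)).clm_apply continuous_const))).mul
      (contDiff_fderiv_apply hu v).continuous
  have hl : ∀ v, Integrable fun z => φ z * w z * fderiv ℝ (fun z => fderiv ℝ u z v) z v := by
    intro v
    refine integrable_of_continuous_of_forall (M := M) ?_ fun z hz => by rw [hw0 z hz]; simp
    exact hφw.continuous.mul
      (((contDiff_fderiv_apply hu v).continuous_fderiv (by simp)).clm_apply continuous_const)
  have hsum : ∫ z, φ z * w z * lap u z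
      = - ∫ z, (Θ (Complex.normSq z) * (radD u z ^ 2 + angD u z ^ 2
        - radD u z * radD u (c * z) - angD u z * angD u (c * z))
        + 2 * (Ψ z * radD u z * w z)) := by
    simp only [lap, mul_add]
    rw [integral_add (hl 1) (hl Complex.I), ibp, ibp, ← neg_add, ← integral_add (hi 1)
      (hi Complex.I)]
    congr 1
    refine integral_congr_ae (Eventually.of_forall fun z => ?_)
    have e1 := normSq_mul_inner_clm (fderiv ℝ u z) (fderiv ℝ u z) z
    have e2 := normSq_mul_inner_clm (fderiv ℝ u z)
      ((fderiv ℝ u (c * z)).comp (ContinuousLinearMap.mul ℝ ℂ c)) z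
    have e3 := clm_apply_eq (fderiv ℝ u z) z
    simp only [ContinuousLinearMap.comp_apply, ContinuousLinearMap.mul_apply', mul_one] at e2
    have e4 : c * (Complex.I * z) = Complex.I * (c * z) := by ring
    rw [e4] at e2
    simp only [hwf, hφf, radD, angD]
    simp only [hφ, Complex.one_re, Complex.one_im, Complex.I_re, Complex.I_im, mul_one]
    rw [e3] at e1 e2 ⊢
    linear_combination Θ (Complex.normSq z) * (e1 - e2)
  have hr : Continuous fun z => radD u (c * z) :=
    (continuous_radD hu).comp (continuous_const.mul continuous_id)
  have ha : Continuous fun z => angD u (c * z) :=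
    (continuous_angD hu).comp (continuous_const.mul continuous_id)
  have hr0 : ∀ z, M < ‖z‖ → radD u z = 0 := fun z hz => by rw [radD, (hM z hz).2]; simp
  have ha0 : ∀ z, M < ‖z‖ → angD u z = 0 := fun z hz => by rw [angD, (hM z hz).2]; simp
  rw [integral_add, integral_const_mul] at hsum
  · linarith
  · refine integrable_of_continuous_of_forall (M := M) ?_ fun z hz => by
      rw [hr0 z hz, ha0 z hz]; simp
    exact (hΘ.continuous.comp hNc).mul (((((continuous_radD hu).pow 2).add
      ((continuous_angD hu).pow 2)).sub ((continuous_radD hu).mul hr)).sub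
      ((continuous_angD hu).mul ha))
  · refine integrable_of_continuous_of_forall (M := M) ?_ fun z hz => by
      rw [hr0 z hz]; simp
    exact continuous_const.mul ((hΨc.mul (continuous_radD hu)).mul hwd.continuous)

/-- Averaged energy inequality: the angular part of the energy is controlled by the derivative of
the weight and by the Laplacian. -/
theorem integral_angD_sq_le {u : ℂ → ℝ} (hu : ContDiff ℝ ∞ u) (hc : HasCompactSupport u)
    {Θ : ℝ → ℝ} (hΘ : ContDiff ℝ ∞ Θ) (hΘ0 : ∀ x, 0 ≤ Θ x) {B : ℝ}
    (hB : ∀ τ ∈ Icc 0 (2 * Real.pi), ∫ z, Complex.normSq z * Θ (Complex.normSq z)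
      * (|lap u z| * |u z - u (cis τ * z)|) ≤ B) :
    ∫ z, Θ (Complex.normSq z) * angD u z ^ 2
      ≤ (∫ z, |Θ (Complex.normSq z) + Complex.normSq z * deriv Θ (Complex.normSq z)|
        * (radD u z ^ 2 + angD u z ^ 2)) + B := by
  obtain ⟨M, hM⟩ := exists_forall_fderiv_eq_zero hc
  have hud : Differentiable ℝ u := hu.differentiable (by simp)
  have hNc : Continuous fun z : ℂ => Complex.normSq z := contDiff_normSq.continuous
  have hN0 : ∀ z : ℂ, 0 ≤ Complex.normSq z := Complex.normSq_nonneg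
  set θ : ℂ → ℝ := fun z => Θ (Complex.normSq z) with hθ
  have hθc : Continuous θ := hΘ.continuous.comp hNc
  have hθ0 : ∀ z, 0 ≤ θ z := fun z => hΘ0 _
  set Ψ : ℂ → ℝ := fun z => Θ (Complex.normSq z) + Complex.normSq z * deriv Θ (Complex.normSq z)
    with hΨ
  have hΨc : Continuous Ψ := hθc.add (hNc.mul ((hΘ.continuous_deriv (by norm_cast)).comp hNc))
  have hθr : ∀ τ z, θ (cis τ * z) = θ z := fun τ z => by simp only [hθ, normSq_cis_mul]
  have hΨr : ∀ τ z, Ψ (cis τ * z) = Ψ z := fun τ z => by simp only [hΨ, normSq_cis_mul]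
  have hE := continuous_radD hu
  have hW := continuous_angD hu
  have hE0 : ∀ z, M < ‖z‖ → radD u z = 0 := fun z hz => by rw [radD, (hM z hz).2]; simp
  have hW0 : ∀ z, M < ‖z‖ → angD u z = 0 := fun z hz => by rw [angD, (hM z hz).2]; simp
  have hu0 : ∀ z, M < ‖z‖ → u z = 0 := fun z hz => (hM z hz).1
  have hrot : ∀ τ, Continuous fun z : ℂ => cis τ * z := fun τ => continuous_const.mul continuous_id
  have hrot2 : Continuous fun q : ℝ × ℂ => cis q.1 * q.2 :=
    (continuous_cis.comp continuous_fst).mul continuous_snd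
  have hpi : (0 : ℝ) < 2 * Real.pi := by positivity
  have int : ∀ {h : ℂ → ℝ}, Continuous h → (∀ z, M < ‖z‖ → h z = 0) → Integrable h :=
    fun h1 h2 => integrable_of_continuous_of_forall h1 h2
  set a : ℝ → ℝ := fun τ => ∫ z, θ z * angD u z * angD u (cis τ * z) with ha
  set b : ℝ → ℝ := fun τ => ∫ z, Ψ z * radD u z * (u z - u (cis τ * z)) with hb
  have hacont : Continuous (Function.uncurry fun (τ : ℝ) (z : ℂ) =>
      θ z * angD u z * angD u (cis τ * z)) :=
    ((hθc.comp continuous_snd).mul (hW.comp continuous_snd)).mul (hW.comp hrot2)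
  have ha00 : ∀ (τ : ℝ) (z : ℂ), M < ‖z‖ → θ z * angD u z * angD u (cis τ * z) = 0 :=
    fun τ z hz => by rw [hW0 z hz]; simp
  have hbcont : Continuous (Function.uncurry fun (τ : ℝ) (z : ℂ) =>
      Ψ z * radD u z * (u z - u (cis τ * z))) :=
    ((hΨc.comp continuous_snd).mul (hE.comp continuous_snd)).mul
      ((hu.continuous.comp continuous_snd).sub (hu.continuous.comp hrot2))
  have hb00 : ∀ (τ : ℝ) (z : ℂ), M < ‖z‖ → Ψ z * radD u z * (u z - u (cis τ * z)) = 0 :=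
    fun τ z hz => by rw [hE0 z hz]; simp
  -- The mixed radial term is at most the radial energy, by 2xy ≤ x² + y² and rotation invariance.
  -- The radial energies therefore cancel and only the angular one remains on the left.
  have step : ∀ τ ∈ Icc 0 (2 * Real.pi), ∫ z, θ z * angD u z ^ 2 ≤ a τ - 2 * b τ + B := by
    intro τ hτ
    have h1 := integral_energy_rotation_eq hu hc hΘ τ
    have iE : Integrable fun z => θ z * radD u z ^ 2 :=
      int (hθc.mul (hE.pow 2)) fun z hz => by rw [hE0 z hz]; simp
    have iW : Integrable fun z => θ z * angD u z ^ 2 :=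
      int (hθc.mul (hW.pow 2)) fun z hz => by rw [hW0 z hz]; simp
    have iEr : Integrable fun z => θ z * radD u (cis τ * z) ^ 2 :=
      int (hθc.mul ((hE.comp (hrot τ)).pow 2)) fun z hz => by
        rw [hE0 (cis τ * z) (by rwa [norm_cis_mul])]; simp
    have iEE : Integrable fun z => θ z * radD u z * radD u (cis τ * z) :=
      int ((hθc.mul hE).mul (hE.comp (hrot τ))) fun z hz => by rw [hE0 z hz]; simp
    have iWW : Integrable fun z => θ z * angD u z * angD u (cis τ * z) :=
      int ((hθc.mul hW).mul (hW.comp (hrot τ))) fun z hz => by rw [hW0 z hz]; simp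
    have h2 : ∫ z, θ z * (radD u z ^ 2 + angD u z ^ 2
        - radD u z * radD u (cis τ * z) - angD u z * angD u (cis τ * z))
        = (∫ z, θ z * radD u z ^ 2) + (∫ z, θ z * angD u z ^ 2)
          - (∫ z, θ z * radD u z * radD u (cis τ * z)) - a τ := by
      have iEW : Integrable fun z => θ z * radD u z ^ 2 + θ z * angD u z ^ 2 := iE.add iW
      have iEWE : Integrable fun z => θ z * radD u z ^ 2 + θ z * angD u z ^ 2
        - θ z * radD u z * radD u (cis τ * z) := iEW.sub iEE
      rw [ha, ← integral_add iE iW, ← integral_sub iEW iEE, ← integral_sub iEWE iWW]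
      refine integral_congr_ae (Eventually.of_forall fun z => ?_)
      ring
    have h3 : ∫ z, θ z * radD u (cis τ * z) ^ 2 = ∫ z, θ z * radD u z ^ 2 := by
      rw [← integral_cis_mul τ fun z => θ z * radD u z ^ 2]
      simp only [hθr]
    have h4 : ∫ z, θ z * radD u z * radD u (cis τ * z) ≤ ∫ z, θ z * radD u z ^ 2 := by
      have : ∫ z, θ z * radD u z * radD u (cis τ * z)
          ≤ ∫ z, (θ z * radD u z ^ 2 + θ z * radD u (cis τ * z) ^ 2) / 2 := by
        refine integral_mono iEE ((iE.add iEr).div_const 2) fun z => ?_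
        simp only
        nlinarith [mul_nonneg (hθ0 z) (sq_nonneg (radD u z - radD u (cis τ * z)))]
      rw [integral_div, integral_add iE iEr, h3] at this
      linarith
    have h5 : - (∫ z, Complex.normSq z * θ z * (u z - u (cis τ * z)) * lap u z) ≤ B := by
      refine le_trans ?_ (hB τ hτ)
      rw [← integral_neg]
      have hlc := continuous_lap hu
      have hwc : Continuous fun z => u z - u (cis τ * z) :=
        hu.continuous.sub (hu.continuous.comp (hrot τ))
      have hw0 : ∀ z, M < ‖z‖ → u z - u (cis τ * z) = 0 := fun z hz => by
        rw [hu0 z hz, hu0 (cis τ * z) (by rwa [norm_cis_mul]), sub_zero]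
      refine integral_mono (int (((hNc.mul hθc).mul hwc).mul hlc).neg fun z hz => by
        rw [hw0 z hz]; simp) (int ((hNc.mul hθc).mul (hlc.abs.mul hwc.abs)) fun z hz => by
        rw [hw0 z hz]; simp) fun z => ?_
      have h6 := neg_abs_le ((u z - u (cis τ * z)) * lap u z)
      rw [abs_mul] at h6
      have h7 := mul_nonneg (hN0 z) (hθ0 z)
      simp only
      nlinarith
    rw [h2] at h1
    linarith
  have hac : Continuous a := continuous_integral_slice hacont ha00
  have hbc : Continuous b := continuous_integral_slice hbcont hb00
  -- Averaging over τ replaces the rotated function by the circular mean of u, and d is the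
  -- deviation from that mean.
  set d : ℂ → ℝ := fun z => u z - (2 * Real.pi)⁻¹ * ∫ τ in (0 : ℝ)..2 * Real.pi, u (cis τ * z)
    with hd
  have hdc : Continuous d := hu.continuous.sub (continuous_const.mul
    (intervalIntegral.continuous_parametric_intervalIntegral_of_continuous'
      (f := fun (z : ℂ) (τ : ℝ) => u (cis τ * z))
      (hu.continuous.comp (hrot2.comp continuous_swap)) 0 (2 * Real.pi)))
  have hd0 : ∀ z, M < ‖z‖ → d z = 0 := fun z hz => by
    have : ∀ τ, u (cis τ * z) = 0 := fun τ => hu0 _ (by rwa [norm_cis_mul])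
    simp only [hd, this, hu0 z hz]
    simp
  have hslice : ∀ z : ℂ, Continuous fun τ : ℝ => cis τ * z := fun z =>
    continuous_cis.mul continuous_const
  have hui : ∀ z : ℂ, IntervalIntegrable (fun τ => u (cis τ * z)) volume 0 (2 * Real.pi) :=
    fun z => (hu.continuous.comp (hslice z)).intervalIntegrable _ _
  -- The mixed angular term averages out: over a full turn the angular derivative integrates to
  -- zero.
  have ha1 : ∫ τ in (0 : ℝ)..2 * Real.pi, a τ = 0 := by
    rw [ha, intervalIntegral_integral_swap_of_support hacont ha00]
    simp only [intervalIntegral.integral_const_mul]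
    have : ∀ z, ∫ τ in (0 : ℝ)..2 * Real.pi, angD u (cis τ * z) = 0 := by
      intro z
      rw [intervalIntegral.integral_eq_sub_of_hasDerivAt
        (fun τ _ => hasDerivAt_comp_cis hud z τ) ((hW.comp (hslice z)).intervalIntegrable _ _)]
      have := cis_add_two_pi 0
      rw [zero_add] at this
      rw [this, sub_self]
    simp [this]
  have hb1 : ∫ τ in (0 : ℝ)..2 * Real.pi, b τ
      = 2 * Real.pi * ∫ z, Ψ z * radD u z * d z := by
    rw [hb, intervalIntegral_integral_swap_of_support hbcont hb00, ← integral_const_mul]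
    refine integral_congr_ae (Eventually.of_forall fun z => ?_)
    simp only [intervalIntegral.integral_const_mul]
    rw [intervalIntegral.integral_sub (continuous_const.intervalIntegrable _ _) (hui z), hd,
      intervalIntegral.integral_const, sub_zero, smul_eq_mul]
    beta_reduce
    generalize (∫ τ in (0 : ℝ)..2 * Real.pi, u (cis τ * z)) = I
    field_simp
  have havg : 2 * Real.pi * ∫ z, θ z * angD u z ^ 2
      ≤ 2 * Real.pi * (-2 * (∫ z, Ψ z * radD u z * d z) + B) := by
    have h1 : ∫ τ in (0 : ℝ)..2 * Real.pi, (∫ z, θ z * angD u z ^ 2)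
        ≤ ∫ τ in (0 : ℝ)..2 * Real.pi, (a τ - 2 * b τ + B) :=
      intervalIntegral.integral_mono_on hpi.le (by simp)
        (((hac.sub (continuous_const.mul hbc)).add continuous_const).intervalIntegrable _ _)
        fun τ hτ => step τ hτ
    have ib : IntervalIntegrable (fun τ => 2 * b τ) volume 0 (2 * Real.pi) :=
      (continuous_const.mul hbc).intervalIntegrable _ _
    have iab : IntervalIntegrable (fun τ => a τ - 2 * b τ) volume 0 (2 * Real.pi) :=
      (hac.intervalIntegrable _ _).sub ib
    rw [intervalIntegral.integral_const, intervalIntegral.integral_add iab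
      (continuous_const.intervalIntegrable _ _),
      intervalIntegral.integral_sub (hac.intervalIntegrable _ _) ib, intervalIntegral.integral_const_mul,
      ha1, hb1, intervalIntegral.integral_const] at h1
    simp only [sub_zero, smul_eq_mul] at h1
    linarith
  have havg' := le_of_mul_le_mul_left havg hpi
  -- Wirtinger on each circle, with constant exactly 1; together with the cross term this leaves |Ψ|
  -- with coefficient 1 before the full energy, and every s < 1 becomes admissible later.
  have hwirt : ∫ z, |Ψ z| * d z ^ 2 ≤ ∫ z, |Ψ z| * angD u z ^ 2 := by
    have hmean : ∀ σ z, d (cis σ * z)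
        = u (cis σ * z) - (2 * Real.pi)⁻¹ * ∫ τ in (0 : ℝ)..2 * Real.pi, u (cis τ * z) := by
      intro σ z
      simp only [hd]
      congr 2
      have hper : Function.Periodic (fun τ => u (cis τ * z)) (2 * Real.pi) := fun τ => by
        simp only [cis_add_two_pi]
      have h1 := hper.intervalIntegral_add_eq σ 0
      rw [zero_add] at h1
      rw [← h1]
      have h2 := intervalIntegral.integral_comp_add_right (a := 0) (b := 2 * Real.pi)
        (fun τ => u (cis τ * z)) σ
      rw [zero_add, add_comm (2 * Real.pi) σ] at h2
      rw [← h2]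
      simp only [cis_add, mul_assoc]
    have hpt : ∀ z, ∫ σ in (0 : ℝ)..2 * Real.pi, d (cis σ * z) ^ 2
        ≤ ∫ σ in (0 : ℝ)..2 * Real.pi, angD u (cis σ * z) ^ 2 := by
      intro z
      refine integral_sq_le_integral_deriv_sq (g := fun σ => d (cis σ * z))
        (g' := fun σ => angD u (cis σ * z)) (fun σ => ?_) (hW.comp (hslice z)) ?_ ?_
      · simp only [hmean]
        exact (hasDerivAt_comp_cis hud z σ).sub_const _
      · have := cis_add_two_pi 0
        rw [zero_add] at this
        simp only [this]
      · simp only [hmean]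
        rw [intervalIntegral.integral_sub (hui z)
          (continuous_const.intervalIntegrable _ _), intervalIntegral.integral_const, sub_zero, smul_eq_mul]
        generalize (∫ τ in (0 : ℝ)..2 * Real.pi, u (cis τ * z)) = I
        field_simp
        ring
    have havgr : ∀ g : ℂ → ℝ, Continuous g → (∀ z, M < ‖z‖ → g z = 0) →
        2 * Real.pi * (∫ z, |Ψ z| * g z)
          = ∫ z, |Ψ z| * ∫ σ in (0 : ℝ)..2 * Real.pi, g (cis σ * z) := by
      intro g hg hg0
      have h1 : ∀ σ, ∫ z, |Ψ z| * g (cis σ * z) = ∫ z, |Ψ z| * g z := fun σ => by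
        rw [← integral_cis_mul σ fun z => |Ψ z| * g z]
        simp only [hΨr]
      have h2 := intervalIntegral_integral_swap_of_support
        (F := fun σ z => |Ψ z| * g (cis σ * z)) (M := M)
        ((hΨc.abs.comp continuous_snd).mul (hg.comp hrot2))
        (fun σ z hz => by rw [hg0 _ (by rwa [norm_cis_mul])]; simp) 0 (2 * Real.pi)
      simp only [h1, intervalIntegral.integral_const_mul, intervalIntegral.integral_const] at h2
      rw [← h2]
      simp
    refine le_of_mul_le_mul_left (a := 2 * Real.pi) ?_ hpi
    rw [havgr (fun z => d z ^ 2) (hdc.pow 2) (fun z hz => by rw [hd0 z hz]; simp),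
      havgr (fun z => angD u z ^ 2) (hW.pow 2) (fun z hz => by rw [hW0 z hz]; simp)]
    have hcont : ∀ g : ℂ → ℝ, Continuous g → Continuous fun z =>
        ∫ σ in (0 : ℝ)..2 * Real.pi, g (cis σ * z) := fun g hg =>
      intervalIntegral.continuous_parametric_intervalIntegral_of_continuous'
        (f := fun (z : ℂ) (τ : ℝ) => g (cis τ * z))
        (hg.comp (hrot2.comp continuous_swap)) 0 (2 * Real.pi)
    refine integral_mono (int (hΨc.abs.mul (hcont _ (hdc.pow 2))) fun z hz => ?_)
      (int (hΨc.abs.mul (hcont _ (hW.pow 2))) fun z hz => ?_) fun z =>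
      mul_le_mul_of_nonneg_left (hpt z) (abs_nonneg _)
    · have : ∀ σ, d (cis σ * z) = 0 := fun σ => hd0 _ (by rwa [norm_cis_mul])
      simp [this]
    · have : ∀ σ, angD u (cis σ * z) = 0 := fun σ => hW0 _ (by rwa [norm_cis_mul])
      simp [this]
  have iE : Integrable fun z => |Ψ z| * radD u z ^ 2 :=
    int (hΨc.abs.mul (hE.pow 2)) fun z hz => by rw [hE0 z hz]; simp
  have iW : Integrable fun z => |Ψ z| * angD u z ^ 2 :=
    int (hΨc.abs.mul (hW.pow 2)) fun z hz => by rw [hW0 z hz]; simp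
  have id' : Integrable fun z => |Ψ z| * d z ^ 2 :=
    int (hΨc.abs.mul (hdc.pow 2)) fun z hz => by rw [hd0 z hz]; simp
  have hcross : -2 * (∫ z, Ψ z * radD u z * d z)
      ≤ (∫ z, |Ψ z| * radD u z ^ 2) + ∫ z, |Ψ z| * d z ^ 2 := by
    rw [← integral_const_mul, ← integral_add iE id']
    refine integral_mono (int (continuous_const.mul ((hΨc.mul hE).mul hdc)) fun z hz => by
      rw [hE0 z hz]; simp) (iE.add id') fun z => ?_
    simp only
    rcases abs_cases (Ψ z) with ⟨h, h'⟩ | ⟨h, h'⟩ <;> rw [h]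
    · nlinarith [mul_nonneg h' (sq_nonneg (radD u z + d z))]
    · nlinarith [mul_nonneg (neg_nonneg.2 h'.le) (sq_nonneg (radD u z - d z))]
  have hfin : ∫ z, |Ψ z| * (radD u z ^ 2 + angD u z ^ 2)
      = (∫ z, |Ψ z| * radD u z ^ 2) + ∫ z, |Ψ z| * angD u z ^ 2 := by
    rw [← integral_add iE iW]
    simp only [mul_add]
  rw [hfin]
  linarith

/-! ### Dyadic annuli and scale-invariant estimates. -/

/-- The annulus `r ≤ |z| < 2r`. -/
def ann (r : ℝ) : Set ℂ := {z | r ≤ ‖z‖ ∧ ‖z‖ < 2 * r}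

/-- The annulus `r/2 ≤ |z| < 4r`. -/
def annW (r : ℝ) : Set ℂ := {z | r / 2 ≤ ‖z‖ ∧ ‖z‖ < 4 * r}

theorem measurableSet_ann (r : ℝ) : MeasurableSet (ann r) :=
  (measurableSet_le measurable_const measurable_norm).inter
    (measurableSet_lt measurable_norm measurable_const)

theorem measurableSet_annW (r : ℝ) : MeasurableSet (annW r) :=
  (measurableSet_le measurable_const measurable_norm).inter
    (measurableSet_lt measurable_norm measurable_const)

theorem ann_subset_annW {r : ℝ} (hr : 0 < r) : ann r ⊆ annW r := fun z hz =>
  ⟨by linarith [hz.1], by linarith [hz.2]⟩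

theorem cis_mul_mem_annW {τ r : ℝ} {z : ℂ} : cis τ * z ∈ annW r ↔ z ∈ annW r := by
  simp only [annW, mem_ofPred_eq, norm_cis_mul]

/-- All cutoffs are dilates of one function, hence the constant independent of r. The support bounds
3/4 and 3 lie strictly between those of `ann` and `annW`. -/
theorem exists_annCutoff : ∃ (C : ℝ), 0 ≤ C ∧ ∀ r : ℝ, 0 < r → ∃ ζ : ℂ → ℝ, ContDiff ℝ ∞ ζ ∧
    (∀ z, 0 ≤ ζ z ∧ ζ z ≤ 1) ∧ (∀ z ∈ ann r, ζ z = 1) ∧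
    tsupport ζ ⊆ {z | r * (3 / 4) ≤ ‖z‖ ∧ ‖z‖ ≤ 3 * r} ∧ ∀ z, ‖fderiv ℝ ζ z‖ ≤ C / r := by
  set S := Real.smoothTransition with hS
  set ζ : ℂ → ℝ := fun z => S ((Complex.normSq z - 9 / 16) / (7 / 16))
    * S ((9 - Complex.normSq z) / 5) with hζ
  have hsm : ContDiff ℝ ∞ ζ := by
    have hSc : ContDiff ℝ ∞ S := Real.smoothTransition.contDiff (n := ⊤)
    exact (hSc.comp ((contDiff_normSq.sub contDiff_const).div_const _)).mul
      (hSc.comp ((contDiff_const.sub contDiff_normSq).div_const _))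
  have h01 : ∀ z, 0 ≤ ζ z ∧ ζ z ≤ 1 := fun z =>
    ⟨mul_nonneg (Real.smoothTransition.nonneg _) (Real.smoothTransition.nonneg _),
      mul_le_one₀ (Real.smoothTransition.le_one _) (Real.smoothTransition.nonneg _)
        (Real.smoothTransition.le_one _)⟩
  have h1 : ∀ z : ℂ, 1 ≤ ‖z‖ → ‖z‖ ≤ 2 → ζ z = 1 := fun z hz hz' => by
    simp only [hζ, Complex.normSq_eq_norm_sq]
    rw [hS, Real.smoothTransition.one_of_one_le (by rw [le_div_iff₀ (by norm_num)]; nlinarith),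
      Real.smoothTransition.one_of_one_le (by rw [le_div_iff₀ (by norm_num)]; nlinarith), one_mul]
  have h0 : ∀ z : ℂ, ζ z ≠ 0 → 3 / 4 ≤ ‖z‖ ∧ ‖z‖ ≤ 3 := fun z hz => by
    by_contra h
    apply hz
    simp only [hζ, Complex.normSq_eq_norm_sq]
    rw [not_and_or, not_le, not_le] at h
    have := norm_nonneg z
    rcases h with h | h
    · rw [hS, Real.smoothTransition.zero_of_nonpos
        (div_nonpos_of_nonpos_of_nonneg (by nlinarith) (by norm_num)), zero_mul]
    · rw [hS, mul_comm, Real.smoothTransition.zero_of_nonpos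
        (div_nonpos_of_nonpos_of_nonneg (by nlinarith) (by norm_num)), zero_mul]
  have hcs : HasCompactSupport ζ := by
    refine HasCompactSupport.intro (isCompact_closedBall (0 : ℂ) 3) fun z hz => ?_
    by_contra h
    exact hz (by simpa using (h0 z h).2)
  obtain ⟨C, hC⟩ := (hcs.fderiv ℝ).exists_bound_of_continuous (hsm.continuous_fderiv (by simp))
  refine ⟨C, (norm_nonneg _).trans (hC 0), fun r hr => ⟨fun z => ζ ((r⁻¹ : ℝ) * z), ?_, ?_, ?_, ?_,
    ?_⟩⟩
  · exact hsm.comp (contDiff_const.mul contDiff_id)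
  · exact fun z => h01 _
  · intro z hz
    have hn : ‖((r⁻¹ : ℝ) : ℂ) * z‖ = ‖z‖ / r := by
      rw [norm_mul, Complex.norm_real, Real.norm_of_nonneg (by positivity)]; ring
    refine h1 _ ?_ ?_ <;> rw [hn]
    · rw [le_div_iff₀ hr]; linarith [hz.1]
    · rw [div_le_iff₀ hr]; exact hz.2.le
  · refine closure_minimal (fun z hz => ?_) ?_
    · have hn : ‖((r⁻¹ : ℝ) : ℂ) * z‖ = ‖z‖ / r := by
        rw [norm_mul, Complex.norm_real, Real.norm_of_nonneg (by positivity)]; ring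
      obtain ⟨h2, h3⟩ := h0 _ hz
      rw [hn] at h2 h3
      rw [le_div_iff₀ hr] at h2
      rw [div_le_iff₀ hr] at h3
      exact ⟨by linarith, h3⟩
    · exact (isClosed_le continuous_const continuous_norm).inter
        (isClosed_le continuous_norm continuous_const)
  · intro z
    refine ContinuousLinearMap.opNorm_le_bound _ (div_nonneg ((norm_nonneg _).trans (hC 0)) hr.le)
      fun v => ?_
    rw [fderiv_comp_mul_left (hsm.differentiable (by simp))]
    refine (ContinuousLinearMap.le_opNorm _ _).trans ?_
    rw [norm_mul, Complex.norm_real, Real.norm_of_nonneg (by positivity)]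
    calc _ ≤ C * (r⁻¹ * ‖v‖) := by gcongr; exact hC _
      _ = C / r * ‖v‖ := by ring

theorem lintegral_sq_le_mul_lintegral_sq {α : Type*} [MeasurableSpace α] {μ : Measure α}
    {f : α → ℝ≥0∞} (hf : AEMeasurable f μ) :
    (∫⁻ a, f a ∂μ) ^ (2 : ℝ) ≤ μ univ * ∫⁻ a, f a ^ (2 : ℝ) ∂μ := by
  have h := ENNReal.lintegral_mul_le_Lp_mul_Lq μ Real.HolderConjugate.two_two hf
    (aemeasurable_const (b := (1 : ℝ≥0∞)))
  simp only [Pi.mul_apply, mul_one, ENNReal.one_rpow, lintegral_const, one_mul] at h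
  refine (ENNReal.rpow_le_rpow h (by norm_num : (0:ℝ) ≤ 2)).trans (le_of_eq ?_)
  rw [ENNReal.mul_rpow_of_nonneg _ _ (by norm_num), ← ENNReal.rpow_mul, ← ENNReal.rpow_mul]
  norm_num
  rw [mul_comm]

/-- Up to sign the difference is the integral of the angular derivative over an angle of at most 2π;
Cauchy–Schwarz and the rotation invariance of the annulus do the rest. This plays the role of a
Poincaré inequality. -/
theorem eLpNorm_sub_rot_le {u : ℂ → ℝ} (hu : ContDiff ℝ ∞ u) {τ : ℝ}
    (hτ : τ ∈ Icc 0 (2 * Real.pi)) (r : ℝ) :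
    eLpNorm (fun z => u z - u (cis τ * z)) 2 (volume.restrict (annW r))
      ≤ ENNReal.ofReal (2 * Real.pi) * eLpNorm (angD u) 2 (volume.restrict (annW r)) := by
  have hpi : (0 : ℝ) < 2 * Real.pi := by positivity
  have hW := continuous_angD hu
  have hrot2 : Continuous fun q : ℂ × ℝ => cis q.2 * q.1 :=
    (continuous_cis.comp continuous_snd).mul continuous_fst
  set ν : Measure ℝ := volume.restrict (Ioc 0 (2 * Real.pi)) with hν
  have hν1 : ν univ = ENNReal.ofReal (2 * Real.pi) := by simp [hν]
  have hpt : ∀ z, ‖u z - u (cis τ * z)‖ₑ ^ (2 : ℝ)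
      ≤ ENNReal.ofReal (2 * Real.pi) * ∫⁻ σ, ‖angD u (cis σ * z)‖ₑ ^ (2 : ℝ) ∂ν := by
    intro z
    have hWc : Continuous fun σ => angD u (cis σ * z) :=
      hW.comp (continuous_cis.mul continuous_const)
    have h1 := intervalIntegral.integral_eq_sub_of_hasDerivAt (a := 0) (b := τ)
      (fun σ _ => hasDerivAt_comp_cis (hu.differentiable (by simp)) z σ)
      (hWc.intervalIntegrable _ _)
    rw [cis_zero, one_mul] at h1
    have h2 : ‖u z - u (cis τ * z)‖ₑ ≤ ∫⁻ σ, ‖angD u (cis σ * z)‖ₑ ∂ν := by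
      rw [← enorm_neg, neg_sub, ← h1, intervalIntegral.integral_of_le hτ.1]
      refine (enorm_integral_le_lintegral_enorm _).trans ?_
      exact lintegral_mono_set (Ioc_subset_Ioc_right hτ.2)
    rw [← hν1]
    exact (ENNReal.rpow_le_rpow h2 (by norm_num)).trans
      (lintegral_sq_le_mul_lintegral_sq hWc.enorm.measurable.aemeasurable)
  rw [eLpNorm_eq_lintegral_rpow_enorm_toReal (by norm_num) (by norm_num),
    eLpNorm_eq_lintegral_rpow_enorm_toReal (by norm_num) (by norm_num)]
  simp only [ENNReal.toReal_ofNat]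
  have hs := measurableSet_annW r
  have key : ∫⁻ z in annW r, ‖u z - u (cis τ * z)‖ₑ ^ (2 : ℝ)
      ≤ ENNReal.ofReal (2 * Real.pi) ^ (2 : ℝ) * ∫⁻ z in annW r, ‖angD u z‖ₑ ^ (2 : ℝ) := by
    calc _ ≤ ∫⁻ z in annW r, ENNReal.ofReal (2 * Real.pi)
          * ∫⁻ σ, ‖angD u (cis σ * z)‖ₑ ^ (2 : ℝ) ∂ν := lintegral_mono hpt
      _ = ENNReal.ofReal (2 * Real.pi)
          * ∫⁻ z in annW r, ∫⁻ σ, ‖angD u (cis σ * z)‖ₑ ^ (2 : ℝ) ∂ν :=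
          lintegral_const_mul' _ _ ENNReal.ofReal_ne_top
      _ = ENNReal.ofReal (2 * Real.pi)
          * ∫⁻ σ, (∫⁻ z in annW r, ‖angD u (cis σ * z)‖ₑ ^ (2 : ℝ)) ∂ν := by
          rw [lintegral_lintegral_swap]
          exact ((hW.comp hrot2).enorm.measurable.pow_const _).aemeasurable
      _ = ENNReal.ofReal (2 * Real.pi)
          * ∫⁻ σ, (∫⁻ z in annW r, ‖angD u z‖ₑ ^ (2 : ℝ)) ∂ν := by
          refine congrArg _ (lintegral_congr fun σ => ?_)
          have hp := (measurePreserving_cis_mul σ).restrict_preimage hs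
          have he : (fun z => cis σ * z) ⁻¹' annW r = annW r := by
            ext z; exact cis_mul_mem_annW
          rw [he] at hp
          exact hp.lintegral_comp (f := fun z => ‖angD u z‖ₑ ^ (2 : ℝ))
            (hW.enorm.measurable.pow_const _)
      _ = _ := by
          rw [lintegral_const, hν1, show (2 : ℝ) = 1 + 1 by norm_num,
            ENNReal.rpow_add_of_nonneg _ _ zero_le_one zero_le_one, ENNReal.rpow_one]
          ring
  refine (ENNReal.rpow_le_rpow key (by norm_num)).trans (le_of_eq ?_)
  rw [ENNReal.mul_rpow_of_nonneg _ _ (by norm_num), ← ENNReal.rpow_mul]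
  norm_num

theorem volume_annW_le (r : ℝ) :
    volume (annW r) ≤ ENNReal.ofReal (4 * r) ^ 2 * NNReal.pi := by
  rw [← Complex.volume_ball 0]
  exact measure_mono fun z hz => by simpa using hz.2

set_option maxHeartbeats 800000 in
/-- Scale-invariant Sobolev inequality on annuli for the difference of a function and a rotation
of it. -/
theorem exists_eLpNorm_sub_rot_le {p : ℝ} (hp1 : 1 < p) (hp2 : p < 2) :
    ∃ C : ℝ≥0∞, C ≠ ⊤ ∧ ∀ r : ℝ, 0 < r → ∀ u : ℂ → ℝ, ContDiff ℝ ∞ u →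
      ∀ τ ∈ Icc 0 (2 * Real.pi),
      eLpNorm (fun z => u z - u (cis τ * z)) (ENNReal.ofReal (p / (p - 1)))
        (volume.restrict (ann r))
      ≤ C * ENNReal.ofReal (r ^ (2 - 2 / p))
        * eLpNorm (fderiv ℝ u) 2 (volume.restrict (annW r)) := by
  obtain ⟨C₀, hC₀, hcut⟩ := exists_annCutoff
  have hp0 : 0 < p := by linarith
  -- The exponent whose Sobolev conjugate in the plane is p/(p - 1). As q ≤ 2, Hölder on the annulus
  -- passes to L² at the cost of the area to the power 1/q - 1/2 = 1 - 1/p, which gives r^(2 - 2/p).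
  set q : ℝ := 2 * p / (3 * p - 2) with hq
  have hq3 : 0 < 3 * p - 2 := by linarith
  have hq1 : 1 ≤ q := by rw [hq, le_div_iff₀ hq3]; linarith
  have hq2 : q ≤ 2 := by rw [hq, div_le_iff₀ hq3]; linarith
  have hq0 : 0 < q := by linarith
  have hm0 : 0 < p / (p - 1) := div_pos hp0 (by linarith)
  set K : ℝ≥0 := SNormLESNormFDerivOfEqConst ℝ (volume : Measure ℂ) (Real.toNNReal q) with hK
  set α : ℝ := 1 - 1 / p with hα
  have hα0 : 0 < α := by rw [hα, sub_pos, div_lt_one hp0]; exact hp1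
  have hqα : 1 / q - 1 / 2 = α := by
    rw [hq, hα]
    field_simp
    ring
  -- The 2 stands for the gradients of u and of its rotation. In 8π = 2π · 4, the 4 comes from the
  -- outer radius 4r, which offsets the 1/r of the cutoff.
  set D : ℝ≥0∞ := 2 + ENNReal.ofReal (C₀ * (8 * Real.pi)) with hD
  set G : ℝ≥0∞ := (ENNReal.ofReal 4 ^ 2 * (NNReal.pi : ℝ≥0∞)) ^ α with hG
  refine ⟨K * (D * G), ENNReal.mul_ne_top (by simp) (ENNReal.mul_ne_top (by simp [hD])
    (ENNReal.rpow_ne_top_of_nonneg hα0.le (by finiteness))), fun r hr u hu τ hτ => ?_⟩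
  obtain ⟨ζ, hζs, hζ01, hζ1, hζt, hζd⟩ := hcut r hr
  have hud : Differentiable ℝ u := hu.differentiable (by simp)
  set c := cis τ with hc
  set w : ℂ → ℝ := fun z => u z - u (c * z) with hw
  have hwd : ContDiff ℝ ∞ w := hu.sub (hu.comp (contDiff_const.mul contDiff_id))
  have hts : tsupport ζ ⊆ annW r := fun z hz =>
    ⟨by linarith [(hζt hz).1], by linarith [(hζt hz).2]⟩
  have hζc : HasCompactSupport ζ := by
    refine HasCompactSupport.intro (isCompact_closedBall (0 : ℂ) (3 * r)) fun z hz => ?_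
    refine image_eq_zero_of_notMem_tsupport fun h => hz ?_
    simpa using (hζt h).2
  set g : ℂ → ℝ := fun z => ζ z * w z with hg
  have hgd : ContDiff ℝ ∞ g := hζs.mul hwd
  have hgc : HasCompactSupport g := hζc.mul_right
  have hgns := eLpNorm_le_eLpNorm_fderiv_of_eq (volume : Measure ℂ)
    (hgd.of_le (by norm_cast) : ContDiff ℝ 1 g) hgc (p := Real.toNNReal q)
    (p' := Real.toNNReal (p / (p - 1))) (by simpa using hq1) (by simp) (by
      rw [NNReal.coe_inv, Real.coe_toNNReal _ hq0.le, Real.coe_toNNReal _ hm0.le,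
        Complex.finrank_real_complex, hq]
      have : p - 1 ≠ 0 := by linarith
      push_cast
      field_simp
      ring)
  set μ := (volume : Measure ℂ).restrict (annW r) with hμ
  have hfg : Continuous (fderiv ℝ g) := hgd.continuous_fderiv (by simp)
  have hfsub : Function.support (fderiv ℝ g) ⊆ annW r :=
    ((support_fderiv_subset ℝ).trans (tsupport_mul_subset_left)).trans hts
  have hfu : Continuous (fderiv ℝ u) := hu.continuous_fderiv (by simp)
  have hrotc : Continuous fun z : ℂ => c * z := continuous_const.mul continuous_id
  have hpt : ∀ᵐ z ∂μ, ‖fderiv ℝ g z‖ ≤ ‖fderiv ℝ u z‖ + ‖fderiv ℝ u (c * z)‖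
      + C₀ / r * ‖w z‖ := by
    refine Eventually.of_forall fun z => ?_
    have hcd : Differentiable ℝ fun z => u (c * z) :=
      hud.comp (differentiable_const _ |>.mul differentiable_id)
    rw [hg, fderiv_fun_mul (hζs.differentiable (by simp) z) (hwd.differentiable (by simp) z)]
    refine (norm_add_le _ _).trans (add_le_add ?_ ?_)
    · rw [norm_smul, Real.norm_of_nonneg (hζ01 z).1]
      refine (mul_le_of_le_one_left (norm_nonneg _) (hζ01 z).2).trans ?_
      rw [hw, fderiv_fun_sub (hud z) (hcd z)]
      refine (norm_sub_le _ _).trans (add_le_add le_rfl ?_)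
      refine ContinuousLinearMap.opNorm_le_bound _ (norm_nonneg _) fun v => ?_
      rw [fderiv_comp_mul_left hud]
      refine (ContinuousLinearMap.le_opNorm _ _).trans ?_
      rw [hc, norm_cis_mul]
    · rw [norm_smul, mul_comm]
      exact mul_le_mul_of_nonneg_right (hζd z) (norm_nonneg _)
  have hrotn : eLpNorm (fun z => fderiv ℝ u (c * z)) 2 μ = eLpNorm (fderiv ℝ u) 2 μ := by
    have hp := (measurePreserving_cis_mul τ).restrict_preimage (measurableSet_annW r)
    have he : (fun z => cis τ * z) ⁻¹' annW r = annW r := by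
      ext z; exact cis_mul_mem_annW
    rw [he] at hp
    exact eLpNorm_comp_measurePreserving hfu.aestronglyMeasurable hp
  have hang : eLpNorm (angD u) 2 μ ≤ ENNReal.ofReal (4 * r) * eLpNorm (fderiv ℝ u) 2 μ := by
    refine eLpNorm_le_mul_eLpNorm_of_ae_le_mul ?_ 2
    filter_upwards [ae_restrict_mem (measurableSet_annW r)] with z hz
    refine ((fderiv ℝ u z).le_opNorm _).trans ?_
    rw [norm_mul, Complex.norm_I, one_mul, mul_comm]
    exact mul_le_mul_of_nonneg_right hz.2.le (norm_nonneg _)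
  have hL2 : eLpNorm (fderiv ℝ g) 2 μ ≤ D * eLpNorm (fderiv ℝ u) 2 μ := by
    have m1 : AEStronglyMeasurable (fun z => ‖fderiv ℝ u z‖) μ := hfu.norm.aestronglyMeasurable
    have m2 : AEStronglyMeasurable (fun z => ‖fderiv ℝ u (c * z)‖) μ :=
      (hfu.comp hrotc).norm.aestronglyMeasurable
    have m3 : AEStronglyMeasurable (fun z => C₀ / r * ‖w z‖) μ :=
      (continuous_const.mul hwd.continuous.norm).aestronglyMeasurable
    refine (eLpNorm_mono_ae_real hpt).trans ?_
    refine (eLpNorm_add_le (m1.add m2) m3 one_le_two).trans ?_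
    refine (add_le_add (eLpNorm_add_le m1 m2 one_le_two) le_rfl).trans ?_
    have h3 : eLpNorm (fun z => C₀ / r * ‖w z‖) 2 μ
        ≤ ENNReal.ofReal (C₀ * (8 * Real.pi)) * eLpNorm (fderiv ℝ u) 2 μ := by
      have : (fun z => C₀ / r * ‖w z‖) = (C₀ / r) • fun z => ‖w z‖ := rfl
      rw [this, eLpNorm_const_smul, eLpNorm_norm,
        Real.enorm_of_nonneg (div_nonneg hC₀ hr.le)]
      calc _ ≤ ENNReal.ofReal (C₀ / r) * (ENNReal.ofReal (2 * Real.pi)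
            * (ENNReal.ofReal (4 * r) * eLpNorm (fderiv ℝ u) 2 μ)) :=
            mul_le_mul' le_rfl ((eLpNorm_sub_rot_le hu hτ r).trans (mul_le_mul' le_rfl hang))
        _ = _ := by
            rw [← mul_assoc, ← mul_assoc, ← ENNReal.ofReal_mul (by positivity),
              ← ENNReal.ofReal_mul (by positivity)]
            congr 2
            field_simp
            ring
    rw [eLpNorm_norm, eLpNorm_norm (f := fun z => fderiv ℝ u (c * z)), hrotn, hD, add_mul,
      two_mul]
    exact add_le_add le_rfl h3
  have hfin : eLpNorm (fderiv ℝ g) (ENNReal.ofReal q) volume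
      ≤ D * G * ENNReal.ofReal (r ^ (2 - 2 / p)) * eLpNorm (fderiv ℝ u) 2 μ := by
    have hres : eLpNorm (fun z => ‖fderiv ℝ g z‖) (ENNReal.ofReal q) μ
        = eLpNorm (fun z => ‖fderiv ℝ g z‖) (ENNReal.ofReal q) volume := by
      refine eLpNorm_restrict_eq_of_support_subset fun z hz => hfsub ?_
      rw [Function.mem_support] at hz ⊢
      exact norm_ne_zero_iff.1 hz
    rw [eLpNorm_norm, eLpNorm_norm] at hres
    rw [← hres]
    refine (eLpNorm_le_eLpNorm_mul_rpow_measure_univ (q := 2) (by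
      rw [← ENNReal.ofReal_ofNat]; exact ENNReal.ofReal_le_ofReal hq2)
      hfg.aestronglyMeasurable).trans ?_
    rw [ENNReal.toReal_ofReal hq0.le, ENNReal.toReal_ofNat, hqα, Measure.restrict_apply_univ]
    have hvol : volume (annW r) ^ α ≤ G * ENNReal.ofReal (r ^ (2 - 2 / p)) := by
      refine (ENNReal.rpow_le_rpow (volume_annW_le r) hα0.le).trans (le_of_eq ?_)
      rw [hG, ENNReal.ofReal_mul (by norm_num), mul_pow, mul_right_comm,
        ENNReal.mul_rpow_of_nonneg _ _ hα0.le]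
      congr 1
      rw [← ENNReal.rpow_natCast, ← ENNReal.rpow_mul, ENNReal.ofReal_rpow_of_pos hr]
      congr 2
      rw [hα]
      push_cast
      ring
    calc _ ≤ D * eLpNorm (fderiv ℝ u) 2 μ * (G * ENNReal.ofReal (r ^ (2 - 2 / p))) :=
          mul_le_mul' hL2 hvol
      _ = _ := by ring
  have hstart : eLpNorm w (ENNReal.ofReal (p / (p - 1))) (volume.restrict (ann r))
      ≤ eLpNorm g (ENNReal.ofReal (p / (p - 1))) volume := by
    refine le_trans (le_of_eq (eLpNorm_congr_ae ?_))
      (eLpNorm_mono_measure g Measure.restrict_le_self)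
    filter_upwards [ae_restrict_mem (measurableSet_ann r)] with z hz
    simp only [hg, hζ1 z hz, one_mul]
  refine hstart.trans (hgns.trans ((mul_le_mul' le_rfl hfin).trans (le_of_eq ?_)))
  ring

theorem lintegral_enorm_mul_le_eLpNorm_mul {p : ℝ} (hp1 : 1 < p) {μ : Measure ℂ} {f g : ℂ → ℝ}
    (hf : AEStronglyMeasurable f μ) (hg : AEStronglyMeasurable g μ) :
    ∫⁻ z, ‖f z‖ₑ * ‖g z‖ₑ ∂μ
      ≤ eLpNorm f (ENNReal.ofReal p) μ * eLpNorm g (ENNReal.ofReal (p / (p - 1))) μ := by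
  have hp0 : 0 < p := by linarith
  have hm0 : 0 < p / (p - 1) := div_pos hp0 (by linarith)
  have h := ENNReal.lintegral_mul_le_Lp_mul_Lq μ (Real.HolderConjugate.conjExponent hp1)
    hf.enorm hg.enorm
  rw [eLpNorm_eq_lintegral_rpow_enorm_toReal (by simpa using hp0) ENNReal.ofReal_ne_top,
    eLpNorm_eq_lintegral_rpow_enorm_toReal (by simpa using hm0) ENNReal.ofReal_ne_top,
    ENNReal.toReal_ofReal hp0.le, ENNReal.toReal_ofReal hm0.le]
  exact h

/-- The abstract error bound B of `integral_angD_sq_le` is made concrete: on each dyadic annulus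
Hölder pairs the Laplacian in L^p with the rotation difference in the dual exponent. -/
theorem exists_lintegral_angD_sq_le {p : ℝ} (hp1 : 1 < p) (hp2 : p < 2) :
    ∃ C : ℝ≥0∞, C ≠ ⊤ ∧ ∀ u : ℂ → ℝ, ContDiff ℝ ∞ u → HasCompactSupport u →
      ∀ Θ : ℝ → ℝ, ContDiff ℝ ∞ Θ → (∀ x, 0 ≤ Θ x) → ∀ (J : Finset ℤ) (s : ℤ → ℝ≥0∞),
      (∀ z : ℂ, Θ (Complex.normSq z) ≠ 0 → ∃ j ∈ J, z ∈ ann (2 ^ j)) →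
      (∀ j ∈ J, ∀ z ∈ ann (2 ^ j),
        ENNReal.ofReal (Complex.normSq z * Θ (Complex.normSq z)) ≤ s j) →
      ∫⁻ z, ENNReal.ofReal (Θ (Complex.normSq z)) * ‖angD u z‖ₑ ^ 2
        ≤ (∫⁻ z, ENNReal.ofReal |Θ (Complex.normSq z)
            + Complex.normSq z * deriv Θ (Complex.normSq z)|
            * (‖radD u z‖ₑ ^ 2 + ‖angD u z‖ₑ ^ 2))
          + ∑ j ∈ J, s j * (C * ENNReal.ofReal (((2 : ℝ) ^ j) ^ (2 - 2 / p))
            * eLpNorm (lap u) (ENNReal.ofReal p) (volume.restrict (ann (2 ^ j)))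
            * eLpNorm (fderiv ℝ u) 2 (volume.restrict (annW (2 ^ j)))) := by
  obtain ⟨C, hC, hdiff⟩ := exists_eLpNorm_sub_rot_le hp1 hp2
  refine ⟨C, hC, fun u hu hc Θ hΘ hΘ0 J s hcov hs => ?_⟩
  set T := ∑ j ∈ J, s j * (C * ENNReal.ofReal (((2 : ℝ) ^ j) ^ (2 - 2 / p))
            * eLpNorm (lap u) (ENNReal.ofReal p) (volume.restrict (ann (2 ^ j)))
            * eLpNorm (fderiv ℝ u) 2 (volume.restrict (annW (2 ^ j)))) with hT
  -- The real-valued inequality needs a finite bound; an infinite one leaves nothing to prove.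
  by_cases hTt : T = ⊤
  · rw [hTt]; simp
  have hNc : Continuous fun z : ℂ => Complex.normSq z := contDiff_normSq.continuous
  have hN0 : ∀ z : ℂ, 0 ≤ Complex.normSq z := Complex.normSq_nonneg
  have hθc : Continuous fun z : ℂ => Θ (Complex.normSq z) := hΘ.continuous.comp hNc
  have hE := continuous_radD hu
  have hW := continuous_angD hu
  have hl := continuous_lap hu
  obtain ⟨M, hM⟩ := exists_forall_fderiv_eq_zero hc
  have hE0 : ∀ z, M < ‖z‖ → radD u z = 0 := fun z hz => by rw [radD, (hM z hz).2]; simp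
  have hW0 : ∀ z, M < ‖z‖ → angD u z = 0 := fun z hz => by rw [angD, (hM z hz).2]; simp
  have hB : ∀ τ ∈ Icc 0 (2 * Real.pi), ∫ z, Complex.normSq z * Θ (Complex.normSq z)
      * (|lap u z| * |u z - u (cis τ * z)|) ≤ T.toReal := by
    intro τ hτ
    have hwc : Continuous fun z => u z - u (cis τ * z) :=
      hu.continuous.sub (hu.continuous.comp (continuous_const.mul continuous_id))
    have hFc : Continuous fun z => Complex.normSq z * Θ (Complex.normSq z)
        * (|lap u z| * |u z - u (cis τ * z)|) := (hNc.mul hθc).mul (hl.abs.mul hwc.abs)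
    rw [integral_eq_lintegral_of_nonneg_ae (Eventually.of_forall fun z =>
      mul_nonneg (mul_nonneg (hN0 z) (hΘ0 _)) (mul_nonneg (abs_nonneg _) (abs_nonneg _)))
      hFc.aestronglyMeasurable]
    refine ENNReal.toReal_mono hTt ?_
    have hpt : ∀ z, ENNReal.ofReal (Complex.normSq z * Θ (Complex.normSq z)
        * (|lap u z| * |u z - u (cis τ * z)|))
        ≤ ∑ j ∈ J, (ann (2 ^ j)).indicator
          (fun z => s j * (‖lap u z‖ₑ * ‖u z - u (cis τ * z)‖ₑ)) z := by
      intro z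
      by_cases h0 : Θ (Complex.normSq z) = 0
      · simp [h0]
      obtain ⟨j, hj, hz⟩ := hcov z h0
      refine le_trans ?_ (Finset.single_le_sum (f := fun j => (ann (2 ^ j)).indicator
          (fun z => s j * (‖lap u z‖ₑ * ‖u z - u (cis τ * z)‖ₑ)) z) (fun _ _ => zero_le) hj)
      rw [indicator_of_mem hz, ENNReal.ofReal_mul (mul_nonneg (hN0 z) (hΘ0 _)),
        ENNReal.ofReal_mul (abs_nonneg _)]
      simp only [← Real.norm_eq_abs, ofReal_norm]
      exact mul_le_mul' (hs j hj z hz) le_rfl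
    refine (lintegral_mono hpt).trans ?_
    have hmeas : Measurable fun z => ‖lap u z‖ₑ * ‖u z - u (cis τ * z)‖ₑ :=
      hl.enorm.measurable.mul hwc.enorm.measurable
    rw [lintegral_finsetSum _ fun j _ => (hmeas.const_mul _).indicator (measurableSet_ann _)]
    refine Finset.sum_le_sum fun j hj => ?_
    rw [lintegral_indicator (measurableSet_ann _), lintegral_const_mul _ hmeas]
    refine mul_le_mul' le_rfl ?_
    refine (lintegral_enorm_mul_le_eLpNorm_mul hp1 hl.aestronglyMeasurable
      hwc.aestronglyMeasurable).trans ?_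
    refine (mul_le_mul' le_rfl (hdiff (2 ^ j) (by positivity) u hu τ hτ)).trans (le_of_eq ?_)
    ring
  have hmain := integral_angD_sq_le hu hc hΘ hΘ0 hB
  have hΨc : Continuous fun z : ℂ => |Θ (Complex.normSq z)
      + Complex.normSq z * deriv Θ (Complex.normSq z)| :=
    (hθc.add (hNc.mul ((hΘ.continuous_deriv (by norm_cast)).comp hNc))).abs
  have i1 : Integrable fun z => Θ (Complex.normSq z) * angD u z ^ 2 :=
    integrable_of_continuous_of_forall (M := M) (hθc.mul (hW.pow 2))
      fun z hz => by rw [hW0 z hz]; simp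
  have i2 : Integrable fun z => |Θ (Complex.normSq z)
      + Complex.normSq z * deriv Θ (Complex.normSq z)| * (radD u z ^ 2 + angD u z ^ 2) :=
    integrable_of_continuous_of_forall (M := M) (hΨc.mul ((hE.pow 2).add (hW.pow 2)))
      fun z hz => by rw [hE0 z hz, hW0 z hz]; simp
  have hsq : ∀ x : ℝ, ENNReal.ofReal (x ^ 2) = ‖x‖ₑ ^ 2 := fun x => by
    rw [← sq_abs, ENNReal.ofReal_pow (abs_nonneg _), ← Real.norm_eq_abs, ofReal_norm]
  have e1 : ∫⁻ z, ENNReal.ofReal (Θ (Complex.normSq z)) * ‖angD u z‖ₑ ^ 2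
      = ENNReal.ofReal (∫ z, Θ (Complex.normSq z) * angD u z ^ 2) := by
    rw [ofReal_integral_eq_lintegral_ofReal i1
      (Eventually.of_forall fun z => mul_nonneg (hΘ0 _) (sq_nonneg _))]
    refine lintegral_congr fun z => ?_
    rw [ENNReal.ofReal_mul (hΘ0 _), hsq]
  have e2 : ∫⁻ z, ENNReal.ofReal |Θ (Complex.normSq z)
      + Complex.normSq z * deriv Θ (Complex.normSq z)| * (‖radD u z‖ₑ ^ 2 + ‖angD u z‖ₑ ^ 2)
      = ENNReal.ofReal (∫ z, |Θ (Complex.normSq z)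
      + Complex.normSq z * deriv Θ (Complex.normSq z)| * (radD u z ^ 2 + angD u z ^ 2)) := by
    rw [ofReal_integral_eq_lintegral_ofReal i2
      (Eventually.of_forall fun z => mul_nonneg (abs_nonneg _) (by positivity))]
    refine lintegral_congr fun z => ?_
    rw [ENNReal.ofReal_mul (abs_nonneg _), ENNReal.ofReal_add (sq_nonneg _) (sq_nonneg _),
      hsq, hsq]
  rw [e1, e2]
  refine (ENNReal.ofReal_le_ofReal hmain).trans ?_
  refine ENNReal.ofReal_add_le.trans (le_of_eq ?_)
  rw [ENNReal.ofReal_toReal hTt]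

/-! ### Passage of the energy inequality to weak derivatives. -/

theorem tendsto_eLpNorm_of_tendsto_sub {α E : Type*} [MeasurableSpace α] [NormedAddCommGroup E]
    {μ : Measure α} {q : ℝ≥0∞} (hq : 1 ≤ q) {g : ℕ → α → E} {g' : α → E}
    (hg : ∀ n, AEStronglyMeasurable (g n) μ) (hg' : MemLp g' q μ)
    (h : Tendsto (fun n => eLpNorm (g n - g') q μ) atTop (𝓝 0)) :
    Tendsto (fun n => eLpNorm (g n) q μ) atTop (𝓝 (eLpNorm g' q μ)) := by
  have hup : ∀ n, eLpNorm (g n) q μ ≤ eLpNorm g' q μ + eLpNorm (g n - g') q μ := fun n => by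
    have := eLpNorm_add_le hg'.1 ((hg n).sub hg'.1) hq
    rwa [add_sub_cancel] at this
  have hlo : ∀ n, eLpNorm g' q μ - eLpNorm (g n - g') q μ ≤ eLpNorm (g n) q μ := fun n => by
    rw [tsub_le_iff_right]
    have := eLpNorm_sub_le (hg n) ((hg n).sub hg'.1) hq
    rwa [sub_sub_cancel] at this
  refine tendsto_of_tendsto_of_tendsto_of_le_of_le ?_ ?_ hlo hup
  · have := ENNReal.Tendsto.sub (tendsto_const_nhds (x := eLpNorm g' q μ) (f := atTop)) h
      (Or.inl hg'.2.ne)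
    simpa using this
  · have := (tendsto_const_nhds (x := eLpNorm g' q μ) (f := atTop)).add h
    simpa using this

theorem tendsto_lintegral_enorm_sq_mollify {a b : ℂ → ℝ} (ha : MemLp a 2) (hb : MemLp b 2)
    {α β : ℂ → ℝ} (hα : Continuous α) (hαc : HasCompactSupport α) (hβ : Continuous β)
    (hβc : HasCompactSupport β) :
    Tendsto (fun n => ∫⁻ z, ‖α z * mollify n a z + β z * mollify n b z‖ₑ ^ 2) atTop
      (𝓝 (∫⁻ z, ‖α z * a z + β z * b z‖ₑ ^ 2)) := by
  have h2 : ∀ g : ℂ → ℝ, ∫⁻ z, ‖g z‖ₑ ^ 2 = eLpNorm g 2 volume ^ 2 := fun g => by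
    rw [eLpNorm_eq_lintegral_rpow_enorm_toReal (by norm_num) (by norm_num),
      ← ENNReal.rpow_natCast, ← ENNReal.rpow_mul]
    norm_num
  simp only [h2]
  refine (ENNReal.continuous_pow 2).continuousAt.tendsto.comp ?_
  obtain ⟨A, hA⟩ := hαc.exists_bound_of_continuous hα
  obtain ⟨B, hB⟩ := hβc.exists_bound_of_continuous hβ
  have htwo : ENNReal.ofReal 2 = 2 := ENNReal.ofReal_ofNat 2
  have mem : ∀ {c : ℂ → ℝ} {K : ℝ} {g : ℂ → ℝ}, Continuous c → (∀ z, ‖c z‖ ≤ K) → MemLp g 2 →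
      MemLp (fun z => c z * g z) 2 := fun hc hK hg =>
    hg.of_le_mul (hc.aestronglyMeasurable.mul hg.1) (Eventually.of_forall fun z => by
      rw [norm_mul]; exact mul_le_mul_of_nonneg_right (hK z) (norm_nonneg _))
  have hcont : ∀ n {g : ℂ → ℝ}, MemLp g 2 → Continuous (mollify n g) := fun n g hg =>
    (contDiff_mollify n (hg.locallyIntegrable one_le_two)).continuous
  refine tendsto_eLpNorm_of_tendsto_sub one_le_two (fun n =>
    ((hα.mul (hcont n ha)).add (hβ.mul (hcont n hb))).aestronglyMeasurable)
    ((mem hα hA ha).add (mem hβ hB hb)) ?_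
  have hlim : Tendsto (fun n => ENNReal.ofReal A * eLpNorm (mollify n a - a) 2 volume
      + ENNReal.ofReal B * eLpNorm (mollify n b - b) 2 volume) atTop (𝓝 0) := by
    have h1 := tendsto_eLpNorm_mollify_sub (p := 2) one_le_two (by rwa [htwo] : MemLp a _ _)
    have h3 := tendsto_eLpNorm_mollify_sub (p := 2) one_le_two (by rwa [htwo] : MemLp b _ _)
    rw [htwo] at h1 h3
    have := (ENNReal.Tendsto.const_mul h1 (Or.inr (ENNReal.ofReal_ne_top (r := A)))).add
      (ENNReal.Tendsto.const_mul h3 (Or.inr (ENNReal.ofReal_ne_top (r := B))))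
    simpa using this
  refine tendsto_of_tendsto_of_tendsto_of_le_of_le tendsto_const_nhds hlim
    (fun n => zero_le) fun n => ?_
  have m1 : AEStronglyMeasurable (mollify n a - a) := (hcont n ha).aestronglyMeasurable.sub ha.1
  have m2 : AEStronglyMeasurable (mollify n b - b) := (hcont n hb).aestronglyMeasurable.sub hb.1
  have heq : ((fun z => α z * mollify n a z + β z * mollify n b z)
      - fun z => α z * a z + β z * b z)
      = (fun z => α z * (mollify n a - a) z) + fun z => β z * (mollify n b - b) z := by
    ext z
    simp only [Pi.sub_apply, Pi.add_apply]
    ring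
  change eLpNorm ((fun z => α z * mollify n a z + β z * mollify n b z)
      - fun z => α z * a z + β z * b z) 2 volume ≤ _
  rw [heq]
  refine (eLpNorm_add_le (hα.aestronglyMeasurable.mul m1) (hβ.aestronglyMeasurable.mul m2)
    one_le_two).trans (add_le_add ?_ ?_)
  · exact eLpNorm_le_mul_eLpNorm_of_ae_le_mul (Eventually.of_forall fun z => by
      rw [Pi.mul_apply, norm_mul]; exact mul_le_mul_of_nonneg_right (hA z) (norm_nonneg _)) 2
  · exact eLpNorm_le_mul_eLpNorm_of_ae_le_mul (Eventually.of_forall fun z => by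
      rw [Pi.mul_apply, norm_mul]; exact mul_le_mul_of_nonneg_right (hB z) (norm_nonneg _)) 2

theorem tendsto_eLpNorm_mollify_restrict {p : ℝ} (hp : 1 ≤ p) {g : ℂ → ℝ}
    (hg : MemLp g (ENNReal.ofReal p) volume) (s : Set ℂ) :
    Tendsto (fun n => eLpNorm (mollify n g) (ENNReal.ofReal p) (volume.restrict s)) atTop
      (𝓝 (eLpNorm g (ENNReal.ofReal p) (volume.restrict s))) := by
  have hp1 : 1 ≤ ENNReal.ofReal p := by simpa using hp
  refine tendsto_eLpNorm_of_tendsto_sub hp1 (fun n =>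
    (contDiff_mollify n (hg.locallyIntegrable hp1)).continuous.aestronglyMeasurable)
    (hg.restrict s) ?_
  exact tendsto_of_tendsto_of_tendsto_of_le_of_le tendsto_const_nhds
    (tendsto_eLpNorm_mollify_sub hp hg) (fun n => zero_le)
    fun n => eLpNorm_mono_measure _ Measure.restrict_le_self

/-- The averaged energy inequality for compactly supported functions with weak derivatives
`a = ∂ₓU`, `b = ∂ᵧU` and Laplacian `aa + bb`. -/
theorem exists_lintegral_weak_angular_sq_le {p : ℝ} (hp1 : 1 < p) (hp2 : p < 2) :
    ∃ C : ℝ≥0∞, C ≠ ⊤ ∧ ∀ U a b aa bb : ℂ → ℝ, HasCompactSupport U →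
      HasWeakDeriv 1 U a → HasWeakDeriv Complex.I U b → HasWeakDeriv 1 a aa →
      HasWeakDeriv Complex.I b bb → MemLp a 2 → MemLp b 2 →
      MemLp (aa + bb) (ENNReal.ofReal p) →
      ∀ Θ : ℝ → ℝ, ContDiff ℝ ∞ Θ → HasCompactSupport Θ → (∀ x, 0 ≤ Θ x) →
      ∀ (J : Finset ℤ) (s : ℤ → ℝ≥0∞), (∀ j, s j ≠ ⊤) →
      (∀ z : ℂ, Θ (Complex.normSq z) ≠ 0 → ∃ j ∈ J, z ∈ ann (2 ^ j)) →
      (∀ j ∈ J, ∀ z ∈ ann (2 ^ j),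
        ENNReal.ofReal (Complex.normSq z * Θ (Complex.normSq z)) ≤ s j) →
      ∫⁻ z, ENNReal.ofReal (Θ (Complex.normSq z)) * ‖-z.im * a z + z.re * b z‖ₑ ^ 2
        ≤ (∫⁻ z, ENNReal.ofReal |Θ (Complex.normSq z)
            + Complex.normSq z * deriv Θ (Complex.normSq z)|
            * (‖z.re * a z + z.im * b z‖ₑ ^ 2 + ‖-z.im * a z + z.re * b z‖ₑ ^ 2))
          + ∑ j ∈ J, s j * (C * ENNReal.ofReal (((2 : ℝ) ^ j) ^ (2 - 2 / p))
            * eLpNorm (aa + bb) (ENNReal.ofReal p) (volume.restrict (ann (2 ^ j)))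
            * (eLpNorm a 2 (volume.restrict (annW (2 ^ j)))
              + eLpNorm b 2 (volume.restrict (annW (2 ^ j))))) := by
  obtain ⟨C, hC, hsm⟩ := exists_lintegral_angD_sq_le hp1 hp2
  refine ⟨C, hC, fun U a b aa bb hUc h0 h1 h00 h11 ha hb hl Θ hΘ hΘc hΘ0 J s hst hcov hs => ?_⟩
  have hNc : Continuous fun z : ℂ => Complex.normSq z := contDiff_normSq.continuous
  have hθc : Continuous fun z : ℂ => Θ (Complex.normSq z) := hΘ.continuous.comp hNc
  set Ψ : ℂ → ℝ := fun z => |Θ (Complex.normSq z)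
      + Complex.normSq z * deriv Θ (Complex.normSq z)| with hΨ
  have hΨc : Continuous Ψ :=
    (hθc.add (hNc.mul ((hΘ.continuous_deriv (by norm_cast)).comp hNc))).abs
  have hΨ0 : ∀ z, 0 ≤ Ψ z := fun z => abs_nonneg _
  obtain ⟨M, hM⟩ := hΘc.isCompact.isBounded.subset_closedBall 0
  have hbig : ∀ z : ℂ, z ∉ closedBall (0 : ℂ) (|M| + 1) → Complex.normSq z ∉ tsupport Θ := by
    intro z hz h
    have h2 := hM h
    simp only [mem_closedBall, dist_zero_right, not_le] at hz h2
    rw [Real.norm_of_nonneg (Complex.normSq_nonneg z), Complex.normSq_eq_norm_sq] at h2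
    nlinarith [le_abs_self M, abs_nonneg M]
  have hθ0 : ∀ z : ℂ, z ∉ closedBall (0 : ℂ) (|M| + 1) → Θ (Complex.normSq z) = 0 := fun z hz =>
    image_eq_zero_of_notMem_tsupport (hbig z hz)
  have hΨz : ∀ z : ℂ, z ∉ closedBall (0 : ℂ) (|M| + 1) → Ψ z = 0 := fun z hz => by
    have h2 : deriv Θ (Complex.normSq z) = 0 := by
      by_contra h
      exact hbig z hz (support_deriv_subset h)
    simp [hΨ, hθ0 z hz, h2]
  have cs : ∀ {w c : ℂ → ℝ}, (∀ z : ℂ, z ∉ closedBall (0 : ℂ) (|M| + 1) → w z = 0) →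
      HasCompactSupport fun z => √(w z) * c z := fun hw =>
    HasCompactSupport.intro (isCompact_closedBall (0 : ℂ) (|M| + 1)) fun z hz => by
      rw [hw z hz]; simp
  -- Moving the square root of the weight inside turns weighted energies into squared L² norms with
  -- continuous compactly supported coefficients, which are stable under mollification.
  have hsplit : ∀ (w : ℂ → ℝ), (∀ z, 0 ≤ w z) → ∀ (x y : ℂ → ℝ) (z : ℂ) (s t : ℝ),
      ENNReal.ofReal (w z) * ‖x z * s + y z * t‖ₑ ^ 2
        = ‖√(w z) * x z * s + √(w z) * y z * t‖ₑ ^ 2 := by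
    intro w hw x y z s t
    rw [mul_assoc, mul_assoc, ← mul_add, enorm_mul, mul_pow, Real.enorm_of_nonneg (Real.sqrt_nonneg _),
      ← ENNReal.ofReal_pow (Real.sqrt_nonneg _), Real.sq_sqrt (hw z)]
  set L := fun (w x y : ℂ → ℝ) (s t : ℂ → ℝ) =>
    ∫⁻ z, ENNReal.ofReal (w z) * ‖x z * s z + y z * t z‖ₑ ^ 2 with hLdef
  have hL : ∀ (w x y : ℂ → ℝ), Continuous w → Continuous x → Continuous y → (∀ z, 0 ≤ w z) →
      (∀ z : ℂ, z ∉ closedBall (0 : ℂ) (|M| + 1) → w z = 0) →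
      Tendsto (fun n => L w x y (mollify n a) (mollify n b)) atTop (𝓝 (L w x y a b)) := by
    intro w x y hw hx hy hw0 hwz
    simp only [hLdef, hsplit w hw0]
    exact tendsto_lintegral_enorm_sq_mollify ha hb (hw.sqrt.mul hx) (cs hwz) (hw.sqrt.mul hy)
      (cs hwz)
  have hre : Continuous fun z : ℂ => z.re := Complex.continuous_re
  have him : Continuous fun z : ℂ => z.im := Complex.continuous_im
  have hnim : Continuous fun z : ℂ => -z.im := him.neg
  have hU : LocallyIntegrable U := h0.1
  have hus : ∀ n, ContDiff ℝ ∞ (mollify n U) := fun n => contDiff_mollify n hU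
  have hd0 : ∀ n z, fderiv ℝ (mollify n U) z 1 = mollify n a z := fun n z => h0.fderiv_mollify n z
  have hd1 : ∀ n z, fderiv ℝ (mollify n U) z Complex.I = mollify n b z :=
    fun n z => h1.fderiv_mollify n z
  have hrad : ∀ n z, radD (mollify n U) z = z.re * mollify n a z + z.im * mollify n b z := by
    intro n z
    rw [radD, clm_apply_eq, hd0, hd1]
  have hang : ∀ n z, angD (mollify n U) z = -z.im * mollify n a z + z.re * mollify n b z := by
    intro n z
    rw [angD, clm_apply_eq, hd0, hd1]
    simp
  have hlap : ∀ n, lap (mollify n U) = mollify n (aa + bb) := by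
    intro n
    ext z
    rw [lap, mollify_add n h00.2 h11.2]
    simp only [hd0, hd1]
    rw [Pi.add_apply, ← h00.fderiv_mollify, ← h11.fderiv_mollify]
  have hmc : ∀ n {g : ℂ → ℝ}, LocallyIntegrable g → Continuous (mollify n g) :=
    fun n g hg => (contDiff_mollify n hg).continuous
  have hfd : ∀ n (μ : Measure ℂ), eLpNorm (fderiv ℝ (mollify n U)) 2 μ
      ≤ eLpNorm (mollify n a) 2 μ + eLpNorm (mollify n b) 2 μ := by
    intro n μ
    have h2 : ∀ᵐ z ∂μ, ‖fderiv ℝ (mollify n U) z‖ ≤ ‖mollify n a z‖ + ‖mollify n b z‖ := by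
      refine Eventually.of_forall fun z => ?_
      refine ContinuousLinearMap.opNorm_le_bound _ (by positivity) fun v => ?_
      rw [clm_apply_eq, hd0, hd1]
      refine (norm_add_le _ _).trans ?_
      rw [norm_mul, norm_mul, add_mul, mul_comm, mul_comm (‖v.im‖)]
      exact add_le_add (mul_le_mul_of_nonneg_left (Complex.abs_re_le_norm v) (norm_nonneg _))
        (mul_le_mul_of_nonneg_left (Complex.abs_im_le_norm v) (norm_nonneg _))
    refine (eLpNorm_mono_ae_real h2).trans ((eLpNorm_add_le
      (hmc n h0.2).norm.aestronglyMeasurable (hmc n h1.2).norm.aestronglyMeasurable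
      one_le_two).trans (le_of_eq ?_))
    rw [eLpNorm_norm, eLpNorm_norm]
  have key : ∀ n, L (fun z => Θ (Complex.normSq z)) (fun z => -z.im) (fun z => z.re)
      (mollify n a) (mollify n b)
      ≤ (L Ψ (fun z => z.re) (fun z => z.im) (mollify n a) (mollify n b)
        + L Ψ (fun z => -z.im) (fun z => z.re) (mollify n a) (mollify n b))
        + ∑ j ∈ J, s j * (C * ENNReal.ofReal (((2 : ℝ) ^ j) ^ (2 - 2 / p))
            * eLpNorm (mollify n (aa + bb)) (ENNReal.ofReal p) (volume.restrict (ann (2 ^ j)))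
            * (eLpNorm (mollify n a) 2 (volume.restrict (annW (2 ^ j)))
              + eLpNorm (mollify n b) 2 (volume.restrict (annW (2 ^ j))))) := by
    intro n
    have h2 := hsm (mollify n U) (hus n) (hasCompactSupport_mollify n hUc) Θ hΘ hΘ0 J s hcov hs
    simp only [hrad, hang, hlap] at h2
    refine h2.trans (add_le_add (le_of_eq ?_) ?_)
    · simp only [hLdef]
      rw [← lintegral_add_left]
      · simp only [mul_add, hΨ]
      · exact hΨc.measurable.ennreal_ofReal.mul
          (((hre.mul (hmc n h0.2)).add (him.mul (hmc n h1.2))).enorm.measurable.pow_const 2)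
    · exact Finset.sum_le_sum fun j _ => mul_le_mul' le_rfl (mul_le_mul' le_rfl (hfd n _))
  have htwo : ENNReal.ofReal 2 = 2 := ENNReal.ofReal_ofNat 2
  have hlim2 : ∀ {g : ℂ → ℝ} (S : Set ℂ), MemLp g 2 →
      Tendsto (fun n => eLpNorm (mollify n g) 2 (volume.restrict S)) atTop
        (𝓝 (eLpNorm g 2 (volume.restrict S))) := fun S hg => by
    have := tendsto_eLpNorm_mollify_restrict (p := 2) one_le_two (by rwa [htwo]) S
    rwa [htwo] at this
  have hfinal := le_of_tendsto_of_tendsto'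
    (hL _ _ _ hθc hnim hre (fun z => hΘ0 _) hθ0)
    (((hL Ψ _ _ hΨc hre him hΨ0 hΨz).add (hL Ψ _ _ hΨc hnim hre hΨ0 hΨz)).add
      (tendsto_finsetSum J fun j _ => ENNReal.Tendsto.const_mul
        (ENNReal.Tendsto.mul (ENNReal.Tendsto.const_mul
          (tendsto_eLpNorm_mollify_restrict hp1.le hl (ann (2 ^ j)))
          (Or.inr (ENNReal.mul_ne_top hC ENNReal.ofReal_ne_top)))
          (Or.inr ?_) ((hlim2 (annW (2 ^ j)) ha).add (hlim2 (annW (2 ^ j)) hb)) (Or.inr ?_))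
        (Or.inr (hst j)))) key
  · refine hfinal.trans (add_le_add (le_of_eq ?_) le_rfl)
    simp only [hLdef]
    rw [← lintegral_add_left']
    · simp only [mul_add, hΨ]
    · exact hΨc.measurable.ennreal_ofReal.aemeasurable.mul
        (((hre.aestronglyMeasurable.mul ha.1).add
          (him.aestronglyMeasurable.mul hb.1)).enorm.pow_const 2)
  · exact ENNReal.add_ne_top.2 ⟨(ha.restrict _).2.ne, (hb.restrict _).2.ne⟩
  · exact ENNReal.mul_ne_top (ENNReal.mul_ne_top hC ENNReal.ofReal_ne_top) (hl.restrict _).2.ne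

/-! ### Local weak derivatives and the complex gradient. -/

section weak

variable {n : ℕ} {Ω : Set ℂ}

theorem integrable_smul_of_locallyIntegrableOn {g : ℂ → EuclideanSpace ℝ (Fin n)} (hg : LocallyIntegrableOn g Ω)
    {φ : ℂ → ℝ} (hφ : Continuous φ) (hc : HasCompactSupport φ) (hs : tsupport φ ⊆ Ω) :
    Integrable fun z => φ z • g z := by
  have hK : IntegrableOn (fun z => φ z • g z) (tsupport φ) volume :=
    (hg.integrableOn_compact_subset hs hc).continuousOn_smul hφ.continuousOn hc
  refine (integrableOn_iff_integrable_of_support_subset fun z hz => ?_).1 hK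
  by_contra h
  exact hz (by simp [image_eq_zero_of_notMem_tsupport h])

theorem continuous_fderiv_apply {φ : ℂ → ℝ} (hφ : ContDiff ℝ ∞ φ) (v : ℂ) :
    Continuous fun z => fderiv ℝ φ z v :=
  (hφ.continuous_fderiv (by simp)).clm_apply continuous_const

theorem tsupport_fderiv_apply_subset' (φ : ℂ → ℝ) (v : ℂ) :
    tsupport (fun z => fderiv ℝ φ z v) ⊆ tsupport φ :=
  tsupport_fderiv_apply_subset ℝ v

/-- Multiplying by a cutoff turns a local weak derivative into a global one. -/
theorem IsWeakDerivOn.hasWeakDeriv_smul {v : ℂ} {f g : ℂ → EuclideanSpace ℝ (Fin n)} (h : IsWeakDerivOn Ω v f g)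
    {η : ℂ → ℝ} (hη : ContDiff ℝ ∞ η) (hηc : HasCompactSupport η) (hs : tsupport η ⊆ Ω) :
    HasWeakDeriv v (fun z => η z • f z) (fun z => η z • g z + fderiv ℝ η z v • f z) := by
  have hdc := continuous_fderiv_apply hη v
  have hds := (tsupport_fderiv_apply_subset' η v).trans hs
  have hdcs : HasCompactSupport fun z => fderiv ℝ η z v := hηc.fderiv_apply ℝ v
  have i1 := integrable_smul_of_locallyIntegrableOn h.1 hη.continuous hηc hs
  have i2 := integrable_smul_of_locallyIntegrableOn h.2 hη.continuous hηc hs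
  have i3 := integrable_smul_of_locallyIntegrableOn h.1 hdc hdcs hds
  refine ⟨i1.locallyIntegrable, (i2.add i3).locallyIntegrable, fun φ hφ hφc => ?_⟩
  have hφη : ContDiff ℝ ∞ fun z => φ z * η z := hφ.mul hη
  have hφηc : HasCompactSupport fun z => φ z * η z := hφc.mul_right
  have hφηs : tsupport (fun z => φ z * η z) ⊆ Ω := (tsupport_mul_subset_right).trans hs
  have h1 := h.integral_eq _ hφη hφηc hφηs
  have hf : ∀ z, fderiv ℝ (fun z => φ z * η z) z v
      = φ z * fderiv ℝ η z v + η z * fderiv ℝ φ z v := fun z => by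
    rw [fderiv_fun_mul (hφ.differentiable (by simp) z) (hη.differentiable (by simp) z)]
    simp
  have j1 : Integrable fun z => (φ z * fderiv ℝ η z v) • f z :=
    integrable_smul_of_locallyIntegrableOn h.1 (hφ.continuous.mul hdc) hφc.mul_right
      ((tsupport_mul_subset_right).trans hds)
  have j2 : Integrable fun z => (η z * fderiv ℝ φ z v) • f z :=
    integrable_smul_of_locallyIntegrableOn h.1 (hη.continuous.mul (continuous_fderiv_apply hφ v))
      hηc.mul_right ((tsupport_mul_subset_left).trans hs)
  have j3 : Integrable fun z => (φ z * η z) • g z :=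
    integrable_smul_of_locallyIntegrableOn h.2 hφη.continuous hφηc hφηs
  simp only [hf, add_smul] at h1
  rw [integral_add j1 j2] at h1
  have e1 : ∫ z, fderiv ℝ φ z v • η z • f z = ∫ z, (η z * fderiv ℝ φ z v) • f z := by
    refine integral_congr_ae (Eventually.of_forall fun z => ?_)
    simp only [smul_smul, mul_comm]
  have e2 : ∫ z, φ z • (η z • g z + fderiv ℝ η z v • f z)
      = (∫ z, (φ z * η z) • g z) + ∫ z, (φ z * fderiv ℝ η z v) • f z := by
    rw [← integral_add j3 j1]
    simp only [smul_add, smul_smul]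
  rw [e1, e2, neg_add, ← h1]
  abel

/-- Weak second derivatives commute. -/
theorem IsWeakDerivOn.swap {v w : ℂ} {f gv gw h : ℂ → EuclideanSpace ℝ (Fin n)} (hv : IsWeakDerivOn Ω v f gv)
    (hw : IsWeakDerivOn Ω w f gw) (hvw : IsWeakDerivOn Ω w gv h) : IsWeakDerivOn Ω v gw h := by
  refine ⟨hw.2, hvw.2, fun φ hφ hc hs => ?_⟩
  have h1 := hvw.integral_eq φ hφ hc hs
  have hd : ∀ a : ℂ, ContDiff ℝ ∞ fun z => fderiv ℝ φ z a := fun a => contDiff_fderiv_apply hφ a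
  have hdc : ∀ a : ℂ, HasCompactSupport fun z => fderiv ℝ φ z a := fun a => hc.fderiv_apply ℝ a
  have hds : ∀ a : ℂ, tsupport (fun z => fderiv ℝ φ z a) ⊆ Ω :=
    fun a => (tsupport_fderiv_apply_subset' φ a).trans hs
  have h2 := hv.integral_eq _ (hd w) (hdc w) (hds w)
  have h3 := hw.integral_eq _ (hd v) (hdc v) (hds v)
  have hsymm : ∀ z, fderiv ℝ (fun z => fderiv ℝ φ z w) z v
      = fderiv ℝ (fun z => fderiv ℝ φ z v) z w := by
    intro z
    have hdiff : DifferentiableAt ℝ (fderiv ℝ φ) z :=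
      (hφ.fderiv_right (m := ∞) (by norm_cast)).differentiable (by simp) z
    have hh := (hφ.contDiffAt (x := z)).isSymmSndFDerivAt
      (by rw [minSmoothness_of_isRCLikeNormedField]; norm_cast)
    rw [fderiv_clm_apply hdiff (differentiableAt_const _),
      fderiv_clm_apply hdiff (differentiableAt_const _)]
    simpa using hh v w
  simp only [hsymm] at h2
  rw [← h1, ← neg_inj, ← h2, h3]

/-- Multiplying by an L² function loses exactly what Sobolev's inequality gains. The nonlinearity
b|∇f| is therefore critical, and only smallness of b can absorb it. -/
theorem holderTriple_two {q : ℝ} (hq1 : 1 < q) (hq2 : q < 2) :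
    ENNReal.HolderTriple 2 (ENNReal.ofReal (2 * q / (2 - q))) (ENNReal.ofReal q) := by
  have h2 : 0 < 2 - q := by linarith
  refine ⟨?_⟩
  rw [← ENNReal.ofReal_inv_of_pos (by positivity), ← ENNReal.ofReal_inv_of_pos (by positivity),
    ← ENNReal.ofReal_ofNat, ← ENNReal.ofReal_inv_of_pos (by positivity),
    ← ENNReal.ofReal_add (by positivity) (by positivity)]
  congr 1
  field_simp
  ring

theorem eLpNorm_mul_le_two {q : ℝ} (hq1 : 1 < q) (hq2 : q < 2) {μ : Measure ℂ} {b g : ℂ → ℝ}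
    (hb : AEStronglyMeasurable b μ) (hg : AEStronglyMeasurable g μ) :
    eLpNorm (fun z => b z * g z) (ENNReal.ofReal q) μ
      ≤ eLpNorm b 2 μ * eLpNorm g (ENNReal.ofReal (2 * q / (2 - q))) μ := by
  have h3 := holderTriple_two hq1 hq2
  change eLpNorm (b • g) _ μ ≤ _
  exact eLpNorm_smul_le_mul_eLpNorm (p := 2) (q := ENNReal.ofReal (2 * q / (2 - q)))
    (r := ENNReal.ofReal q) hg hb

/-- The length of the gradient with components `G 0` and `G 1`. -/
def gradLen (G : Fin 2 → ℂ → EuclideanSpace ℝ (Fin n)) (z : ℂ) : ℝ := √(∑ i, ‖G i z‖ ^ 2)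

theorem norm_le_gradLen (G : Fin 2 → ℂ → EuclideanSpace ℝ (Fin n)) (i : Fin 2) (z : ℂ) :
    ‖G i z‖ ≤ gradLen G z := by
  refine Real.le_sqrt_of_sq_le ?_
  exact Finset.single_le_sum (f := fun i => ‖G i z‖ ^ 2) (fun _ _ => sq_nonneg _)
    (Finset.mem_univ i)

/-- The components of `∂ₓf - i ∂ᵧf`. -/
def cgrad (G : Fin 2 → ℂ → EuclideanSpace ℝ (Fin n)) (k : Fin n) (z : ℂ) : ℂ :=
  (G 0 z k : ℂ) - Complex.I * (G 1 z k : ℂ)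

theorem norm_sub_I_mul_sq (x y : ℝ) : ‖(x : ℂ) - Complex.I * (y : ℂ)‖ ^ 2 = x ^ 2 + y ^ 2 := by
  rw [← Complex.normSq_eq_norm_sq, Complex.normSq_apply]
  simp
  ring

theorem norm_cgrad_sq (G : Fin 2 → ℂ → EuclideanSpace ℝ (Fin n)) (k : Fin n) (z : ℂ) :
    ‖cgrad G k z‖ ^ 2 = G 0 z k ^ 2 + G 1 z k ^ 2 := norm_sub_I_mul_sq _ _

theorem gradLen_sq (G : Fin 2 → ℂ → EuclideanSpace ℝ (Fin n)) (z : ℂ) :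
    gradLen G z ^ 2 = ∑ k, ‖cgrad G k z‖ ^ 2 := by
  rw [gradLen, Real.sq_sqrt (Finset.sum_nonneg fun _ _ => sq_nonneg _)]
  simp only [norm_cgrad_sq, Fin.sum_univ_two, EuclideanSpace.norm_sq_eq, Finset.sum_add_distrib,
    Real.norm_eq_abs, sq_abs]

theorem gradLen_nonneg (G : Fin 2 → ℂ → EuclideanSpace ℝ (Fin n)) (z : ℂ) : 0 ≤ gradLen G z :=
  Real.sqrt_nonneg _

theorem norm_cgrad_le (G : Fin 2 → ℂ → EuclideanSpace ℝ (Fin n)) (k : Fin n) (z : ℂ) :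
    ‖cgrad G k z‖ ≤ gradLen G z := by
  refine Real.le_sqrt_of_sq_le ?_
  have := gradLen_sq G z
  rw [gradLen, Real.sq_sqrt (Finset.sum_nonneg fun _ _ => sq_nonneg _)] at this
  rw [this]
  exact Finset.single_le_sum (f := fun k => ‖cgrad G k z‖ ^ 2) (fun _ _ => sq_nonneg _)
    (Finset.mem_univ k)

theorem gradLen_le_sum (G : Fin 2 → ℂ → EuclideanSpace ℝ (Fin n)) (z : ℂ) :
    gradLen G z ≤ ∑ k, ‖cgrad G k z‖ := by
  refine abs_le_of_sq_le_sq' ?_ (Finset.sum_nonneg fun _ _ => norm_nonneg _) |>.2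
  rw [gradLen_sq]
  exact Finset.sum_sq_le_sq_sum_of_nonneg fun _ _ => norm_nonneg _

theorem aestronglyMeasurable_gradLen {G : Fin 2 → ℂ → EuclideanSpace ℝ (Fin n)} {μ : Measure ℂ}
    (hG : ∀ i, AEStronglyMeasurable (G i) μ) : AEStronglyMeasurable (gradLen G) μ := by
  have : AEStronglyMeasurable (fun z => ∑ i, ‖G i z‖ ^ 2) μ :=
    Finset.aestronglyMeasurable_fun_sum _ fun i _ => (hG i).norm.pow 2
  exact Real.continuous_sqrt.comp_aestronglyMeasurable this

end weak

/-! ### The interior Hessian estimate. -/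

section hessian

variable {n : ℕ} {Ω : Set ℂ}

/-- `G` is a gradient on `Ω` with weak derivatives `H i j = ∂ⱼ G i`, symmetric Hessian, and
Laplacian bounded by `b |G|`. -/
structure GradData (Ω : Set ℂ) (G : Fin 2 → ℂ → EuclideanSpace ℝ (Fin n))
    (H : Fin 2 → Fin 2 → ℂ → EuclideanSpace ℝ (Fin n)) (b : ℂ → ℝ) : Prop where
  deriv : ∀ i j, IsWeakDerivOn Ω (coordDir j) (G i) (H i j)
  symm : H 0 1 =ᵐ[volume.restrict Ω] H 1 0
  laplacian_le : ∀ᵐ z ∂(volume.restrict Ω), ‖H 0 0 z + H 1 1 z‖ ≤ b z * gradLen G z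
  aestronglyMeasurable : AEStronglyMeasurable b (volume.restrict Ω)

theorem aestronglyMeasurable_smul_of_restrict {F : Type*} [NormedAddCommGroup F] [NormedSpace ℝ F]
    (hΩ : MeasurableSet Ω) {g : ℂ → F} (hg : AEStronglyMeasurable g (volume.restrict Ω))
    {φ : ℂ → ℝ} (hφ : Continuous φ) (hs : Function.support φ ⊆ Ω) :
    AEStronglyMeasurable fun z => φ z • g z := by
  have h : (fun z => φ z • g z) = Ω.indicator fun z => φ z • g z := by
    symm
    refine indicator_eq_self.2 fun z hz => hs ?_
    intro h0
    exact hz (by simp [h0])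
  rw [h, aestronglyMeasurable_indicator_iff hΩ]
  exact hφ.aestronglyMeasurable.smul hg

theorem euclidean_norm_le_sum (x : EuclideanSpace ℝ (Fin n)) : ‖x‖ ≤ ∑ k, ‖x k‖ := by
  refine abs_le_of_sq_le_sq' ?_ (Finset.sum_nonneg fun _ _ => norm_nonneg _) |>.2
  rw [EuclideanSpace.norm_sq_eq]
  exact Finset.sum_sq_le_sq_sum_of_nonneg fun _ _ => norm_nonneg _

theorem ENNReal.le_two_mul_of_le_half_add {x z : ℝ≥0∞} (hx : x ≠ ⊤) (h : x ≤ x / 2 + z) :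
    x ≤ 2 * z := by
  have h1 : x / 2 + x / 2 ≤ x / 2 + z := by rwa [ENNReal.add_halves]
  have h2 : x / 2 ≤ z := (ENNReal.add_le_add_iff_left (ENNReal.div_ne_top hx (by norm_num))).1 h1
  calc x = 2 * (x / 2) := by rw [two_mul, ENNReal.add_halves]
    _ ≤ 2 * z := mul_le_mul' le_rfl h2

theorem MemLpLocOn.memLp_smul {q : ℝ} {g : ℂ → EuclideanSpace ℝ (Fin n)} (hg : MemLpLocOn q Ω g)
    {φ : ℂ → ℝ} (hφ : Continuous φ) (hφc : HasCompactSupport φ) (hs : tsupport φ ⊆ Ω) :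
    MemLp (fun z => φ z • g z) (ENNReal.ofReal q) := by
  obtain ⟨K, hK⟩ := hφc.exists_bound_of_continuous hφ
  have hgμ := hg (tsupport φ) hφc.isCompact hs
  have h1 : MemLp (fun z => φ z • g z) (ENNReal.ofReal q) (volume.restrict (tsupport φ)) := by
    refine MemLp.of_le_mul (c := K) hgμ (hφ.aestronglyMeasurable.smul hgμ.1)
      (Eventually.of_forall fun z => ?_)
    rw [norm_smul]
    exact mul_le_mul_of_nonneg_right (hK z) (norm_nonneg _)
  have h2 : (fun z => φ z • g z) = (tsupport φ).indicator fun z => φ z • g z := by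
    symm
    refine indicator_eq_self.2 fun z hz => ?_
    by_contra h
    exact hz (by simp [image_eq_zero_of_notMem_tsupport h])
  rw [h2, memLp_indicator_iff_restrict (isClosed_tsupport φ).measurableSet]
  exact h1

/-- Interior Hessian estimate, with the smallness of `b` used to absorb the nonlinearity. -/
theorem exists_eLpNorm_hessian_le (n : ℕ) {q : ℝ} (hq1 : 1 < q) (hq2 : q < 2) :
    ∃ C δ : ℝ≥0∞, C ≠ ⊤ ∧ δ ≠ 0 ∧ ∀ (Ω : Set ℂ), IsOpen Ω →
      ∀ (G : Fin 2 → ℂ → EuclideanSpace ℝ (Fin n))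
        (H : Fin 2 → Fin 2 → ℂ → EuclideanSpace ℝ (Fin n)) (b : ℂ → ℝ), GradData Ω G H b →
      (∀ i, MemLpLocOn q Ω (G i)) → (∀ i j, MemLpLocOn q Ω (H i j)) →
      ∀ η : ℂ → ℝ, ContDiff ℝ ∞ η → HasCompactSupport η → tsupport η ⊆ Ω →
      eLpNorm b 2 (volume.restrict (tsupport η)) ≤ δ →
      eLpNorm (fun z => η z * gradLen G z) (ENNReal.ofReal (2 * q / (2 - q))) volume
        ≤ C * eLpNorm (fun z => ‖fderiv ℝ η z‖ * gradLen G z) (ENNReal.ofReal q) volume ∧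
      ∀ i j, eLpNorm (fun z => η z • H i j z) (ENNReal.ofReal q) volume
        ≤ C * eLpNorm (fun z => ‖fderiv ℝ η z‖ * gradLen G z) (ENNReal.ofReal q) volume := by
  obtain ⟨C₀, hC₀, hcz⟩ := exists_eLpNorm_le_dzBar hq1 hq2
  set N : ℝ≥0∞ := (n : ℝ≥0∞) * C₀ with hN
  have hNt : N ≠ ⊤ := ENNReal.mul_ne_top (by simp) hC₀
  -- Ensures N δ ≤ 1/2 for the absorption; the summand 1 keeps δ finite even when N = 0.
  set δ : ℝ≥0∞ := (2 * (N + 1))⁻¹ with hδ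
  have hδN : N * δ ≤ 1 / 2 := by
    rw [hδ, ENNReal.mul_inv (Or.inl (by norm_num)) (Or.inl (by norm_num)), one_div, mul_left_comm]
    refine mul_le_of_le_one_right zero_le ?_
    rw [← div_eq_mul_inv]
    exact ENNReal.div_le_of_le_mul (by rw [one_mul]; exact le_self_add)
  have hq0 : 0 < q := by linarith
  have hq1' : 1 ≤ ENNReal.ofReal q := by simpa using hq1.le
  have hqs : 1 ≤ ENNReal.ofReal (2 * q / (2 - q)) := by
    have : (1 : ℝ) ≤ 2 * q / (2 - q) := by
      rw [le_div_iff₀ (by linarith)]; linarith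
    simpa using this
  refine ⟨4 * N + (n : ℝ≥0∞) * (C₀ * 4 + 1), δ, ?_, ?_, ?_⟩
  · finiteness
  · rw [hδ]; exact ENNReal.inv_ne_zero.2 (by finiteness)
  intro Ω hΩ G H b hD hGl hHl η hη hηc hηs hb
  have hΩm := hΩ.measurableSet
  have hsupp : Function.support η ⊆ Ω := (subset_tsupport η).trans hηs
  have hfc : Continuous (fderiv ℝ η) := hη.continuous_fderiv (by simp)
  have hfz : ∀ z, z ∉ tsupport η → fderiv ℝ η z = 0 := fun z hz => by
    by_contra h
    exact hz (support_fderiv_subset ℝ h)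
  have hηz : ∀ z, z ∉ tsupport η → η z = 0 := fun z hz => image_eq_zero_of_notMem_tsupport hz
  have hfs : Function.support (fun z => ‖fderiv ℝ η z‖) ⊆ Ω := fun z hz => hηs (by
    by_contra h
    exact hz (by simp [hfz z h]))
  have hGm : ∀ i, AEStronglyMeasurable (G i) (volume.restrict Ω) := fun i =>
    (hD.deriv i 0).1.aestronglyMeasurable
  have hHm : ∀ i j, AEStronglyMeasurable (H i j) (volume.restrict Ω) := fun i j =>
    (hD.deriv i j).2.aestronglyMeasurable
  have hγm := aestronglyMeasurable_gradLen hGm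
  have hηγ : AEStronglyMeasurable fun z => η z * gradLen G z :=
    aestronglyMeasurable_smul_of_restrict hΩm hγm hη.continuous hsupp
  have hdγ : AEStronglyMeasurable fun z => ‖fderiv ℝ η z‖ * gradLen G z :=
    aestronglyMeasurable_smul_of_restrict hΩm hγm hfc.norm hfs
  set X := eLpNorm (fun z => η z * gradLen G z) (ENNReal.ofReal (2 * q / (2 - q))) volume with hX
  set Y := eLpNorm (fun z => ‖fderiv ℝ η z‖ * gradLen G z) (ENNReal.ofReal q) volume with hY
  set μ := (volume : Measure ℂ).restrict (tsupport η) with hμ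
  have hμle : μ ≤ volume.restrict Ω := Measure.restrict_mono hηs le_rfl
  let L : Fin n → EuclideanSpace ℝ (Fin n) →L[ℝ] ℂ := fun k =>
    Complex.ofRealCLM.comp (EuclideanSpace.proj k)
  let M : Fin n → EuclideanSpace ℝ (Fin n) →L[ℝ] ℂ := fun k =>
    (ContinuousLinearMap.mul ℝ ℂ (-Complex.I)).comp (L k)
  -- The complex gradient times the cutoff. Since the Hessian is symmetric, ∂_x + i∂_y maps it to η
  -- Δf plus terms in ∇η, with no other second derivatives.
  set V : Fin n → ℂ → ℂ := fun k z => L k (η z • G 0 z) + M k (η z • G 1 z) with hV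
  set V' : Fin n → Fin 2 → ℂ → ℂ := fun k j z =>
    L k (η z • H 0 j z + fderiv ℝ η z (coordDir j) • G 0 z)
      + M k (η z • H 1 j z + fderiv ℝ η z (coordDir j) • G 1 z) with hV'
  have hVd : ∀ k j, HasWeakDeriv (coordDir j) (V k) (V' k j) := fun k j =>
    (((hD.deriv 0 j).hasWeakDeriv_smul hη hηc hηs).clm_comp (L k)).add
      (((hD.deriv 1 j).hasWeakDeriv_smul hη hηc hηs).clm_comp (M k))
  have hproj : ∀ (k : Fin n) (x : EuclideanSpace ℝ (Fin n)),
      (EuclideanSpace.proj k : EuclideanSpace ℝ (Fin n) →L[ℝ] ℝ) x = x k := fun _ _ => rfl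
  have hVeq : ∀ k z, V k z = η z * cgrad G k z := by
    intro k z
    simp only [hV, M, L, cgrad, ContinuousLinearMap.comp_apply, map_smul,
      ContinuousLinearMap.mul_apply', Complex.ofRealCLM_apply, hproj,
      Complex.real_smul]
    ring
  have hV'eq : ∀ k j z, V' k j z = η z * ((H 0 j z k : ℂ) - Complex.I * (H 1 j z k : ℂ))
      + fderiv ℝ η z (coordDir j) * cgrad G k z := by
    intro k j z
    simp only [hV', M, L, cgrad, ContinuousLinearMap.comp_apply, map_smul, map_add,
      ContinuousLinearMap.mul_apply', Complex.ofRealCLM_apply, hproj,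
      Complex.real_smul]
    ring
  have hVc : ∀ k, HasCompactSupport (V k) := fun k =>
    HasCompactSupport.intro hηc.isCompact fun z hz => by rw [hVeq, hηz z hz]; simp
  have hVm : ∀ k, AEStronglyMeasurable (V k) := fun k => (hVd k 0).1.aestronglyMeasurable
  have hV'm : ∀ k j, AEStronglyMeasurable (V' k j) := fun k j => (hVd k j).2.aestronglyMeasurable
  set D : Fin n → ℂ → ℂ := fun k z => V' k 0 z + Complex.I * V' k 1 z with hDdef
  have hcd : ∀ j, ‖coordDir j‖ = 1 := fun j => by fin_cases j <;> simp [coordDir]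
  have hfle : ∀ z j, ‖fderiv ℝ η z (coordDir j)‖ ≤ ‖fderiv ℝ η z‖ := fun z j => by
    have := (fderiv ℝ η z).le_opNorm (coordDir j)
    rwa [hcd, mul_one] at this
  -- the Cauchy–Riemann operator applied to the truncated complex gradient
  have hDle : ∀ k, ∀ᵐ z ∂μ, ‖D k z‖ ≤ ‖b z * (η z * gradLen G z)‖
      + 2 * (‖fderiv ℝ η z‖ * gradLen G z) := by
    intro k
    have hs := hμle.absolutelyContinuous.ae_le hD.symm
    have hl := hμle.absolutelyContinuous.ae_le hD.laplacian_le
    filter_upwards [hs, hl] with z h1 h2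
    have e1 : D k z = η z * ((H 0 0 z + H 1 1 z) k : ℝ)
        + (fderiv ℝ η z (coordDir 0) + Complex.I * fderiv ℝ η z (coordDir 1)) * cgrad G k z := by
      simp only [hDdef, hV'eq, h1, PiLp.add_apply]
      push_cast
      linear_combination (-(η z : ℂ) * (H 1 1 z k : ℂ)) * Complex.I_mul_I
    rw [e1]
    refine (norm_add_le _ _).trans (add_le_add ?_ ?_)
    · rw [norm_mul, Complex.norm_real, Complex.norm_real, norm_mul, norm_mul]
      have h3 : ‖(H 0 0 z + H 1 1 z) k‖ ≤ ‖b z‖ * ‖gradLen G z‖ := by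
        rw [← norm_mul]
        exact ((PiLp.norm_apply_le _ k).trans h2).trans (le_abs_self _)
      calc _ ≤ ‖η z‖ * (‖b z‖ * ‖gradLen G z‖) := by gcongr
        _ = _ := by ring
    · rw [norm_mul, ← mul_assoc]
      refine mul_le_mul ?_ (norm_cgrad_le G k z) (norm_nonneg _) (by positivity)
      refine (norm_add_le _ _).trans ?_
      rw [norm_mul, Complex.norm_I, one_mul, Complex.norm_real, Complex.norm_real, two_mul]
      exact add_le_add (hfle z 0) (hfle z 1)
  have hDn : ∀ k, eLpNorm (D k) (ENNReal.ofReal q) volume ≤ δ * X + 2 * Y := by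
    intro k
    have hsD : Function.support (D k) ⊆ tsupport η := fun z hz => by
      by_contra h
      apply hz
      simp only [hDdef, hV'eq, hηz z h, hfz z h]
      simp
    have m1 : AEStronglyMeasurable (fun z => η z * gradLen G z) μ :=
      hηγ.mono_measure Measure.restrict_le_self
    have m2 : AEStronglyMeasurable (fun z => ‖fderiv ℝ η z‖ * gradLen G z) μ :=
      hdγ.mono_measure Measure.restrict_le_self
    have mb : AEStronglyMeasurable b μ := hD.aestronglyMeasurable.mono_measure hμle
    rw [← eLpNorm_restrict_eq_of_support_subset hsD]
    refine (eLpNorm_mono_ae_real (hDle k)).trans ?_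
    refine (eLpNorm_add_le (mb.mul m1).norm (m2.const_mul 2) hq1').trans (add_le_add ?_ ?_)
    · rw [eLpNorm_norm]
      refine (eLpNorm_mul_le_two hq1 hq2 mb m1).trans (mul_le_mul' hb ?_)
      exact eLpNorm_mono_measure _ Measure.restrict_le_self
    · have : (fun z => 2 * (‖fderiv ℝ η z‖ * gradLen G z))
          = (2 : ℝ) • fun z => ‖fderiv ℝ η z‖ * gradLen G z := rfl
      rw [this, eLpNorm_const_smul, Real.enorm_of_nonneg zero_le_two, ENNReal.ofReal_ofNat]
      exact mul_le_mul' le_rfl (eLpNorm_mono_measure _ Measure.restrict_le_self)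
  have hcz' := fun k => hcz (V k) (V' k 0) (V' k 1) (hVc k) (hVd k 0) (hVd k 1)
  have hXV : X ≤ ∑ k, eLpNorm (V k) (ENNReal.ofReal (2 * q / (2 - q))) volume := by
    have h1 : ∀ᵐ z, ‖η z * gradLen G z‖ ≤ (∑ k, fun z => ‖V k z‖) z := by
      refine Eventually.of_forall fun z => ?_
      rw [norm_mul, Real.norm_of_nonneg (gradLen_nonneg G z), Finset.sum_apply]
      simp only [hVeq, norm_mul, Complex.norm_real, ← Finset.mul_sum]
      exact mul_le_mul_of_nonneg_left (gradLen_le_sum G z) (norm_nonneg _)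
    refine (eLpNorm_mono_ae_real h1).trans ?_
    refine (eLpNorm_sum_le (fun k _ => (hVm k).norm) hqs).trans (le_of_eq ?_)
    simp only [eLpNorm_norm]
  have hV'mem : ∀ k j, MemLp (V' k j) (ENNReal.ofReal q) := by
    intro k j
    have hdj : Continuous fun z => fderiv ℝ η z (coordDir j) := continuous_fderiv_apply hη _
    have hds : tsupport (fun z => fderiv ℝ η z (coordDir j)) ⊆ Ω :=
      (tsupport_fderiv_apply_subset' η _).trans hηs
    have hdc : HasCompactSupport fun z => fderiv ℝ η z (coordDir j) := hηc.fderiv_apply ℝ _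
    have m1 := fun i => ((hHl i j).memLp_smul hη.continuous hηc hηs).add
      ((hGl i).memLp_smul hdj hdc hds)
    exact ((L k).comp_memLp' (m1 0)).add ((M k).comp_memLp' (m1 1))
  have hDt : ∀ k, eLpNorm (D k) (ENNReal.ofReal q) volume ≠ ⊤ := fun k =>
    ((hV'mem k 0).add ((hV'mem k 1).const_mul Complex.I)).2.ne
  -- Absorption is legitimate only for finite X. Finiteness comes from the qualitative local L^q
  -- hypotheses through the Sobolev bound, independently of the estimate being proved.
  have hXt : X ≠ ⊤ := by
    refine ne_top_of_le_ne_top ?_ hXV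
    exact ENNReal.sum_ne_top.2 fun k _ => ne_top_of_le_ne_top
      (ENNReal.mul_ne_top hC₀ (hDt k)) (hcz' k).2.2
  have hXle : X ≤ 4 * N * Y := by
    have h1 : X ≤ X / 2 + N * (2 * Y) := by
      calc X ≤ ∑ k : Fin n, C₀ * (δ * X + 2 * Y) := hXV.trans (Finset.sum_le_sum fun k _ =>
            (hcz' k).2.2.trans (mul_le_mul' le_rfl (hDn k)))
        _ = N * δ * X + N * (2 * Y) := by
            rw [Finset.sum_const, Finset.card_univ, Fintype.card_fin, nsmul_eq_mul, hN]
            ring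
        _ ≤ X / 2 + N * (2 * Y) := by
            refine add_le_add ?_ le_rfl
            calc N * δ * X ≤ 1 / 2 * X := mul_le_mul' hδN le_rfl
              _ = X / 2 := by rw [one_div, mul_comm, div_eq_mul_inv]
    refine (ENNReal.le_two_mul_of_le_half_add hXt h1).trans (le_of_eq ?_)
    ring
  have hDY : ∀ k, eLpNorm (D k) (ENNReal.ofReal q) volume ≤ 4 * Y := by
    intro k
    refine (hDn k).trans ?_
    calc δ * X + 2 * Y ≤ δ * (4 * N * Y) + 2 * Y := add_le_add (mul_le_mul' le_rfl hXle) le_rfl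
      _ = N * δ * (4 * Y) + 2 * Y := by ring
      _ ≤ 1 / 2 * (4 * Y) + 2 * Y := add_le_add (mul_le_mul' hδN le_rfl) le_rfl
      _ = 4 * Y := by
          rw [← mul_assoc, one_div, show (2 : ℝ≥0∞)⁻¹ * 4 = 2 by
            rw [show (4 : ℝ≥0∞) = 2 * 2 by norm_num, ← mul_assoc,
              ENNReal.inv_mul_cancel (by norm_num) (by norm_num), one_mul], ← add_mul]
          norm_num
  have hV'le : ∀ k j, eLpNorm (V' k j) (ENNReal.ofReal q) volume ≤ C₀ * 4 * Y := by
    intro k j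
    rw [mul_assoc]
    have h0 := (hcz' k).1.trans (mul_le_mul' le_rfl (hDY k))
    have h1 := (hcz' k).2.1.trans (mul_le_mul' le_rfl (hDY k))
    fin_cases j
    · exact h0
    · exact h1
  refine ⟨hXle.trans (mul_le_mul' le_self_add le_rfl), fun i j => ?_⟩
  have hpt : ∀ᵐ z, ‖η z • H i j z‖
      ≤ (∑ k, ((fun z => ‖V' k j z‖) + fun z => ‖fderiv ℝ η z‖ * gradLen G z)) z := by
    refine Eventually.of_forall fun z => ?_
    refine (euclidean_norm_le_sum _).trans ?_
    rw [Finset.sum_apply]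
    refine Finset.sum_le_sum fun k _ => ?_
    -- Up to sign, each second derivative is the real or the imaginary part of H 0 j - i H 1 j.
    have h1 : ‖(η z • H i j z) k‖
        ≤ ‖η z * ((H 0 j z k : ℂ) - Complex.I * (H 1 j z k : ℂ))‖ := by
      rw [PiLp.smul_apply, smul_eq_mul, norm_mul, norm_mul, Complex.norm_real]
      refine mul_le_mul_of_nonneg_left ?_ (norm_nonneg _)
      refine abs_le_of_sq_le_sq ?_ (norm_nonneg _)
      rw [norm_sub_I_mul_sq]
      fin_cases i
      · exact le_add_of_nonneg_right (sq_nonneg _)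
      · exact le_add_of_nonneg_left (sq_nonneg _)
    refine h1.trans ?_
    have h2 : (η z : ℂ) * ((H 0 j z k : ℂ) - Complex.I * (H 1 j z k : ℂ))
        = V' k j z - fderiv ℝ η z (coordDir j) * cgrad G k z := by
      rw [hV'eq]; ring
    rw [h2]
    refine (norm_sub_le _ _).trans (add_le_add le_rfl ?_)
    rw [norm_mul, Complex.norm_real]
    exact mul_le_mul (hfle z j) (norm_cgrad_le G k z) (norm_nonneg _) (norm_nonneg _)
  refine (eLpNorm_mono_ae_real hpt).trans ?_
  refine (eLpNorm_sum_le (fun k _ => (hV'm k j).norm.add hdγ) hq1').trans ?_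
  calc _ ≤ ∑ k : Fin n, (C₀ * 4 * Y + Y) := Finset.sum_le_sum fun k _ =>
        (eLpNorm_add_le (hV'm k j).norm hdγ hq1').trans
          (add_le_add (by rw [eLpNorm_norm]; exact hV'le k j) le_rfl)
    _ = (n : ℝ≥0∞) * (C₀ * 4 + 1) * Y := by
        rw [Finset.sum_const, Finset.card_univ, Fintype.card_fin, nsmul_eq_mul]
        ring
    _ ≤ _ := mul_le_mul' le_add_self le_rfl

end hessian

/-! ### Conformal maps: angular energy and the Laplacian on annuli. -/

section conformal

variable {n : ℕ} {Ω : Set ℂ}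

/-- The properties of a weakly conformal map `f` with gradient `G` and Hessian `H` on `Ω` that enter
the energy estimates. -/
structure ConfData (p : ℝ) (Ω : Set ℂ) (f : ℂ → EuclideanSpace ℝ (Fin n))
    (G : Fin 2 → ℂ → EuclideanSpace ℝ (Fin n))
    (H : Fin 2 → Fin 2 → ℂ → EuclideanSpace ℝ (Fin n)) (b : ℂ → ℝ) : Prop
    extends GradData Ω G H b where
  weakDeriv : ∀ i, IsWeakDerivOn Ω (coordDir i) f (G i)
  memLp_two : MemLpLocOn 2 Ω f
  memLp : MemLpLocOn p Ω f
  memLp_grad_two : ∀ i, MemLpLocOn 2 Ω (G i)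
  memLp_grad : ∀ i, MemLpLocOn p Ω (G i)
  memLp_hess : ∀ i j, MemLpLocOn p Ω (H i j)
  conformal : ∀ᵐ z ∂(volume.restrict Ω), ∑ k, cgrad G k z ^ 2 = 0

/-- Real and imaginary parts of the conformality relation say |f_x| = |f_y| and f_x ⟂ f_y, so every
direction carries half of the energy. This is the only use of conformality in the decay argument. -/
theorem sum_angular_sq_of_conformal {G : Fin 2 → ℂ → EuclideanSpace ℝ (Fin n)} {z : ℂ}
    (h : ∑ k, cgrad G k z ^ 2 = 0) :
    ∑ k, (-z.im * G 0 z k + z.re * G 1 z k) ^ 2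
      = Complex.normSq z / 2 * gradLen G z ^ 2 := by
  have hexp : ∀ k, cgrad G k z ^ 2 = ((G 0 z k ^ 2 - G 1 z k ^ 2 : ℝ) : ℂ)
      - ((2 * (G 0 z k * G 1 z k) : ℝ) : ℂ) * Complex.I := fun k => by
    rw [cgrad]
    push_cast
    linear_combination (G 1 z k : ℂ) ^ 2 * Complex.I_sq
  have hre := congrArg Complex.re h
  have him := congrArg Complex.im h
  simp only [hexp, Complex.re_sum, Complex.im_sum, Complex.sub_re, Complex.sub_im,
    Complex.ofReal_re, Complex.ofReal_im, Complex.mul_re, Complex.mul_im, Complex.I_re,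
    Complex.I_im, mul_zero, mul_one, sub_zero, Complex.zero_re, Complex.zero_im,
    add_zero, Finset.sum_sub_distrib, Finset.sum_const_zero, ← Finset.mul_sum] at hre him
  have hE : gradLen G z ^ 2 = ∑ k, G 0 z k ^ 2 + ∑ k, G 1 z k ^ 2 := by
    rw [gradLen_sq]
    simp only [norm_cgrad_sq, Finset.sum_add_distrib]
  have h1 : ∑ k, (-z.im * G 0 z k + z.re * G 1 z k) ^ 2
      = z.im ^ 2 * ∑ k, G 0 z k ^ 2 + z.re ^ 2 * ∑ k, G 1 z k ^ 2
        - 2 * z.re * z.im * ∑ k, G 0 z k * G 1 z k := by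
    simp only [Finset.mul_sum, ← Finset.sum_add_distrib, ← Finset.sum_sub_distrib]
    exact Finset.sum_congr rfl fun k _ => by ring
  rw [h1, hE, Complex.normSq_apply]
  have h2 : ∑ k, G 0 z k * G 1 z k = 0 := by linarith
  rw [h2]
  linear_combination (z.im ^ 2 - z.re ^ 2) / 2 * hre

theorem sum_radial_angular_sq (G : Fin 2 → ℂ → EuclideanSpace ℝ (Fin n)) (z : ℂ) :
    ∑ k, ((z.re * G 0 z k + z.im * G 1 z k) ^ 2 + (-z.im * G 0 z k + z.re * G 1 z k) ^ 2)
      = Complex.normSq z * gradLen G z ^ 2 := by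
  rw [gradLen_sq, Finset.mul_sum, Complex.normSq_apply]
  refine Finset.sum_congr rfl fun k _ => ?_
  rw [norm_cgrad_sq]
  ring

theorem enorm_sq_eq_ofReal (x : ℝ) : ‖x‖ₑ ^ 2 = ENNReal.ofReal (x ^ 2) := by
  rw [← sq_abs, ENNReal.ofReal_pow (abs_nonneg _), ← Real.norm_eq_abs, ofReal_norm]

/-- The energy inequality for one component of a map with weak derivatives on `Ω`. -/
theorem exists_lintegral_component_le (n : ℕ) {p : ℝ} (hp1 : 1 < p) (hp2 : p < 2) :
    ∃ C : ℝ≥0∞, C ≠ ⊤ ∧ ∀ (Ω O : Set ℂ), IsOpen Ω → IsOpen O →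
      ∀ (f : ℂ → EuclideanSpace ℝ (Fin n)) (G : Fin 2 → ℂ → EuclideanSpace ℝ (Fin n))
        (H : Fin 2 → Fin 2 → ℂ → EuclideanSpace ℝ (Fin n)) (b : ℂ → ℝ), ConfData p Ω f G H b →
      ∀ ζ : ℂ → ℝ, ContDiff ℝ ∞ ζ → HasCompactSupport ζ → tsupport ζ ⊆ Ω → (∀ z ∈ O, ζ z = 1) →
      ∀ Θ : ℝ → ℝ, ContDiff ℝ ∞ Θ → HasCompactSupport Θ → (∀ x, 0 ≤ Θ x) →
      ∀ (J : Finset ℤ) (s : ℤ → ℝ≥0∞), (∀ j, s j ≠ ⊤) →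
      (∀ z : ℂ, Complex.normSq z ∈ tsupport Θ → ∃ j ∈ J, z ∈ ann (2 ^ j)) →
      (∀ j ∈ J, annW (2 ^ j) ⊆ O) →
      (∀ j ∈ J, ∀ z ∈ ann (2 ^ j),
        ENNReal.ofReal (Complex.normSq z * Θ (Complex.normSq z)) ≤ s j) → ∀ k : Fin n,
      ∫⁻ z in Ω, ENNReal.ofReal (Θ (Complex.normSq z)) * ‖-z.im * G 0 z k + z.re * G 1 z k‖ₑ ^ 2
        ≤ (∫⁻ z in Ω, ENNReal.ofReal |Θ (Complex.normSq z)
            + Complex.normSq z * deriv Θ (Complex.normSq z)|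
            * (‖z.re * G 0 z k + z.im * G 1 z k‖ₑ ^ 2
              + ‖-z.im * G 0 z k + z.re * G 1 z k‖ₑ ^ 2))
          + ∑ j ∈ J, s j * (C * ENNReal.ofReal (((2 : ℝ) ^ j) ^ (2 - 2 / p))
            * eLpNorm (fun z => H 0 0 z + H 1 1 z) (ENNReal.ofReal p)
              (volume.restrict (ann (2 ^ j)))
            * (2 * eLpNorm (gradLen G) 2 (volume.restrict (annW (2 ^ j))))) := by
  obtain ⟨C, hC, hT⟩ := exists_lintegral_weak_angular_sq_le hp1 hp2
  refine ⟨C, hC, fun Ω O hΩ hO f G H b hD ζ hζ hζc hζs hζ1 Θ hΘ hΘc hΘ0 J s hst hcov hJO hs k => ?_⟩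
  let P : EuclideanSpace ℝ (Fin n) →L[ℝ] ℝ := EuclideanSpace.proj k
  have hd : ∀ i, ContDiff ℝ ∞ fun z => fderiv ℝ ζ z (coordDir i) :=
    fun i => contDiff_fderiv_apply hζ _
  have hdc : ∀ i, HasCompactSupport fun z => fderiv ℝ ζ z (coordDir i) :=
    fun i => hζc.fderiv_apply ℝ _
  have hds : ∀ i, tsupport (fun z => fderiv ℝ ζ z (coordDir i)) ⊆ Ω :=
    fun i => (tsupport_fderiv_apply_subset' ζ _).trans hζs
  set dd : Fin 2 → ℂ → ℝ :=
    fun i z => fderiv ℝ (fun z => fderiv ℝ ζ z (coordDir i)) z (coordDir i) with hdd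
  have hddc : ∀ i, Continuous (dd i) := fun i => continuous_fderiv_apply (hd i) _
  have hddcs : ∀ i, HasCompactSupport (dd i) := fun i => (hdc i).fderiv_apply ℝ _
  have hdds : ∀ i, tsupport (dd i) ⊆ Ω :=
    fun i => (tsupport_fderiv_apply_subset' _ _).trans (hds i)
  set a : Fin 2 → ℂ → EuclideanSpace ℝ (Fin n) :=
    fun i z => ζ z • G i z + fderiv ℝ ζ z (coordDir i) • f z with ha
  set aa : Fin 2 → ℂ → EuclideanSpace ℝ (Fin n) :=
    fun i z => (ζ z • H i i z + fderiv ℝ ζ z (coordDir i) • G i z)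
      + (fderiv ℝ ζ z (coordDir i) • G i z + dd i z • f z) with haa
  have w1 : ∀ i, HasWeakDeriv (coordDir i) (fun z => P (ζ z • f z)) (fun z => P (a i z)) :=
    fun i => ((hD.weakDeriv i).hasWeakDeriv_smul hζ hζc hζs).clm_comp P
  have w2 : ∀ i, HasWeakDeriv (coordDir i) (fun z => P (a i z)) (fun z => P (aa i z)) := fun i =>
    (((hD.deriv i i).hasWeakDeriv_smul hζ hζc hζs).add
      ((hD.weakDeriv i).hasWeakDeriv_smul (hd i) (hdc i) (hds i))).clm_comp P
  have htwo : ENNReal.ofReal 2 = 2 := ENNReal.ofReal_ofNat 2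
  have m1 : ∀ i, MemLp (fun z => P (a i z)) 2 := fun i => by
    have h := P.comp_memLp' (((hD.memLp_grad_two i).memLp_smul hζ.continuous hζc hζs).add
      (hD.memLp_two.memLp_smul (hd i).continuous (hdc i) (hds i)))
    rwa [htwo] at h
  have m2 : ∀ i, MemLp (fun z => P (aa i z)) (ENNReal.ofReal p) := fun i =>
    P.comp_memLp' ((((hD.memLp_hess i i).memLp_smul hζ.continuous hζc hζs).add
      ((hD.memLp_grad i).memLp_smul (hd i).continuous (hdc i) (hds i))).add
      (((hD.memLp_grad i).memLp_smul (hd i).continuous (hdc i) (hds i)).add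
      (hD.memLp.memLp_smul (hddc i) (hddcs i) (hdds i))))
  have hcs : HasCompactSupport fun z => P (ζ z • f z) :=
    HasCompactSupport.intro hζc.isCompact fun z hz => by
      rw [image_eq_zero_of_notMem_tsupport hz]; simp
  have hcov' : ∀ z : ℂ, Θ (Complex.normSq z) ≠ 0 → ∃ j ∈ J, z ∈ ann (2 ^ j) :=
    fun z hz => hcov z (subset_tsupport Θ hz)
  have main := hT (fun z => P (ζ z • f z)) (fun z => P (a 0 z)) (fun z => P (a 1 z))
    (fun z => P (aa 0 z)) (fun z => P (aa 1 z)) hcs (w1 0) (w1 1) (w2 0) (w2 1) (m1 0) (m1 1)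
    ((m2 0).add (m2 1)) Θ hΘ hΘc hΘ0 J s hst hcov' hs
  -- O is open, so ζ is constant near each of its points and the derivatives of the cutoff vanish
  -- there. The weight and the annuli in J all lie in O, where ζ f may be replaced by f.
  have hζd : ∀ z ∈ O, fderiv ℝ ζ z = 0 := fun z hz => by
    have : ζ =ᶠ[𝓝 z] fun _ => (1 : ℝ) := by
      filter_upwards [hO.mem_nhds hz] with y hy using hζ1 y hy
    rw [this.fderiv_eq]
    simp
  have hdd0 : ∀ i, ∀ z ∈ O, dd i z = 0 := fun i z hz => by
    have : (fun z => fderiv ℝ ζ z (coordDir i)) =ᶠ[𝓝 z] fun _ => (0 : ℝ) := by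
      filter_upwards [hO.mem_nhds hz] with y hy
      rw [hζd y hy]
      simp
    simp only [hdd]
    rw [this.fderiv_eq]
    simp
  have hPa : ∀ i, ∀ z ∈ O, P (a i z) = G i z k := fun i z hz => by
    simp only [ha, hζ1 z hz, hζd z hz]
    simp [P]
  have hPaa : ∀ i, ∀ z ∈ O, P (aa i z) = H i i z k := fun i z hz => by
    simp only [haa, hζ1 z hz, hζd z hz, hdd0 i z hz]
    simp [P]
  have hin : ∀ z : ℂ, Complex.normSq z ∈ tsupport Θ → z ∈ O ∧ z ∈ Ω := fun z hz => by
    obtain ⟨j, hj, hzj⟩ := hcov z hz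
    have hzO := hJO j hj (ann_subset_annW (by positivity) hzj)
    refine ⟨hzO, hζs (subset_tsupport ζ ?_)⟩
    rw [Function.mem_support, hζ1 z hzO]
    exact one_ne_zero
  have hΨ0 : ∀ z : ℂ, Complex.normSq z ∉ tsupport Θ →
      Θ (Complex.normSq z) + Complex.normSq z * deriv Θ (Complex.normSq z) = 0 := fun z hz => by
    have h1 : deriv Θ (Complex.normSq z) = 0 := by
      by_contra h
      exact hz (support_deriv_subset h)
    rw [image_eq_zero_of_notMem_tsupport hz, h1]
    simp
  refine le_trans (le_trans (le_of_eq ?_) (setLIntegral_le_lintegral Ω _)) (main.trans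
    (add_le_add (le_of_eq ?_) (Finset.sum_le_sum fun j hj => ?_)))
  · refine lintegral_congr fun z => ?_
    by_cases hz : Complex.normSq z ∈ tsupport Θ
    · rw [hPa 0 z (hin z hz).1, hPa 1 z (hin z hz).1]
    · rw [image_eq_zero_of_notMem_tsupport hz]; simp
  · rw [← setLIntegral_eq_of_support_subset (s := Ω)]
    · refine lintegral_congr fun z => ?_
      by_cases hz : Complex.normSq z ∈ tsupport Θ
      · rw [hPa 0 z (hin z hz).1, hPa 1 z (hin z hz).1]
      · rw [hΨ0 z hz]; simp
    · intro z hz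
      by_contra h
      apply hz
      have h1 : Complex.normSq z ∉ tsupport Θ := fun h2 => h (hin z h2).2
      simp only [hΨ0 z h1]
      simp
  · have hr : (0 : ℝ) < 2 ^ j := by positivity
    have e1 : eLpNorm ((fun z => P (aa 0 z)) + fun z => P (aa 1 z)) (ENNReal.ofReal p)
        (volume.restrict (ann (2 ^ j)))
        ≤ eLpNorm (fun z => H 0 0 z + H 1 1 z) (ENNReal.ofReal p)
          (volume.restrict (ann (2 ^ j))) := by
      refine eLpNorm_mono_ae ?_
      filter_upwards [ae_restrict_mem (measurableSet_ann _)] with z hz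
      have hzO := hJO j hj (ann_subset_annW hr hz)
      rw [Pi.add_apply, hPaa 0 z hzO, hPaa 1 z hzO, ← PiLp.add_apply]
      exact PiLp.norm_apply_le _ k
    have e2 : ∀ i, eLpNorm (fun z => P (a i z)) 2 (volume.restrict (annW (2 ^ j)))
        ≤ eLpNorm (gradLen G) 2 (volume.restrict (annW (2 ^ j))) := fun i => by
      refine eLpNorm_mono_ae ?_
      filter_upwards [ae_restrict_mem (measurableSet_annW _)] with z hz
      rw [hPa i z (hJO j hj hz), Real.norm_of_nonneg (gradLen_nonneg G z)]
      exact (PiLp.norm_apply_le _ k).trans (norm_le_gradLen G i z)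
    refine mul_le_mul' le_rfl (mul_le_mul' (mul_le_mul' le_rfl e1) ?_)
    rw [two_mul]
    exact add_le_add (e2 0) (e2 1)

/-- Scale-invariant estimate of the Laplacian on annuli. -/
theorem exists_eLpNorm_laplacian_le (n : ℕ) {p : ℝ} (hp1 : 1 < p) (hp2 : p < 2) :
    ∃ C δ : ℝ≥0∞, C ≠ ⊤ ∧ δ ≠ 0 ∧ ∀ (Ω : Set ℂ), IsOpen Ω →
      ∀ (G : Fin 2 → ℂ → EuclideanSpace ℝ (Fin n))
        (H : Fin 2 → Fin 2 → ℂ → EuclideanSpace ℝ (Fin n)) (b : ℂ → ℝ), GradData Ω G H b →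
      (∀ i, MemLpLocOn p Ω (G i)) → (∀ i j, MemLpLocOn p Ω (H i j)) →
      ∀ r : ℝ, 0 < r → annW r ⊆ Ω → eLpNorm b 2 (volume.restrict (annW r)) ≤ δ →
      eLpNorm (fun z => H 0 0 z + H 1 1 z) (ENNReal.ofReal p) (volume.restrict (ann r))
        ≤ C * ENNReal.ofReal (r ^ (2 / p - 2)) * eLpNorm b 2 (volume.restrict (annW r))
          * eLpNorm (gradLen G) 2 (volume.restrict (annW r)) := by
  obtain ⟨C₁, δ, hC₁, hδ, hK⟩ := exists_eLpNorm_hessian_le n hp1 hp2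
  obtain ⟨C₀, hC₀, hcut⟩ := exists_annCutoff
  have hp0 : 0 < p := by linarith
  -- The power of the area lost from L² to L^p on the annulus. With the 1/r of the cutoff it gives
  -- r^(2α - 1) = r^(2/p - 2).
  set α : ℝ := 1 / p - 1 / 2 with hα
  have hα0 : 0 < α := by rw [hα, sub_pos]; exact one_div_lt_one_div_of_lt hp0 hp2
  set V : ℝ≥0∞ := (ENNReal.ofReal 4 ^ 2 * (NNReal.pi : ℝ≥0∞)) ^ α with hV
  have hVt : V ≠ ⊤ := ENNReal.rpow_ne_top_of_nonneg hα0.le (by finiteness)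
  refine ⟨C₁ * (ENNReal.ofReal C₀ * V), δ, ENNReal.mul_ne_top hC₁
    (ENNReal.mul_ne_top ENNReal.ofReal_ne_top hVt), hδ,
    fun Ω hΩ G H b hD hGl hHl r hr hrΩ hb => ?_⟩
  obtain ⟨ζ, hζs, hζ01, hζ1, hζt, hζd⟩ := hcut r hr
  have hts : tsupport ζ ⊆ annW r := fun z hz =>
    ⟨by linarith [(hζt hz).1], by linarith [(hζt hz).2]⟩
  have hζc : HasCompactSupport ζ := by
    refine HasCompactSupport.intro (isCompact_closedBall (0 : ℂ) (3 * r)) fun z hz => ?_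
    refine image_eq_zero_of_notMem_tsupport fun h => hz ?_
    simpa using (hζt h).2
  have hmono : (volume : Measure ℂ).restrict (tsupport ζ) ≤ volume.restrict (annW r) :=
    Measure.restrict_mono hts le_rfl
  have hannΩ : (volume : Measure ℂ).restrict (ann r) ≤ volume.restrict Ω :=
    Measure.restrict_mono ((ann_subset_annW hr).trans hrΩ) le_rfl
  have hannWΩ : (volume : Measure ℂ).restrict (annW r) ≤ volume.restrict Ω :=
    Measure.restrict_mono hrΩ le_rfl
  have hann : (volume : Measure ℂ).restrict (ann r) ≤ volume.restrict (annW r) :=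
    Measure.restrict_mono (ann_subset_annW hr) le_rfl
  have hk := (hK Ω hΩ G H b hD hGl hHl ζ hζs hζc (hts.trans hrΩ)
    ((eLpNorm_mono_measure b hmono).trans hb)).1
  have hγm : AEStronglyMeasurable (gradLen G) (volume.restrict Ω) :=
    aestronglyMeasurable_gradLen fun i => (hD.deriv i 0).1.aestronglyMeasurable
  have h1 : eLpNorm (fun z => H 0 0 z + H 1 1 z) (ENNReal.ofReal p) (volume.restrict (ann r))
      ≤ eLpNorm b 2 (volume.restrict (annW r))
        * eLpNorm (fun z => ζ z * gradLen G z) (ENNReal.ofReal (2 * p / (2 - p))) volume := by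
    have hl := hannΩ.absolutelyContinuous.ae_le hD.laplacian_le
    have h2 : ∀ᵐ z ∂(volume.restrict (ann r)), ‖H 0 0 z + H 1 1 z‖
        ≤ b z * (ζ z * gradLen G z) := by
      filter_upwards [hl, ae_restrict_mem (measurableSet_ann r)] with z hz hz'
      rwa [hζ1 z hz', one_mul]
    refine (eLpNorm_mono_ae_real h2).trans ?_
    refine (eLpNorm_mul_le_two hp1 hp2 (hD.aestronglyMeasurable.mono_measure hannΩ)
      (hζs.continuous.aestronglyMeasurable.mul (hγm.mono_measure hannΩ))).trans ?_
    exact mul_le_mul' (eLpNorm_mono_measure b hann)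
      (eLpNorm_mono_measure _ Measure.restrict_le_self)
  have h3 : eLpNorm (fun z => ‖fderiv ℝ ζ z‖ * gradLen G z) (ENNReal.ofReal p) volume
      ≤ ENNReal.ofReal C₀ * V * ENNReal.ofReal (r ^ (2 / p - 2))
        * eLpNorm (gradLen G) 2 (volume.restrict (annW r)) := by
    have hsub : Function.support (fun z => ‖fderiv ℝ ζ z‖ * gradLen G z) ⊆ annW r := by
      intro z hz
      have hz' : fderiv ℝ ζ z ≠ 0 := fun h => hz (by simp only [h, norm_zero, zero_mul])
      exact hts (support_fderiv_subset ℝ hz')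
    rw [← eLpNorm_restrict_eq_of_support_subset hsub]
    have h4 : eLpNorm (fun z => ‖fderiv ℝ ζ z‖ * gradLen G z) (ENNReal.ofReal p)
        (volume.restrict (annW r))
        ≤ ENNReal.ofReal (C₀ / r)
          * eLpNorm (gradLen G) (ENNReal.ofReal p) (volume.restrict (annW r)) := by
      refine eLpNorm_le_mul_eLpNorm_of_ae_le_mul (Eventually.of_forall fun z => ?_) _
      rw [norm_mul, norm_norm]
      exact mul_le_mul_of_nonneg_right (hζd z) (norm_nonneg _)
    have h5 := eLpNorm_le_eLpNorm_mul_rpow_measure_univ (μ := volume.restrict (annW r))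
      (f := gradLen G) (p := ENNReal.ofReal p) (q := 2) (by
      rw [← ENNReal.ofReal_ofNat]; exact ENNReal.ofReal_le_ofReal hp2.le)
      (hγm.mono_measure hannWΩ)
    rw [ENNReal.toReal_ofReal hp0.le, ENNReal.toReal_ofNat, Measure.restrict_apply_univ, ← hα]
      at h5
    have hvol : volume (annW r) ^ α ≤ V * ENNReal.ofReal (r ^ (2 * α)) := by
      refine (ENNReal.rpow_le_rpow (volume_annW_le r) hα0.le).trans (le_of_eq ?_)
      rw [hV, ENNReal.ofReal_mul (by norm_num), mul_pow, mul_right_comm,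
        ENNReal.mul_rpow_of_nonneg _ _ hα0.le]
      congr 1
      rw [← ENNReal.rpow_natCast, ← ENNReal.rpow_mul, ENNReal.ofReal_rpow_of_pos hr]
      norm_num
    refine h4.trans ((mul_le_mul' le_rfl (h5.trans (mul_le_mul' le_rfl hvol))).trans
      (le_of_eq ?_))
    have h6 : ENNReal.ofReal (C₀ / r) * ENNReal.ofReal (r ^ (2 * α))
        = ENNReal.ofReal C₀ * ENNReal.ofReal (r ^ (2 / p - 2)) := by
      rw [← ENNReal.ofReal_mul (by positivity), ← ENNReal.ofReal_mul hC₀]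
      congr 1
      have : r ^ (2 * α) = r ^ (2 / p - 2) * r := by
        rw [← Real.rpow_add_one hr.ne']
        congr 1
        rw [hα]
        ring
      rw [this]
      field_simp
    calc _ = (ENNReal.ofReal (C₀ / r) * ENNReal.ofReal (r ^ (2 * α))) * V
          * eLpNorm (gradLen G) 2 (volume.restrict (annW r)) := by ring
      _ = _ := by rw [h6]; ring
  refine (h1.trans (mul_le_mul' le_rfl (hk.trans (mul_le_mul' le_rfl h3)))).trans (le_of_eq ?_)
  ring

end conformal

/-! ### The weighted energy inequality on the punctured disk. -/

section decay

variable {n : ℕ}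

/-- The punctured unit disk. -/
abbrev pDisk : Set ℂ := ball (0 : ℂ) 1 \ {0}

theorem isOpen_pDisk : IsOpen pDisk := isOpen_ball.sdiff isClosed_singleton

theorem exists_cutoff_one_on_annulus {l : ℝ} (hl : 0 < l) :
    ∃ ζ : ℂ → ℝ, ContDiff ℝ ∞ ζ ∧ HasCompactSupport ζ ∧ tsupport ζ ⊆ pDisk ∧
      ∀ z : ℂ, l ^ 2 / 2 < Complex.normSq z → Complex.normSq z < 1 / 4 → ζ z = 1 := by
  set S := Real.smoothTransition with hS
  have hSc : ContDiff ℝ ∞ S := Real.smoothTransition.contDiff (n := ⊤)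
  set ζ : ℂ → ℝ := fun z => S ((Complex.normSq z - l ^ 2 / 4) / (l ^ 2 / 4))
    * S ((1 / 2 - Complex.normSq z) / (1 / 4)) with hζ
  have hsupp : tsupport ζ ⊆ {z | l ^ 2 / 4 ≤ Complex.normSq z ∧ Complex.normSq z ≤ 1 / 2} := by
    refine closure_minimal (fun z hz => ?_) ?_
    · by_contra h
      apply hz
      rw [mem_ofPred_eq, not_and_or, not_le, not_le] at h
      simp only [hζ]
      rcases h with h | h
      · rw [hS, Real.smoothTransition.zero_of_nonpos
          (div_nonpos_of_nonpos_of_nonneg (by linarith) (by positivity)), zero_mul]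
      · rw [hS, mul_comm, Real.smoothTransition.zero_of_nonpos
          (div_nonpos_of_nonpos_of_nonneg (by linarith) (by positivity)), zero_mul]
    · exact (isClosed_le continuous_const contDiff_normSq.continuous).inter
        (isClosed_le contDiff_normSq.continuous continuous_const)
  refine ⟨ζ, ?_, ?_, fun z hz => ⟨?_, ?_⟩, fun z h1 h2 => ?_⟩
  · exact (hSc.comp ((contDiff_normSq.sub contDiff_const).div_const _)).mul
      (hSc.comp ((contDiff_const.sub contDiff_normSq).div_const _))
  · refine HasCompactSupport.intro (isCompact_closedBall (0 : ℂ) 1) fun z hz => ?_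
    refine image_eq_zero_of_notMem_tsupport fun h => hz ?_
    have := (hsupp h).2
    rw [Complex.normSq_eq_norm_sq] at this
    simp only [mem_closedBall, dist_zero_right]
    nlinarith [norm_nonneg z]
  · have := (hsupp hz).2
    rw [Complex.normSq_eq_norm_sq] at this
    simp only [mem_ball, dist_zero_right]
    nlinarith [norm_nonneg z]
  · rintro rfl
    have := (hsupp hz).1
    rw [map_zero] at this
    have : 0 < l ^ 2 := by positivity
    linarith
  · simp only [hζ]
    rw [hS, Real.smoothTransition.one_of_one_le (by rw [le_div_iff₀ (by positivity)]; linarith),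
      Real.smoothTransition.one_of_one_le (by rw [le_div_iff₀ (by positivity)]; linarith), one_mul]

theorem eLpNorm_two_sq (g : ℂ → ℝ) (μ : Measure ℂ) :
    eLpNorm g 2 μ ^ 2 = ∫⁻ z, ‖g z‖ₑ ^ 2 ∂μ := by
  rw [eLpNorm_eq_lintegral_rpow_enorm_toReal (by norm_num) (by norm_num),
    ← ENNReal.rpow_natCast, ← ENNReal.rpow_mul]
  norm_num

theorem annW_subset_pDisk {r : ℝ} (hr : 0 < r) (hr1 : 4 * r ≤ 1) : annW r ⊆ pDisk := fun z hz =>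
  ⟨by simpa using hz.2.trans_le hr1, by
    rintro rfl
    have := hz.1
    rw [norm_zero] at this
    linarith⟩

/-- Weighted energy inequality for conformal maps on the punctured disk. -/
theorem exists_weighted_energy_le (n : ℕ) {p : ℝ} (hp1 : 1 < p) (hp2 : p < 2) :
    ∃ C δ : ℝ≥0∞, C ≠ ⊤ ∧ δ ≠ 0 ∧
      ∀ (f : ℂ → EuclideanSpace ℝ (Fin n)) (G : Fin 2 → ℂ → EuclideanSpace ℝ (Fin n))
        (H : Fin 2 → Fin 2 → ℂ → EuclideanSpace ℝ (Fin n)) (b : ℂ → ℝ),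
      ConfData p pDisk f G H b →
      ∀ Θ : ℝ → ℝ, ContDiff ℝ ∞ Θ → HasCompactSupport Θ → (∀ x, 0 ≤ Θ x) →
      ∀ (J : Finset ℤ) (s : ℤ → ℝ≥0∞), (∀ j, s j ≠ ⊤) →
      (∀ z : ℂ, Complex.normSq z ∈ tsupport Θ → ∃ j ∈ J, z ∈ ann (2 ^ j)) →
      (∀ j ∈ J, j ≤ -4) →
      (∀ j ∈ J, ∀ z ∈ ann (2 ^ j),
        ENNReal.ofReal (Complex.normSq z * Θ (Complex.normSq z)) ≤ s j) →
      ∀ B : ℝ≥0∞, B ≤ δ → (∀ j ∈ J, eLpNorm b 2 (volume.restrict (annW (2 ^ j))) ≤ B) →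
      ∫⁻ z in pDisk, ENNReal.ofReal (Complex.normSq z * Θ (Complex.normSq z) / 2)
          * ‖gradLen G z‖ₑ ^ 2
        ≤ (∫⁻ z in pDisk, ENNReal.ofReal (|Θ (Complex.normSq z)
            + Complex.normSq z * deriv Θ (Complex.normSq z)| * Complex.normSq z)
            * ‖gradLen G z‖ₑ ^ 2)
          + C * B * ∑ j ∈ J, s j * ∫⁻ z in annW (2 ^ j), ‖gradLen G z‖ₑ ^ 2 := by
  obtain ⟨C₁, hC₁, hcomp⟩ := exists_lintegral_component_le n hp1 hp2
  obtain ⟨C₂, δ, hC₂, hδ, hlap⟩ := exists_eLpNorm_laplacian_le n hp1 hp2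
  refine ⟨(n : ℝ≥0∞) * (C₁ * C₂ * 2), δ, ENNReal.mul_ne_top (by simp)
    (ENNReal.mul_ne_top (ENNReal.mul_ne_top hC₁ hC₂) (by norm_num)), hδ, ?_⟩
  intro f G H b hD Θ hΘ hΘc hΘ0 J s hst hcov hJ hs B hBδ hB
  obtain ⟨m₀, hm₀⟩ := J.bddBelow
  -- As m₀ bounds J from below, 2^(m₀ - 1) is at most the inner radius of every widened annulus.
  obtain ⟨ζ, hζ, hζc, hζs, hζ1⟩ := exists_cutoff_one_on_annulus (l := 2 ^ (m₀ - 1)) (by positivity)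
  have hpow : ∀ j ∈ J, (2 : ℝ) ^ j ≤ 1 / 16 := fun j hj => by
    calc (2 : ℝ) ^ j ≤ 2 ^ (-4 : ℤ) := zpow_le_zpow_right₀ one_le_two (hJ j hj)
      _ = 1 / 16 := by norm_num
  set O : Set ℂ := {z | (2 ^ (m₀ - 1) : ℝ) ^ 2 / 2 < Complex.normSq z ∧ Complex.normSq z < 1 / 4}
    with hO
  have hOo : IsOpen O := (isOpen_lt continuous_const contDiff_normSq.continuous).inter
    (isOpen_lt contDiff_normSq.continuous continuous_const)
  have hJO : ∀ j ∈ J, annW (2 ^ j) ⊆ O := fun j hj z hz => by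
    have h1 : (2 : ℝ) ^ (m₀ - 1) ≤ ‖z‖ := by
      refine le_trans ?_ hz.1
      rw [zpow_sub_one₀ two_ne_zero, ← div_eq_mul_inv]
      exact div_le_div_of_nonneg_right (zpow_le_zpow_right₀ one_le_two (hm₀ (Finset.mem_coe.2 hj))) zero_le_two
    have h2 : ‖z‖ < 1 / 4 := hz.2.trans_le (by linarith [hpow j hj])
    have h3 : (0 : ℝ) < 2 ^ (m₀ - 1) := by positivity
    rw [hO, mem_ofPred_eq, Complex.normSq_eq_norm_sq]
    constructor <;> nlinarith
  have hk := fun k => hcomp pDisk O isOpen_pDisk hOo f G H b hD ζ hζ hζc hζs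
    (fun z hz => hζ1 z hz.1 hz.2) Θ hΘ hΘc hΘ0 J s hst hcov hJO hs k
  set μ := (volume : Measure ℂ).restrict pDisk with hμ
  have hGm : ∀ i k, AEStronglyMeasurable (fun z => G i z k) μ := fun i k =>
    (EuclideanSpace.proj k : EuclideanSpace ℝ (Fin n) →L[ℝ] ℝ).continuous.comp_aestronglyMeasurable
      (hD.deriv i 0).1.aestronglyMeasurable
  have hNc : Continuous fun z : ℂ => Complex.normSq z := contDiff_normSq.continuous
  have hθc : Continuous fun z : ℂ => Θ (Complex.normSq z) := hΘ.continuous.comp hNc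
  have hΨc : Continuous fun z : ℂ => |Θ (Complex.normSq z)
      + Complex.normSq z * deriv Θ (Complex.normSq z)| :=
    (hθc.add (hNc.mul ((hΘ.continuous_deriv (by norm_cast)).comp hNc))).abs
  have hre : AEStronglyMeasurable (fun z : ℂ => z.re) μ :=
    Complex.continuous_re.aestronglyMeasurable
  have him : AEStronglyMeasurable (fun z : ℂ => z.im) μ :=
    Complex.continuous_im.aestronglyMeasurable
  have mW : ∀ k, AEMeasurable (fun z : ℂ => ‖-z.im * G 0 z k + z.re * G 1 z k‖ₑ ^ 2) μ := fun k =>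
    ((him.neg.mul (hGm 0 k)).add (hre.mul (hGm 1 k))).enorm.pow_const 2
  have mE : ∀ k, AEMeasurable (fun z : ℂ => ‖z.re * G 0 z k + z.im * G 1 z k‖ₑ ^ 2) μ := fun k =>
    ((hre.mul (hGm 0 k)).add (him.mul (hGm 1 k))).enorm.pow_const 2
  have hsum := Finset.sum_le_sum fun k (_ : k ∈ (Finset.univ : Finset (Fin n))) => hk k
  have mθ : ∀ k ∈ (Finset.univ : Finset (Fin n)), AEMeasurable (fun z : ℂ =>
      ENNReal.ofReal (Θ (Complex.normSq z))
        * ‖-z.im * G 0 z k + z.re * G 1 z k‖ₑ ^ 2) μ := fun k _ =>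
    hθc.measurable.ennreal_ofReal.aemeasurable.mul (mW k)
  have mΨ : ∀ k ∈ (Finset.univ : Finset (Fin n)), AEMeasurable (fun z : ℂ =>
      ENNReal.ofReal |Θ (Complex.normSq z) + Complex.normSq z * deriv Θ (Complex.normSq z)|
        * (‖z.re * G 0 z k + z.im * G 1 z k‖ₑ ^ 2
          + ‖-z.im * G 0 z k + z.re * G 1 z k‖ₑ ^ 2)) μ := fun k _ =>
    hΨc.measurable.ennreal_ofReal.aemeasurable.mul ((mE k).add (mW k))
  rw [Finset.sum_add_distrib, ← lintegral_finsetSum' _ mθ, ← lintegral_finsetSum' _ mΨ] at hsum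
  refine le_trans (le_of_eq ?_) (hsum.trans (add_le_add (le_of_eq ?_) ?_))
  · refine lintegral_congr_ae ?_
    filter_upwards [hD.conformal] with z hz
    rw [← Finset.mul_sum]
    simp only [enorm_sq_eq_ofReal]
    rw [← ENNReal.ofReal_sum_of_nonneg fun _ _ => sq_nonneg _, sum_angular_sq_of_conformal hz,
      ← ENNReal.ofReal_mul (hΘ0 _), ← ENNReal.ofReal_mul (by
        have := mul_nonneg (Complex.normSq_nonneg z) (hΘ0 (Complex.normSq z))
        positivity)]
    congr 1
    ring
  · refine lintegral_congr fun z => ?_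
    rw [← Finset.mul_sum]
    simp only [enorm_sq_eq_ofReal, ← ENNReal.ofReal_add (sq_nonneg _) (sq_nonneg _)]
    rw [← ENNReal.ofReal_sum_of_nonneg fun _ _ => by positivity, sum_radial_angular_sq,
      ← ENNReal.ofReal_mul (abs_nonneg _), ← ENNReal.ofReal_mul
        (mul_nonneg (abs_nonneg _) (Complex.normSq_nonneg z))]
    congr 1
    ring
  · rw [Finset.sum_const, Finset.card_univ, Fintype.card_fin, nsmul_eq_mul, Finset.mul_sum,
      Finset.mul_sum]
    refine Finset.sum_le_sum fun j hj => ?_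
    have hr : (0 : ℝ) < 2 ^ j := by positivity
    have h1 := hlap pDisk isOpen_pDisk G H b hD.toGradData hD.memLp_grad hD.memLp_hess (2 ^ j) hr
      (annW_subset_pDisk hr (by linarith [hpow j hj])) ((hB j hj).trans hBδ)
    rw [← eLpNorm_two_sq]
    set X := eLpNorm (gradLen G) 2 (volume.restrict (annW (2 ^ j))) with hX
    -- The powers of the radius from the Sobolev and the Laplacian estimates cancel, so the error
    -- has the same scaling as the energy and can be summed over annuli.
    have h2 : ENNReal.ofReal (((2 : ℝ) ^ j) ^ (2 - 2 / p))
        * ENNReal.ofReal (((2 : ℝ) ^ j) ^ (2 / p - 2)) = 1 := by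
      rw [← ENNReal.ofReal_mul (by positivity), ← Real.rpow_add hr]
      simp
    calc _ ≤ (n : ℝ≥0∞) * (s j * (C₁ * ENNReal.ofReal (((2 : ℝ) ^ j) ^ (2 - 2 / p))
          * (C₂ * ENNReal.ofReal (((2 : ℝ) ^ j) ^ (2 / p - 2)) * B * X) * (2 * X))) := by
          refine mul_le_mul' le_rfl (mul_le_mul' le_rfl (mul_le_mul' (mul_le_mul' le_rfl ?_)
            le_rfl))
          exact h1.trans (mul_le_mul' (mul_le_mul' le_rfl (hB j hj)) le_rfl)
      _ = (n : ℝ≥0∞) * (C₁ * C₂ * 2) * B * (s j * X ^ 2)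
          * (ENNReal.ofReal (((2 : ℝ) ^ j) ^ (2 - 2 / p))
            * ENNReal.ofReal (((2 : ℝ) ^ j) ^ (2 / p - 2))) := by ring
      _ = _ := by rw [h2, mul_one]

end decay

/-! ### Regularised and truncated weights. -/

section weight

/-- A regularization of the weight `ρ ^ (-s / 2)`. -/
def wgt (s ε ρ : ℝ) : ℝ := (ρ + ε ^ 2) ^ (-s / 2)

theorem wgt_pos {s ε ρ : ℝ} (hε : 0 < ε) (hρ : 0 ≤ ρ) : 0 < wgt s ε ρ :=
  Real.rpow_pos_of_pos (by positivity) _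

theorem wgt_anti {s ε ρ ρ' : ℝ} (hs : 0 ≤ s) (hε : 0 < ε) (hρ : 0 ≤ ρ) (h : ρ ≤ ρ') :
    wgt s ε ρ' ≤ wgt s ε ρ :=
  Real.rpow_le_rpow_of_nonpos (by positivity) (by linarith) (by linarith)

/-- Compares the weight at the inner radius of a dyadic annulus with its values on the widened
annulus, where |z|² is at most 4² = 16 times larger; 16^(-s/2) ≥ 1/4 for s ≤ 1. -/
theorem wgt_le_four_mul {s ε ρ ρ' : ℝ} (hs : 0 ≤ s) (hs1 : s ≤ 1) (hε : 0 < ε) (hρ : 0 ≤ ρ)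
    (hρ' : 0 ≤ ρ') (h : ρ' ≤ 16 * ρ) : wgt s ε ρ ≤ 4 * wgt s ε ρ' := by
  have h1 : (16 * (ρ + ε ^ 2)) ^ (-s / 2) ≤ wgt s ε ρ' :=
    Real.rpow_le_rpow_of_nonpos (by positivity) (by nlinarith [sq_nonneg ε]) (by linarith)
  rw [Real.mul_rpow (by norm_num) (by positivity)] at h1
  have h2 : (1 / 4 : ℝ) ≤ 16 ^ (-s / 2) := by
    calc (1 / 4 : ℝ) = 16 ^ (-(1 / 2) : ℝ) := by
          rw [Real.rpow_neg (by norm_num), ← Real.sqrt_eq_rpow,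
            show (16 : ℝ) = 4 ^ 2 by norm_num, Real.sqrt_sq (by norm_num)]
          norm_num
      _ ≤ 16 ^ (-s / 2) := Real.rpow_le_rpow_of_exponent_le (by norm_num) (by linarith)
  have h3 : (0 : ℝ) < wgt s ε ρ := wgt_pos hε hρ
  have h4 : (1 / 4 : ℝ) * wgt s ε ρ ≤ wgt s ε ρ' :=
    (mul_le_mul_of_nonneg_right h2 h3.le).trans h1
  linarith

theorem wgt_le_rpow {s ε r ρ : ℝ} (hs : 0 ≤ s) (hr : 0 < r) (h : r ^ 2 ≤ ρ) :
    wgt s ε ρ ≤ r ^ (-s) := by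
  calc wgt s ε ρ ≤ (r ^ 2) ^ (-s / 2) :=
        Real.rpow_le_rpow_of_nonpos (by positivity) (by nlinarith [sq_nonneg ε]) (by linarith)
    _ = r ^ (-s) := by
        rw [← Real.rpow_natCast, ← Real.rpow_mul hr.le]
        congr 1
        push_cast
        ring

/-- On the disk of radius ε the regularised weight is still of size ε^(-s), so a weighted bound
uniform in ε is a decay rate. -/
theorem rpow_le_two_mul_wgt {s ε ρ : ℝ} (hs : 0 ≤ s) (hs1 : s ≤ 1) (hε : 0 < ε) (hρ : 0 ≤ ρ)
    (h : ρ ≤ ε ^ 2) : ε ^ (-s) ≤ 2 * wgt s ε ρ := by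
  have h1 : (2 * ε ^ 2) ^ (-s / 2) ≤ wgt s ε ρ :=
    Real.rpow_le_rpow_of_nonpos (by positivity) (by linarith) (by linarith)
  have h3 : (ε ^ 2) ^ (-s / 2) = ε ^ (-s) := by
    rw [← Real.rpow_natCast, ← Real.rpow_mul hε.le]
    congr 1
    push_cast
    ring
  rw [Real.mul_rpow (by norm_num) (by positivity), h3] at h1
  have h2 : (1 / 2 : ℝ) ≤ 2 ^ (-s / 2) := by
    calc (1 / 2 : ℝ) = 2 ^ (-1 : ℝ) := by rw [Real.rpow_neg_one]; norm_num
      _ ≤ 2 ^ (-s / 2) := Real.rpow_le_rpow_of_exponent_le (by norm_num) (by linarith)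
  have h4 : (0 : ℝ) < ε ^ (-s) := Real.rpow_pos_of_pos hε _
  nlinarith

theorem hasDerivAt_wgt {s ε ρ : ℝ} (hε : 0 < ε) (hρ : 0 ≤ ρ) :
    HasDerivAt (wgt s ε) (-s / 2 * (ρ + ε ^ 2) ^ (-s / 2 - 1)) ρ := by
  have := ((hasDerivAt_id ρ).add_const (ε ^ 2)).rpow_const (p := -s / 2)
    (Or.inl (by simp only [id]; positivity))
  change HasDerivAt (fun y => (y + ε ^ 2) ^ (-s / 2)) _ _
  simpa using this

theorem deriv_smoothTransition_of_one_lt {x : ℝ} (hx : 1 < x) :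
    deriv Real.smoothTransition x = 0 := by
  have : Real.smoothTransition =ᶠ[𝓝 x] fun _ => 1 := by
    filter_upwards [lt_mem_nhds hx] with y hy
    exact Real.smoothTransition.one_of_one_le hy.le
  rw [this.deriv_eq, deriv_const]

theorem deriv_smoothTransition_of_neg {x : ℝ} (hx : x < 0) :
    deriv Real.smoothTransition x = 0 := by
  have : Real.smoothTransition =ᶠ[𝓝 x] fun _ => 0 := by
    filter_upwards [gt_mem_nhds hx] with y hy
    exact Real.smoothTransition.zero_of_nonpos hy.le
  rw [this.deriv_eq, deriv_const]

theorem exists_deriv_smoothTransition_le :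
    ∃ K : ℝ, 0 ≤ K ∧ ∀ x, |deriv Real.smoothTransition x| ≤ K := by
  have hSc : ContDiff ℝ 1 Real.smoothTransition := Real.smoothTransition.contDiff (n := 1)
  have hd : ∀ x ∉ Icc (0 : ℝ) 1, deriv Real.smoothTransition x = 0 := fun x hx => by
    rw [mem_Icc, not_and_or, not_le, not_le] at hx
    exact hx.elim deriv_smoothTransition_of_neg deriv_smoothTransition_of_one_lt
  obtain ⟨K, hK⟩ := (isCompact_Icc (a := (0 : ℝ)) (b := 1)).exists_bound_of_continuousOn
    (hSc.continuous_deriv le_rfl).continuousOn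
  refine ⟨|K|, abs_nonneg _, fun x => ?_⟩
  by_cases hx : x ∈ Icc (0 : ℝ) 1
  · exact (hK x hx).trans (le_abs_self K)
  · rw [hd x hx, abs_zero]
    exact abs_nonneg _

/-- A truncation of `ρ ↦ wgt s ε ρ / ρ` to the range `t ^ 2 ≤ ρ ≤ 4 * r ^ 2`. -/
theorem exists_truncated_weight : ∃ K : ℝ, 0 ≤ K ∧ ∀ s ε t r : ℝ, 0 < s → 0 < ε → 0 < t → 0 < r →
    ∃ Θ : ℝ → ℝ, ContDiff ℝ ∞ Θ ∧ HasCompactSupport Θ ∧ (∀ x, 0 ≤ Θ x) ∧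
      tsupport Θ ⊆ Icc (t ^ 2) (4 * r ^ 2) ∧ (∀ ρ, 0 ≤ ρ → ρ * Θ ρ ≤ wgt s ε ρ) ∧
      (∀ ρ, 4 * t ^ 2 ≤ ρ → ρ ≤ r ^ 2 → ρ * Θ ρ = wgt s ε ρ) ∧
      ∀ ρ, 0 ≤ ρ → |Θ ρ + ρ * deriv Θ ρ| * ρ ≤ s / 2 * (ρ * Θ ρ)
        + ((Iic (4 * t ^ 2)).indicator (fun _ => K * wgt s ε ρ) ρ
          + (Ici (r ^ 2)).indicator (fun _ => K * wgt s ε ρ) ρ) := by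
  obtain ⟨K₀, hK₀, hK⟩ := exists_deriv_smoothTransition_le
  -- On a transition range ρ is at most four times the squared radius, while the argument of the
  -- transition function has slope one third of its inverse.
  refine ⟨4 / 3 * K₀, by positivity, fun s ε t r hs hε ht hr => ?_⟩
  set S := Real.smoothTransition with hS
  have hSc : ContDiff ℝ ∞ S := Real.smoothTransition.contDiff (n := ⊤)
  have ht2 : 0 < t ^ 2 := by positivity
  have hr2 : 0 < r ^ 2 := by positivity
  -- χ₁ rises on [t², 4t²] and χ₂ falls on [r², 4r²]. These ranges are scale invariant, so ρ times
  -- the derivative is bounded independently of t and r.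
  set χ₁ : ℝ → ℝ := fun ρ => S ((ρ / t ^ 2 - 1) / 3) with hχ₁
  set χ₂ : ℝ → ℝ := fun ρ => S ((4 - ρ / r ^ 2) / 3) with hχ₂
  have c1 : ContDiff ℝ ∞ χ₁ :=
    hSc.comp (((contDiff_id.div_const _).sub contDiff_const).div_const _)
  have c2 : ContDiff ℝ ∞ χ₂ :=
    hSc.comp ((contDiff_const.sub (contDiff_id.div_const _)).div_const _)
  have p1 : ∀ ρ, 0 ≤ χ₁ ρ := fun ρ => Real.smoothTransition.nonneg _
  have p2 : ∀ ρ, 0 ≤ χ₂ ρ := fun ρ => Real.smoothTransition.nonneg _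
  have q1 : ∀ ρ, χ₁ ρ ≤ 1 := fun ρ => Real.smoothTransition.le_one _
  have q2 : ∀ ρ, χ₂ ρ ≤ 1 := fun ρ => Real.smoothTransition.le_one _
  have z1 : ∀ ρ, ρ ≤ t ^ 2 → χ₁ ρ = 0 := fun ρ h =>
    Real.smoothTransition.zero_of_nonpos (div_nonpos_of_nonpos_of_nonneg
      (by rw [sub_nonpos, div_le_one ht2]; exact h) (by norm_num))
  have z2 : ∀ ρ, 4 * r ^ 2 ≤ ρ → χ₂ ρ = 0 := fun ρ h =>
    Real.smoothTransition.zero_of_nonpos (div_nonpos_of_nonpos_of_nonneg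
      (by rw [sub_nonpos, le_div_iff₀ hr2]; exact h) (by norm_num))
  set Θ : ℝ → ℝ := fun ρ => χ₁ ρ * χ₂ ρ * wgt s ε ρ / ρ with hΘ
  have hsupp : tsupport Θ ⊆ Icc (t ^ 2) (4 * r ^ 2) := by
    refine closure_minimal (fun ρ hρ => ?_) isClosed_Icc
    by_contra h
    apply hρ
    rw [mem_Icc, not_and_or, not_le, not_le] at h
    simp only [hΘ]
    rcases h with h | h
    · simp [z1 ρ h.le]
    · simp [z2 ρ h.le]
  have h0 : ∀ ρ, ρ < t ^ 2 → Θ =ᶠ[𝓝 ρ] fun _ => 0 := fun ρ h => by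
    filter_upwards [gt_mem_nhds h] with x hx
    simp [hΘ, z1 x hx.le]
  have hpos : ∀ ρ, 0 < ρ → ρ * Θ ρ = χ₁ ρ * χ₂ ρ * wgt s ε ρ := fun ρ h => by
    simp only [hΘ]
    field_simp
  have hcd : ContDiff ℝ ∞ Θ := by
    rw [contDiff_iff_contDiffAt]
    intro ρ
    rcases lt_or_ge ρ (t ^ 2) with h | h
    · exact contDiffAt_const.congr_of_eventuallyEq (h0 ρ h)
    · have hρ : 0 < ρ := ht2.trans_le h
      refine (((c1.contDiffAt.mul c2.contDiffAt).mul ?_).div contDiffAt_id hρ.ne')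
      exact (contDiffAt_id.add contDiffAt_const).rpow_const_of_ne (by simp only [id]; positivity)
  refine ⟨Θ, hcd, HasCompactSupport.of_support_subset_isCompact isCompact_Icc
    ((subset_tsupport _).trans hsupp), fun x => ?_, hsupp, fun ρ hρ => ?_, fun ρ h1 h2 => ?_,
    fun ρ hρ => ?_⟩
  · rcases le_or_gt x (t ^ 2) with h | h
    · simp [hΘ, z1 x h]
    · have hx : 0 < x := ht2.trans h
      exact div_nonneg (mul_nonneg (mul_nonneg (p1 x) (p2 x)) (wgt_pos hε hx.le).le) hx.le
  · rcases hρ.eq_or_lt with h | h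
    · rw [← h, zero_mul]
      exact (wgt_pos hε le_rfl).le
    · rw [hpos ρ h]
      exact mul_le_of_le_one_left (wgt_pos hε hρ).le (mul_le_one₀ (q1 ρ) (p2 ρ) (q2 ρ))
  · rw [hpos ρ (by linarith)]
    have e1 : χ₁ ρ = 1 := Real.smoothTransition.one_of_one_le (by
      rw [le_div_iff₀ (by norm_num), le_sub_iff_add_le, le_div_iff₀ ht2]; linarith)
    have e2 : χ₂ ρ = 1 := Real.smoothTransition.one_of_one_le (by
      rw [le_div_iff₀ (by norm_num), le_sub_comm, div_le_iff₀ hr2]; linarith)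
    rw [e1, e2, one_mul, one_mul]
  · have hi1 : 0 ≤ (Iic (4 * t ^ 2)).indicator (fun _ => 4 / 3 * K₀ * wgt s ε ρ) ρ :=
      indicator_nonneg (fun _ _ => mul_nonneg (by positivity) (wgt_pos hε hρ).le) _
    have hi2 : 0 ≤ (Ici (r ^ 2)).indicator (fun _ => 4 / 3 * K₀ * wgt s ε ρ) ρ :=
      indicator_nonneg (fun _ _ => mul_nonneg (by positivity) (wgt_pos hε hρ).le) _
    rcases lt_or_ge ρ (t ^ 2) with h | h
    · rw [(h0 ρ h).deriv_eq, (h0 ρ h).eq_of_nhds, deriv_const]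
      simp only [mul_zero, add_zero, abs_zero, zero_mul, zero_add]
      exact add_nonneg hi1 hi2
    have hρ0 : 0 < ρ := ht2.trans_le h
    set L := wgt s ε ρ with hL
    have hL0 : 0 < L := wgt_pos hε hρ
    set L' := -s / 2 * (ρ + ε ^ 2) ^ (-s / 2 - 1) with hL'
    set d₁ := deriv S ((ρ / t ^ 2 - 1) / 3) * (1 / t ^ 2 / 3) with hd₁
    set d₂ := deriv S ((4 - ρ / r ^ 2) / 3) * (-(1 / r ^ 2) / 3) with hd₂
    have D1 : HasDerivAt χ₁ d₁ ρ := by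
      refine HasDerivAt.comp ρ (hSc.differentiable (by norm_num) _).hasDerivAt ?_
      exact (((hasDerivAt_id ρ).div_const _).sub_const _).div_const _
    have D2 : HasDerivAt χ₂ d₂ ρ := by
      refine HasDerivAt.comp ρ (hSc.differentiable (by norm_num) _).hasDerivAt ?_
      exact (((hasDerivAt_id ρ).div_const _).const_sub _).div_const _
    have D3 := (D1.mul D2).mul (hasDerivAt_wgt (s := s) hε hρ)
    have D4 := (hasDerivAt_id ρ).mul (hcd.differentiable (by norm_num) ρ).hasDerivAt
    -- This is the derivative of ρ Θ(ρ) = χ₁ χ₂ · weight. When it falls on the weight it costs the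
    -- factor s/2 after multiplication by ρ; the other terms live on the transition ranges.
    have heq : Θ ρ + ρ * deriv Θ ρ = (d₁ * χ₂ ρ + χ₁ ρ * d₂) * L + χ₁ ρ * χ₂ ρ * L' := by
      have hev : id * Θ =ᶠ[𝓝 ρ] χ₁ * χ₂ * wgt s ε := by
        filter_upwards [lt_mem_nhds hρ0] with x hx
        exact hpos x hx
      have := D4.unique (D3.congr_of_eventuallyEq hev)
      simpa using this
    have hL'ρ : |L'| * ρ ≤ s / 2 * L := by
      have hp : 0 < ρ + ε ^ 2 := by positivity
      have hpw : (ρ + ε ^ 2) ^ (-s / 2 - 1) * (ρ + ε ^ 2) = L := by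
        rw [hL, wgt, ← Real.rpow_add_one hp.ne']
        congr 1
        ring
      have hq : 0 < (ρ + ε ^ 2) ^ (-s / 2 - 1) := Real.rpow_pos_of_pos hp _
      rw [hL', abs_mul, abs_of_pos hq, show |-s / 2| = s / 2 by
        rw [abs_of_neg (by linarith)]; ring, mul_assoc]
      refine mul_le_mul_of_nonneg_left ?_ (by positivity)
      rw [← hpw]
      exact mul_le_mul_of_nonneg_left (by linarith [sq_nonneg ε]) hq.le
    have b1 : |d₁| * L * ρ ≤ (Iic (4 * t ^ 2)).indicator (fun _ => 4 / 3 * K₀ * L) ρ := by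
      by_cases hm : ρ ∈ Iic (4 * t ^ 2)
      · rw [indicator_of_mem hm]
        rw [mem_Iic] at hm
        have : |d₁| * ρ ≤ 4 / 3 * K₀ := by
          rw [hd₁, abs_mul, abs_of_pos (show (0 : ℝ) < 1 / t ^ 2 / 3 by positivity)]
          calc _ ≤ K₀ * (1 / t ^ 2 / 3) * (4 * t ^ 2) := by
                refine mul_le_mul (mul_le_mul_of_nonneg_right (hK _) (by positivity)) hm hρ
                  (by positivity)
            _ = 4 / 3 * K₀ := by field_simp
        nlinarith
      · rw [indicator_of_notMem hm, hd₁, deriv_smoothTransition_of_one_lt, zero_mul, abs_zero,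
          zero_mul, zero_mul]
        rw [mem_Iic, not_le] at hm
        rw [lt_div_iff₀ (by norm_num), lt_sub_iff_add_lt, lt_div_iff₀ ht2]
        linarith
    have b2 : |d₂| * L * ρ ≤ (Ici (r ^ 2)).indicator (fun _ => 4 / 3 * K₀ * L) ρ := by
      by_cases hm : ρ ∈ Ici (r ^ 2)
      · rw [indicator_of_mem hm]
        rcases le_or_gt ρ (4 * r ^ 2) with h4 | h4
        · have : |d₂| * ρ ≤ 4 / 3 * K₀ := by
            rw [hd₂, abs_mul, neg_div, abs_neg, abs_of_pos (show (0 : ℝ) < 1 / r ^ 2 / 3 by positivity)]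
            calc _ ≤ K₀ * (1 / r ^ 2 / 3) * (4 * r ^ 2) := by
                  refine mul_le_mul (mul_le_mul_of_nonneg_right (hK _) (by positivity)) h4 hρ
                    (by positivity)
              _ = 4 / 3 * K₀ := by field_simp
          nlinarith
        · rw [hd₂, deriv_smoothTransition_of_neg, zero_mul, abs_zero, zero_mul, zero_mul]
          · positivity
          · refine div_neg_of_neg_of_pos ?_ (by norm_num)
            rw [sub_neg, lt_div_iff₀ hr2]
            exact h4
      · rw [indicator_of_notMem hm, hd₂, deriv_smoothTransition_of_one_lt, zero_mul, abs_zero,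
          zero_mul, zero_mul]
        rw [mem_Ici, not_le] at hm
        rw [lt_div_iff₀ (by norm_num), lt_sub_comm, div_lt_iff₀ hr2]
        linarith
    rw [heq, hpos ρ hρ0]
    have t1 : |(d₁ * χ₂ ρ + χ₁ ρ * d₂) * L + χ₁ ρ * χ₂ ρ * L'|
        ≤ (|d₁| + |d₂|) * L + χ₁ ρ * χ₂ ρ * |L'| := by
      refine (abs_add_le _ _).trans (add_le_add ?_ ?_)
      · rw [abs_mul, abs_of_pos hL0]
        refine mul_le_mul_of_nonneg_right ((abs_add_le _ _).trans (add_le_add ?_ ?_)) hL0.le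
        · rw [abs_mul, abs_of_nonneg (p2 ρ)]
          exact mul_le_of_le_one_right (abs_nonneg _) (q2 ρ)
        · rw [abs_mul, abs_of_nonneg (p1 ρ)]
          exact mul_le_of_le_one_left (abs_nonneg _) (q1 ρ)
      · rw [abs_mul, abs_of_nonneg (mul_nonneg (p1 ρ) (p2 ρ))]
    have t2 := mul_le_mul_of_nonneg_right t1 hρ
    have t3 := mul_le_mul_of_nonneg_left hL'ρ (mul_nonneg (p1 ρ) (p2 ρ))
    nlinarith

end weight

/-! ### Decay of the energy at the puncture. -/

section decay

theorem ENNReal.ofReal_sub_mul_le {a b : ℝ} {X Y : ℝ≥0∞} (hb : 0 ≤ b) (hab : b ≤ a) (hX : X ≠ ⊤)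
    (h : ENNReal.ofReal a * X ≤ ENNReal.ofReal b * X + Y) : ENNReal.ofReal (a - b) * X ≤ Y := by
  have h1 : ENNReal.ofReal a = ENNReal.ofReal b + ENNReal.ofReal (a - b) := by
    rw [← ENNReal.ofReal_add hb (by linarith)]
    congr 1
    ring
  rw [h1, add_mul] at h
  exact (ENNReal.add_le_add_iff_left (ENNReal.mul_ne_top ENNReal.ofReal_ne_top hX)).1 h

theorem tendsto_setLIntegral_ball {μ : Measure ℂ} (hμ : μ ≤ volume) {w : ℂ → ℝ≥0∞}
    (hw : ∫⁻ z, w z ∂μ ≠ ⊤) :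
    Tendsto (fun r : ℝ => ∫⁻ z in ball 0 r, w z ∂μ) (𝓝 0) (𝓝 0) := by
  refine tendsto_setLIntegral_zero hw ?_
  have h : Tendsto (fun r : ℝ => ENNReal.ofReal r ^ 2 * NNReal.pi) (𝓝 0) (𝓝 0) := by
    have h1 : Tendsto (fun r : ℝ => ENNReal.ofReal r ^ 2) (𝓝 0) (𝓝 0) := by
      have := ENNReal.Tendsto.pow (n := 2) (ENNReal.continuous_ofReal.tendsto 0)
      simpa using this
    simpa using ENNReal.Tendsto.mul_const h1 (Or.inr ENNReal.coe_ne_top)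
  refine tendsto_of_tendsto_of_tendsto_of_le_of_le tendsto_const_nhds h (fun _ => zero_le)
    fun r => ?_
  rw [← Complex.volume_ball 0 r]
  exact hμ _

theorem pairwise_disjoint_ann_zpow (i : ℤ) :
    Pairwise (Function.onFun Disjoint fun j : ℤ => ann (2 ^ (j + i))) := by
  have key : ∀ j k : ℤ, j < k → Disjoint (ann (2 ^ (j + i))) (ann (2 ^ (k + i))) := by
    intro j k hjk
    refine Set.disjoint_left.2 fun z hz hz' => ?_
    have h : (2 : ℝ) * 2 ^ (j + i) ≤ 2 ^ (k + i) := by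
      rw [← zpow_one_add₀ two_ne_zero]
      exact zpow_le_zpow_right₀ one_le_two (by omega)
    exact absurd (hz'.1.trans_lt hz.2) (not_lt.2 h)
  intro j k hjk
  rcases lt_or_gt_of_ne hjk with h | h
  · exact key j k h
  · exact (key k j h).symm

theorem annW_zpow_subset (j : ℤ) :
    annW (2 ^ j) ⊆ ann (2 ^ (j + (-1))) ∪ ann (2 ^ (j + 0)) ∪ ann (2 ^ (j + 1)) := by
  intro z hz
  have h1 : (2 : ℝ) ^ (j + (-1)) = 2 ^ j / 2 := by
    rw [zpow_add₀ two_ne_zero, zpow_neg_one, div_eq_mul_inv]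
  have h2 : (2 : ℝ) ^ (j + 1) = 2 ^ j * 2 := zpow_add_one₀ two_ne_zero j
  have ha := hz.1
  have hb := hz.2
  rw [add_zero]
  simp only [mem_union, ann, mem_ofPred_eq, h1, h2]
  rcases lt_or_ge ‖z‖ (2 ^ j) with h | h
  · exact Or.inl (Or.inl ⟨ha, by linarith⟩)
  · rcases lt_or_ge ‖z‖ (2 ^ j * 2) with h' | h'
    · exact Or.inl (Or.inr ⟨h, by linarith⟩)
    · exact Or.inr ⟨h', by linarith⟩

/-- A widened annulus is covered by three consecutive dyadic ones, and the dyadic annuli are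
disjoint. -/
theorem sum_lintegral_annW_le (μ : Measure ℂ) (w : ℂ → ℝ≥0∞) (J : Finset ℤ) {r : ℝ}
    (hJ : ∀ j ∈ J, 4 * (2 : ℝ) ^ j ≤ r) :
    ∑ j ∈ J, ∫⁻ z in annW (2 ^ j), w z ∂μ ≤ 3 * ∫⁻ z in ball 0 r, w z ∂μ := by
  have key : ∀ i : ℤ, i ≤ 1 →
      ∑ j ∈ J, ∫⁻ z in ann (2 ^ (j + i)), w z ∂μ ≤ ∫⁻ z in ball 0 r, w z ∂μ := by
    intro i hi
    rw [← lintegral_biUnion_finset (fun j _ k _ h => pairwise_disjoint_ann_zpow i h)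
      fun j _ => measurableSet_ann _]
    refine lintegral_mono_set (iUnion₂_subset fun j hj z hz => ?_)
    rw [mem_ball_zero_iff]
    refine hz.2.trans_le (le_trans ?_ (hJ j hj))
    have : (2 : ℝ) ^ (j + i) ≤ 2 ^ (j + 1) := zpow_le_zpow_right₀ one_le_two (by omega)
    rw [zpow_add_one₀ two_ne_zero] at this
    linarith
  calc ∑ j ∈ J, ∫⁻ z in annW (2 ^ j), w z ∂μ
      ≤ ∑ j ∈ J, ((∫⁻ z in ann (2 ^ (j + (-1))), w z ∂μ) + (∫⁻ z in ann (2 ^ (j + 0)), w z ∂μ)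
        + ∫⁻ z in ann (2 ^ (j + 1)), w z ∂μ) :=
        Finset.sum_le_sum fun j _ => (lintegral_mono_set (annW_zpow_subset j)).trans
          ((lintegral_union_le _ _ _).trans (add_le_add (lintegral_union_le _ _ _) le_rfl))
    _ ≤ 3 * ∫⁻ z in ball 0 r, w z ∂μ := by
        rw [Finset.sum_add_distrib, Finset.sum_add_distrib]
        refine (add_le_add (add_le_add (key (-1) (by norm_num)) (key 0 (by norm_num)))
          (key 1 le_rfl)).trans (le_of_eq ?_)
        ring

/-- Energy decay at an isolated singularity of a conformal map: on the disk of radius `ε` the energy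
is `O(ε ^ s)` for every `s < 1`. -/
theorem ConfData.exists_energy_decay {n : ℕ} {p s : ℝ} (hp1 : 1 < p) (hp2 : p < 2) (hs : 0 < s)
    (hs1 : s < 1) {f : ℂ → EuclideanSpace ℝ (Fin n)} {G : Fin 2 → ℂ → EuclideanSpace ℝ (Fin n)}
    {H : Fin 2 → Fin 2 → ℂ → EuclideanSpace ℝ (Fin n)} {b : ℂ → ℝ} (hD : ConfData p pDisk f G H b)
    (hE : ∫⁻ z in pDisk, ‖gradLen G z‖ₑ ^ 2 ≠ ⊤) (hb : ∫⁻ z in pDisk, ‖b z‖ₑ ^ 2 ≠ ⊤) :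
    ∃ (M : ℝ≥0∞) (r : ℝ), M ≠ ⊤ ∧ 0 < r ∧ ∀ ε, 0 < ε → ε ≤ r →
      ∫⁻ z in ball 0 ε, ‖gradLen G z‖ₑ ^ 2 ∂(volume.restrict pDisk)
        ≤ M * ENNReal.ofReal (ε ^ s) := by
  obtain ⟨C, δ, hC, hδ, hmain⟩ := exists_weighted_energy_le n hp1 hp2
  obtain ⟨K, hK0, hK⟩ := exists_truncated_weight
  set μ := (volume : Measure ℂ).restrict pDisk with hμ
  -- The share 1/2 of the angular energy minus the cost s/2 of differentiating the weight; positive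
  -- because s < 1.
  set κ : ℝ := (1 - s) / 2 with hκ
  have hκ0 : 0 < κ := by rw [hκ]; linarith
  have hγm : AEMeasurable (fun z => ‖gradLen G z‖ₑ ^ 2) μ :=
    (aestronglyMeasurable_gradLen fun i => (hD.deriv i 0).1.aestronglyMeasurable).enorm.pow_const 2
  -- 12 = 4 · 3, from the comparability of the weight on a widened annulus and the overlap of these
  -- annuli. The error then uses up at most half of κ.
  set δ' : ℝ≥0∞ := min δ (ENNReal.ofReal (κ / 2) / (C * 12)) with hδ'
  have hδ'0 : 0 < δ' := lt_min (pos_iff_ne_zero.2 hδ) (ENNReal.div_pos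
    (by simpa using by positivity) (ENNReal.mul_ne_top hC (by norm_num)))
  obtain ⟨ρ₀, hρ₀, hρ₀b⟩ : ∃ ρ₀ : ℝ, 0 < ρ₀ ∧ ∫⁻ z in ball 0 ρ₀, ‖b z‖ₑ ^ 2 ∂μ < δ' ^ 2 := by
    have h := (tendsto_setLIntegral_ball Measure.restrict_le_self hb).eventually
      (gt_mem_nhds (ENNReal.pow_pos hδ'0 2))
    have h' : ∀ᶠ r in 𝓝[>] (0 : ℝ), 0 < r ∧ ∫⁻ z in ball 0 r, ‖b z‖ₑ ^ 2 ∂μ < δ' ^ 2 :=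
      (eventually_mem_nhdsWithin.and (h.filter_mono nhdsWithin_le_nhds))
    exact h'.exists
  -- The factor 1/32 keeps the widened annuli, which reach radius 8 r₀, inside the ball of radius ρ₀
  -- where b is small, and keeps the dyadic indices at most -4.
  obtain ⟨m₀, hm₀⟩ := exists_pow_lt_of_lt_one (show (0 : ℝ) < min ρ₀ 1 / 32 by positivity)
    (show (1 / 2 : ℝ) < 1 by norm_num)
  set r₀ : ℝ := 2 ^ (-(m₀ : ℤ)) with hr₀
  have hr₀' : r₀ = (1 / 2) ^ m₀ := by rw [hr₀, zpow_neg, zpow_natCast, one_div, inv_pow]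
  have hr₀0 : 0 < r₀ := by positivity
  have hr₀1 : 8 * r₀ ≤ ρ₀ := by
    rw [hr₀']; linarith [min_le_left ρ₀ 1]
  have hr₀2 : r₀ < 1 / 32 := by
    rw [hr₀']; linarith [min_le_right ρ₀ 1]
  have hm5 : (5 : ℤ) < m₀ := by
    by_contra! h
    have : (2 : ℝ) ^ (-5 : ℤ) ≤ r₀ := zpow_le_zpow_right₀ one_le_two (by omega)
    norm_num at this
    linarith
  set E := ∫⁻ z, ‖gradLen G z‖ₑ ^ 2 ∂μ with hEdef
  set T := ENNReal.ofReal (r₀ ^ (-s)) * E with hT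
  have hTt : T ≠ ⊤ := ENNReal.mul_ne_top ENNReal.ofReal_ne_top hE
  have hN : ∀ (z : ℂ), Complex.normSq z = ‖z‖ ^ 2 := Complex.normSq_eq_norm_sq
  have hNc : Continuous fun z : ℂ => Complex.normSq z := contDiff_normSq.continuous
  -- The point is a bound independent of ε. For fixed ε the regularised weight is bounded, so the
  -- quantity is finite beforehand and may be absorbed.
  have hQ : ∀ ε, 0 < ε → ∫⁻ z in ball 0 r₀, ENNReal.ofReal (wgt s ε (Complex.normSq z))
      * ‖gradLen G z‖ₑ ^ 2 ∂μ
      ≤ (ENNReal.ofReal K + ENNReal.ofReal (κ / 2)) * T / ENNReal.ofReal (κ / 2) := by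
    intro ε hε
    set w : ℂ → ℝ≥0∞ := fun z => ENNReal.ofReal (wgt s ε (Complex.normSq z)) * ‖gradLen G z‖ₑ ^ 2
      with hw
    have hwt : ∫⁻ z, w z ∂μ ≠ ⊤ := by
      refine ne_top_of_le_ne_top (ENNReal.mul_ne_top (ENNReal.ofReal_ne_top (r := wgt s ε 0)) hE) ?_
      rw [← lintegral_const_mul' _ _ ENNReal.ofReal_ne_top]
      exact lintegral_mono fun z => mul_le_mul' (ENNReal.ofReal_le_ofReal
        (wgt_anti hs.le hε le_rfl (Complex.normSq_nonneg z))) le_rfl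
    have hout : ∀ S : Set ℂ, MeasurableSet S → (∀ z ∈ S, r₀ ≤ ‖z‖) → ∫⁻ z in S, w z ∂μ ≤ T := by
      intro S hS h
      calc ∫⁻ z in S, w z ∂μ ≤ ∫⁻ z in S, ENNReal.ofReal (r₀ ^ (-s)) * ‖gradLen G z‖ₑ ^ 2 ∂μ :=
            setLIntegral_mono' hS fun z hz => mul_le_mul' (ENNReal.ofReal_le_ofReal
              (wgt_le_rpow hs.le hr₀0 (by
                rw [hN]; exact pow_le_pow_left₀ hr₀0.le (h z hz) 2))) le_rfl
        _ ≤ T := by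
            rw [lintegral_const_mul' _ _ ENNReal.ofReal_ne_top]
            exact mul_le_mul' le_rfl (setLIntegral_le_lintegral _ _)
    set Q := ∫⁻ z in ball 0 r₀, w z ∂μ with hQd
    have hQt : Q ≠ ⊤ := ne_top_of_le_ne_top hwt (setLIntegral_le_lintegral _ _)
    have hQ8 : ∫⁻ z in ball 0 (8 * r₀), w z ∂μ ≤ Q + T := by
      have : ball (0 : ℂ) (8 * r₀) ⊆ ball 0 r₀ ∪ (ball 0 r₀)ᶜ := by simp
      refine (lintegral_mono_set this).trans ((lintegral_union_le _ _ _).trans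
        (add_le_add le_rfl (hout _ measurableSet_ball.compl fun z hz => ?_)))
      simpa using hz
    -- the inequality with an inner truncation at radius `2 ^ (-m)`
    have step : ∀ m : ℕ, ENNReal.ofReal κ * Q ≤ (ENNReal.ofReal K + ENNReal.ofReal κ)
        * (∫⁻ z in ball 0 (4 * (1 / 2) ^ m), w z ∂μ) + (ENNReal.ofReal K * T
        + ENNReal.ofReal (κ / 2) * (Q + T)) := by
      intro m
      set t : ℝ := 2 ^ (-(m : ℤ)) with ht
      have ht' : t = (1 / 2) ^ m := by rw [ht, zpow_neg, zpow_natCast, one_div, inv_pow]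
      have ht0 : 0 < t := by positivity
      obtain ⟨Θ, hΘ, hΘc, hΘ0, hΘs, hΘle, hΘeq, hΘd⟩ := hK s ε t r₀ hs hε ht0 hr₀0
      -- Indices of the dyadic annuli meeting t ≤ |z| ≤ 2 r₀. The circle |z| = 2 r₀ belongs to the
      -- annulus of index 1 - m₀, so that index is included.
      set J := Finset.Icc (-(m : ℤ)) (1 - m₀) with hJ
      have hJ1 : ∀ j ∈ J, (2 : ℝ) ^ j ≤ 2 * r₀ := fun j hj => by
        rw [hr₀, ← zpow_one_add₀ two_ne_zero]
        exact zpow_le_zpow_right₀ one_le_two (by have := Finset.mem_Icc.1 hj; omega)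
      set B := eLpNorm b 2 (μ.restrict (ball 0 ρ₀)) with hB
      have hBδ : B ≤ δ' := by
        by_contra! h
        have := ENNReal.pow_right_strictMono (n := 2) (by norm_num) h
        simp only at this
        rw [hB, eLpNorm_two_sq] at this
        exact absurd this hρ₀b.not_gt
      have hsub : ∀ j ∈ J, annW (2 ^ j) ⊆ pDisk := fun j hj =>
        annW_subset_pDisk (by positivity) (by linarith [hJ1 j hj])
      have hre : ∀ j ∈ J, volume.restrict (annW (2 ^ j)) = μ.restrict (annW (2 ^ j)) :=
        fun j hj => by
          rw [hμ, Measure.restrict_restrict (measurableSet_annW _),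
            inter_eq_left.2 (hsub j hj)]
      set X := ∫⁻ z, ENNReal.ofReal (Complex.normSq z * Θ (Complex.normSq z))
        * ‖gradLen G z‖ₑ ^ 2 ∂μ with hX
      have hΘN : Continuous fun z : ℂ => Θ (Complex.normSq z) := hΘ.continuous.comp hNc
      have hXw : X ≤ ∫⁻ z, w z ∂μ := lintegral_mono fun z => mul_le_mul'
        (ENNReal.ofReal_le_ofReal (hΘle _ (Complex.normSq_nonneg z))) le_rfl
      have hXt : X ≠ ⊤ := ne_top_of_le_ne_top hwt hXw
      have h := hmain f G H b hD Θ hΘ hΘc hΘ0 J (fun j => ENNReal.ofReal (wgt s ε ((2 ^ j) ^ 2)))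
        (fun _ => ENNReal.ofReal_ne_top) ?_ ?_ ?_ B (hBδ.trans (min_le_left _ _)) ?_
      rotate_left
      · intro z hz
        have hz' := hΘs hz
        rw [mem_Icc, hN] at hz'
        have hz0 : t ≤ ‖z‖ := by
          exact (pow_le_pow_iff_left₀ ht0.le (norm_nonneg z) two_ne_zero).1 hz'.1
        have hz1 : ‖z‖ ≤ 2 * r₀ := by
          refine (pow_le_pow_iff_left₀ (norm_nonneg z) (by positivity) two_ne_zero).1 ?_
          linarith [hz'.2]
        obtain ⟨j, hj1, hj2⟩ := exists_mem_Ico_zpow (ht0.trans_le hz0) (one_lt_two (α := ℝ))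
        refine ⟨j, Finset.mem_Icc.2 ⟨?_, ?_⟩, hj1, ?_⟩
        · have := (zpow_lt_zpow_iff_right₀ (one_lt_two (α := ℝ))).1 (hz0.trans_lt hj2)
          omega
        · have h2 : (2 : ℝ) ^ j ≤ 2 ^ (1 + -(m₀ : ℤ)) := by
            rw [zpow_one_add₀ two_ne_zero]
            exact hj1.trans hz1
          have := (zpow_le_zpow_iff_right₀ (one_lt_two (α := ℝ))).1 h2
          omega
        · rw [zpow_add_one₀ two_ne_zero] at hj2
          linarith
      · intro j hj
        have := Finset.mem_Icc.1 hj
        omega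
      · intro j _ z hz
        refine ENNReal.ofReal_le_ofReal ((hΘle _ (Complex.normSq_nonneg z)).trans
          (wgt_anti hs.le hε (by positivity) ?_))
        rw [hN]
        exact pow_le_pow_left₀ (by positivity) hz.1 2
      · intro j hj
        rw [hre j hj]
        refine eLpNorm_mono_measure _ (Measure.restrict_mono (fun z hz => ?_) le_rfl)
        rw [mem_ball_zero_iff]
        exact hz.2.trans_le (by linarith [hJ1 j hj])
      have hlhs : ∫⁻ z in pDisk, ENNReal.ofReal (Complex.normSq z * Θ (Complex.normSq z) / 2)
          * ‖gradLen G z‖ₑ ^ 2 = ENNReal.ofReal (1 / 2) * X := by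
        rw [hX, ← lintegral_const_mul' _ _ ENNReal.ofReal_ne_top]
        refine lintegral_congr fun z => ?_
        rw [← mul_assoc, ← ENNReal.ofReal_mul (by norm_num)]
        congr 2
        ring
      set Wt := ∫⁻ z in ball 0 (4 * (1 / 2) ^ m), w z ∂μ with hWt
      have hmid : ∫⁻ z in pDisk, ENNReal.ofReal (|Θ (Complex.normSq z)
            + Complex.normSq z * deriv Θ (Complex.normSq z)| * Complex.normSq z)
            * ‖gradLen G z‖ₑ ^ 2
          ≤ ENNReal.ofReal (s / 2) * X + (ENNReal.ofReal K * Wt + ENNReal.ofReal K * T) := by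
        have mX : AEMeasurable (fun z => ENNReal.ofReal (s / 2) * (ENNReal.ofReal
            (Complex.normSq z * Θ (Complex.normSq z)) * ‖gradLen G z‖ₑ ^ 2)) μ :=
          ((hNc.mul hΘN).measurable.ennreal_ofReal.aemeasurable.mul hγm).const_mul _
        have mw : AEMeasurable w μ := by
          refine AEMeasurable.mul (Measurable.aemeasurable ?_) hγm
          exact ((hNc.measurable.add_const _).pow_const _).ennreal_ofReal
        have mb : MeasurableSet (ball (0 : ℂ) (4 * (1 / 2) ^ m)) := measurableSet_ball
        have mc : MeasurableSet (ball (0 : ℂ) r₀)ᶜ := measurableSet_ball.compl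
        have mK : AEMeasurable (fun z => ENNReal.ofReal K * w z) μ := mw.const_mul _
        calc _ ≤ ∫⁻ z, (ENNReal.ofReal (s / 2) * (ENNReal.ofReal
                (Complex.normSq z * Θ (Complex.normSq z)) * ‖gradLen G z‖ₑ ^ 2)
              + ((ball (0 : ℂ) (4 * (1 / 2) ^ m)).indicator (fun z => ENNReal.ofReal K * w z) z
              + (ball (0 : ℂ) r₀)ᶜ.indicator (fun z => ENNReal.ofReal K * w z) z)) ∂μ := by
              refine lintegral_mono fun z => ?_
              have hz := hΘd _ (Complex.normSq_nonneg z)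
              have hw0 : 0 ≤ K * wgt s ε (Complex.normSq z) :=
                mul_nonneg hK0 (wgt_pos hε (Complex.normSq_nonneg z)).le
              have hNΘ := mul_nonneg (Complex.normSq_nonneg z) (hΘ0 (Complex.normSq z))
              have i1 : ENNReal.ofReal ((Iic (4 * t ^ 2)).indicator
                  (fun _ => K * wgt s ε (Complex.normSq z)) (Complex.normSq z))
                  * ‖gradLen G z‖ₑ ^ 2
                  ≤ (ball (0 : ℂ) (4 * (1 / 2) ^ m)).indicator
                    (fun z => ENNReal.ofReal K * w z) z := by
                by_cases hm : Complex.normSq z ∈ Iic (4 * t ^ 2)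
                · have hzb : z ∈ ball (0 : ℂ) (4 * (1 / 2) ^ m) := by
                    rw [mem_ball_zero_iff, ← ht']
                    rw [mem_Iic, hN] at hm
                    nlinarith [norm_nonneg z]
                  rw [indicator_of_mem hm, indicator_of_mem hzb, hw, ENNReal.ofReal_mul hK0,
                    mul_assoc]
                · rw [indicator_of_notMem hm]
                  simp
              have i2 : ENNReal.ofReal ((Ici (r₀ ^ 2)).indicator
                  (fun _ => K * wgt s ε (Complex.normSq z)) (Complex.normSq z))
                  * ‖gradLen G z‖ₑ ^ 2
                  ≤ (ball (0 : ℂ) r₀)ᶜ.indicator (fun z => ENNReal.ofReal K * w z) z := by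
                by_cases hm : Complex.normSq z ∈ Ici (r₀ ^ 2)
                · have hzb : z ∈ (ball (0 : ℂ) r₀)ᶜ := by
                    rw [mem_compl_iff, mem_ball_zero_iff, not_lt]
                    rw [mem_Ici, hN] at hm
                    exact (pow_le_pow_iff_left₀ hr₀0.le (norm_nonneg z) two_ne_zero).1 hm
                  rw [indicator_of_mem hm, indicator_of_mem hzb, hw, ENNReal.ofReal_mul hK0,
                    mul_assoc]
                · rw [indicator_of_notMem hm]
                  simp
              refine le_trans ?_ (add_le_add le_rfl (add_le_add i1 i2))
              rw [← add_mul, ← mul_assoc, ← add_mul, ← ENNReal.ofReal_mul (by positivity)]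
              refine mul_le_mul' ((ENNReal.ofReal_le_ofReal hz).trans ?_) le_rfl
              exact ENNReal.ofReal_add_le.trans (add_le_add le_rfl ENNReal.ofReal_add_le)
          _ = ENNReal.ofReal (s / 2) * X + (ENNReal.ofReal K * Wt
              + ENNReal.ofReal K * ∫⁻ z in (ball (0 : ℂ) r₀)ᶜ, w z ∂μ) := by
              rw [lintegral_add_left' mX, lintegral_add_left' (mK.indicator mb),
                lintegral_indicator mb, lintegral_indicator mc,
                lintegral_const_mul' _ _ ENNReal.ofReal_ne_top,
                lintegral_const_mul' _ _ ENNReal.ofReal_ne_top,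
                lintegral_const_mul' _ _ ENNReal.ofReal_ne_top]
          _ ≤ _ := by
              refine add_le_add le_rfl (add_le_add le_rfl (mul_le_mul' le_rfl
                (hout _ mc fun z hz => ?_)))
              simpa using hz
      have hsum : C * B * ∑ j ∈ J, ENNReal.ofReal (wgt s ε ((2 ^ j) ^ 2))
          * ∫⁻ z in annW (2 ^ j), ‖gradLen G z‖ₑ ^ 2 ≤ ENNReal.ofReal (κ / 2) * (Q + T) := by
        have h1 : ∀ j ∈ J, ENNReal.ofReal (wgt s ε ((2 ^ j) ^ 2))
            * ∫⁻ z in annW (2 ^ j), ‖gradLen G z‖ₑ ^ 2 ≤ 4 * ∫⁻ z in annW (2 ^ j), w z ∂μ := by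
          intro j hj
          rw [hre j hj, ← lintegral_const_mul' _ _ ENNReal.ofReal_ne_top,
            ← lintegral_const_mul' _ _ (by norm_num)]
          refine setLIntegral_mono' (measurableSet_annW _) fun z hz => ?_
          rw [hw, ← mul_assoc]
          refine mul_le_mul' ?_ le_rfl
          rw [show (4 : ℝ≥0∞) = ENNReal.ofReal 4 by simp, ← ENNReal.ofReal_mul (by norm_num)]
          refine ENNReal.ofReal_le_ofReal (wgt_le_four_mul hs.le hs1.le hε (by positivity)
            (Complex.normSq_nonneg z) ?_)
          rw [hN]
          nlinarith [hz.2, norm_nonneg z, show (0 : ℝ) < 2 ^ j by positivity]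
        calc _ ≤ C * B * (4 * (3 * ∫⁻ z in ball 0 (8 * r₀), w z ∂μ)) := by
              refine mul_le_mul' le_rfl ((Finset.sum_le_sum h1).trans ?_)
              rw [← Finset.mul_sum]
              exact mul_le_mul' le_rfl (sum_lintegral_annW_le μ w J fun j hj => by
                linarith [hJ1 j hj])
          _ = C * 12 * B * ∫⁻ z in ball 0 (8 * r₀), w z ∂μ := by ring
          _ ≤ _ := mul_le_mul' (ENNReal.mul_le_of_le_div' (hBδ.trans (min_le_right _ _))) hQ8
      rw [hlhs] at h
      have h' := h.trans (add_le_add hmid hsum)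
      rw [add_assoc] at h'
      have h'' := ENNReal.ofReal_sub_mul_le (by positivity) (by linarith) hXt h'
      rw [show 1 / 2 - s / 2 = κ by rw [hκ]; ring] at h''
      -- For 4t ≤ |z| < r₀ the truncation is inactive and the integrands of Q and X agree.
      have hQX : Q ≤ Wt + X := by
        have hcov : ball (0 : ℂ) r₀ ⊆ ball 0 (4 * (1 / 2) ^ m)
            ∪ (ball 0 r₀ \ ball 0 (4 * (1 / 2) ^ m)) := by simp
        refine (lintegral_mono_set hcov).trans ((lintegral_union_le _ _ _).trans
          (add_le_add le_rfl (le_trans ?_ (setLIntegral_le_lintegral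
            (ball 0 r₀ \ ball 0 (4 * (1 / 2) ^ m)) _))))
        refine setLIntegral_mono' (measurableSet_ball.diff measurableSet_ball) fun z hz => ?_
        have hz1 : ‖z‖ < r₀ := by simpa using hz.1
        have hz2 : 4 * t ≤ ‖z‖ := by rw [ht']; simpa using hz.2
        rw [hw, hΘeq]
        · rw [hN]; nlinarith
        · rw [hN]; nlinarith [norm_nonneg z]
      calc ENNReal.ofReal κ * Q ≤ ENNReal.ofReal κ * (Wt + X) := mul_le_mul' le_rfl hQX
        _ = ENNReal.ofReal κ * Wt + ENNReal.ofReal κ * X := mul_add _ _ _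
        _ ≤ ENNReal.ofReal κ * Wt + _ := add_le_add le_rfl h''
        _ = _ := by ring
    -- The inner truncation is removed: w is integrable for fixed ε, so its integral over disks
    -- shrinking to the origin vanishes in the limit.
    have hlim : ENNReal.ofReal κ * Q ≤ ENNReal.ofReal K * T + ENNReal.ofReal (κ / 2) * (Q + T) := by
      have hr : Tendsto (fun m : ℕ => 4 * (1 / 2 : ℝ) ^ m) atTop (𝓝 0) := by
        simpa using (tendsto_pow_atTop_nhds_zero_of_lt_one (r := (1 / 2 : ℝ)) (by norm_num)
          (by norm_num)).const_mul 4
      have h1 := (tendsto_setLIntegral_ball Measure.restrict_le_self hwt).comp hr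
      have h2 := ENNReal.Tendsto.const_mul (a := ENNReal.ofReal K + ENNReal.ofReal κ) h1
        (Or.inr (by simp))
      have h3 := h2.add_const (ENNReal.ofReal K * T + ENNReal.ofReal (κ / 2) * (Q + T))
      rw [mul_zero, zero_add] at h3
      exact ge_of_tendsto' h3 step
    have hlim' : ENNReal.ofReal κ * Q ≤ ENNReal.ofReal (κ / 2) * Q
        + (ENNReal.ofReal K + ENNReal.ofReal (κ / 2)) * T := hlim.trans (le_of_eq (by ring))
    have := ENNReal.ofReal_sub_mul_le (by positivity) (by linarith) hQt hlim'
    rw [show κ - κ / 2 = κ / 2 by ring] at this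
    rw [ENNReal.le_div_iff_mul_le (Or.inl (by simpa using by positivity))
      (Or.inl ENNReal.ofReal_ne_top), mul_comm]
    exact this
  set M₀ := (ENNReal.ofReal K + ENNReal.ofReal (κ / 2)) * T / ENNReal.ofReal (κ / 2) with hM₀
  have hM₀t : M₀ ≠ ⊤ := ENNReal.div_ne_top (ENNReal.mul_ne_top (by simp) hTt)
    (by simpa using by positivity)
  refine ⟨2 * M₀, r₀, ENNReal.mul_ne_top (by norm_num) hM₀t, hr₀0, fun ε hε hεr => ?_⟩
  have h1 : ENNReal.ofReal (ε ^ (-s)) * ∫⁻ z in ball 0 ε, ‖gradLen G z‖ₑ ^ 2 ∂μ ≤ 2 * M₀ := by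
    rw [← lintegral_const_mul' _ _ ENNReal.ofReal_ne_top]
    calc _ ≤ ∫⁻ z in ball 0 ε, 2 * (ENNReal.ofReal (wgt s ε (Complex.normSq z))
          * ‖gradLen G z‖ₑ ^ 2) ∂μ := by
          refine setLIntegral_mono' measurableSet_ball fun z hz => ?_
          rw [← mul_assoc]
          refine mul_le_mul' ?_ le_rfl
          rw [show (2 : ℝ≥0∞) = ENNReal.ofReal 2 by simp, ← ENNReal.ofReal_mul (by norm_num)]
          refine ENNReal.ofReal_le_ofReal (rpow_le_two_mul_wgt hs.le hs1.le hε
            (Complex.normSq_nonneg z) ?_)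
          rw [hN]
          exact pow_le_pow_left₀ (norm_nonneg z) (mem_ball_zero_iff.1 hz).le 2
      _ ≤ 2 * M₀ := by
          rw [lintegral_const_mul' _ _ (by norm_num)]
          exact mul_le_mul' le_rfl ((lintegral_mono_set (ball_subset_ball hεr)).trans (hQ ε hε))
  calc _ = ENNReal.ofReal (ε ^ s) * (ENNReal.ofReal (ε ^ (-s))
        * ∫⁻ z in ball 0 ε, ‖gradLen G z‖ₑ ^ 2 ∂μ) := by
        rw [← mul_assoc, ← ENNReal.ofReal_mul (by positivity), ← Real.rpow_add hε]
        simp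
    _ ≤ ENNReal.ofReal (ε ^ s) * (2 * M₀) := mul_le_mul' le_rfl h1
    _ = _ := mul_comm _ _

end decay

/-! ### Integrability of the Hessian at the puncture. -/

section hessian

variable {n : ℕ}

theorem exists_innerCutoff : ∃ C : ℝ, 0 ≤ C ∧ ∀ ε : ℝ, 0 < ε → ∃ ψ : ℂ → ℝ, ContDiff ℝ ∞ ψ ∧
    (∀ z, 0 ≤ ψ z ∧ ψ z ≤ 1) ∧ tsupport ψ ⊆ {z | ε ≤ ‖z‖} ∧ (∀ z, 2 * ε ≤ ‖z‖ → ψ z = 1) ∧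
    (∀ z, ‖fderiv ℝ ψ z‖ ≤ C / ε) ∧ ∀ z, 2 * ε < ‖z‖ → fderiv ℝ ψ z = 0 := by
  let χ : ContDiffBump (0 : ℂ) := ⟨1, 2, one_pos, one_lt_two⟩
  have hχ : ContDiff ℝ ∞ χ := χ.contDiff
  obtain ⟨C, hC⟩ := (χ.hasCompactSupport.fderiv ℝ).exists_bound_of_continuous
    (hχ.continuous_fderiv (by simp))
  have hC0 : 0 ≤ C := (norm_nonneg _).trans (hC 0)
  refine ⟨C, hC0, fun ε hε => ?_⟩
  have hn : ∀ z : ℂ, ‖((ε⁻¹ : ℝ) : ℂ) * z‖ = ‖z‖ / ε := fun z => by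
    rw [norm_mul, Complex.norm_real, Real.norm_of_nonneg (by positivity)]; ring
  have h1 : ∀ z : ℂ, 2 * ε ≤ ‖z‖ → 1 - χ ((ε⁻¹ : ℝ) * z) = 1 := fun z hz => by
    rw [χ.zero_of_le_dist, sub_zero]
    rw [dist_zero_right, hn, le_div_iff₀ hε]
    exact hz
  refine ⟨fun z => 1 - χ ((ε⁻¹ : ℝ) * z), ?_, fun z => ⟨?_, ?_⟩, ?_, h1, fun z => ?_, fun z hz => ?_⟩
  · exact contDiff_const.sub (hχ.comp (contDiff_const.mul contDiff_id))
  · linarith [χ.le_one (x := (ε⁻¹ : ℝ) * z)]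
  · linarith [χ.nonneg (x := (ε⁻¹ : ℝ) * z)]
  · refine closure_minimal (fun z hz => ?_) (isClosed_le continuous_const continuous_norm)
    by_contra h
    rw [mem_ofPred_eq, not_le] at h
    apply hz
    simp only
    rw [χ.one_of_mem_closedBall, sub_self]
    rw [mem_closedBall_zero_iff, hn, div_le_iff₀ hε]
    change ‖z‖ ≤ 1 * ε
    linarith
  · rw [fderiv_const_sub, norm_neg]
    refine ContinuousLinearMap.opNorm_le_bound _ (div_nonneg hC0 hε.le) fun v => ?_
    rw [fderiv_comp_mul_left (hχ.differentiable (by simp))]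
    refine (ContinuousLinearMap.le_opNorm _ _).trans ?_
    rw [norm_mul, Complex.norm_real, Real.norm_of_nonneg (by positivity)]
    calc _ ≤ C * (ε⁻¹ * ‖v‖) := by gcongr; exact hC _
      _ = C / ε * ‖v‖ := by ring
  · have : (fun z : ℂ => 1 - χ ((ε⁻¹ : ℝ) * z)) =ᶠ[𝓝 z] fun _ => 1 := by
      filter_upwards [(continuous_norm.tendsto z).eventually (lt_mem_nhds hz)] with w hw
      exact h1 w hw.le
    rw [this.fderiv_eq, fderiv_fun_const]
    rfl

/-- Hölder on a disk. The power of ρ is 2(1/q - 1/2), and the constant is at most 2 because π ≤ 4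
and 2/q - 1 ≤ 1. -/
theorem eLpNorm_ball_le_eLpNorm_two {F : Type*} [NormedAddCommGroup F] {μ : Measure ℂ}
    (hμ : μ ≤ volume) {q : ℝ} (hq1 : 1 ≤ q) (hq2 : q ≤ 2) {g : ℂ → F}
    (hg : AEStronglyMeasurable g μ) {ρ : ℝ} (hρ : 0 < ρ) :
    eLpNorm g (ENNReal.ofReal q) (μ.restrict (ball 0 ρ))
      ≤ eLpNorm g 2 (μ.restrict (ball 0 ρ)) * (2 * ENNReal.ofReal (ρ ^ (2 / q - 1))) := by
  have hle : ENNReal.ofReal q ≤ 2 := by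
    rw [show (2 : ℝ≥0∞) = ENNReal.ofReal 2 by simp]; exact ENNReal.ofReal_le_ofReal hq2
  refine (eLpNorm_le_eLpNorm_mul_rpow_measure_univ hle hg.restrict).trans (mul_le_mul' le_rfl ?_)
  have hq0 : 0 < q := by linarith
  rw [Measure.restrict_apply_univ, ENNReal.toReal_ofReal hq0.le, ENNReal.toReal_ofNat]
  have he : 0 ≤ 1 / q - 1 / 2 := by
    rw [sub_nonneg]
    exact one_div_le_one_div_of_le hq0 hq2
  have he1 : 2 / q - 1 ≤ 1 := by
    rw [sub_le_iff_le_add, div_le_iff₀ hq0]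
    linarith
  have hv : μ (ball 0 ρ) ≤ ENNReal.ofReal ((2 * ρ) ^ 2) := by
    refine (hμ _).trans ?_
    rw [Complex.volume_ball, mul_pow, ENNReal.ofReal_mul (by norm_num), ← ENNReal.ofReal_pow hρ.le,
      mul_comm]
    refine mul_le_mul' ?_ le_rfl
    rw [show (NNReal.pi : ℝ≥0∞) = ENNReal.ofReal Real.pi by
      rw [← NNReal.coe_real_pi, ENNReal.ofReal_coe_nnreal]]
    exact ENNReal.ofReal_le_ofReal (by linarith [Real.pi_lt_four])
  calc μ (ball 0 ρ) ^ (1 / q - 1 / 2) ≤ ENNReal.ofReal ((2 * ρ) ^ 2) ^ (1 / q - 1 / 2) :=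
        ENNReal.rpow_le_rpow hv he
    _ = ENNReal.ofReal (2 ^ (2 / q - 1) * ρ ^ (2 / q - 1)) := by
        rw [ENNReal.ofReal_rpow_of_nonneg (by positivity) he, ← Real.rpow_natCast,
          ← Real.rpow_mul (by positivity), ← Real.mul_rpow (by norm_num) hρ.le]
        congr 2
        push_cast
        ring
    _ ≤ 2 * ENNReal.ofReal (ρ ^ (2 / q - 1)) := by
        rw [ENNReal.ofReal_mul (by positivity)]
        refine mul_le_mul' ?_ le_rfl
        rw [show (2 : ℝ≥0∞) = ENNReal.ofReal 2 by simp]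
        refine ENNReal.ofReal_le_ofReal ?_
        calc (2 : ℝ) ^ (2 / q - 1) ≤ 2 ^ (1 : ℝ) :=
              Real.rpow_le_rpow_of_exponent_le one_le_two he1
          _ = 2 := Real.rpow_one 2

theorem eLpNorm_mul_le_of_bound_on_ball {μ : Measure ℂ} {q : ℝ≥0∞} {φ g : ℂ → ℝ} {K ρ : ℝ}
    (hK : 0 ≤ K) (hφ : ∀ z, |φ z| ≤ K) (h0 : ∀ z, ρ ≤ ‖z‖ → φ z = 0) :
    eLpNorm (fun z => φ z * g z) q μ ≤ ENNReal.ofReal K * eLpNorm g q (μ.restrict (ball 0 ρ)) := by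
  rw [← eLpNorm_restrict_eq_of_support_subset (s := ball (0 : ℂ) ρ)]
  · rw [show ENNReal.ofReal K = ‖K‖ₑ by rw [← ofReal_norm, Real.norm_of_nonneg hK],
      ← eLpNorm_const_smul]
    refine eLpNorm_mono fun z => ?_
    rw [norm_mul, Pi.smul_apply, norm_smul, Real.norm_of_nonneg hK]
    exact mul_le_mul_of_nonneg_right (hφ z) (norm_nonneg _)
  · intro z hz
    by_contra h
    rw [mem_ball_zero_iff, not_lt] at h
    exact hz (by simp [h0 z h])

theorem restrict_pDisk : (volume : Measure ℂ).restrict pDisk = volume.restrict (ball 0 1) :=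
  Measure.restrict_congr_set (sdiff_null_ae_eq_self (by simp))

/-- The second derivatives of a conformal map are in `L ^ q` near an isolated singularity of finite
energy if `q < 4 / 3`. -/
theorem ConfData.exists_memLp_hessian {p q : ℝ} (hp2 : p < 2) (hq1 : 1 < q) (hq2 : q < 4 / 3)
    (hqp : q ≤ p) {f : ℂ → EuclideanSpace ℝ (Fin n)} {G : Fin 2 → ℂ → EuclideanSpace ℝ (Fin n)}
    {H : Fin 2 → Fin 2 → ℂ → EuclideanSpace ℝ (Fin n)} {b : ℂ → ℝ} (hD : ConfData p pDisk f G H b)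
    (hE : ∫⁻ z in pDisk, ‖gradLen G z‖ₑ ^ 2 ≠ ⊤) (hb : ∫⁻ z in pDisk, ‖b z‖ₑ ^ 2 ≠ ⊤) :
    ∃ r : ℝ, 0 < r ∧ r ≤ 1 ∧
      ∀ i j, MemLp (H i j) (ENNReal.ofReal q) (volume.restrict (ball 0 r)) := by
  have hq0 : 0 < q := by linarith
  -- Chosen so that s/2 + (2/q - 1) = 1, the power of ε that compensates the 1/ε of the inner
  -- cutoff. The condition s < 1 is q < 4/3.
  set s : ℝ := 4 - 4 / q with hs
  have hs0 : 0 < s := by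
    rw [hs, sub_pos, div_lt_iff₀ hq0]
    linarith
  have hs1 : s < 1 := by
    rw [hs, sub_lt_comm, lt_div_iff₀ hq0]
    linarith
  obtain ⟨M, r₁, hM, hr₁, hdecay⟩ := hD.exists_energy_decay (hq1.trans_le hqp) hp2 hs0 hs1 hE hb
  obtain ⟨C, δ, hC, hδ, hhess⟩ := exists_eLpNorm_hessian_le n hq1 (by linarith : q < 2)
  obtain ⟨K, hK0, hcut⟩ := exists_innerCutoff
  set μ := (volume : Measure ℂ).restrict pDisk with hμ
  have hγm : AEStronglyMeasurable (gradLen G) μ :=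
    aestronglyMeasurable_gradLen fun i => (hD.deriv i 0).1.aestronglyMeasurable
  obtain ⟨r₀, hr₀, hr₀1, hr₀b⟩ : ∃ r₀ : ℝ, 0 < r₀ ∧ r₀ < 1 ∧
      ∫⁻ z in ball 0 r₀, ‖b z‖ₑ ^ 2 ∂μ < δ ^ 2 := by
    have h := (tendsto_setLIntegral_ball Measure.restrict_le_self hb).eventually
      (gt_mem_nhds (ENNReal.pow_pos (pos_iff_ne_zero.2 hδ) 2))
    have h' : ∀ᶠ r in 𝓝[>] (0 : ℝ), 0 < r ∧ r < 1 ∧ ∫⁻ z in ball 0 r, ‖b z‖ₑ ^ 2 ∂μ < δ ^ 2 :=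
      eventually_mem_nhdsWithin.and (((gt_mem_nhds one_pos).filter_mono nhdsWithin_le_nhds).and
        (h.filter_mono nhdsWithin_le_nhds))
    exact h'.exists
  let χ : ContDiffBump (0 : ℂ) := ⟨r₀ / 4, r₀ / 2, by positivity, by linarith⟩
  have hχ : ContDiff ℝ ∞ χ := χ.contDiff
  have hχs : tsupport χ ⊆ ball 0 r₀ := by
    rw [χ.tsupport_eq]
    exact closedBall_subset_ball (by change r₀ / 2 < r₀; linarith)
  obtain ⟨L, hL⟩ := (χ.hasCompactSupport.fderiv ℝ).exists_bound_of_continuous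
    (hχ.continuous_fderiv (by simp))
  have hL0 : 0 ≤ L := (norm_nonneg _).trans (hL 0)
  have hγ2 : eLpNorm (gradLen G) 2 μ ≠ ⊤ := fun h => hE (by rw [← eLpNorm_two_sq, h]; simp)
  set A₁ : ℝ≥0∞ := ENNReal.ofReal L * (eLpNorm (gradLen G) 2 μ * (2 * ENNReal.ofReal
    (r₀ ^ (2 / q - 1)))) with hA₁
  set A₂ : ℝ≥0∞ := ENNReal.ofReal (3 * K) * (M ^ (1 / 2 : ℝ) * 2) with hA₂
  have hA₁t : A₁ ≠ ⊤ := ENNReal.mul_ne_top ENNReal.ofReal_ne_top (ENNReal.mul_ne_top hγ2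
    (ENNReal.mul_ne_top (by norm_num) ENNReal.ofReal_ne_top))
  have hA₂t : A₂ ≠ ⊤ := ENNReal.mul_ne_top ENNReal.ofReal_ne_top (ENNReal.mul_ne_top
    (ENNReal.rpow_ne_top_of_nonneg (by norm_num) hM) (by norm_num))
  have hloc : ∀ g : ℂ → EuclideanSpace ℝ (Fin n), MemLpLocOn p pDisk g → MemLpLocOn q pDisk g :=
    fun g hg S hS hSΩ => by
      have : IsFiniteMeasure ((volume : Measure ℂ).restrict S) := ⟨by simpa using hS.measure_lt_top⟩
      exact (hg S hS hSΩ).mono_exponent (ENNReal.ofReal_le_ofReal hqp)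
  -- A bound that survives ε → 0: the gradient of χ contributes a fixed amount A₁ and that of ψ an
  -- amount A₂ in which ε has cancelled by the energy decay.
  have step : ∀ ε, 0 < ε → 3 * ε ≤ r₁ → ∃ η : ℂ → ℝ, Continuous η ∧
      (∀ z, 2 * ε ≤ ‖z‖ → ‖z‖ < r₀ / 4 → η z = 1) ∧
      ∀ i j, eLpNorm (fun z => η z • H i j z) (ENNReal.ofReal q) volume ≤ C * (A₁ + A₂) := by
    intro ε hε hεr
    obtain ⟨ψ, hψ, hψ01, hψs, hψ1, hψd, hψd0⟩ := hcut ε hε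
    set η : ℂ → ℝ := fun z => ψ z * χ z with hη
    have hηs : tsupport η ⊆ tsupport ψ ∩ tsupport χ :=
      subset_inter (tsupport_mul_subset_left) (tsupport_mul_subset_right)
    have hηp : tsupport η ⊆ pDisk := fun z hz => by
      have h1 : ε ≤ ‖z‖ := hψs (hηs hz).1
      have h2 := mem_ball_zero_iff.1 (hχs (hηs hz).2)
      refine ⟨mem_ball_zero_iff.2 (h2.trans hr₀1), ?_⟩
      rintro rfl
      rw [norm_zero] at h1
      linarith
    have hηc : HasCompactSupport η := χ.hasCompactSupport.mul_left
    have hbη : eLpNorm b 2 (volume.restrict (tsupport η)) ≤ δ := by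
      have h1 : eLpNorm b 2 (volume.restrict (tsupport η)) ≤ eLpNorm b 2 (μ.restrict (ball 0 r₀)) := by
        rw [hμ, Measure.restrict_restrict measurableSet_ball]
        exact eLpNorm_mono_measure _ (Measure.restrict_mono
          (subset_inter (fun z hz => hχs (hηs hz).2) hηp) le_rfl)
      refine h1.trans ?_
      by_contra! h
      have := ENNReal.pow_right_strictMono (n := 2) (by norm_num) h
      simp only at this
      rw [eLpNorm_two_sq] at this
      exact absurd this hr₀b.not_gt
    have hmain := (hhess pDisk isOpen_pDisk G H b hD.toGradData (fun i => hloc _ (hD.memLp_grad i))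
      (fun i j => hloc _ (hD.memLp_hess i j)) η (hψ.mul hχ) hηc hηp hbη).2
    have hfd : ∀ z, ‖fderiv ℝ η z‖ ≤ ‖fderiv ℝ χ z‖ + ‖fderiv ℝ ψ z‖ := fun z => by
      rw [hη, fderiv_fun_mul (hψ.differentiable (by simp) z) (hχ.differentiable (by simp) z)]
      refine (norm_add_le _ _).trans (add_le_add ?_ ?_)
      · rw [norm_smul, Real.norm_of_nonneg (hψ01 z).1]
        exact mul_le_of_le_one_left (norm_nonneg _) (hψ01 z).2
      · rw [norm_smul, Real.norm_of_nonneg χ.nonneg]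
        exact mul_le_of_le_one_left (norm_nonneg _) χ.le_one
    have hest : eLpNorm (fun z => ‖fderiv ℝ η z‖ * gradLen G z) (ENNReal.ofReal q) volume
        ≤ A₁ + A₂ := by
      rw [← eLpNorm_restrict_eq_of_support_subset (s := pDisk)]
      swap
      · intro z hz
        refine hηp (support_fderiv_subset ℝ fun h => hz ?_)
        simp [h]
      have hψm : Continuous fun z => ‖fderiv ℝ ψ z‖ := (hψ.continuous_fderiv (by simp)).norm
      have hχm : Continuous fun z => ‖fderiv ℝ χ z‖ := (hχ.continuous_fderiv (by simp)).norm
      have m1 : AEStronglyMeasurable (fun z => ‖fderiv ℝ χ z‖ * gradLen G z) μ :=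
        hχm.aestronglyMeasurable.mul hγm
      have m2 : AEStronglyMeasurable (fun z => ‖fderiv ℝ ψ z‖ * gradLen G z) μ :=
        hψm.aestronglyMeasurable.mul hγm
      have hq1' : (1 : ℝ≥0∞) ≤ ENNReal.ofReal q := by simpa using hq1.le
      calc _ ≤ eLpNorm ((fun z => ‖fderiv ℝ χ z‖ * gradLen G z)
            + fun z => ‖fderiv ℝ ψ z‖ * gradLen G z) (ENNReal.ofReal q) μ := by
            refine eLpNorm_mono_real fun z => ?_
            rw [norm_mul, norm_norm, Real.norm_of_nonneg (gradLen_nonneg G z), Pi.add_apply,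
              ← add_mul]
            exact mul_le_mul_of_nonneg_right (hfd z) (gradLen_nonneg G z)
        _ ≤ _ := (eLpNorm_add_le m1 m2 hq1').trans (add_le_add ?_ ?_)
      · refine (eLpNorm_mul_le_of_bound_on_ball (ρ := r₀) hL0 (fun z => ?_) fun z hz => ?_).trans
          (mul_le_mul' le_rfl ((eLpNorm_ball_le_eLpNorm_two Measure.restrict_le_self hq1.le
            (by linarith) hγm hr₀).trans (mul_le_mul' (eLpNorm_mono_measure _
              Measure.restrict_le_self) le_rfl)))
        · rw [abs_of_nonneg (norm_nonneg _)]
          exact hL z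
        · rw [norm_eq_zero]
          by_contra h
          have := mem_ball_zero_iff.1 (hχs (support_fderiv_subset ℝ h))
          linarith
      -- The gradient of ψ is known to vanish only strictly outside radius 2ε, whence the slightly
      -- larger disk.
      · refine (eLpNorm_mul_le_of_bound_on_ball (ρ := 3 * ε) (div_nonneg hK0 hε.le) (fun z => ?_)
          fun z hz => ?_).trans ?_
        · rw [abs_of_nonneg (norm_nonneg _)]
          exact hψd z
        · rw [hψd0 z (by linarith), norm_zero]
        · have h3 : (0 : ℝ) < 3 * ε := by positivity
          have hd : eLpNorm (gradLen G) 2 (μ.restrict (ball 0 (3 * ε)))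
              ≤ M ^ (1 / 2 : ℝ) * ENNReal.ofReal ((3 * ε) ^ (s / 2)) := by
            have h1 := hdecay (3 * ε) h3 hεr
            rw [← eLpNorm_two_sq] at h1
            have h2 := ENNReal.rpow_le_rpow h1 (show (0 : ℝ) ≤ 1 / 2 by norm_num)
            rw [← ENNReal.rpow_natCast, ← ENNReal.rpow_mul, ENNReal.mul_rpow_of_nonneg _ _
              (by norm_num), ENNReal.ofReal_rpow_of_nonneg (by positivity) (by norm_num),
              ← Real.rpow_mul h3.le] at h2
            norm_num at h2
            rw [show s / 2 = s * (1 / 2) by ring]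
            simpa using h2
          refine (mul_le_mul' le_rfl ((eLpNorm_ball_le_eLpNorm_two Measure.restrict_le_self hq1.le
            (by linarith) hγm h3).trans (mul_le_mul' hd le_rfl))).trans (le_of_eq ?_)
          have hpow : (3 * ε) ^ (s / 2) * (3 * ε) ^ (2 / q - 1) = 3 * ε := by
            rw [← Real.rpow_add h3, show s / 2 + (2 / q - 1) = 1 by rw [hs]; ring, Real.rpow_one]
          calc _ = ENNReal.ofReal (K / ε) * (ENNReal.ofReal ((3 * ε) ^ (s / 2))
                * ENNReal.ofReal ((3 * ε) ^ (2 / q - 1))) * (M ^ (1 / 2 : ℝ) * 2) := by ring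
            _ = A₂ := by
                rw [← ENNReal.ofReal_mul (by positivity), hpow,
                  ← ENNReal.ofReal_mul (by positivity), hA₂]
                congr 2
                field_simp
    refine ⟨η, (hψ.mul hχ).continuous, fun z h1 h2 => ?_, fun i j =>
      (hmain i j).trans (mul_le_mul' le_rfl hest)⟩
    simp only [hη]
    rw [hψ1 z h1, χ.one_of_mem_closedBall, one_mul]
    rw [mem_closedBall_zero_iff]
    exact h2.le
  have hεm : ∀ m : ℕ, 0 < r₁ / 3 * (1 / 2) ^ m := fun m => by positivity
  choose η hηc hη1 hηle using fun m : ℕ => step (r₁ / 3 * (1 / 2) ^ m) (hεm m) (by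
    have : (1 / 2 : ℝ) ^ m ≤ 1 := pow_le_one₀ (by norm_num) (by norm_num)
    nlinarith)
  refine ⟨r₀ / 4, by positivity, by linarith, fun i j => ?_⟩
  have hHm : AEStronglyMeasurable (H i j) (volume.restrict (ball 0 (r₀ / 4))) := by
    have h := (hD.deriv i j).2.aestronglyMeasurable
    rw [restrict_pDisk] at h
    exact h.mono_measure (Measure.restrict_mono (ball_subset_ball (by linarith)) le_rfl)
  -- Fatou: off the origin the cutoffs are eventually equal to 1.
  refine ⟨hHm, lt_of_le_of_lt (Lp.eLpNorm_lim_le_liminf_eLpNorm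
    (f := fun m z => η m z • H i j z) (fun m => (hηc m).aestronglyMeasurable.smul hHm) _ ?_)
    (lt_of_le_of_lt (liminf_le_of_le (by isBoundedDefault) (a := C * (A₁ + A₂)) fun B hB => ?_)
    (ENNReal.mul_ne_top hC (ENNReal.add_ne_top.2 ⟨hA₁t, hA₂t⟩)).lt_top)⟩
  · have h0 : ∀ᵐ z ∂((volume : Measure ℂ).restrict (ball 0 (r₀ / 4))), z ≠ 0 :=
      ae_restrict_of_ae (by simp [ae_iff])
    filter_upwards [h0, ae_restrict_mem measurableSet_ball] with z hz hzb
    have hlim : Tendsto (fun m : ℕ => 2 * (r₁ / 3 * (1 / 2 : ℝ) ^ m)) atTop (𝓝 0) := by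
      simpa using ((tendsto_pow_atTop_nhds_zero_of_lt_one (r := (1 / 2 : ℝ)) (by norm_num)
        (by norm_num)).const_mul (r₁ / 3)).const_mul 2
    refine tendsto_const_nhds.congr' ?_
    filter_upwards [hlim.eventually (gt_mem_nhds (norm_pos_iff.2 hz))] with m hm
    rw [hη1 m z hm.le (mem_ball_zero_iff.1 hzb), one_smul]
  · obtain ⟨m, hm⟩ := hB.exists
    exact hm.trans ((eLpNorm_mono_measure _ Measure.restrict_le_self).trans (hηle m i j))

end hessian

/-! ### Removing the point from the domain of weak derivatives. -/

section extension

variable {n : ℕ}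

theorem tendsto_eLpNorm_two_ball {μ : Measure ℂ} (hμ : μ ≤ volume) {g : ℂ → ℝ}
    (hg : eLpNorm g 2 μ ≠ ⊤) :
    Tendsto (fun r : ℝ => eLpNorm g 2 (μ.restrict (ball 0 r))) (𝓝 0) (𝓝 0) := by
  have h1 : ∫⁻ z, ‖g z‖ₑ ^ 2 ∂μ ≠ ⊤ := by
    rw [← eLpNorm_two_sq]
    exact ENNReal.pow_ne_top hg
  have h2 := (ENNReal.continuous_rpow_const (y := (1 / 2 : ℝ))).tendsto 0 |>.comp
    (tendsto_setLIntegral_ball hμ h1)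
  rw [ENNReal.zero_rpow_of_pos (by norm_num)] at h2
  refine h2.congr fun r => ?_
  rw [Function.comp_apply, ← eLpNorm_two_sq, ← ENNReal.rpow_natCast, ← ENNReal.rpow_mul]
  norm_num

/-- A point of the plane is removable for weak derivatives of square-integrable functions. -/
theorem IsWeakDerivOn.of_pDisk {v : ℂ} {f g : ℂ → EuclideanSpace ℝ (Fin n)}
    (h : IsWeakDerivOn pDisk v f g) (hf : MemLp f 2 (volume.restrict (ball 0 1)))
    (hg : LocallyIntegrableOn g (ball 0 1)) : IsWeakDerivOn (ball 0 1) v f g := by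
  have hfin : IsFiniteMeasure ((volume : Measure ℂ).restrict (ball 0 1)) :=
    ⟨by rw [Measure.restrict_apply_univ]; exact measure_ball_lt_top⟩
  have hfl : LocallyIntegrableOn f (ball 0 1) :=
    IntegrableOn.locallyIntegrableOn (hf.integrable (by norm_num))
  refine ⟨hfl, hg, fun φ hφ hφc hφs => ?_⟩
  obtain ⟨K, hK0, hcut⟩ := exists_innerCutoff
  have hε : ∀ m : ℕ, (0 : ℝ) < (1 / 2) ^ m := fun m => by positivity
  choose ψ hψ hψ01 hψs hψ1 hψd hψd0 using fun m : ℕ => hcut ((1 / 2) ^ m) (hε m)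
  set μ := (volume : Measure ℂ).restrict (ball 0 1) with hμ
  have hψlim : ∀ z : ℂ, z ≠ 0 → ∀ᶠ m in atTop, ψ m z = 1 := fun z hz => by
    have hlim : Tendsto (fun m : ℕ => 2 * (1 / 2 : ℝ) ^ m) atTop (𝓝 0) := by
      simpa using (tendsto_pow_atTop_nhds_zero_of_lt_one (r := (1 / 2 : ℝ)) (by norm_num)
        (by norm_num)).const_mul 2
    filter_upwards [hlim.eventually (gt_mem_nhds (norm_pos_iff.2 hz))] with m hm
    exact hψ1 m z hm.le
  have hdom : ∀ u : ℂ → EuclideanSpace ℝ (Fin n), Integrable u →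
      Tendsto (fun m => ∫ z, ψ m z • u z) atTop (𝓝 (∫ z, u z)) := by
    intro u hu
    refine tendsto_integral_of_dominated_convergence (fun z => ‖u z‖)
      (fun m => (hψ m).continuous.aestronglyMeasurable.smul hu.1) hu.norm
      (fun m => Eventually.of_forall fun z => ?_) ?_
    · rw [norm_smul, Real.norm_of_nonneg (hψ01 m z).1]
      exact mul_le_of_le_one_left (norm_nonneg _) (hψ01 m z).2
    · have h0 : ∀ᵐ z : ℂ, z ≠ 0 := by simp [ae_iff]
      filter_upwards [h0] with z hz
      refine tendsto_const_nhds.congr' ?_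
      filter_upwards [hψlim z hz] with m hm
      rw [hm, one_smul]
  have i1 : Integrable (fun z => fderiv ℝ φ z v • f z) :=
    integrable_smul_of_locallyIntegrableOn hfl (continuous_fderiv_apply hφ v)
      (hφc.fderiv_apply ℝ v) ((tsupport_fderiv_apply_subset' φ v).trans hφs)
  have i2 : Integrable (fun z => φ z • g z) :=
    integrable_smul_of_locallyIntegrableOn hg hφ.continuous hφc hφs
  have i3 : ∀ m, Integrable (fun z => (φ z * fderiv ℝ (ψ m) z v) • f z) := fun m =>
    integrable_smul_of_locallyIntegrableOn hfl
      (hφ.continuous.mul (continuous_fderiv_apply (hψ m) v)) hφc.mul_right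
      ((tsupport_mul_subset_left).trans hφs)
  have i1' : ∀ m, Integrable (fun z => ψ m z • fderiv ℝ φ z v • f z) := fun m =>
    i1.bdd_smul 1 (hψ m).continuous.aestronglyMeasurable
      (Eventually.of_forall fun z => by
        rw [Real.norm_of_nonneg (hψ01 m z).1]; exact (hψ01 m z).2)
  have hid : ∀ m, (∫ z, ψ m z • fderiv ℝ φ z v • f z) + (∫ z, (φ z * fderiv ℝ (ψ m) z v) • f z)
      = -∫ z, ψ m z • φ z • g z := by
    intro m
    have hs : tsupport (fun z => φ z * ψ m z) ⊆ pDisk := fun z hz => by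
      refine ⟨hφs (tsupport_mul_subset_left hz), ?_⟩
      rintro rfl
      have : (1 / 2 : ℝ) ^ m ≤ ‖(0 : ℂ)‖ := hψs m (tsupport_mul_subset_right hz)
      rw [norm_zero] at this
      linarith [hε m]
    have hw := h.integral_eq _ (hφ.mul (hψ m)) hφc.mul_right hs
    rw [← integral_add (i1' m) (i3 m)]
    refine Eq.trans (integral_congr_ae (Eventually.of_forall fun z => ?_)) (hw.trans
      (congrArg Neg.neg (integral_congr_ae (Eventually.of_forall fun z => ?_))))
    · simp only
      rw [fderiv_fun_mul (hφ.differentiable (by simp) z) ((hψ m).differentiable (by simp) z)]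
      simp only [add_apply, smul_apply, smul_eq_mul]
      rw [smul_smul, ← add_smul]
      congr 1
      ring
    · simp only
      rw [smul_smul, mul_comm]
  obtain ⟨Kφ, hKφ⟩ := hφc.exists_bound_of_continuous hφ.continuous
  have hKφ0 : 0 ≤ Kφ := (norm_nonneg _).trans (hKφ 0)
  have hfn : AEStronglyMeasurable (fun z => ‖f z‖) μ := hf.1.norm
  -- The gradient of the cutoff is of size 1/ε on a disk of radius comparable to ε. By
  -- Cauchy–Schwarz the L¹ norm of f there is at most a constant times ε times its L² norm, so the
  -- powers of ε cancel and the L² norm over the shrinking disk tends to zero.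
  have hb : Tendsto (fun m => ∫ z, (φ z * fderiv ℝ (ψ m) z v) • f z) atTop (𝓝 0) := by
    have hlim : Tendsto (fun m : ℕ => 3 * (1 / 2 : ℝ) ^ m) atTop (𝓝 0) := by
      simpa using (tendsto_pow_atTop_nhds_zero_of_lt_one (r := (1 / 2 : ℝ)) (by norm_num)
        (by norm_num)).const_mul 3
    have ht := ENNReal.Tendsto.const_mul (a := ENNReal.ofReal (Kφ * K * ‖v‖ * 6))
      ((tendsto_eLpNorm_two_ball (μ := μ) Measure.restrict_le_self (g := fun z => ‖f z‖)
        (by rw [eLpNorm_norm]; exact hf.2.ne)).comp hlim) (Or.inr ENNReal.ofReal_ne_top)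
    rw [mul_zero] at ht
    rw [tendsto_zero_iff_enorm_tendsto_zero]
    refine tendsto_of_tendsto_of_tendsto_of_le_of_le tendsto_const_nhds ht (fun _ => zero_le)
      fun m => ?_
    have h3 : (0 : ℝ) < 3 * (1 / 2) ^ m := by positivity
    calc ‖∫ z, (φ z * fderiv ℝ (ψ m) z v) • f z‖ₑ
        ≤ ∫⁻ z, ‖(φ z * fderiv ℝ (ψ m) z v) • f z‖ₑ := enorm_integral_le_lintegral_enorm _
      _ = eLpNorm (fun z => (φ z * fderiv ℝ (ψ m) z v) * ‖f z‖) 1 volume := by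
          rw [eLpNorm_one_eq_lintegral_enorm]
          exact lintegral_congr fun z => by simp only [enorm_smul, enorm_mul, enorm_norm]
      _ = eLpNorm (fun z => (φ z * fderiv ℝ (ψ m) z v) * ‖f z‖) 1 μ := by
          rw [hμ, eLpNorm_restrict_eq_of_support_subset]
          intro z hz
          refine hφs (subset_tsupport _ fun h => hz ?_)
          simp [h]
      _ ≤ ENNReal.ofReal (Kφ * (K / (1 / 2) ^ m * ‖v‖))
          * eLpNorm (fun z => ‖f z‖) 1 (μ.restrict (ball 0 (3 * (1 / 2) ^ m))) := by
          refine eLpNorm_mul_le_of_bound_on_ball (by positivity) (fun z => ?_) fun z hz => ?_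
          · rw [abs_mul]
            exact mul_le_mul (hKφ z) (((fderiv ℝ (ψ m) z).le_opNorm v).trans
              (mul_le_mul_of_nonneg_right (hψd m z) (norm_nonneg v))) (abs_nonneg _) hKφ0
          · rw [hψd0 m z (by linarith [hε m])]
            simp
      _ ≤ ENNReal.ofReal (Kφ * (K / (1 / 2) ^ m * ‖v‖))
          * (eLpNorm (fun z => ‖f z‖) 2 (μ.restrict (ball 0 (3 * (1 / 2) ^ m)))
          * (2 * ENNReal.ofReal (3 * (1 / 2) ^ m))) := by
          refine mul_le_mul' le_rfl ?_
          have := eLpNorm_ball_le_eLpNorm_two (μ := μ) Measure.restrict_le_self (q := 1) le_rfl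
            one_le_two hfn h3
          norm_num at this ⊢
          exact this
      _ = ENNReal.ofReal (Kφ * (K / (1 / 2) ^ m * ‖v‖)) * ENNReal.ofReal 2
          * ENNReal.ofReal (3 * (1 / 2) ^ m)
          * eLpNorm (fun z => ‖f z‖) 2 (μ.restrict (ball 0 (3 * (1 / 2) ^ m))) := by
          rw [show ENNReal.ofReal 2 = 2 by simp]
          ring
      _ = _ := by
          rw [← ENNReal.ofReal_mul (by positivity), ← ENNReal.ofReal_mul (by positivity),
            Function.comp_apply]
          congr 2
          field_simp
          ring
  have hlim := (hdom _ i1).add hb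
  simp only [hid, add_zero] at hlim
  exact tendsto_nhds_unique hlim (hdom _ i2).neg

/-- A compact subset of the disk, once a small open ball about the origin is removed, is a compact
subset of the punctured disk. -/
theorem MemLpLocOn.of_pDisk {q r : ℝ} (hq : 0 < q) (hr : 0 < r) {g : ℂ → EuclideanSpace ℝ (Fin n)}
    (hg : MemLpLocOn q pDisk g) (h0 : MemLp g (ENNReal.ofReal q) (volume.restrict (ball 0 r))) :
    MemLpLocOn q (ball 0 1) g := by
  intro K hK hKs
  have hsub : K \ ball 0 r ⊆ pDisk := fun z hz => ⟨hKs hz.1, by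
    rintro rfl
    exact hz.2 (mem_ball_self hr)⟩
  have h1 := hg (K \ ball 0 r) (hK.diff isOpen_ball) hsub
  have hq0 : ENNReal.ofReal q ≠ 0 := by simpa using hq
  have h2 : MemLp g (ENNReal.ofReal q) (volume.restrict (K \ ball 0 r)
      + volume.restrict (ball 0 r)) := by
    refine ⟨h1.1.add_measure h0.1, ?_⟩
    rw [eLpNorm_lt_top_iff_lintegral_rpow_enorm_lt_top hq0 ENNReal.ofReal_ne_top,
      lintegral_add_measure, ENNReal.add_lt_top]
    exact ⟨lintegral_rpow_enorm_lt_top_of_eLpNorm_lt_top hq0 ENNReal.ofReal_ne_top h1.2,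
      lintegral_rpow_enorm_lt_top_of_eLpNorm_lt_top hq0 ENNReal.ofReal_ne_top h0.2⟩
  exact h2.mono_measure ((Measure.restrict_mono
    (show K ⊆ (K \ ball 0 r) ∪ ball 0 r by simp) le_rfl).trans (Measure.restrict_union_le _ _))

theorem MemLpLocOn.locallyIntegrableOn {q : ℝ} (hq : 1 ≤ q) {Ω : Set ℂ} (hΩ : IsOpen Ω)
    {g : ℂ → EuclideanSpace ℝ (Fin n)} (hg : MemLpLocOn q Ω g) : LocallyIntegrableOn g Ω := by
  rw [locallyIntegrableOn_iff hΩ.isLocallyClosed]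
  intro K hKs hK
  have : IsFiniteMeasure ((volume : Measure ℂ).restrict K) := ⟨by simpa using hK.measure_lt_top⟩
  exact (hg K hK hKs).integrable (by simpa using hq)

end extension

/-! ### Assembling the extension. -/

section removability

variable {n : ℕ} {Ω : Set ℂ}

theorem isWeakDerivOn_weakDeriv {v : ℂ} {f g : ℂ → EuclideanSpace ℝ (Fin n)}
    (h : IsWeakDerivOn Ω v f g) : IsWeakDerivOn Ω v f (weakDeriv Ω v f) := by
  have h' : ∃ g, IsWeakDerivOn Ω v f g := ⟨g, h⟩
  rw [weakDeriv, dif_pos h']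
  exact h'.choose_spec

theorem locallyIntegrableOn_congr_ae (hΩ : IsOpen Ω) {f f' : ℂ → EuclideanSpace ℝ (Fin n)}
    (hff' : f =ᵐ[volume.restrict Ω] f') (h : LocallyIntegrableOn f Ω) :
    LocallyIntegrableOn f' Ω := by
  rw [locallyIntegrableOn_iff hΩ.isLocallyClosed] at h ⊢
  exact fun K hKs hK => (h K hKs hK).congr (ae_restrict_of_ae_restrict_of_subset hKs hff')

theorem IsWeakDerivOn.congr_ae (hΩ : IsOpen Ω) {v : ℂ} {f f' g : ℂ → EuclideanSpace ℝ (Fin n)}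
    (h : IsWeakDerivOn Ω v f g) (hff' : f =ᵐ[volume.restrict Ω] f') :
    IsWeakDerivOn Ω v f' g := by
  refine ⟨locallyIntegrableOn_congr_ae hΩ hff' h.1, h.2, fun φ hφ hφc hφs => ?_⟩
  rw [← h.integral_eq φ hφ hφc hφs]
  rw [Filter.EventuallyEq, ae_restrict_iff' hΩ.measurableSet] at hff'
  refine integral_congr_ae ?_
  filter_upwards [hff'] with z hz
  by_cases hzΩ : z ∈ Ω
  · rw [hz hzΩ]
  · have : fderiv ℝ φ z = 0 := by
      by_contra h0
      exact hzΩ (hφs (support_fderiv_subset ℝ h0))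
    simp [this]

theorem MemLpLocOn.congr_ae {q : ℝ} {f f' : ℂ → EuclideanSpace ℝ (Fin n)}
    (h : MemLpLocOn q Ω f) (hff' : f =ᵐ[volume.restrict Ω] f') : MemLpLocOn q Ω f' :=
  fun K hK hKs => (h K hK hKs).ae_eq (ae_restrict_of_ae_restrict_of_subset hKs hff')

theorem MemLp.memLpLocOn {r : ℝ≥0∞} {q : ℝ} (hq : ENNReal.ofReal q ≤ r)
    {f : ℂ → EuclideanSpace ℝ (Fin n)} (h : MemLp f r (volume.restrict Ω)) : MemLpLocOn q Ω f :=
  fun K hK hKs => by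
    have : IsFiniteMeasure ((volume : Measure ℂ).restrict K) := ⟨by simpa using hK.measure_lt_top⟩
    exact (h.mono_measure (Measure.restrict_mono hKs le_rfl)).mono_exponent hq

theorem gradLen_weakPartial_sq (Ω : Set ℂ) (f : ℂ → EuclideanSpace ℝ (Fin n)) (z : ℂ) :
    gradLen (fun i => weakPartial Ω i f) z ^ 2 = gradSq Ω f z :=
  Real.sq_sqrt (Finset.sum_nonneg fun _ _ => sq_nonneg _)

theorem MemF.memLp_top {p R : ℝ} {f : ℂ → EuclideanSpace ℝ (Fin n)} (hΩ : MeasurableSet Ω)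
    (hf : MemF p R Ω f) : MemLp f ⊤ (volume.restrict Ω) := by
  refine memLp_top_of_bound (hf.memW2Loc.isWeakDeriv 0).1.aestronglyMeasurable R ?_
  filter_upwards [ae_restrict_mem hΩ] with z hz
  simpa using hf.mapsTo hz

theorem lintegral_gradLen_sq (Ω : Set ℂ) (f : ℂ → EuclideanSpace ℝ (Fin n)) :
    ∫⁻ z in Ω, ‖gradLen (fun i => weakPartial Ω i f) z‖ₑ ^ 2 = dirichletEnergy Ω f :=
  lintegral_congr fun z => by rw [enorm_sq_eq_ofReal, gradLen_weakPartial_sq]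

theorem memLp_two_weakPartial {p : ℝ} {f : ℂ → EuclideanSpace ℝ (Fin n)} (hf : MemW2Loc p Ω f)
    (hE : dirichletEnergy Ω f < ⊤) (i : Fin 2) :
    MemLp (weakPartial Ω i f) 2 (volume.restrict Ω) := by
  have hm : ∀ i, AEStronglyMeasurable (weakPartial Ω i f) (volume.restrict Ω) :=
    fun i => (hf.isWeakDeriv i).2.aestronglyMeasurable
  have hγ : MemLp (gradLen fun i => weakPartial Ω i f) 2 (volume.restrict Ω) := by
    refine ⟨aestronglyMeasurable_gradLen hm, ?_⟩
    by_contra! h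
    rw [top_le_iff] at h
    rw [← lintegral_gradLen_sq, ← eLpNorm_two_sq, h] at hE
    simp at hE
  refine hγ.mono (hm i) (Eventually.of_forall fun z => ?_)
  rw [Real.norm_of_nonneg (gradLen_nonneg _ z)]
  exact norm_le_gradLen (fun i => weakPartial Ω i f) i z

/-- Taking b = β|∇f| makes the quadratic bound on the Laplacian look linear in the gradient.
Boundedness of f supplies local square-integrability, finite energy supplies that of the gradient,
and the mixed derivatives agree almost everywhere by uniqueness of weak derivatives. -/
theorem MemFConf.confData {p R : ℝ} {f : ℂ → EuclideanSpace ℝ (Fin n)} (hΩ : IsOpen Ω)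
    (hf : MemFConf p R Ω f) (hE : dirichletEnergy Ω f < ⊤) {β : ℂ → ℝ≥0} (hβ : Measurable β)
    (hlap : ∀ᵐ z ∂(volume.restrict Ω), ‖weakLaplacian Ω f z‖ ≤ β z * gradSq Ω f z) :
    ConfData p Ω f (fun i => weakPartial Ω i f) (fun i j => weakPartial Ω j (weakPartial Ω i f))
      fun z => β z * gradLen (fun i => weakPartial Ω i f) z where
  deriv := hf.memW2Loc.isWeakDeriv_partial
  symm := IsWeakDerivOn.ae_eq hΩ ((hf.memW2Loc.isWeakDeriv 0).swap (hf.memW2Loc.isWeakDeriv 1)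
    (hf.memW2Loc.isWeakDeriv_partial 0 1)) (hf.memW2Loc.isWeakDeriv_partial 1 0)
  laplacian_le := by
    filter_upwards [hlap] with z hz
    rw [← gradLen_weakPartial_sq, weakLaplacian, Fin.sum_univ_two] at hz
    refine hz.trans (le_of_eq ?_)
    ring
  aestronglyMeasurable := (hβ.coe_nnreal_real.aestronglyMeasurable).mul
    (aestronglyMeasurable_gradLen fun i => (hf.memW2Loc.isWeakDeriv i).2.aestronglyMeasurable)
  weakDeriv := hf.memW2Loc.isWeakDeriv
  memLp_two := MemLp.memLpLocOn le_top (hf.toMemF.memLp_top hΩ.measurableSet)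
  memLp := hf.memW2Loc.memLp
  memLp_grad_two := fun i =>
    MemLp.memLpLocOn (by simp) (memLp_two_weakPartial hf.memW2Loc hE i)
  memLp_grad := hf.memW2Loc.memLp_partial
  memLp_hess := hf.memW2Loc.memLp_partial_partial
  conformal := by
    filter_upwards [hf.conformal] with z hz
    have h : ∀ k, cgrad (fun i => weakPartial Ω i f) k z ^ 2 = 4 * weakDz Ω f z k ^ 2 := fun k => by
      rw [cgrad, weakDz]
      ring
    rw [Finset.sum_congr rfl fun k _ => h k, ← Finset.mul_sum, hz, mul_zero]

/-- The value 0 at the origin is as good as any in the closed ball of radius R. Across the origin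
weak derivatives are extended in order: those of f, which is bounded, then those of its gradient,
which is square-integrable, the Hessian being locally integrable by `ConfData.exists_memLp_hessian`.
All pointwise conditions then carry over almost everywhere. -/
theorem MemFConf.exists_extension {p R : ℝ} (hR : 0 < R) (hp₂ : p < 2)
    (f : ℂ → EuclideanSpace ℝ (Fin n)) (hf : MemFConf p R pDisk f)
    (hE : dirichletEnergy pDisk f < ⊤) :
    ∃ g : ℂ → EuclideanSpace ℝ (Fin n), EqOn g f pDisk ∧
      ∀ p' : ℝ, 1 < p' → p' < 4 / 3 → p' ≤ p → MemFConf p' R (ball 0 1) g := by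
  have hg0 : EqOn (Function.update f 0 0) f pDisk := fun z hz =>
    Function.update_of_ne (fun h => hz.2 (by simpa using h)) _ _
  refine ⟨Function.update f 0 0, hg0, fun p' hp'1 hp'43 hp'p => ?_⟩
  set g := Function.update f 0 0 with hg
  obtain ⟨β, hβ, hlap, hβint⟩ := hf.laplacian_le
  have hD := hf.confData isOpen_pDisk hE hβ hlap
  have hB : IsOpen (ball (0 : ℂ) 1) := isOpen_ball
  have hEE : ∫⁻ z in pDisk, ‖gradLen (fun i => weakPartial pDisk i f) z‖ₑ ^ 2 ≠ ⊤ := by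
    rw [lintegral_gradLen_sq]
    exact hE.ne
  have hbb : ∫⁻ z in pDisk, ‖(β z : ℝ) * gradLen (fun i => weakPartial pDisk i f) z‖ₑ ^ 2 ≠ ⊤ := by
    refine ne_of_eq_of_ne (lintegral_congr fun z => ?_) hβint.ne
    rw [enorm_sq_eq_ofReal, mul_pow, gradLen_weakPartial_sq]
  obtain ⟨r, hr, -, hhess⟩ := hD.exists_memLp_hessian hp₂ hp'1 hp'43 hp'p hEE hbb
  have hp'2 : ENNReal.ofReal p' ≤ 2 := by
    rw [show (2 : ℝ≥0∞) = ENNReal.ofReal 2 by simp]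
    exact ENNReal.ofReal_le_ofReal (by linarith)
  have hfin : IsFiniteMeasure ((volume : Measure ℂ).restrict (ball 0 1)) :=
    ⟨by rw [Measure.restrict_apply_univ]; exact measure_ball_lt_top⟩
  have hfg : f =ᵐ[volume.restrict (ball 0 1)] g := by
    rw [← restrict_pDisk]
    filter_upwards [ae_restrict_mem isOpen_pDisk.measurableSet] with z hz
    exact (hg0 hz).symm
  have hftop : MemLp f ⊤ (volume.restrict (ball 0 1)) := by
    rw [← restrict_pDisk]
    exact hf.toMemF.memLp_top isOpen_pDisk.measurableSet
  have hG2 : ∀ i, MemLp (weakPartial pDisk i f) 2 (volume.restrict (ball 0 1)) := fun i => by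
    rw [← restrict_pDisk]
    exact memLp_two_weakPartial hf.memW2Loc hE i
  have hGloc : ∀ i, MemLpLocOn p' (ball 0 1) (weakPartial pDisk i f) := fun i =>
    MemLp.memLpLocOn hp'2 (hG2 i)
  have hHloc : ∀ i j, MemLpLocOn p' (ball 0 1) (weakPartial pDisk j (weakPartial pDisk i f)) :=
    fun i j => by
      refine MemLpLocOn.of_pDisk (by linarith) hr (fun K hK hKs => ?_) (hhess i j)
      have : IsFiniteMeasure ((volume : Measure ℂ).restrict K) :=
        ⟨by simpa using hK.measure_lt_top⟩
      exact (hf.memW2Loc.memLp_partial_partial i j K hK hKs).mono_exponent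
        (ENNReal.ofReal_le_ofReal hp'p)
  have w1 : ∀ i, IsWeakDerivOn (ball 0 1) (coordDir i) g (weakPartial pDisk i f) := fun i =>
    ((hf.memW2Loc.isWeakDeriv i).of_pDisk (hftop.mono_exponent le_top)
      ((hGloc i).locallyIntegrableOn hp'1.le hB)).congr_ae hB hfg
  have w1' : ∀ i, IsWeakDerivOn (ball 0 1) (coordDir i) g (weakPartial (ball 0 1) i g) := fun i =>
    isWeakDerivOn_weakDeriv (w1 i)
  -- The representatives chosen on the two domains are unrelated as functions; only uniqueness of
  -- weak derivatives identifies them, almost everywhere.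
  have e1 : ∀ i, weakPartial pDisk i f =ᵐ[volume.restrict (ball 0 1)] weakPartial (ball 0 1) i g :=
    fun i => (w1 i).ae_eq hB (w1' i)
  have w2 : ∀ i j, IsWeakDerivOn (ball 0 1) (coordDir j) (weakPartial (ball 0 1) i g)
      (weakPartial pDisk j (weakPartial pDisk i f)) := fun i j =>
    ((hf.memW2Loc.isWeakDeriv_partial i j).of_pDisk (hG2 i)
      ((hHloc i j).locallyIntegrableOn hp'1.le hB)).congr_ae hB (e1 i)
  have w2' : ∀ i j, IsWeakDerivOn (ball 0 1) (coordDir j) (weakPartial (ball 0 1) i g)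
      (weakPartial (ball 0 1) j (weakPartial (ball 0 1) i g)) := fun i j =>
    isWeakDerivOn_weakDeriv (w2 i j)
  have e2 : ∀ i j, weakPartial pDisk j (weakPartial pDisk i f) =ᵐ[volume.restrict (ball 0 1)]
      weakPartial (ball 0 1) j (weakPartial (ball 0 1) i g) := fun i j =>
    (w2 i j).ae_eq hB (w2' i j)
  have egrad : ∀ᵐ z ∂(volume.restrict (ball 0 1)), gradSq (ball 0 1) g z = gradSq pDisk f z := by
    filter_upwards [e1 0, e1 1] with z h0 h1
    simp only [gradSq, Fin.sum_univ_two, h0, h1]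
  rw [restrict_pDisk] at hlap hβint
  have hconf := hf.conformal
  rw [restrict_pDisk] at hconf
  refine ⟨⟨⟨?_, w1', fun i => (hGloc i).congr_ae (e1 i), w2', fun i j =>
    (hHloc i j).congr_ae (e2 i j)⟩, fun z hz => ?_, β, hβ, ?_, ?_⟩, ?_⟩
  · exact (MemLp.memLpLocOn le_top hftop).congr_ae hfg
  · by_cases h0 : z = 0
    · rw [h0, hg, Function.update_self]
      exact mem_closedBall_self hR.le
    · rw [hg0 ⟨hz, by simpa using h0⟩]
      exact hf.mapsTo ⟨hz, by simpa using h0⟩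
  · filter_upwards [hlap, egrad, e2 0 0, e2 1 1] with z hz h1 h2 h3
    rw [h1]
    simp only [weakLaplacian, Fin.sum_univ_two] at hz ⊢
    rwa [h2, h3] at hz
  · refine lt_of_eq_of_lt (lintegral_congr_ae ?_) hβint
    filter_upwards [egrad] with z hz
    rw [hz]
  · filter_upwards [hconf, e1 0, e1 1] with z hz h0 h1
    simp only [weakDz, h0, h1] at hz ⊢
    exact hz

end removability

end

theorem mainTheorem10 {n : ℕ} {p R : ℝ} (hR : 0 < R) (hp₁ : 1 < p) (hp₂ : p < 2)
    (f : ℂ → EuclideanSpace ℝ (Fin n))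
    (hf : MemFConf p R (Metric.ball (0 : ℂ) 1 \ {0}) f)
    (hE : dirichletEnergy (Metric.ball (0 : ℂ) 1 \ {0}) f < ⊤) :
    ∃ g : ℂ → EuclideanSpace ℝ (Fin n),
      EqOn g f (Metric.ball (0 : ℂ) 1 \ {0}) ∧
      ∀ p' : ℝ, 1 < p' → p' < 4 / 3 → p' ≤ p → MemFConf p' R (Metric.ball (0 : ℂ) 1) g :=
  hf.exists_extension hR hp₂ f hE
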